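/- Identify $SU(2)$ with the group of unit quaternions, write $\operatorname{Im}(x)=x-\operatorname{Re}(x)$, and let $\bar x$ denote the inverse of a group element $x$. Let $$\Pi=\pi_1\big((S^2\times I)\setminus(L\cup E\cup W\cup Q_p\cup Q_q)\big)$$ be the fundamental group of the complement of the four strands $L$, the earring $E$, the $w_2$-arc $W$ and the two perturbation solid tori $Q_p,Q_q$ of the earring tangle. It has the presentation with generators $w,a,b,e,f,p,q,h$ and relations $$[p,bh]=1,\quad [q,f\bar a h]=1,\quad ba=ef,\quad cd=gf,\quad [\bar f\bar q f\bar a\bar b\bar p b,h]=w,$$ where $c=\bar q\bar p b p q$, $d=\bar h a w h$, $g=\bar q e q$. For $s\in\mathbb R$ let $\widetilde R_s$ be the set of homomorphisms $\rho:\Pi\to SU(2)$ such that $\rho(w)=-1$, $\operatorname{Re}\rho(x)=0$ for $x\in\{a,b,e,f,h\}$, $\rho(p)=e^{s\operatorname{Im}\rho(bh)}$ and $\rho(q)=e^{s\operatorname{Im}\rho(f\bar a h)}$. It is a subspace of $SU(2)^8\subset\mathbb H^8$ by evaluation on the generators. Let $NAT_s=\widetilde R_s/SU(2)$ be its quotient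 by conjugation. Let $T=(\mathbb R/2\pi\mathbb Z)^2$ have coordinates $(\gamma,\theta)$, let $P=T/\iota$ with $\iota(\gamma,\theta)=(-\gamma,-\theta)$ be the pillowcase, and let $P^*\subset P$ be the complement of the four corners, that is, of the images of the points $(\gamma,\theta)$ with $\gamma,\theta\in\{0,\pi\}$. The surface $P^*$ carries the smooth structure and the symplectic form $\omega$ induced by $d\gamma\wedge d\theta$, and $(P^*)^-$ denotes $(P^*,-\omega)$. A traceless $SU(2)$ representation of $\langle a,b,e,f\mid ba=ef\rangle$ (one that sends $a,b,e,f$ to imaginary quaternions) is conjugate to one with $a\mapsto\mathbf i$, $b\mapsto e^{\gamma\mathbf k}\mathbf i$, $f\mapsto e^{\theta\mathbf k}\mathbf i$ for a unique point $[\gamma,\theta]\in P$. Restricting $\rho\in\widetilde R_s$ to the groups $\langle a,b,e,f\mid ba=ef\rangle$ and $\langle d,c,g,f\mid cd=gf\rangle$ of the two boundary spheres (with $d,c,g,f$ in the roles of $a,b,e,f$) gives the restriction map $r_s:NAT_s\to P\times P$. Let $\widehat\Sigma=\{(\gamma,\theta,\nu)\mid\sin\theta\sin\nu+\sin\gamma\cos\nu=0\}\subset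 T\times S^1$, where $S^1=\mathbb R/2\pi\mathbb Z$, and let $\hat\iota(\gamma,\theta,\nu)=(-\gamma,-\theta,\nu+\pi)$. **Theorem.** With the real-analytic structure induced from $T\times S^1$, $\widehat\Sigma$ is a closed (compact, connected, without boundary) orientable real-analytic surface of genus $5$. The involution $\hat\iota$ acts freely on $\widehat\Sigma$, and $\widehat\Sigma/\hat\iota$ is, with the structure induced from $\widehat\Sigma$, a closed orientable real-analytic surface of genus $3$. There is an $\varepsilon>0$ such that for all $s$ with $0<|s|<\varepsilon$: 1. With the real-analytic structure induced from $\widetilde R_s\subset\mathbb H^8$ (a function on $NAT_s$ is analytic near a point if and only if its pull-back to $\widetilde R_s$ is, near a point above it, the restriction of a real-analytic function on $\mathbb H^8$), $NAT_s$ is a closed orientable real-analytic surface of genus $3$. 2. $NAT_s$ is real-analytically diffeomorphic to $\widehat\Sigma/\hat\iota$. 3. The image of $r_s$ lies in $P^*\times P^*$, and $r_s:NAT_s\to(P^*)^-\times P^*$ is a Lagrangian immersion: it is smooth, its differential is injective at every point, and the symplectic form $(-\omega)\oplus\omega$ pulls back to $0$. -/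

import Mathlib

open scoped Manifold ContDiff Quaternion Topology commutatorElement

namespace Earring

/-! ### The group `SU(2)` and the earring tangle group -/

/-- `SU(2)`, identified with the group of unit quaternions. -/
abbrev SU2 : Type := unitary ℍ[ℝ]

/-- The model plane for surfaces. -/
abbrev Plane : Type := EuclideanSpace ℝ (Fin 2)

/-- The generators `w, a, b, e, f, p, q, h` of the fundamental group of the complement, in
`S² × I`, of the earring tangle, the `w₂`-arc and the two perturbation curves. -/
inductive Gen | w | a | b | e | f | p | q | h
  deriving DecidableEq

instance : Fintype Gen where
  elems := {Gen.w, Gen.a, Gen.b, Gen.e, Gen.f, Gen.p, Gen.q, Gen.h}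
  complete x := by cases x <;> simp

/-- The word of a generator. -/
abbrev word (x : Gen) : FreeGroup Gen := FreeGroup.of x

/-- The word `λ_p = b h`. -/
def wordLamP : FreeGroup Gen := word .b * word .h

/-- The word `λ_q = f a⁻¹ h`. -/
def wordLamQ : FreeGroup Gen := word .f * (word .a)⁻¹ * word .h

/-- The word `c = q⁻¹ p⁻¹ b p q`. -/
def wordC : FreeGroup Gen := (word .q)⁻¹ * (word .p)⁻¹ * word .b * word .p * word .q

/-- The word `d = h⁻¹ a w h`. -/
def wordD : FreeGroup Gen := (word .h)⁻¹ * word .a * word .w * word .h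

/-- The word `g = q⁻¹ e q`. -/
def wordG : FreeGroup Gen := (word .q)⁻¹ * word .e * word .q

/-- The relators of the tangle group:
`[p, λ_p] = 1`, `[q, λ_q] = 1`, `b a = e f`, `c d = g f` and
`[f⁻¹ q⁻¹ f a⁻¹ b⁻¹ p⁻¹ b, h] = w`. -/
def relators : Set (FreeGroup Gen) :=
  {⁅word .p, wordLamP⁆,
   ⁅word .q, wordLamQ⁆,
   word .b * word .a * (word .e * word .f)⁻¹,
   wordC * wordD * (wordG * word .f)⁻¹,
   ⁅(word .f)⁻¹ * (word .q)⁻¹ * word .f * (word .a)⁻¹ * (word .b)⁻¹ * (word .p)⁻¹ * word .b,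
      word .h⁆ * (word .w)⁻¹}

/-- The group `Π = π₁((S² × I) ∖ (L ∪ W ∪ E ∪ Q_p ∪ Q_q))`. -/
abbrev TangleGroup : Type := PresentedGroup relators

/-- The element of `Π` represented by a word. -/
abbrev elt (x : FreeGroup Gen) : TangleGroup := PresentedGroup.mk relators x

/-- `ρ` is a perturbed traceless representation with perturbation parameter `s` that satisfies the
`w₂`-condition. -/
structure IsPerturbedTraceless (s : ℝ) (ρ : TangleGroup →* SU2) : Prop where
  /-- the `w₂`-condition `ρ(w) = -1` -/
  w2 : (ρ (elt (word .w)) : ℍ[ℝ]) = -1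
  a_traceless : (ρ (elt (word .a)) : ℍ[ℝ]).re = 0
  b_traceless : (ρ (elt (word .b)) : ℍ[ℝ]).re = 0
  e_traceless : (ρ (elt (word .e)) : ℍ[ℝ]).re = 0
  f_traceless : (ρ (elt (word .f)) : ℍ[ℝ]).re = 0
  h_traceless : (ρ (elt (word .h)) : ℍ[ℝ]).re = 0
  /-- the perturbation condition `ρ(p) = exp (s Im ρ(λ_p))` -/
  p_pert : (ρ (elt (word .p)) : ℍ[ℝ]) = NormedSpace.exp (s • (ρ (elt wordLamP) : ℍ[ℝ]).im)
  /-- the perturbation condition `ρ(q) = exp (s Im ρ(λ_q))` -/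
  q_pert : (ρ (elt (word .q)) : ℍ[ℝ]) = NormedSpace.exp (s • (ρ (elt wordLamQ) : ℍ[ℝ]).im)

/-- The space of perturbed traceless representations. -/
def PertRep (s : ℝ) : Type := {ρ : TangleGroup →* SU2 // IsPerturbedTraceless s ρ}

/-- Evaluation on the eight generators, which embeds the space of perturbed traceless
representations in `SU(2)⁸ ⊆ ℍ⁸`. -/
noncomputable def evalGen (s : ℝ) (ρ : PertRep s) : Gen → ℍ[ℝ] := fun x => (ρ.1 (elt (word x)) : ℍ[ℝ])

/-- The topology of the space of perturbed traceless representations, as a subspace of `SU(2)⁸`. -/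
noncomputable instance (s : ℝ) : TopologicalSpace (PertRep s) :=
  TopologicalSpace.induced (evalGen s) inferInstance

/-- Conjugacy of representations under `SU(2)`. -/
instance conjSetoid (s : ℝ) : Setoid (PertRep s) where
  r ρ σ := ∃ u : SU2, ∀ x : TangleGroup, σ.1 x = u * ρ.1 x * u⁻¹
  iseqv :=
    { refl := fun _ => ⟨1, fun x => by simp⟩
      symm := by
        rintro ρ σ ⟨u, hu⟩
        exact ⟨u⁻¹, fun x => by rw [hu]; group⟩
      trans := by
        rintro ρ σ τ ⟨u, hu⟩ ⟨v, hv⟩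
        exact ⟨v * u, fun x => by rw [hv, hu]; group⟩ }

/-- The perturbed traceless moduli space `NAT_s` of the earring tangle: the quotient of the space
of perturbed traceless representations by conjugation, with the quotient topology. -/
def NAT (s : ℝ) : Type := Quotient (conjSetoid s)

noncomputable instance (s : ℝ) : TopologicalSpace (NAT s) :=
  inferInstanceAs (TopologicalSpace (Quotient (conjSetoid s)))

/-- The conjugacy class of a perturbed traceless representation. -/
def conjClass (s : ℝ) (ρ : PertRep s) : NAT s := Quotient.mk (conjSetoid s) ρ

/-! ### Real-analytic surfaces and their genus -/

/-- Let `Z` be a subspace of the normed space `V`, with inclusion `i`, and let `π : Z → X` be a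
quotient map. The given surface charts on `X` induce the real-analytic structure that `X` inherits
from `V`: a real function on `X` is analytic near a point if and only if its pull-back to `Z` is,
near a point above it, the restriction of an analytic function on `V`. -/
def InducesAnalyticStructure {V Z X : Type*} [NormedAddCommGroup V] [NormedSpace ℝ V]
    [TopologicalSpace Z] [TopologicalSpace X] [ChartedSpace Plane X]
    (i : Z → V) (π : Z → X) : Prop :=
  ∀ (φ : X → ℝ) (z : Z), ContMDiffAt (𝓡 2) 𝓘(ℝ, ℝ) ω φ (π z) ↔
    ∃ Φ : V → ℝ, AnalyticAt ℝ Φ (i z) ∧ ∀ᶠ z' in 𝓝 z, φ (π z') = Φ (i z')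

/-- `X` has an atlas of analytic charts whose coordinate changes have positive Jacobian. -/
def IsOrientable (X : Type*) [TopologicalSpace X] [ChartedSpace Plane X] : Prop :=
  ∃ A ⊆ IsManifold.maximalAtlas (𝓡 2) ω X,
    (∀ x : X, ∃ c ∈ A, x ∈ c.source) ∧
    ∀ c ∈ A, ∀ c' ∈ A, ∀ y ∈ (c.symm.trans c').source,
      0 < (fderiv ℝ (c.symm.trans c') y).det

/-- `X` has a finite CW decomposition for which the alternating sum of the numbers of cells
is `χ`. -/
def HasEulerCharacteristic (X : Type*) [TopologicalSpace X] (χ : ℤ) : Prop :=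
  ∃ C : Topology.CWComplex (Set.univ : Set X),
    Finite (Σ n, C.cell n) ∧ ∑ᶠ n : ℕ, (-1 : ℤ) ^ n * (Nat.card (C.cell n) : ℤ) = χ

/-- `X` is a real-analytic closed (compact, connected, without boundary) orientable surface of
genus `g`, that is, of Euler characteristic `2 - 2g`. -/
structure IsClosedOrientableSurface (g : ℕ) (X : Type*) [TopologicalSpace X]
    [ChartedSpace Plane X] : Prop where
  isManifold : IsManifold (𝓡 2) ω X
  t2 : T2Space X
  compact : CompactSpace X
  connected : ConnectedSpace X
  orientable : IsOrientable X
  euler : HasEulerCharacteristic X (2 - 2 * (g : ℤ))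

/-! ### The surface `Σ̂` and its quotient -/

/-- The surface `Σ̂ = {sin θ sin ν + sin γ cos ν = 0}` in `T × S¹`, with coordinates `(γ, θ, ν)`
in `ℝ / 2πℤ`. The angle `ν` stands for the point `e^{ν𝐢}𝐤` of the circle of imaginary unit
quaternions orthogonal to `𝐢`. -/
def genusFiveSurface : Set (Real.Angle × Real.Angle × Real.Angle) :=
  {x | x.2.1.sin * x.2.2.sin + x.1.sin * x.2.2.cos = 0}

/-- The involution `ι̂(γ, θ, ν) = (-γ, -θ, ν + π)` of `Σ̂`. It is the restriction of
`(γ, θ, h) ↦ (-γ, -θ, -𝐢h𝐢)`, as `-𝐢 e^{ν𝐢}𝐤 𝐢 = e^{(ν + π)𝐢}𝐤`. -/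
noncomputable def iotaHat (x : genusFiveSurface) : genusFiveSurface :=
  ⟨(-x.1.1, -x.1.2.1, x.1.2.2 + (Real.pi : Real.Angle)), by
    have := x.2
    simp only [genusFiveSurface, Set.mem_ofPred_eq] at this ⊢
    simp only [Real.Angle.sin_neg, Real.Angle.sin_add_pi, Real.Angle.cos_add_pi]
    linarith⟩

theorem iotaHat_iotaHat (x : genusFiveSurface) : iotaHat (iotaHat x) = x := by
  apply Subtype.ext
  simp [iotaHat, add_assoc]

/-- The orbits of `ι̂`. -/
instance iotaHatSetoid : Setoid genusFiveSurface where
  r x y := y = x ∨ y = iotaHat x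
  iseqv :=
    { refl := fun _ => Or.inl rfl
      symm := by
        rintro x y (rfl | rfl)
        · exact Or.inl rfl
        · exact Or.inr (iotaHat_iotaHat x).symm
      trans := by
        rintro x y z (rfl | rfl) (rfl | rfl)
        · exact Or.inl rfl
        · exact Or.inr rfl
        · exact Or.inr rfl
        · exact Or.inl (iotaHat_iotaHat x) }

/-- The quotient `Σ̂ / ι̂`, with the quotient topology. -/
def GenusFiveQuotient : Type := Quotient iotaHatSetoid

instance : TopologicalSpace GenusFiveQuotient :=
  inferInstanceAs (TopologicalSpace (Quotient iotaHatSetoid))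

/-- The quotient map `Σ̂ → Σ̂ / ι̂`. -/
def genusFiveMk (x : genusFiveSurface) : GenusFiveQuotient := Quotient.mk iotaHatSetoid x

/-- The analytic embedding `(γ, θ, ν) ↦ (e^{iγ}, e^{iθ}, e^{iν})` of `Σ̂ ⊆ T × S¹` in `ℂ³`. -/
noncomputable def genusFiveEmb (x : genusFiveSurface) : ℂ × ℂ × ℂ :=
  (x.1.1.toCircle, x.1.2.1.toCircle, x.1.2.2.toCircle)

/-! ### The pillowcase -/

/-- The torus `T = (ℝ / 2πℤ)²`, with coordinates `(γ, θ)`. -/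
abbrev Torus : Type := Real.Angle × Real.Angle

/-- The orbits of the elliptic involution `(γ, θ) ↦ (-γ, -θ)`. -/
instance ellipticSetoid : Setoid Torus where
  r x y := y = x ∨ y = -x
  iseqv :=
    { refl := fun _ => Or.inl rfl
      symm := by
        rintro x y (rfl | rfl)
        · exact Or.inl rfl
        · exact Or.inr (neg_neg x).symm
      trans := by
        rintro x y z (rfl | rfl) (rfl | rfl)
        · exact Or.inl rfl
        · exact Or.inr rfl
        · exact Or.inr rfl
        · exact Or.inl (neg_neg x) }

/-- The pillowcase `P = T / ι`. -/
def Pillowcase : Type := Quotient ellipticSetoid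

instance : TopologicalSpace Pillowcase :=
  inferInstanceAs (TopologicalSpace (Quotient ellipticSetoid))

/-- The point `[γ, θ]` of the pillowcase. -/
def pillowMk (x : Torus) : Pillowcase := Quotient.mk ellipticSetoid x

/-- The four corners of the pillowcase. -/
def corners : Set Pillowcase :=
  pillowMk '' {((0 : Real.Angle), (0 : Real.Angle)), ((0 : Real.Angle), (Real.pi : Real.Angle)),
    ((Real.pi : Real.Angle), (0 : Real.Angle)), ((Real.pi : Real.Angle), (Real.pi : Real.Angle))}

/-- The smooth stratum `P* = P ∖ C` of the pillowcase. -/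
def PStar : Type := {p : Pillowcase // p ∉ corners}

instance : TopologicalSpace PStar :=
  inferInstanceAs (TopologicalSpace {p : Pillowcase // p ∉ corners})

/-- The points of the plane that do not lie above a corner. -/
def regularPlane : Set Plane := {x | Real.sin (x 0) ≠ 0 ∨ Real.sin (x 1) ≠ 0}


theorem isOpen_regularPlane : IsOpen regularPlane := by
  have h0 : Continuous fun x : Plane => Real.sin (x 0) := by fun_prop
  have h1 : Continuous fun x : Plane => Real.sin (x 1) := by fun_prop
  exact (isOpen_ne_fun h0 continuous_const).union (isOpen_ne_fun h1 continuous_const)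

/-- The covering `(γ, θ) ↦ [γ, θ]` of the pillowcase by the plane, branched over the corners. -/
noncomputable def planeMk (x : Plane) : Pillowcase :=
  pillowMk ((x 0 : Real.Angle), (x 1 : Real.Angle))

theorem pillowMk_eq_iff {x y : Torus} : pillowMk x = pillowMk y ↔ y = x ∨ y = -x :=
  Quotient.eq (r := ellipticSetoid)

theorem pillowMk_mem_corners {x : Torus} :
    pillowMk x ∈ corners ↔ x.1.sin = 0 ∧ x.2.sin = 0 := by
  have key : ∀ y : Torus, (y.1.sin = 0 ∧ y.2.sin = 0) ↔
      y ∈ ({((0 : Real.Angle), (0 : Real.Angle)), ((0 : Real.Angle), (Real.pi : Real.Angle)),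
        ((Real.pi : Real.Angle), (0 : Real.Angle)),
        ((Real.pi : Real.Angle), (Real.pi : Real.Angle))} : Set Torus) := by
    rintro ⟨u, v⟩
    simp only [Real.Angle.sin_eq_zero_iff, Set.mem_insert_iff, Set.mem_singleton_iff,
      Prod.mk.injEq]
    tauto
  constructor
  · rintro ⟨y, hy, hyx⟩
    rcases pillowMk_eq_iff.1 hyx with rfl | rfl
    · exact (key _).2 hy
    · have := (key _).2 hy
      simpa using this
  · intro h
    exact ⟨x, (key x).1 h, rfl⟩

theorem planeMk_mem_corners {x : Plane} : planeMk x ∉ corners ↔ x ∈ regularPlane := by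
  rw [planeMk, pillowMk_mem_corners]
  simp only [Real.Angle.sin_coe, regularPlane, Set.mem_ofPred_eq]
  tauto

theorem planeMk_surjective : Function.Surjective planeMk := by
  intro p
  obtain ⟨⟨u, v⟩, rfl⟩ := Quotient.exists_rep p
  induction u using Real.Angle.induction_on with
  | _ x =>
    induction v using Real.Angle.induction_on with
    | _ y => exact ⟨!₂[x, y], rfl⟩

theorem planeMk_eq_iff {x y : Plane} : planeMk x = planeMk y ↔
    ∃ σ : ℝ, (σ = 1 ∨ σ = -1) ∧ ∃ m n : ℤ,
      y 0 = σ * x 0 + 2 * Real.pi * m ∧ y 1 = σ * x 1 + 2 * Real.pi * n := by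
  rw [planeMk, planeMk, pillowMk_eq_iff]
  simp only [Prod.neg_mk, Prod.mk.injEq, ← Real.Angle.coe_neg,
    Real.Angle.angle_eq_iff_two_pi_dvd_sub]
  constructor
  · rintro (⟨⟨m, hm⟩, n, hn⟩ | ⟨⟨m, hm⟩, n, hn⟩)
    · exact ⟨1, Or.inl rfl, m, n, by linarith, by linarith⟩
    · exact ⟨-1, Or.inr rfl, m, n, by linarith, by linarith⟩
  · rintro ⟨σ, rfl | rfl, m, n, hm, hn⟩
    · exact Or.inl ⟨⟨m, by linarith⟩, n, by linarith⟩
    · exact Or.inr ⟨⟨m, by linarith⟩, n, by linarith⟩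

theorem continuous_planeMk : Continuous planeMk := by
  have h : Continuous fun x : Plane => ((x 0 : Real.Angle), (x 1 : Real.Angle)) :=
    (Real.Angle.continuous_coe.comp (by fun_prop)).prodMk
      (Real.Angle.continuous_coe.comp (by fun_prop))
  exact (continuous_quotient_mk' (s := ellipticSetoid)).comp h

theorem isOpenMap_planeMk : IsOpenMap planeMk := by
  have hc : IsOpenMap ((↑) : ℝ → Real.Angle) := QuotientAddGroup.isOpenMap_coe
  have hT : IsOpenMap fun x : Plane => ((x 0 : Real.Angle), (x 1 : Real.Angle)) := by
    have e := (EuclideanSpace.equiv (Fin 2) ℝ).toHomeomorph.trans (Homeomorph.finTwoArrow (X := ℝ))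
    have : IsOpenMap fun x : Plane => (x 0, x 1) :=
      ((EuclideanSpace.equiv (Fin 2) ℝ).toHomeomorph.trans
        (Homeomorph.finTwoArrow (X := ℝ))).isOpenMap
    exact (hc.prodMap hc).comp this
  have hq : IsOpenMap pillowMk := by
    intro U hU
    have : pillowMk ⁻¹' (pillowMk '' U) = U ∪ (fun x => -x) ⁻¹' U := by
      ext x
      simp only [Set.mem_preimage, Set.mem_image, Set.mem_union]
      constructor
      · rintro ⟨y, hy, hyx⟩
        rcases pillowMk_eq_iff.1 hyx with rfl | rfl
        · exact Or.inl hy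
        · exact Or.inr (by simpa using hy)
      · rintro (h | h)
        · exact ⟨x, h, rfl⟩
        · exact ⟨-x, h, pillowMk_eq_iff.2 (Or.inr (by simp))⟩
    change IsOpen (pillowMk ⁻¹' (pillowMk '' U))
    rw [this]
    exact hU.union (hU.preimage continuous_neg)
  exact hq.comp hT

theorem planeMk_locally_injective {x : Plane} (hx : x ∈ regularPlane) :
    ∃ U ∈ 𝓝 x, Set.InjOn planeMk U := by
  have key : ∀ i : Fin 2, Real.sin (x i) ≠ 0 → ∃ U ∈ 𝓝 x, Set.InjOn planeMk U := by
    intro i hi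
    have hcont : Continuous fun y : Plane => Real.sin (x i) * Real.sin (y i) := by fun_prop
    refine ⟨Metric.ball x 1 ∩ {y | 0 < Real.sin (x i) * Real.sin (y i)}, ?_, ?_⟩
    · refine Filter.inter_mem (Metric.ball_mem_nhds x one_pos) ?_
      exact (isOpen_lt continuous_const hcont).mem_nhds (mul_self_pos.2 hi)
    · rintro y ⟨hy, hy'⟩ z ⟨hz, hz'⟩ hyz
      obtain ⟨σ, hσ, m, n, hm, hn⟩ := planeMk_eq_iff.1 hyz
      have hpi := Real.pi_gt_three
      have hlt : ∀ j : Fin 2, |z j - y j| < 2 := by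
        intro j
        have h1 : dist (z j) (y j) ≤ dist z y := by
          rw [dist_eq_norm, dist_eq_norm]
          exact PiLp.norm_apply_le (z - y) j
        have h2 : dist z y < 2 := by
          have := dist_triangle_right z y x
          simp only [Metric.mem_ball] at hy hz
          linarith
        rw [← Real.dist_eq]
        linarith
      have hint : ∀ k : ℤ, |2 * Real.pi * (k : ℝ)| < 2 → k = 0 := by
        intro k hk
        by_contra hk0
        have : (1 : ℝ) ≤ |(k : ℝ)| := by exact_mod_cast Int.one_le_abs hk0
        rw [abs_mul, abs_of_pos (by positivity : (0 : ℝ) < 2 * Real.pi)] at hk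
        nlinarith
      rcases hσ with rfl | rfl
      · have hm0 : m = 0 := hint m (by
          have := hlt 0
          rwa [hm, show 1 * y 0 + 2 * Real.pi * m - y 0 = 2 * Real.pi * m by ring] at this)
        have hn0 : n = 0 := hint n (by
          have := hlt 1
          rwa [hn, show 1 * y 1 + 2 * Real.pi * n - y 1 = 2 * Real.pi * n by ring] at this)
        subst hm0 hn0
        ext j
        fin_cases j
        · simpa using hm.symm
        · simpa using hn.symm
      · exfalso
        have hs : Real.sin (z i) = -Real.sin (y i) := by
          have aux : ∀ (a b : ℝ) (k : ℤ), b = -1 * a + 2 * Real.pi * k →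
              Real.sin b = -Real.sin a := by
            intro a b k h
            rw [h, show -1 * a + 2 * Real.pi * (k : ℝ) = -a + (k : ℝ) * (2 * Real.pi) by ring,
              Real.sin_add_int_mul_two_pi, Real.sin_neg]
          fin_cases i
          · exact aux _ _ m hm
          · exact aux _ _ n hn
        simp only [Set.mem_ofPred_eq] at hy' hz'
        rw [hs] at hz'
        linarith
  rcases hx with h | h
  · exact key 0 h
  · exact key 1 h

/-- The covering `(γ, θ) ↦ [γ, θ]` of `P*` by the plane with the points above corners removed. -/
noncomputable def regularMk (x : regularPlane) : PStar := ⟨planeMk x.1, planeMk_mem_corners.2 x.2⟩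

theorem regularMk_surjective : Function.Surjective regularMk := by
  rintro ⟨p, hp⟩
  obtain ⟨x, rfl⟩ := planeMk_surjective p
  exact ⟨⟨x, planeMk_mem_corners.1 hp⟩, rfl⟩

theorem regularMk_isLocalHomeomorph : IsLocalHomeomorph regularMk := by
  have hcont : Continuous regularMk :=
    (continuous_planeMk.comp continuous_subtype_val).subtype_mk _
  have hopen : IsOpenMap regularMk := by
    intro U hU
    have h1 : IsOpen (planeMk '' (Subtype.val '' U)) :=
      isOpenMap_planeMk _ (isOpen_regularPlane.isOpenMap_subtype_val U hU)
    have h2 : regularMk '' U = Subtype.val ⁻¹' (planeMk '' (Subtype.val '' U)) := by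
      ext p
      constructor
      · rintro ⟨x, hx, rfl⟩
        exact ⟨x.1, ⟨x, hx, rfl⟩, rfl⟩
      · rintro ⟨_, ⟨x, hx, rfl⟩, h⟩
        exact ⟨x, hx, Subtype.ext h⟩
    rw [h2]
    exact h1.preimage continuous_subtype_val
  rw [isLocalHomeomorph_iff_isOpenEmbedding_restrict]
  intro x
  obtain ⟨U, hU, hinj⟩ := planeMk_locally_injective x.2
  obtain ⟨V, hVU, hVo, hxV⟩ := mem_nhds_iff.1 hU
  have hV : IsOpen (Subtype.val ⁻¹' V : Set regularPlane) := hVo.preimage continuous_subtype_val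
  refine ⟨Subtype.val ⁻¹' V, hV.mem_nhds hxV, ?_⟩
  refine Topology.IsOpenEmbedding.of_continuous_injective_isOpenMap
    (hcont.comp continuous_subtype_val) ?_ (hopen.comp hV.isOpenMap_subtype_val)
  rintro ⟨y, hy⟩ ⟨z, hz⟩ h
  have h' : planeMk y.1 = planeMk z.1 := congrArg Subtype.val h
  exact Subtype.ext (Subtype.ext (hinj (hVU hy) (hVU hz) h'))

instance : Nonempty regularPlane :=
  ⟨⟨!₂[Real.pi / 2, 0], by simp [regularPlane]⟩⟩

/-- The inclusion of the regular part of the plane, as a chart. -/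
noncomputable def regularInclusion : OpenPartialHomeomorph regularPlane Plane :=
  isOpen_regularPlane.isOpenEmbedding_subtypeVal.toOpenPartialHomeomorph Subtype.val

/-- The chart of `P*` near `[γ, θ]` with coordinates `(γ, θ)`: a local inverse of
`(γ, θ) ↦ [γ, θ]`. -/
noncomputable def pillowChart (x : regularPlane) : OpenPartialHomeomorph PStar Plane :=
  (regularMk_isLocalHomeomorph.localInverseAt (x := x)).trans regularInclusion

/-- The smooth structure of `P*`, which has the local inverses of `(γ, θ) ↦ [γ, θ]` as charts. -/
noncomputable instance : ChartedSpace Plane PStar where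
  atlas := Set.range pillowChart
  chartAt p := pillowChart (Function.surjInv regularMk_surjective p)
  mem_chart_source p := by
    obtain ⟨x, hx⟩ : ∃ x, x = Function.surjInv regularMk_surjective p := ⟨_, rfl⟩
    have hp : regularMk x = p := by rw [hx]; exact Function.surjInv_eq _ p
    rw [← hx, ← hp]
    simp [pillowChart, regularInclusion]
  chart_mem_atlas p := ⟨_, rfl⟩

theorem regularMk_pillowChart {x : regularPlane} {p : PStar} (hp : p ∈ (pillowChart x).source) :
    planeMk (pillowChart x p) = p.1 ∧ pillowChart x p ∈ regularPlane := by
  have h1 : p ∈ (regularMk_isLocalHomeomorph.localInverseAt (x := x)).source := by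
    simp only [pillowChart, OpenPartialHomeomorph.trans_source, Set.mem_inter_iff] at hp
    exact hp.1
  have h2 : regularMk (regularMk_isLocalHomeomorph.localInverseAt (x := x) p) = p :=
    regularMk_isLocalHomeomorph.apply_localInverseAt_of_mem h1
  exact ⟨congrArg Subtype.val h2,
    (regularMk_isLocalHomeomorph.localInverseAt (x := x) p).2⟩

/-- The coordinate changes of `P*` are locally of the form `y ↦ ±y + 2π(m, n)`. -/
theorem pillowChart_transition (x x' : regularPlane) {y : Plane}
    (hy : y ∈ ((pillowChart x).symm.trans (pillowChart x')).source) :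
    ∃ σ : ℝ, (σ = 1 ∨ σ = -1) ∧ ∃ t : Plane,
      (pillowChart x).symm.trans (pillowChart x') =ᶠ[𝓝 y] fun z => σ • z + t := by
  set T := (pillowChart x).symm.trans (pillowChart x') with hT
  have hTmk : ∀ z ∈ T.source, planeMk z = planeMk (T z) ∧ T z ∈ regularPlane := by
    intro z hz
    rw [hT, OpenPartialHomeomorph.trans_source] at hz
    have hz1 : z ∈ (pillowChart x).target := hz.1
    have hz2 : (pillowChart x).symm z ∈ (pillowChart x').source := hz.2
    have h1 := regularMk_pillowChart ((pillowChart x).map_target hz1)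
    rw [(pillowChart x).right_inv hz1] at h1
    have h2 := regularMk_pillowChart hz2
    exact ⟨h1.1.trans h2.1.symm, h2.2⟩
  obtain ⟨hmk, hreg⟩ := hTmk y hy
  obtain ⟨σ, hσ, m, n, hm, hn⟩ := planeMk_eq_iff.1 hmk
  refine ⟨σ, hσ, !₂[2 * Real.pi * m, 2 * Real.pi * n], ?_⟩
  set t : Plane := !₂[2 * Real.pi * m, 2 * Real.pi * n] with ht
  have hTy : T y = σ • y + t := by
    ext j
    fin_cases j
    · simpa [ht] using hm
    · simpa [ht] using hn
  obtain ⟨U, hU, hinj⟩ := planeMk_locally_injective hreg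
  have hcont : Filter.Tendsto T (𝓝 y) (𝓝 (T y)) := T.continuousAt hy
  have hA : Filter.Tendsto (fun z : Plane => σ • z + t) (𝓝 y) (𝓝 (T y)) := by
    rw [hTy]
    exact Continuous.tendsto (by fun_prop) y
  filter_upwards [hcont hU, hA hU, T.open_source.mem_nhds hy] with z h1 h2 h3
  refine hinj h1 h2 ?_
  rw [← (hTmk z h3).1]
  exact planeMk_eq_iff.2 ⟨σ, hσ, m, n, by simp [ht], by simp [ht]⟩

instance : IsManifold (𝓡 2) ω PStar := by
  refine isManifold_of_contDiffOn (𝓡 2) ω PStar ?_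
  rintro _ _ ⟨x, rfl⟩ ⟨x', rfl⟩
  rintro y ⟨hy, -⟩
  obtain ⟨σ, -, t, h⟩ := pillowChart_transition x x' (y := y) hy
  refine ContDiffAt.contDiffWithinAt ?_
  have hs : ContDiffAt ℝ ω (fun z : Plane => σ • z + t) y := by fun_prop
  exact hs.congr_of_eventuallyEq h

/-- The symplectic form `dγ ∧ dθ` of `P*`. It is evaluated in a chart with coordinates `(γ, θ)`;
since the coordinate changes are locally of the form `y ↦ ±y + const`, it does not depend on the
chart. -/
noncomputable def pillowForm (p : PStar) (u v : TangentSpace (𝓡 2) p) : ℝ :=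
  let u' : Plane := u
  let v' : Plane := v
  u' 0 * v' 1 - u' 1 * v' 0

/-- The symplectic form `(-dγ ∧ dθ) ⊕ (dγ ∧ dθ)` of `(P*)⁻ × P*`. -/
noncomputable def productForm (p : PStar × PStar)
    (u v : TangentSpace ((𝓡 2).prod (𝓡 2)) p) : ℝ :=
  let u' : Plane × Plane := u
  let v' : Plane × Plane := v
  pillowForm p.2 u'.2 v'.2 - pillowForm p.1 u'.1 v'.1

/-- The map `r` from a surface to `(P*)⁻ × P*` is a Lagrangian immersion: it is smooth, its
differential is injective everywhere, and the symplectic form pulls back to zero. (The surface has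
half the dimension of the target.) -/
structure IsLagrangianImmersion {X : Type*} [TopologicalSpace X] [ChartedSpace Plane X]
    (r : X → PStar × PStar) : Prop where
  smooth : ContMDiff (𝓡 2) ((𝓡 2).prod (𝓡 2)) ∞ r
  immersive : ∀ x : X, Function.Injective (mfderiv (𝓡 2) ((𝓡 2).prod (𝓡 2)) r x)
  isotropic : ∀ (x : X) (u v : TangentSpace (𝓡 2) x),
    productForm (r x) (mfderiv (𝓡 2) ((𝓡 2).prod (𝓡 2)) r x u)
      (mfderiv (𝓡 2) ((𝓡 2).prod (𝓡 2)) r x v) = 0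

/-! ### The traceless character variety of the four-punctured sphere -/

/-- The meridians `a, b, e, f` of the four-punctured sphere. -/
inductive SphereGen | a | b | e | f
  deriving DecidableEq

/-- The relator of `π₁(S² ∖ 4) = ⟨a, b, e, f ∣ b a = e f⟩`. -/
def sphereRelators : Set (FreeGroup SphereGen) :=
  {FreeGroup.of .b * FreeGroup.of .a * (FreeGroup.of .e * FreeGroup.of .f)⁻¹}

/-- The fundamental group `⟨a, b, e, f ∣ b a = e f⟩` of the four-punctured sphere. -/
abbrev SphereGroup : Type := PresentedGroup sphereRelators

/-- A meridian in the fundamental group of the four-punctured sphere. -/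
abbrev meridian (x : SphereGen) : SphereGroup := PresentedGroup.of x

/-- The traceless representations of the four-punctured sphere. -/
def SphereRep : Type :=
  {ρ : SphereGroup →* SU2 // ∀ x : SphereGen, (ρ (meridian x) : ℍ[ℝ]).re = 0}

/-- The unit quaternion `e^{t𝐤}𝐢 = cos t 𝐢 + sin t 𝐣`. -/
noncomputable def circleIJ (t : Real.Angle) : ℍ[ℝ] := ⟨0, t.cos, t.sin, 0⟩

@[simp] theorem circleIJ_re (t : Real.Angle) : (circleIJ t).re = 0 := rfl
@[simp] theorem circleIJ_imI (t : Real.Angle) : (circleIJ t).imI = t.cos := rfl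
@[simp] theorem circleIJ_imJ (t : Real.Angle) : (circleIJ t).imJ = t.sin := rfl
@[simp] theorem circleIJ_imK (t : Real.Angle) : (circleIJ t).imK = 0 := rfl

/-- The representation `ρ` is conjugate to the one with `a ↦ 𝐢`, `b ↦ e^{γ𝐤}𝐢`, `f ↦ e^{θ𝐤}𝐢`. -/
def HasCoordinates (ρ : SphereGroup →* SU2) (x : Torus) : Prop :=
  ∃ u : SU2,
    ((u * ρ (meridian .a) * u⁻¹ : SU2) : ℍ[ℝ]) = circleIJ 0 ∧
    ((u * ρ (meridian .b) * u⁻¹ : SU2) : ℍ[ℝ]) = circleIJ x.1 ∧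
    ((u * ρ (meridian .f) * u⁻¹ : SU2) : ℍ[ℝ]) = circleIJ x.2

theorem SU2.coe_inv (u : SU2) : ((u⁻¹ : SU2) : ℍ[ℝ]) = star (u : ℍ[ℝ]) := rfl

theorem SU2.normSq_eq (u : SU2) :
    (u : ℍ[ℝ]).re ^ 2 + (u : ℍ[ℝ]).imI ^ 2 + (u : ℍ[ℝ]).imJ ^ 2 + (u : ℍ[ℝ]).imK ^ 2 = 1 := by
  have h : star (u : ℍ[ℝ]) * (u : ℍ[ℝ]) = 1 := Unitary.star_mul_self_of_mem u.2
  rw [Quaternion.star_mul_self, ← Quaternion.coe_one] at h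
  have h2 := Quaternion.coe_injective h
  rwa [Quaternion.normSq_def'] at h2

theorem SU2.re_conj (u x : SU2) : ((u * x * u⁻¹ : SU2) : ℍ[ℝ]).re = (x : ℍ[ℝ]).re := by
  have h := SU2.normSq_eq u
  simp only [Submonoid.coe_mul, SU2.coe_inv, Quaternion.re_mul, Quaternion.imI_mul,
    Quaternion.imJ_mul, Quaternion.imK_mul, Quaternion.re_star, Quaternion.imI_star,
    Quaternion.imJ_star, Quaternion.imK_star]
  linear_combination (x : ℍ[ℝ]).re * h

/-- The quaternion `x + y𝐢 + z𝐣 + t𝐤`. -/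
def quat (x y z t : ℝ) : ℍ[ℝ] := ⟨x, y, z, t⟩

/-- The element `x + y𝐢 + z𝐣 + t𝐤` of `SU(2)`. -/
def SU2.mk (x y z t : ℝ) (h : x ^ 2 + y ^ 2 + z ^ 2 + t ^ 2 = 1) : SU2 :=
  ⟨quat x y z t, by
    have hn : Quaternion.normSq (quat x y z t) = 1 := by
      rw [Quaternion.normSq_def']
      exact h
    rw [Unitary.mem_iff, Quaternion.star_mul_self, Quaternion.self_mul_star, hn]
    simp⟩

@[simp] theorem SU2.mk_re (x y z t : ℝ) (h) : (SU2.mk x y z t h : ℍ[ℝ]).re = x := rfl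
@[simp] theorem SU2.mk_imI (x y z t : ℝ) (h) : (SU2.mk x y z t h : ℍ[ℝ]).imI = y := rfl
@[simp] theorem SU2.mk_imJ (x y z t : ℝ) (h) : (SU2.mk x y z t h : ℍ[ℝ]).imJ = z := rfl
@[simp] theorem SU2.mk_imK (x y z t : ℝ) (h) : (SU2.mk x y z t h : ℍ[ℝ]).imK = t := rfl

theorem SU2.conj_eq_of_mul_eq {u x : SU2} {y : ℍ[ℝ]} (h : (u : ℍ[ℝ]) * x = y * u) :
    ((u * x * u⁻¹ : SU2) : ℍ[ℝ]) = y := by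
  have hu : (u : ℍ[ℝ]) * star (u : ℍ[ℝ]) = 1 := Unitary.mul_star_self_of_mem u.2
  rw [Submonoid.coe_mul, Submonoid.coe_mul, SU2.coe_inv, h, mul_assoc, hu, mul_one]

theorem SU2.mul_eq_of_conj_eq {u x : SU2} {y : ℍ[ℝ]} (h : ((u * x * u⁻¹ : SU2) : ℍ[ℝ]) = y) :
    (u : ℍ[ℝ]) * x = y * u := by
  rw [← h, ← Submonoid.coe_mul, ← Submonoid.coe_mul, inv_mul_cancel_right]

theorem exists_angle {c s : ℝ} (h : c ^ 2 + s ^ 2 = 1) :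
    ∃ t : ℝ, Real.cos t = c ∧ Real.sin t = s := by
  have hn : ‖(⟨c, s⟩ : ℂ)‖ = 1 := by
    rw [Complex.norm_eq_sqrt_sq_add_sq, h, Real.sqrt_one]
  have h0 : (⟨c, s⟩ : ℂ) ≠ 0 := by
    intro h0
    rw [h0, norm_zero] at hn
    exact zero_ne_one hn
  exact ⟨Complex.arg ⟨c, s⟩, by rw [Complex.cos_arg h0, hn, div_one],
    by rw [Complex.sin_arg, hn, div_one]⟩

theorem angle_eq_of_cos_sin {s t : Real.Angle} (hc : s.cos = t.cos) (hs : s.sin = t.sin) :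
    s = t := by
  induction s using Real.Angle.induction_on with
  | _ x =>
    induction t using Real.Angle.induction_on with
    | _ y => exact Real.Angle.cos_sin_inj hc hs

/-- Pillowcase coordinates are unique. -/
theorem HasCoordinates.unique {ρ : SphereGroup →* SU2} {x y : Torus}
    (hx : HasCoordinates ρ x) (hy : HasCoordinates ρ y) : pillowMk x = pillowMk y := by
  obtain ⟨u, hua, hub, huf⟩ := hx
  obtain ⟨v, hva, hvb, hvf⟩ := hy
  have key : ∀ (z : SU2) (s t : Real.Angle), ((u * z * u⁻¹ : SU2) : ℍ[ℝ]) = circleIJ s →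
      ((v * z * v⁻¹ : SU2) : ℍ[ℝ]) = circleIJ t →
      ((v * u⁻¹ : SU2) : ℍ[ℝ]) * circleIJ s = circleIJ t * ((v * u⁻¹ : SU2) : ℍ[ℝ]) := by
    intro z s t hs ht
    rw [← hs, ← ht, ← Submonoid.coe_mul, ← Submonoid.coe_mul]
    congr 1
    group
  have ha := key _ _ _ hua hva
  have hb := key _ _ _ hub hvb
  have hf := key _ _ _ huf hvf
  have hn := SU2.normSq_eq (v * u⁻¹)
  generalize ((v * u⁻¹ : SU2) : ℍ[ℝ]) = w at ha hb hf hn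
  have hJ : w.imJ = 0 := by
    have := congrArg (fun q : ℍ[ℝ] => q.imK) ha
    simp [Quaternion.imK_mul] at this
    linarith
  have hK : w.imK = 0 := by
    have := congrArg (fun q : ℍ[ℝ] => q.imJ) ha
    simp [Quaternion.imJ_mul] at this
    linarith
  have comps : ∀ s t : Real.Angle, w * circleIJ s = circleIJ t * w →
      w.re * s.cos = w.re * t.cos ∧ w.imI * s.cos = w.imI * t.cos ∧
      w.re * s.sin = w.re * t.sin ∧ w.imI * s.sin = -(w.imI * t.sin) := by
    intro s t h
    have h0 := congrArg (fun q : ℍ[ℝ] => q.re) h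
    have h1 := congrArg (fun q : ℍ[ℝ] => q.imI) h
    have h2 := congrArg (fun q : ℍ[ℝ] => q.imJ) h
    have h3 := congrArg (fun q : ℍ[ℝ] => q.imK) h
    simp only [Quaternion.re_mul, Quaternion.imI_mul, Quaternion.imJ_mul, Quaternion.imK_mul,
      circleIJ_re, circleIJ_imI, circleIJ_imJ, circleIJ_imK, hJ, hK] at h0 h1 h2 h3
    refine ⟨?_, ?_, ?_, ?_⟩ <;> linarith
  rw [pillowMk_eq_iff]
  by_cases hre : w.re = 0
  · right
    have hI : w.imI ≠ 0 := by
      intro hI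
      rw [hre, hI, hJ, hK] at hn
      norm_num at hn
    have neg : ∀ s t : Real.Angle, w * circleIJ s = circleIJ t * w → t = -s := by
      intro s t h
      obtain ⟨-, hc, -, hs⟩ := comps s t h
      refine angle_eq_of_cos_sin ?_ ?_
      · rw [Real.Angle.cos_neg]
        exact (mul_left_cancel₀ hI hc).symm
      · rw [Real.Angle.sin_neg]
        refine mul_left_cancel₀ hI ?_
        linarith
    exact Prod.ext (neg _ _ hb) (neg _ _ hf)
  · left
    have pos : ∀ s t : Real.Angle, w * circleIJ s = circleIJ t * w → t = s := by
      intro s t h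
      obtain ⟨hc, -, hs, -⟩ := comps s t h
      exact angle_eq_of_cos_sin (mul_left_cancel₀ hre hc).symm (mul_left_cancel₀ hre hs).symm
    exact Prod.ext (pos _ _ hb) (pos _ _ hf)

/-- Every imaginary unit quaternion is conjugate to `𝐢`. -/
theorem exists_conj_eq_I (z : SU2) (hz : (z : ℍ[ℝ]).re = 0) :
    ∃ u : SU2, ((u * z * u⁻¹ : SU2) : ℍ[ℝ]) = circleIJ 0 := by
  have hn := SU2.normSq_eq z
  rw [hz] at hn
  obtain ⟨x, hx⟩ : ∃ x, x = (z : ℍ[ℝ]).imI := ⟨_, rfl⟩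
  obtain ⟨y, hy⟩ : ∃ x, x = (z : ℍ[ℝ]).imJ := ⟨_, rfl⟩
  obtain ⟨t, ht⟩ : ∃ x, x = (z : ℍ[ℝ]).imK := ⟨_, rfl⟩
  rw [← hx, ← hy, ← ht] at hn
  by_cases h1 : x = -1
  · have h2 : y = 0 := by nlinarith [sq_nonneg y, sq_nonneg t]
    have h3 : t = 0 := by nlinarith [sq_nonneg y, sq_nonneg t]
    refine ⟨SU2.mk 0 0 1 0 (by norm_num), SU2.conj_eq_of_mul_eq ?_⟩
    ext <;> simp [hz, ← hx, ← hy, ← ht, h1, h2, h3, Quaternion.re_mul, Quaternion.imI_mul,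
      Quaternion.imJ_mul, Quaternion.imK_mul]
  · have hpos : 0 < 2 + 2 * x := by
      have h2 : -1 ≤ x := by nlinarith [sq_nonneg y, sq_nonneg t]
      have h3 := lt_of_le_of_ne h2 (Ne.symm h1)
      linarith
    obtain ⟨n, hn0, hn2⟩ : ∃ n : ℝ, 0 < n ∧ n ^ 2 = 2 + 2 * x :=
      ⟨_, Real.sqrt_pos.2 hpos, Real.sq_sqrt hpos.le⟩
    refine ⟨SU2.mk 0 ((1 + x) / n) (y / n) (t / n) ?_, SU2.conj_eq_of_mul_eq ?_⟩
    · field_simp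
      linear_combination hn - hn2
    · ext
      · simp [hz, ← hx, ← hy, ← ht, Quaternion.re_mul]
        field_simp
        linear_combination (-1) * hn
      · simp [hz, ← hx, ← hy, ← ht, Quaternion.imI_mul]
        try ring
      · simp [hz, ← hx, ← hy, ← ht, Quaternion.imJ_mul]
        try ring
      · simp [hz, ← hx, ← hy, ← ht, Quaternion.imK_mul]
        try ring

/-- Two parallel vectors of the plane can be rotated simultaneously into the first axis. -/
theorem exists_rotation {b c b' c' : ℝ} (h : b * c' = c * b') :
    ∃ x y : ℝ, x ^ 2 + y ^ 2 = 1 ∧ 2 * x * y * b + (x ^ 2 - y ^ 2) * c = 0 ∧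
      2 * x * y * b' + (x ^ 2 - y ^ 2) * c' = 0 := by
  have main : ∃ C S : ℝ, C ^ 2 + S ^ 2 = 1 ∧ S * b + C * c = 0 ∧ S * b' + C * c' = 0 := by
    have aux : ∀ u v : ℝ, u ^ 2 + v ^ 2 ≠ 0 → v * b = u * c → v * b' = u * c' →
        ∃ C S : ℝ, C ^ 2 + S ^ 2 = 1 ∧ S * b + C * c = 0 ∧ S * b' + C * c' = 0 := by
      intro u v h0 h1 h2
      have hpos : 0 < u ^ 2 + v ^ 2 := lt_of_le_of_ne (by positivity) (Ne.symm h0)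
      obtain ⟨n, hn0, hn2⟩ : ∃ n : ℝ, 0 < n ∧ n ^ 2 = u ^ 2 + v ^ 2 :=
        ⟨_, Real.sqrt_pos.2 hpos, Real.sq_sqrt hpos.le⟩
      refine ⟨u / n, -v / n, ?_, ?_, ?_⟩
      · field_simp
        linear_combination -hn2
      · field_simp
        linear_combination -h1
      · field_simp
        linear_combination -h2
    by_cases h0 : b ^ 2 + c ^ 2 = 0
    · have hb : b = 0 := by nlinarith [sq_nonneg b, sq_nonneg c]
      have hc : c = 0 := by nlinarith [sq_nonneg b, sq_nonneg c]
      by_cases h0' : b' ^ 2 + c' ^ 2 = 0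
      · have hb' : b' = 0 := by nlinarith [sq_nonneg b', sq_nonneg c']
        have hc' : c' = 0 := by nlinarith [sq_nonneg b', sq_nonneg c']
        exact ⟨1, 0, by norm_num, by simp [hc], by simp [hc']⟩
      · exact aux b' c' h0' (by rw [hb, hc]; ring) (by ring)
    · exact aux b c h0 (by ring) (by linarith)
  obtain ⟨C, S, hCS, h1, h2⟩ := main
  obtain ⟨t, rfl, rfl⟩ := exists_angle hCS
  have hc : Real.cos t = Real.cos (t / 2) ^ 2 - Real.sin (t / 2) ^ 2 := by
    rw [← Real.cos_two_mul', mul_div_cancel₀ t two_ne_zero]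
  have hs : Real.sin t = 2 * Real.cos (t / 2) * Real.sin (t / 2) := by
    have := Real.sin_two_mul (t / 2)
    rw [mul_div_cancel₀ t two_ne_zero] at this
    linarith
  rw [hc, hs] at h1 h2
  exact ⟨Real.cos (t / 2), Real.sin (t / 2), Real.cos_sq_add_sin_sq _, h1, h2⟩

theorem sphere_relation : meridian .b * meridian .a = meridian .e * meridian .f := by
  have h : (PresentedGroup.mk sphereRelators)
      (FreeGroup.of .b * FreeGroup.of .a * (FreeGroup.of .e * FreeGroup.of .f)⁻¹) = 1 :=
    PresentedGroup.one_of_mem rfl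
  rw [map_mul, map_inv, mul_inv_eq_one] at h
  exact h

/-- Every traceless representation of the four-punctured sphere has pillowcase coordinates. -/
theorem exists_hasCoordinates (ρ : SphereRep) : ∃ x : Torus, HasCoordinates ρ.1 x := by
  obtain ⟨ρ, hρ⟩ := ρ
  obtain ⟨u, hu⟩ := exists_conj_eq_I (ρ (meridian .a)) (hρ .a)
  obtain ⟨B, hB⟩ : ∃ B, B = u * ρ (meridian .b) * u⁻¹ := ⟨_, rfl⟩
  obtain ⟨F, hF⟩ : ∃ F, F = u * ρ (meridian .f) * u⁻¹ := ⟨_, rfl⟩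
  obtain ⟨A, hA⟩ : ∃ A, A = u * ρ (meridian .a) * u⁻¹ := ⟨_, rfl⟩
  rw [← hA] at hu
  have hBre : (B : ℍ[ℝ]).re = 0 := by rw [hB, SU2.re_conj, hρ]
  have hFre : (F : ℍ[ℝ]).re = 0 := by rw [hF, SU2.re_conj, hρ]
  have hrel : (B : ℍ[ℝ]).imJ * (F : ℍ[ℝ]).imK = (B : ℍ[ℝ]).imK * (F : ℍ[ℝ]).imJ := by
    have h1 : B * A * F⁻¹ = u * ρ (meridian .e) * u⁻¹ := by
      have h2 : ρ (meridian .b) * ρ (meridian .a) = ρ (meridian .e) * ρ (meridian .f) := by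
        rw [← map_mul, ← map_mul, sphere_relation]
      have h3 : ρ (meridian .e) = ρ (meridian .b) * ρ (meridian .a) * (ρ (meridian .f))⁻¹ := by
        rw [h2, mul_inv_cancel_right]
      rw [hB, hA, hF, h3]
      group
    have h4 : ((B * A * F⁻¹ : SU2) : ℍ[ℝ]).re = 0 := by rw [h1, SU2.re_conj, hρ]
    rw [Submonoid.coe_mul, Submonoid.coe_mul, SU2.coe_inv, hu] at h4
    simp [Quaternion.re_mul, Quaternion.imI_mul, Quaternion.imJ_mul, Quaternion.imK_mul, hBre,
      hFre] at h4
    linarith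
  obtain ⟨x, y, hxy, h1, h2⟩ := exists_rotation hrel
  obtain ⟨v, hv⟩ : ∃ v, v = SU2.mk x y 0 0 (by linarith) := ⟨_, rfl⟩
  have rot : ∀ z : SU2, (z : ℍ[ℝ]).re = 0 →
      2 * x * y * (z : ℍ[ℝ]).imJ + (x ^ 2 - y ^ 2) * (z : ℍ[ℝ]).imK = 0 →
      ∃ t : Real.Angle, ((v * z * v⁻¹ : SU2) : ℍ[ℝ]) = circleIJ t := by
    intro z hz h
    have hre : ((v * z * v⁻¹ : SU2) : ℍ[ℝ]).re = 0 := by rw [SU2.re_conj, hz]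
    have him : ((v * z * v⁻¹ : SU2) : ℍ[ℝ]).imK = 0 := by
      simp only [hv, Submonoid.coe_mul, SU2.coe_inv, Quaternion.re_mul, Quaternion.imI_mul,
        Quaternion.imJ_mul, Quaternion.imK_mul, Quaternion.re_star, Quaternion.imI_star,
        Quaternion.imJ_star, Quaternion.imK_star, SU2.mk_re, SU2.mk_imI, SU2.mk_imJ, SU2.mk_imK]
      linear_combination h
    have hn := SU2.normSq_eq (v * z * v⁻¹)
    rw [hre, him] at hn
    obtain ⟨t, hc, hs⟩ := exists_angle
      (c := ((v * z * v⁻¹ : SU2) : ℍ[ℝ]).imI) (s := ((v * z * v⁻¹ : SU2) : ℍ[ℝ]).imJ)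
      (by linarith)
    refine ⟨(t : Real.Angle), Quaternion.ext _ _ hre ?_ ?_ him⟩
    · rw [circleIJ_imI, Real.Angle.cos_coe, hc]
    · rw [circleIJ_imJ, Real.Angle.sin_coe, hs]
  obtain ⟨γ, hγ⟩ := rot B hBre h1
  obtain ⟨θ, hθ⟩ := rot F hFre h2
  refine ⟨(γ, θ), v * u, ?_, ?_, ?_⟩
  · rw [show v * u * ρ (meridian .a) * (v * u)⁻¹ = v * A * v⁻¹ by rw [hA]; group]
    refine SU2.conj_eq_of_mul_eq ?_
    rw [hu, hv]
    ext <;> simp [Quaternion.re_mul, Quaternion.imI_mul, Quaternion.imJ_mul, Quaternion.imK_mul]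
  · rw [show v * u * ρ (meridian .b) * (v * u)⁻¹ = v * B * v⁻¹ by rw [hB]; group]
    exact hγ
  · rw [show v * u * ρ (meridian .f) * (v * u)⁻¹ = v * F * v⁻¹ by rw [hF]; group]
    exact hθ

/-- Conjugate representations have the same pillowcase coordinates. -/
theorem HasCoordinates.of_conj {ρ σ : SphereGroup →* SU2} {u : SU2}
    (h : ∀ x, σ x = u * ρ x * u⁻¹) {x : Torus} (hx : HasCoordinates σ x) :
    HasCoordinates ρ x := by
  obtain ⟨v, h1, h2, h3⟩ := hx
  have key : ∀ y, v * u * ρ y * (v * u)⁻¹ = v * σ y * v⁻¹ := by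
    intro y
    rw [h]
    group
  exact ⟨v * u, by rw [key, h1], by rw [key, h2], by rw [key, h3]⟩

/-- The point `[γ, θ]` of the pillowcase that corresponds to a traceless representation of the
four-punctured sphere, where `(γ, θ)` are pillowcase coordinates of the representation. -/
noncomputable def pillowPoint (ρ : SphereRep) : Pillowcase :=
  pillowMk (exists_hasCoordinates ρ).choose

theorem pillowPoint_eq {ρ : SphereRep} {x : Torus} (h : HasCoordinates ρ.1 x) :
    pillowPoint ρ = pillowMk x :=
  (exists_hasCoordinates ρ).choose_spec.unique h

/-! ### Restriction to the boundary -/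

theorem elt_eq_of_mem {x y : FreeGroup Gen} (h : x * y⁻¹ ∈ relators) : elt x = elt y := by
  have h1 : elt (x * y⁻¹) = 1 := PresentedGroup.one_of_mem h
  rwa [elt, map_mul, map_inv, mul_inv_eq_one] at h1

/-- The words of the meridians `a, b, e, f` of the outer four-punctured sphere. -/
def outerWord : SphereGen → FreeGroup Gen
  | .a => word .a
  | .b => word .b
  | .e => word .e
  | .f => word .f

/-- The words of the meridians `d, c, g, f` of the inner four-punctured sphere, which play the role
of `a, b, e, f`. -/
def innerWord : SphereGen → FreeGroup Gen
  | .a => wordD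
  | .b => wordC
  | .e => wordG
  | .f => word .f

/-- The homomorphism from the group of the outer sphere, `⟨a, b, e, f ∣ b a = e f⟩`. -/
def outerInclusion : SphereGroup →* TangleGroup :=
  PresentedGroup.toGroup (f := fun x => elt (outerWord x)) (by
    rintro _ rfl
    simp only [map_mul, map_inv, FreeGroup.lift_apply_of, mul_inv_eq_one]
    rw [← map_mul, ← map_mul]
    exact elt_eq_of_mem (by simp [relators, outerWord]))

/-- The homomorphism from the group of the inner sphere, `⟨d, c, g, f ∣ c d = g f⟩`. -/
def innerInclusion : SphereGroup →* TangleGroup :=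
  PresentedGroup.toGroup (f := fun x => elt (innerWord x)) (by
    rintro _ rfl
    simp only [map_mul, map_inv, FreeGroup.lift_apply_of, mul_inv_eq_one]
    rw [← map_mul, ← map_mul]
    exact elt_eq_of_mem (by simp [relators, innerWord]))

/-- The restriction of a perturbed traceless representation to the outer sphere. -/
noncomputable def outerRestriction (s : ℝ) (ρ : PertRep s) : SphereRep :=
  ⟨ρ.1.comp outerInclusion, by
    have h := ρ.2
    intro x
    rw [MonoidHom.comp_apply, outerInclusion, meridian, PresentedGroup.toGroup.of]
    cases x
    · exact h.a_traceless
    · exact h.b_traceless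
    · exact h.e_traceless
    · exact h.f_traceless⟩

/-- The restriction of a perturbed traceless representation to the inner sphere. -/
noncomputable def innerRestriction (s : ℝ) (ρ : PertRep s) : SphereRep :=
  ⟨ρ.1.comp innerInclusion, by
    have h := ρ.2
    intro x
    rw [MonoidHom.comp_apply, innerInclusion, meridian, PresentedGroup.toGroup.of]
    cases x
    · have hd : ρ.1 (elt wordD) = (ρ.1 (elt (word .h)))⁻¹ * (ρ.1 (elt (word .a)) *
          ρ.1 (elt (word .w))) * ((ρ.1 (elt (word .h)))⁻¹)⁻¹ := by
        simp only [wordD, elt, map_mul, map_inv, inv_inv, mul_assoc]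
      change (ρ.1 (elt wordD) : ℍ[ℝ]).re = 0
      rw [hd, SU2.re_conj, Submonoid.coe_mul, h.w2, mul_neg, mul_one, Quaternion.re_neg,
        h.a_traceless, neg_zero]
    · have hc : ρ.1 (elt wordC) = (ρ.1 (elt (word .p * word .q)))⁻¹ * ρ.1 (elt (word .b)) *
          ((ρ.1 (elt (word .p * word .q)))⁻¹)⁻¹ := by
        simp only [wordC, elt, map_mul, map_inv, inv_inv, mul_assoc, mul_inv_rev]
      change (ρ.1 (elt wordC) : ℍ[ℝ]).re = 0
      rw [hc, SU2.re_conj, h.b_traceless]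
    · have hg : ρ.1 (elt wordG) = (ρ.1 (elt (word .q)))⁻¹ * ρ.1 (elt (word .e)) *
          ((ρ.1 (elt (word .q)))⁻¹)⁻¹ := by
        simp only [wordG, elt, map_mul, map_inv, inv_inv, mul_assoc]
      change (ρ.1 (elt wordG) : ℍ[ℝ]).re = 0
      rw [hg, SU2.re_conj, h.e_traceless]
    · exact h.f_traceless⟩

/-- The restriction map `NAT_s → P` to the outer sphere. -/
noncomputable def outerMap (s : ℝ) : NAT s → Pillowcase :=
  Quotient.lift (fun ρ => pillowPoint (outerRestriction s ρ)) (by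
    rintro ρ σ ⟨u, hu⟩
    obtain ⟨x, hx⟩ := exists_hasCoordinates (outerRestriction s σ)
    have hx' : HasCoordinates (outerRestriction s ρ).1 x :=
      hx.of_conj (u := u) fun y => hu (outerInclusion y)
    exact (pillowPoint_eq hx').trans (pillowPoint_eq hx).symm)

/-- The restriction map `NAT_s → P` to the inner sphere. -/
noncomputable def innerMap (s : ℝ) : NAT s → Pillowcase :=
  Quotient.lift (fun ρ => pillowPoint (innerRestriction s ρ)) (by
    rintro ρ σ ⟨u, hu⟩
    obtain ⟨x, hx⟩ := exists_hasCoordinates (innerRestriction s σ)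
    have hx' : HasCoordinates (innerRestriction s ρ).1 x :=
      hx.of_conj (u := u) fun y => hu (innerInclusion y)
    exact (pillowPoint_eq hx').trans (pillowPoint_eq hx).symm)

end Earring

open Earring

namespace Earring

/-! ### Finite cell decompositions -/

theorem continuousOn_invFunOn_image_ball {n : ℕ} {X : Type*} [TopologicalSpace X] [T2Space X]
    {Φ : (Fin n → ℝ) → X} (hc : ContinuousOn Φ (Metric.closedBall 0 1))
    (hinj : Set.InjOn Φ (Metric.ball 0 1))
    (hsep : ∀ x ∈ Metric.sphere (0 : Fin n → ℝ) 1, ∀ y ∈ Metric.ball (0 : Fin n → ℝ) 1,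
      Φ x ≠ Φ y) :
    ContinuousOn (hinj.toPartialEquiv Φ (Metric.ball 0 1)).symm (Φ '' Metric.ball 0 1) := by
  rw [continuousOn_iff_isClosed]
  intro A hA
  refine ⟨Φ '' (A ∩ Metric.closedBall 0 1), ?_, ?_⟩
  · refine (IsCompact.image_of_continuousOn ?_ (hc.mono Set.inter_subset_right)).isClosed
    exact (isCompact_closedBall 0 1).inter_left hA
  · have hli : ∀ x ∈ Metric.ball (0 : Fin n → ℝ) 1,
        (hinj.toPartialEquiv Φ (Metric.ball 0 1)).symm (Φ x) = x := fun x hx =>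
      (hinj.toPartialEquiv Φ (Metric.ball 0 1)).left_inv hx
    ext y
    constructor
    · rintro ⟨hy, x, hx, rfl⟩
      rw [Set.mem_preimage, hli x hx] at hy
      exact ⟨⟨x, ⟨hy, Metric.ball_subset_closedBall hx⟩, rfl⟩, x, hx, rfl⟩
    · rintro ⟨⟨x', ⟨hx'A, hx'⟩, hxx'⟩, x, hx, rfl⟩
      refine ⟨?_, x, hx, rfl⟩
      rw [Set.mem_preimage, hli x hx]
      rcases (Metric.mem_closedBall.1 hx').lt_or_eq with h | h
      · rwa [← hinj h hx hxx']
      · exact (hsep x' h x hx hxx').elim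

/-- The index types of a cell decomposition with cells of dimension at most two. -/
def cellType (C₀ C₁ C₂ : Type) : ℕ → Type
  | 0 => C₀
  | 1 => C₁
  | 2 => C₂
  | _ => PEmpty

theorem finite_sigma_cellType (C₀ C₁ C₂ : Type) [Finite C₀] [Finite C₁] [Finite C₂] :
    Finite (Σ n, cellType C₀ C₁ C₂ n) := by
  refine Finite.of_surjective (α := C₀ ⊕ C₁ ⊕ C₂)
    (Sum.elim (fun i => ⟨0, i⟩) (Sum.elim (fun i => ⟨1, i⟩) (fun i => ⟨2, i⟩))) ?_
  rintro ⟨_ | _ | _ | n, i⟩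
  · exact ⟨Sum.inl i, rfl⟩
  · exact ⟨Sum.inr (Sum.inl i), rfl⟩
  · exact ⟨Sum.inr (Sum.inr i), rfl⟩
  · exact i.elim

/-- The characteristic maps of a cell decomposition with cells of dimension at most two. -/
def cellMap {X C₀ C₁ C₂ : Type} (v : C₀ → X) (e : C₁ → ℝ → X) (f : C₂ → ℝ → ℝ → X) :
    ∀ n, cellType C₀ C₁ C₂ n → (Fin n → ℝ) → X
  | 0, i, _ => v i
  | 1, i, x => e i (x 0)
  | 2, i, x => f i (x 0) (x 1)
  | (_ + 3), i, _ => i.elim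

/-- A decomposition of a Hausdorff space into finitely many open cells of dimension at most two
determines its Euler characteristic. The function `d` is the dimension of the cell of a point. -/
theorem hasEulerCharacteristic_of_cells {X C₀ C₁ C₂ : Type} [TopologicalSpace X] [T2Space X]
    [Finite C₀] [Finite C₁] [Finite C₂] (d : X → ℕ)
    (v : C₀ → X) (e : C₁ → ℝ → X) (f : C₂ → ℝ → ℝ → X)
    (he : ∀ i, ContinuousOn (e i) (Set.Icc (-1) 1))
    (hf : ∀ i, ContinuousOn (Function.uncurry (f i)) (Set.Icc (-1) 1 ×ˢ Set.Icc (-1) 1))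
    (dv : ∀ i, d (v i) = 0) (de : ∀ i, ∀ t ∈ Set.Ioo (-1 : ℝ) 1, d (e i t) = 1)
    (df : ∀ i, ∀ t ∈ Set.Ioo (-1 : ℝ) 1, ∀ u ∈ Set.Ioo (-1 : ℝ) 1, d (f i t u) = 2)
    (de' : ∀ i t, |t| = 1 → d (e i t) = 0)
    (df' : ∀ i, ∀ t ∈ Set.Icc (-1 : ℝ) 1, ∀ u ∈ Set.Icc (-1 : ℝ) 1, (|t| = 1 ∨ |u| = 1) →
      d (f i t u) ≤ 1)
    (iv : Function.Injective v)
    (ie : ∀ i, ∀ t ∈ Set.Ioo (-1 : ℝ) 1, ∀ j, ∀ t' ∈ Set.Ioo (-1 : ℝ) 1,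
      e i t = e j t' → i = j ∧ t = t')
    (if' : ∀ i, ∀ t ∈ Set.Ioo (-1 : ℝ) 1, ∀ u ∈ Set.Ioo (-1 : ℝ) 1, ∀ j,
      ∀ t' ∈ Set.Ioo (-1 : ℝ) 1, ∀ u' ∈ Set.Ioo (-1 : ℝ) 1,
      f i t u = f j t' u' → i = j ∧ t = t' ∧ u = u')
    (hd : ∀ x, d x ≤ 2)
    (cv : ∀ x, d x = 0 → ∃ i, v i = x)
    (ce : ∀ x, d x = 1 → ∃ i, ∃ t ∈ Set.Ioo (-1 : ℝ) 1, e i t = x)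
    (cf : ∀ x, d x = 2 → ∃ i, ∃ t ∈ Set.Ioo (-1 : ℝ) 1, ∃ u ∈ Set.Ioo (-1 : ℝ) 1, f i t u = x) :
    HasEulerCharacteristic X (Nat.card C₀ - Nat.card C₁ + Nat.card C₂) := by
  set cell := cellType C₀ C₁ C₂ with hcell
  set Φ := cellMap v e f with hΦ
  have hball : ∀ {n : ℕ} {x : Fin n → ℝ}, x ∈ Metric.ball (0 : Fin n → ℝ) 1 →
      ∀ i, x i ∈ Set.Ioo (-1 : ℝ) 1 := by
    intro n x hx i
    rw [mem_ball_zero_iff, pi_norm_lt_iff one_pos] at hx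
    have := hx i
    rw [Real.norm_eq_abs, abs_lt] at this
    exact this
  have hcball : ∀ {n : ℕ} {x : Fin n → ℝ}, x ∈ Metric.closedBall (0 : Fin n → ℝ) 1 →
      ∀ i, x i ∈ Set.Icc (-1 : ℝ) 1 := by
    intro n x hx i
    rw [mem_closedBall_zero_iff, pi_norm_le_iff_of_nonneg zero_le_one] at hx
    have := hx i
    rw [Real.norm_eq_abs, abs_le] at this
    exact this
  have hdim : ∀ n (i : cell n), ∀ x ∈ Metric.ball (0 : Fin n → ℝ) 1, d (Φ n i x) = n := by
    intro n i x hx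
    match n, i, x, hx with
    | 0, i, x, hx => exact dv i
    | 1, i, x, hx => exact de i _ (hball hx 0)
    | 2, i, x, hx => exact df i _ (hball hx 0) _ (hball hx 1)
    | (_ + 3), i, x, hx => exact i.elim
  have hsph : ∀ n (i : cell n), ∀ x ∈ Metric.sphere (0 : Fin n → ℝ) 1, d (Φ n i x) < n := by
    intro n i x hx
    have hx1 := hcball (Metric.sphere_subset_closedBall hx)
    have hx2 : ‖x‖ = 1 := by simpa using hx
    match n, i, x, hx2, hx1 with
    | 0, i, x, hx, _ =>
      rw [Subsingleton.elim x 0, norm_zero] at hx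
      exact absurd hx zero_ne_one
    | 1, i, x, hx, _ =>
      have h : ‖x‖ = |x 0| := by
        rw [Pi.norm_def]
        simp
      have := de' i (x 0) (h ▸ hx)
      change d (e i (x 0)) < 1
      omega
    | 2, i, x, hx, hx1 =>
      have h : |x 0| = 1 ∨ |x 1| = 1 := by
        by_contra! hcon
        have hlt : ‖x‖ < 1 := by
          rw [pi_norm_lt_iff one_pos]
          intro j
          fin_cases j
          · exact lt_of_le_of_ne (abs_le.2 (hx1 0)) hcon.1
          · exact lt_of_le_of_ne (abs_le.2 (hx1 1)) hcon.2
        exact hlt.ne hx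
      exact Nat.lt_succ_of_le (df' i _ (hx1 0) _ (hx1 1) h)
    | (_ + 3), i, x, _, _ => exact i.elim
  have hcont : ∀ n (i : cell n), ContinuousOn (Φ n i) (Metric.closedBall 0 1) := by
    intro n i
    match n, i with
    | 0, i => exact continuousOn_const
    | 1, i => exact (he i).comp (by fun_prop) (fun x hx => hcball hx 0)
    | 2, i =>
      exact (hf i).comp (f := fun x : Fin 2 → ℝ => (x 0, x 1)) (by fun_prop)
        (fun x hx => ⟨hcball hx 0, hcball hx 1⟩)
    | (_ + 3), i => exact i.elim
  have hinj : ∀ n (i j : cell n), ∀ x ∈ Metric.ball (0 : Fin n → ℝ) 1,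
      ∀ y ∈ Metric.ball (0 : Fin n → ℝ) 1, Φ n i x = Φ n j y → i = j ∧ x = y := by
    intro n i j x hx y hy h
    match n, i, j, x, y, hball hx, hball hy, h with
    | 0, i, j, x, y, _, _, h => exact ⟨iv h, Subsingleton.elim _ _⟩
    | 1, i, j, x, y, hx, hy, h =>
      obtain ⟨h1, h2⟩ := ie i _ (hx 0) j _ (hy 0) h
      refine ⟨h1, funext fun k => ?_⟩
      rw [Subsingleton.elim k 0, h2]
    | 2, i, j, x, y, hx, hy, h =>
      obtain ⟨h1, h2, h3⟩ := if' i _ (hx 0) _ (hx 1) j _ (hy 0) _ (hy 1) h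
      refine ⟨h1, funext fun k => ?_⟩
      fin_cases k
      · exact h2
      · exact h3
    | (_ + 3), i, _, _, _, _, _, _ => exact i.elim
  have hcov : ∀ z, ∃ i : cell (d z), ∃ x ∈ Metric.ball (0 : Fin (d z) → ℝ) 1,
      Φ (d z) i x = z := by
    intro z
    have key : ∀ n ≤ 2, d z = n → ∃ i : cell n, ∃ x ∈ Metric.ball (0 : Fin n → ℝ) 1,
        Φ n i x = z := by
      intro n hn hz
      match n, hn, hz with
      | 0, _, hz =>
        obtain ⟨i, hi⟩ := cv z hz
        exact ⟨i, 0, Metric.mem_ball_self one_pos, hi⟩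
      | 1, _, hz =>
        obtain ⟨i, t, ht, hi⟩ := ce z hz
        refine ⟨i, fun _ => t, ?_, hi⟩
        rw [mem_ball_zero_iff, pi_norm_lt_iff one_pos]
        exact fun _ => abs_lt.2 ht
      | 2, _, hz =>
        obtain ⟨i, t, ht, u, hu, hi⟩ := cf z hz
        refine ⟨i, ![t, u], ?_, hi⟩
        rw [mem_ball_zero_iff, pi_norm_lt_iff one_pos]
        intro j
        fin_cases j
        · exact abs_lt.2 ht
        · exact abs_lt.2 hu
    exact key _ (hd z) rfl
  have hfin : ∀ n, Finite (cell n) := by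
    intro n
    match n with
    | 0 => exact ‹Finite C₀›
    | 1 => exact ‹Finite C₁›
    | 2 => exact ‹Finite C₂›
    | (_ + 3) => exact Finite.of_fintype PEmpty
  have hio : ∀ n (i : cell n), Set.InjOn (Φ n i) (Metric.ball 0 1) :=
    fun n i x hx y hy h => (hinj n i i x hx y hy h).2
  let C : Topology.CWComplex (Set.univ : Set X) :=
    Topology.CWComplex.mkFinite (Set.univ : Set X) (cell := cell)
      (map := fun n i => (hio n i).toPartialEquiv (Φ n i) (Metric.ball 0 1))
      (eventually_isEmpty_cell := by
        filter_upwards [Filter.eventually_ge_atTop 3] with n hn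
        obtain ⟨k, rfl⟩ := Nat.exists_eq_add_of_le' hn
        exact inferInstanceAs (IsEmpty PEmpty))
      (finite_cell := hfin)
      (source_eq := fun n i => rfl)
      (continuousOn := hcont)
      (continuousOn_symm := by
        intro n i
        refine continuousOn_invFunOn_image_ball (hcont n i) (hio n i) ?_
        intro x hx y hy h
        have h1 := hsph n i x hx
        rw [h, hdim n i y hy] at h1
        exact lt_irrefl _ h1)
      (pairwiseDisjoint' := by
        rintro ⟨n, i⟩ - ⟨m, j⟩ - hne
        rw [Function.onFun, Set.disjoint_left]
        rintro _ ⟨x, hx, rfl⟩ ⟨y, hy, hxy⟩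
        change Φ m j y = Φ n i x at hxy
        have h1 : n = m := by rw [← hdim n i x hx, ← hxy, hdim m j y hy]
        subst h1
        obtain ⟨rfl, -⟩ := hinj n j i y hy x hx hxy
        exact hne rfl)
      (mapsTo_iff_image_subset := by
        intro n i x hx
        obtain ⟨j, y, hy, h⟩ := hcov (Φ n i x)
        simp only [Set.mem_iUnion]
        exact ⟨d (Φ n i x), hsph n i x hx, j, y, Metric.ball_subset_closedBall hy, h⟩)
      (union' := by
        rw [Set.eq_univ_iff_forall]
        intro z
        obtain ⟨j, y, hy, h⟩ := hcov z
        simp only [Set.mem_iUnion]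
        exact ⟨d z, j, y, Metric.ball_subset_closedBall hy, h⟩)
  refine ⟨C, ?_, ?_⟩
  · exact finite_sigma_cellType C₀ C₁ C₂
  · change ∑ᶠ n : ℕ, (-1 : ℤ) ^ n * (Nat.card (cell n) : ℤ) = _
    rw [finsum_eq_sum_of_support_subset (s := Finset.range 3)]
    · simp [Finset.sum_range_succ, hcell, cellType]
      ring
    · intro n hn
      by_contra hcon
      simp only [Finset.coe_range, Set.mem_Iio, not_lt] at hcon
      obtain ⟨k, rfl⟩ := Nat.exists_eq_add_of_le' hcon
      exact hn (by simp [hcell, cellType])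

/-! ### A cell decomposition of `Σ̂` -/

/-- The sign `±1` encoded by a Boolean. -/
def boolSign (ε : Bool) : ℝ := if ε then 1 else -1

theorem boolSign_sq (ε : Bool) : boolSign ε * boolSign ε = 1 := by
  cases ε <;> simp [boolSign]

theorem boolSign_mem (ε : Bool) : boolSign ε ∈ Set.Icc (-1 : ℝ) 1 := by
  cases ε <;> simp [boolSign]

theorem abs_boolSign (ε : Bool) : |boolSign ε| = 1 := by
  cases ε <;> simp [boolSign]

theorem boolSign_mul_inj {ε ε' : Bool} {x y : ℝ} (hx : 0 < x) (hy : 0 < y)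
    (h : boolSign ε * x = boolSign ε' * y) : ε = ε' := by
  cases ε <;> cases ε' <;> simp [boolSign] at h ⊢ <;> linarith

theorem boolSign_injective : Function.Injective boolSign := fun ε ε' h =>
  boolSign_mul_inj one_pos one_pos (by rw [h])

theorem exists_boolSign_of_abs {x : ℝ} (h : |x| = 1) : ∃ ε, x = boolSign ε := by
  rcases eq_or_eq_neg_of_abs_eq h with h | h
  · exact ⟨true, by simp [boolSign, h]⟩
  · exact ⟨false, by simp [boolSign, h]⟩

theorem exists_boolSign_nonneg (x : ℝ) : ∃ ε, 0 ≤ boolSign ε * x := by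
  rcases le_total 0 x with h | h
  · exact ⟨true, by simpa [boolSign] using h⟩
  · exact ⟨false, by simpa [boolSign] using h⟩

/-- The angle with sine `x` whose cosine has the sign `ε`. -/
noncomputable def signedArcsin (ε : Bool) (x : ℝ) : ℝ :=
  if ε then Real.arcsin x else Real.pi - Real.arcsin x

theorem continuous_signedArcsin (ε : Bool) : Continuous (signedArcsin ε) := by
  cases ε
  · exact (continuous_const (y := Real.pi)).sub Real.continuous_arcsin |>.congr fun x => by
      simp [signedArcsin]
  · exact Real.continuous_arcsin.congr fun x => by simp [signedArcsin]

theorem sin_signedArcsin (ε : Bool) {x : ℝ} (hx : x ∈ Set.Icc (-1 : ℝ) 1) :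
    Real.sin (signedArcsin ε x) = x := by
  cases ε <;> simp [signedArcsin, Real.sin_pi_sub, Real.sin_arcsin hx.1 hx.2]

theorem cos_signedArcsin (ε : Bool) (x : ℝ) :
    Real.cos (signedArcsin ε x) = boolSign ε * √(1 - x ^ 2) := by
  cases ε <;> simp [signedArcsin, boolSign, Real.cos_pi_sub, Real.cos_arcsin]

/-- The angle with cotangent `c` whose sine has the sign `σ`. -/
noncomputable def signedArccot (σ : Bool) (c : ℝ) : ℝ :=
  Real.pi / 2 - Real.arctan c + if σ then 0 else Real.pi

theorem continuous_signedArccot (σ : Bool) : Continuous (signedArccot σ) :=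
  (continuous_const.sub Real.continuous_arctan).add continuous_const

theorem sin_signedArccot (σ : Bool) (c : ℝ) :
    Real.sin (signedArccot σ c) = boolSign σ * (1 / √(1 + c ^ 2)) := by
  cases σ <;> simp [signedArccot, boolSign, Real.sin_add_pi, Real.sin_pi_div_two_sub,
    Real.cos_arctan]

theorem cos_signedArccot (σ : Bool) (c : ℝ) :
    Real.cos (signedArccot σ c) = boolSign σ * (c / √(1 + c ^ 2)) := by
  cases σ <;> simp [signedArccot, boolSign, Real.cos_add_pi, Real.cos_pi_div_two_sub,
    Real.sin_arctan]

/-- The retraction of the line to `[-1, 1]`. -/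
noncomputable def clamp (x : ℝ) : ℝ := max (-1) (min 1 x)

theorem clamp_mem (x : ℝ) : clamp x ∈ Set.Icc (-1 : ℝ) 1 :=
  ⟨le_max_left _ _, max_le (by norm_num) (min_le_left _ _)⟩

theorem clamp_eq {x : ℝ} (hx : x ∈ Set.Icc (-1 : ℝ) 1) : clamp x = x := by
  rw [clamp, min_eq_right hx.2, max_eq_right hx.1]

theorem continuous_clamp : Continuous clamp := by
  unfold clamp
  fun_prop

theorem mul_mem_Icc {x y : ℝ} (hx : x ∈ Set.Icc (-1 : ℝ) 1) (hy : y ∈ Set.Icc (-1 : ℝ) 1) :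
    x * y ∈ Set.Icc (-1 : ℝ) 1 := by
  rw [Set.mem_Icc, ← abs_le] at *
  rw [abs_mul]
  exact mul_le_one₀ hx (abs_nonneg _) hy

theorem neg_mem_Icc {x : ℝ} (hx : x ∈ Set.Icc (-1 : ℝ) 1) : -x ∈ Set.Icc (-1 : ℝ) 1 :=
  ⟨by linarith [hx.2], by linarith [hx.1]⟩

theorem mem_genusFiveSurface {γ θ ν : Real.Angle} :
    (γ, θ, ν) ∈ genusFiveSurface ↔ θ.sin * ν.sin + γ.sin * ν.cos = 0 := Iff.rfl

/-- The part of `Σ̂` with `|cos ν| ≤ σ sin ν` and with prescribed signs of `cos γ` and `cos θ`,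
parametrized by `u = -sin γ` and `c = cot ν`. -/
noncomputable def face (ε₁ ε₂ σ : Bool) (u c : ℝ) : genusFiveSurface :=
  ⟨((signedArcsin ε₁ (-clamp u) : ℝ), (signedArcsin ε₂ (clamp u * clamp c) : ℝ),
    (signedArccot σ (clamp c) : ℝ)), by
    rw [mem_genusFiveSurface]
    simp only [Real.Angle.sin_coe, Real.Angle.cos_coe]
    rw [sin_signedArcsin _ (mul_mem_Icc (clamp_mem u) (clamp_mem c)),
      sin_signedArcsin _ (neg_mem_Icc (clamp_mem u)), sin_signedArccot, cos_signedArccot]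
    ring⟩

theorem continuous_face (ε₁ ε₂ σ : Bool) : Continuous (Function.uncurry (face ε₁ ε₂ σ)) := by
  have h1 : Continuous fun x : ℝ × ℝ => clamp x.1 := continuous_clamp.comp continuous_fst
  have h2 : Continuous fun x : ℝ × ℝ => clamp x.2 := continuous_clamp.comp continuous_snd
  refine Continuous.subtype_mk (Continuous.prodMk ?_ (Continuous.prodMk ?_ ?_)) _
  · exact Real.Angle.continuous_coe.comp ((continuous_signedArcsin _).comp h1.neg)
  · exact Real.Angle.continuous_coe.comp ((continuous_signedArcsin _).comp (h1.mul h2))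
  · exact Real.Angle.continuous_coe.comp ((continuous_signedArccot _).comp h2)

theorem surface_ext {z z' : genusFiveSurface}
    (h1 : z.1.1.cos = z'.1.1.cos) (h2 : z.1.1.sin = z'.1.1.sin)
    (h3 : z.1.2.1.cos = z'.1.2.1.cos) (h4 : z.1.2.1.sin = z'.1.2.1.sin)
    (h5 : z.1.2.2.cos = z'.1.2.2.cos) (h6 : z.1.2.2.sin = z'.1.2.2.sin) : z = z' :=
  Subtype.ext (Prod.ext (angle_eq_of_cos_sin h1 h2)
    (Prod.ext (angle_eq_of_cos_sin h3 h4) (angle_eq_of_cos_sin h5 h6)))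

theorem face_sin_fst (ε₁ ε₂ σ : Bool) {u c : ℝ}
    (hu : u ∈ Set.Icc (-1 : ℝ) 1) :
    (face ε₁ ε₂ σ u c).1.1.sin = -u := by
  simp only [face, Real.Angle.sin_coe]
  rw [clamp_eq hu, sin_signedArcsin _ (neg_mem_Icc hu)]

theorem face_cos_fst (ε₁ ε₂ σ : Bool) {u c : ℝ}
    (hu : u ∈ Set.Icc (-1 : ℝ) 1) :
    (face ε₁ ε₂ σ u c).1.1.cos = boolSign ε₁ * √(1 - u ^ 2) := by
  simp only [face, Real.Angle.cos_coe]
  rw [clamp_eq hu, cos_signedArcsin, neg_sq]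

theorem face_sin_snd (ε₁ ε₂ σ : Bool) {u c : ℝ}
    (hu : u ∈ Set.Icc (-1 : ℝ) 1) (hc : c ∈ Set.Icc (-1 : ℝ) 1) :
    (face ε₁ ε₂ σ u c).1.2.1.sin = u * c := by
  simp only [face, Real.Angle.sin_coe]
  rw [clamp_eq hu, clamp_eq hc, sin_signedArcsin _ (mul_mem_Icc hu hc)]

theorem face_cos_snd (ε₁ ε₂ σ : Bool) {u c : ℝ}
    (hu : u ∈ Set.Icc (-1 : ℝ) 1) (hc : c ∈ Set.Icc (-1 : ℝ) 1) :
    (face ε₁ ε₂ σ u c).1.2.1.cos = boolSign ε₂ * √(1 - (u * c) ^ 2) := by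
  simp only [face, Real.Angle.cos_coe]
  rw [clamp_eq hu, clamp_eq hc, cos_signedArcsin]

theorem face_sin_trd (ε₁ ε₂ σ : Bool) {u c : ℝ}
    (hc : c ∈ Set.Icc (-1 : ℝ) 1) :
    (face ε₁ ε₂ σ u c).1.2.2.sin = boolSign σ * (1 / √(1 + c ^ 2)) := by
  simp only [face, Real.Angle.sin_coe]
  rw [clamp_eq hc, sin_signedArccot]

theorem face_cos_trd (ε₁ ε₂ σ : Bool) {u c : ℝ}
    (hc : c ∈ Set.Icc (-1 : ℝ) 1) :
    (face ε₁ ε₂ σ u c).1.2.2.cos = boolSign σ * (c / √(1 + c ^ 2)) := by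
  simp only [face, Real.Angle.cos_coe]
  rw [clamp_eq hc, cos_signedArccot]


/-- The symmetry `(γ, θ, ν) ↦ (θ, γ, π / 2 - ν)` of `Σ̂`. -/
noncomputable def surfaceSwap (z : genusFiveSurface) : genusFiveSurface :=
  ⟨(z.1.2.1, z.1.1, ((Real.pi / 2 : ℝ) : Real.Angle) - z.1.2.2), by
    have := z.2
    rw [mem_genusFiveSurface]
    rw [Real.Angle.sin_pi_div_two_sub, Real.Angle.cos_pi_div_two_sub]
    simp only [genusFiveSurface, Set.mem_ofPred_eq] at this
    linarith⟩

theorem continuous_surfaceSwap : Continuous surfaceSwap := by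
  refine Continuous.subtype_mk ?_ _
  fun_prop

theorem surfaceSwap_surfaceSwap (z : genusFiveSurface) : surfaceSwap (surfaceSwap z) = z := by
  apply Subtype.ext
  simp [surfaceSwap]

theorem surfaceSwap_injective : Function.Injective surfaceSwap :=
  Function.LeftInverse.injective surfaceSwap_surfaceSwap

@[simp] theorem surfaceSwap_fst (z : genusFiveSurface) : (surfaceSwap z).1.1 = z.1.2.1 := rfl

@[simp] theorem surfaceSwap_snd (z : genusFiveSurface) : (surfaceSwap z).1.2.1 = z.1.1 := rfl

@[simp] theorem surfaceSwap_sin (z : genusFiveSurface) :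
    (surfaceSwap z).1.2.2.sin = z.1.2.2.cos :=
  Real.Angle.sin_pi_div_two_sub _

@[simp] theorem surfaceSwap_cos (z : genusFiveSurface) :
    (surfaceSwap z).1.2.2.cos = z.1.2.2.sin :=
  Real.Angle.cos_pi_div_two_sub _

theorem sqrt_one_sub_sq_pos {x : ℝ} (hx : x ∈ Set.Ioo (-1 : ℝ) 1) : 0 < √(1 - x ^ 2) :=
  Real.sqrt_pos.2 (by nlinarith [hx.1, hx.2])

theorem sqrt_one_add_sq_pos (c : ℝ) : 0 < √(1 + c ^ 2) := Real.sqrt_pos.2 (by positivity)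

theorem boolSign_mul_nonneg_eq {ε : Bool} {x : ℝ} (h : 0 ≤ boolSign ε * x) :
    boolSign ε * |x| = x := by
  cases ε
  · simp only [boolSign, Bool.false_eq_true, if_false] at h ⊢
    rw [abs_of_nonpos (by linarith)]
    ring
  · simp only [boolSign, if_true] at h ⊢
    rw [abs_of_nonneg (by linarith), one_mul]

/-- A point with `|cos ν| ≤ σ sin ν` lies on a face. -/
theorem eq_face {z : genusFiveSurface} {ε₁ ε₂ σ : Bool} (h1 : 0 ≤ boolSign ε₁ * z.1.1.cos)
    (h2 : 0 ≤ boolSign ε₂ * z.1.2.1.cos) (h3 : |z.1.2.2.cos| ≤ boolSign σ * z.1.2.2.sin) :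
    -z.1.1.sin ∈ Set.Icc (-1 : ℝ) 1 ∧ z.1.2.2.cos / z.1.2.2.sin ∈ Set.Icc (-1 : ℝ) 1 ∧
    z = face ε₁ ε₂ σ (-z.1.1.sin) (z.1.2.2.cos / z.1.2.2.sin) := by
  have hz := mem_genusFiveSurface.1 z.2
  have hγ := Real.Angle.cos_sq_add_sin_sq z.1.1
  have hθ := Real.Angle.cos_sq_add_sin_sq z.1.2.1
  have hν := Real.Angle.cos_sq_add_sin_sq z.1.2.2
  have hss := boolSign_sq σ
  have habs : |boolSign σ * z.1.2.2.sin| = |z.1.2.2.sin| := by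
    rw [abs_mul, abs_boolSign, one_mul]
  have hpos : 0 < boolSign σ * z.1.2.2.sin := by
    refine lt_of_le_of_ne ((abs_nonneg _).trans h3) fun h => ?_
    rw [← h] at h3
    have hc : z.1.2.2.cos = 0 := abs_nonpos_iff.1 h3
    have hs : z.1.2.2.sin = 0 := by
      rw [← abs_eq_zero, ← habs, ← h, abs_zero]
    rw [hc, hs] at hν
    norm_num at hν
  have hs0 : z.1.2.2.sin ≠ 0 := by
    intro h
    rw [h, mul_zero] at hpos
    exact lt_irrefl _ hpos
  have hu : -z.1.1.sin ∈ Set.Icc (-1 : ℝ) 1 := by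
    constructor <;> nlinarith [sq_nonneg z.1.1.cos]
  have hc : z.1.2.2.cos / z.1.2.2.sin ∈ Set.Icc (-1 : ℝ) 1 := by
    rw [Set.mem_Icc, ← abs_le, abs_div, ← habs, abs_of_pos hpos]
    exact div_le_one_of_le₀ h3 hpos.le
  have hsnd : -z.1.1.sin * (z.1.2.2.cos / z.1.2.2.sin) = z.1.2.1.sin := by
    field_simp
    linarith
  have hroot : √(1 + (z.1.2.2.cos / z.1.2.2.sin) ^ 2) = 1 / (boolSign σ * z.1.2.2.sin) := by
    rw [show 1 + (z.1.2.2.cos / z.1.2.2.sin) ^ 2 = (1 / (boolSign σ * z.1.2.2.sin)) ^ 2 by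
      have : (boolSign σ) ^ 2 = 1 := by rw [sq, hss]
      rw [div_pow, div_pow, mul_pow, this]
      field_simp
      linarith]
    exact Real.sqrt_sq (by positivity)
  refine ⟨hu, hc, surface_ext ?_ ?_ ?_ ?_ ?_ ?_⟩
  · rw [face_cos_fst _ _ _ hu, neg_sq, show 1 - z.1.1.sin ^ 2 = z.1.1.cos ^ 2 by linarith,
      Real.sqrt_sq_eq_abs, boolSign_mul_nonneg_eq h1]
  · rw [face_sin_fst _ _ _ hu, neg_neg]
  · rw [face_cos_snd _ _ _ hu hc, hsnd, show 1 - z.1.2.1.sin ^ 2 = z.1.2.1.cos ^ 2 by linarith,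
      Real.sqrt_sq_eq_abs, boolSign_mul_nonneg_eq h2]
  · rw [face_sin_snd _ _ _ hu hc, hsnd]
  · rw [face_cos_trd _ _ _ hc, hroot]
    field_simp
    linear_combination -z.1.2.2.cos * hss
  · rw [face_sin_trd _ _ _ hc, hroot]
    field_simp
    linear_combination -hss

theorem face_inj {ε₁ ε₂ σ ε₁' ε₂' σ' : Bool} {u c u' c' : ℝ} (hu : u ∈ Set.Icc (-1 : ℝ) 1)
    (hc : c ∈ Set.Icc (-1 : ℝ) 1) (hu' : u' ∈ Set.Icc (-1 : ℝ) 1) (hc' : c' ∈ Set.Icc (-1 : ℝ) 1)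
    (h : face ε₁ ε₂ σ u c = face ε₁' ε₂' σ' u' c') :
    u = u' ∧ c = c' ∧ σ = σ' ∧ (u ∈ Set.Ioo (-1 : ℝ) 1 → ε₁ = ε₁') ∧
      (u * c ∈ Set.Ioo (-1 : ℝ) 1 → ε₂ = ε₂') := by
  have h1 := face_sin_fst ε₁ ε₂ σ (c := c) hu
  have h2 := face_cos_fst ε₁ ε₂ σ (c := c) hu
  have h4 := face_cos_snd ε₁ ε₂ σ hu hc
  have h5 := face_sin_trd ε₁ ε₂ σ (u := u) hc
  have h6 := face_cos_trd ε₁ ε₂ σ (u := u) hc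
  rw [h, face_sin_fst _ _ _ hu', neg_inj] at h1
  rw [h, face_cos_fst _ _ _ hu'] at h2
  rw [h, face_cos_snd _ _ _ hu' hc'] at h4
  rw [h, face_sin_trd _ _ _ hc'] at h5
  rw [h, face_cos_trd _ _ _ hc'] at h6
  have p := sqrt_one_add_sq_pos c
  have p' := sqrt_one_add_sq_pos c'
  have hσ : σ' = σ := boolSign_mul_inj (by positivity) (by positivity) h5
  subst hσ h1
  have hne : boolSign σ' ≠ 0 := fun h0 => by
    have := boolSign_sq σ'
    rw [h0] at this
    norm_num at this
  have e5 := mul_left_cancel₀ hne h5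
  have e6 := mul_left_cancel₀ hne h6
  have hcc : c' = c := by
    rw [div_eq_mul_one_div, e5, ← div_eq_mul_one_div] at e6
    exact (div_left_inj' p.ne').1 e6
  subst hcc
  refine ⟨rfl, rfl, rfl, fun hi => ?_, fun hi => ?_⟩
  · exact (boolSign_mul_inj (sqrt_one_sub_sq_pos hi) (sqrt_one_sub_sq_pos hi) h2).symm
  · exact (boolSign_mul_inj (sqrt_one_sub_sq_pos hi) (sqrt_one_sub_sq_pos hi) h4).symm

theorem face_congr_fst (ε₁ ε₂ σ : Bool) {u : ℝ} (c : ℝ) (hu : |u| = 1) :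
    face ε₁ ε₂ σ u c = face true ε₂ σ u c := by
  have hu' : u ∈ Set.Icc (-1 : ℝ) 1 := abs_le.1 hu.le
  refine surface_ext ?_ ?_ rfl rfl rfl rfl
  · rw [face_cos_fst _ _ _ hu', face_cos_fst _ _ _ hu', ← sq_abs, hu]
    simp
  · rw [face_sin_fst _ _ _ hu', face_sin_fst _ _ _ hu']

theorem face_congr_snd (ε₁ ε₂ σ : Bool) {u c : ℝ} (hu : |u| = 1) (hc : |c| = 1) :
    face ε₁ ε₂ σ u c = face ε₁ true σ u c := by
  have hu' : u ∈ Set.Icc (-1 : ℝ) 1 := abs_le.1 hu.le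
  have hc' : c ∈ Set.Icc (-1 : ℝ) 1 := abs_le.1 hc.le
  refine surface_ext rfl rfl ?_ ?_ rfl rfl
  · rw [face_cos_snd _ _ _ hu' hc', face_cos_snd _ _ _ hu' hc', ← sq_abs, abs_mul, hu, hc]
    simp
  · rw [face_sin_snd _ _ _ hu' hc', face_sin_snd _ _ _ hu' hc']

theorem face_abs_sin (ε₁ ε₂ σ : Bool) (u : ℝ) {c : ℝ} (hc : c ∈ Set.Icc (-1 : ℝ) 1) :
    0 < |(face ε₁ ε₂ σ u c).1.2.2.sin| ∧
    |(face ε₁ ε₂ σ u c).1.2.2.cos| = |c| * |(face ε₁ ε₂ σ u c).1.2.2.sin| := by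
  have p := sqrt_one_add_sq_pos c
  rw [face_sin_trd _ _ _ hc, face_cos_trd _ _ _ hc, abs_mul, abs_mul, abs_boolSign, one_mul,
    one_mul, abs_div, abs_div, abs_one, abs_of_pos p]
  exact ⟨by positivity, by ring⟩

/-- The sheet `σ` of a point of `Σ̂`: the sign of the larger of `sin ν` and `cos ν`. The involution
`ι̂` interchanges the two sheets. -/
noncomputable def sheet (z : genusFiveSurface) : Bool :=
  if |z.1.2.2.cos| ≤ |z.1.2.2.sin| then decide (0 < z.1.2.2.sin) else decide (0 < z.1.2.2.cos)

theorem decide_boolSign_mul_pos (σ : Bool) {x : ℝ} (hx : 0 < x) :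
    decide (0 < boolSign σ * x) = σ := by
  cases σ <;> simp [boolSign] <;> linarith

theorem sheet_face (ε₁ ε₂ σ : Bool) (u : ℝ) {c : ℝ} (hc : c ∈ Set.Icc (-1 : ℝ) 1) :
    sheet (face ε₁ ε₂ σ u c) = σ := by
  obtain ⟨h1, h2⟩ := face_abs_sin ε₁ ε₂ σ u hc
  have h3 : |c| ≤ 1 := abs_le.2 hc
  rw [sheet, if_pos (by rw [h2]; nlinarith), face_sin_trd _ _ _ hc]
  exact decide_boolSign_mul_pos σ (one_div_pos.2 (sqrt_one_add_sq_pos c))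

theorem sheet_surfaceSwap_face (ε₁ ε₂ σ : Bool) (u : ℝ) {c : ℝ} (hc : c ∈ Set.Ioo (-1 : ℝ) 1) :
    sheet (surfaceSwap (face ε₁ ε₂ σ u c)) = σ := by
  have hc' := Set.Ioo_subset_Icc_self hc
  obtain ⟨h1, h2⟩ := face_abs_sin ε₁ ε₂ σ u hc'
  have h3 : |c| < 1 := abs_lt.2 hc
  rw [sheet, surfaceSwap_cos, surfaceSwap_sin, if_neg (by rw [h2]; nlinarith),
    face_sin_trd _ _ _ hc']
  exact decide_boolSign_mul_pos σ (one_div_pos.2 (sqrt_one_add_sq_pos c))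

theorem sin_trd_ne_zero {z : genusFiveSurface} (h : |z.1.2.2.cos| ≤ |z.1.2.2.sin|) :
    z.1.2.2.sin ≠ 0 := by
  intro h0
  have hν := Real.Angle.cos_sq_add_sin_sq z.1.2.2
  rw [h0, abs_zero, abs_nonpos_iff] at h
  rw [h, h0] at hν
  norm_num at hν

theorem sheet_iotaHat (z : genusFiveSurface) : sheet (iotaHat z) = !sheet z := by
  have key : ∀ x : ℝ, x ≠ 0 → decide (0 < -x) = !decide (0 < x) := by
    intro x hx
    rcases lt_or_gt_of_ne hx with h | h
    · simp [h, h.le]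
    · simp [h, h.le]
  have h1 : (iotaHat z).1.2.2.sin = -z.1.2.2.sin := Real.Angle.sin_add_pi _
  have h2 : (iotaHat z).1.2.2.cos = -z.1.2.2.cos := Real.Angle.cos_add_pi _
  rw [sheet, sheet, h1, h2, abs_neg, abs_neg]
  split_ifs with h
  · exact key _ (sin_trd_ne_zero h)
  · refine key _ fun h0 => h ?_
    rw [h0, abs_zero]
    exact abs_nonneg _

open Classical in
/-- The dimension of the cell of a point of `Σ̂`. -/
noncomputable def cellDim (z : genusFiveSurface) : ℕ :=
  (if z.1.1.cos = 0 ∨ z.1.2.1.cos = 0 then 0 else 1) +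
    if |z.1.2.2.cos| = |z.1.2.2.sin| then 0 else 1

theorem cellDim_iotaHat (z : genusFiveSurface) : cellDim (iotaHat z) = cellDim z := by
  have h1 : (iotaHat z).1.2.2.sin = -z.1.2.2.sin := Real.Angle.sin_add_pi _
  have h2 : (iotaHat z).1.2.2.cos = -z.1.2.2.cos := Real.Angle.cos_add_pi _
  have h3 : (iotaHat z).1.1.cos = z.1.1.cos := Real.Angle.cos_neg _
  have h4 : (iotaHat z).1.2.1.cos = z.1.2.1.cos := Real.Angle.cos_neg _
  rw [cellDim, cellDim, h1, h2, h3, h4, abs_neg, abs_neg]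

theorem cellDim_surfaceSwap (z : genusFiveSurface) : cellDim (surfaceSwap z) = cellDim z := by
  simp only [cellDim, surfaceSwap_cos, surfaceSwap_sin, surfaceSwap_fst, surfaceSwap_snd]
  congr 1
  · exact if_congr or_comm rfl rfl
  · exact if_congr eq_comm rfl rfl

theorem cellDim_le (z : genusFiveSurface) : cellDim z ≤ 2 := by
  unfold cellDim
  split_ifs <;> simp

theorem boolSign_mul_eq_zero {ε : Bool} {x : ℝ} : boolSign ε * x = 0 ↔ x = 0 := by
  cases ε <;> simp [boolSign]

open Classical in
theorem cellDim_face (ε₁ ε₂ σ : Bool) {u c : ℝ} (hu : u ∈ Set.Icc (-1 : ℝ) 1)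
    (hc : c ∈ Set.Icc (-1 : ℝ) 1) :
    cellDim (face ε₁ ε₂ σ u c) = (if |u| = 1 then 0 else 1) + if |c| = 1 then 0 else 1 := by
  obtain ⟨h1, h2⟩ := face_abs_sin ε₁ ε₂ σ u hc
  have hsq : ∀ {x : ℝ}, x ∈ Set.Icc (-1 : ℝ) 1 → (√(1 - x ^ 2) = 0 ↔ |x| = 1) := by
    intro x hx
    rw [Real.sqrt_eq_zero (by nlinarith [hx.1, hx.2]), sub_eq_zero, eq_comm, ← sq_abs,
      pow_eq_one_iff_of_nonneg (abs_nonneg x) two_ne_zero]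
  have e1 : (face ε₁ ε₂ σ u c).1.1.cos = 0 ∨ (face ε₁ ε₂ σ u c).1.2.1.cos = 0 ↔ |u| = 1 := by
    rw [face_cos_fst _ _ _ hu, face_cos_snd _ _ _ hu hc, boolSign_mul_eq_zero,
      boolSign_mul_eq_zero, hsq hu, hsq (mul_mem_Icc hu hc)]
    refine ⟨fun h => h.elim id fun h => ?_, Or.inl⟩
    rw [abs_mul] at h
    have := abs_le.2 hu
    have := abs_le.2 hc
    nlinarith [abs_nonneg u, abs_nonneg c]
  have e2 : |(face ε₁ ε₂ σ u c).1.2.2.cos| = |(face ε₁ ε₂ σ u c).1.2.2.sin| ↔ |c| = 1 := by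
    rw [h2, mul_eq_right₀ h1.ne']
  rw [cellDim]
  simp only [e1, e2]

/-- Every point of `Σ̂` lies on a face of its sheet or, if `|cos ν| > |sin ν|`, on the image of such
a face under the symmetry. -/
theorem exists_face (z : genusFiveSurface) : ∃ ε₁ ε₂ u c, u ∈ Set.Icc (-1 : ℝ) 1 ∧
    ((c ∈ Set.Icc (-1 : ℝ) 1 ∧ z = face ε₁ ε₂ (sheet z) u c) ∨
      (c ∈ Set.Ioo (-1 : ℝ) 1 ∧ z = surfaceSwap (face ε₁ ε₂ (sheet z) u c))) := by
  have key : ∀ w : genusFiveSurface, |w.1.2.2.cos| ≤ |w.1.2.2.sin| → ∃ ε₁ ε₂ u c,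
      u ∈ Set.Icc (-1 : ℝ) 1 ∧ c ∈ Set.Icc (-1 : ℝ) 1 ∧
        w = face ε₁ ε₂ (decide (0 < w.1.2.2.sin)) u c := by
    intro w hw
    obtain ⟨ε₁, h1⟩ := exists_boolSign_nonneg w.1.1.cos
    obtain ⟨ε₂, h2⟩ := exists_boolSign_nonneg w.1.2.1.cos
    have h3 : |w.1.2.2.cos| ≤ boolSign (decide (0 < w.1.2.2.sin)) * w.1.2.2.sin := by
      refine hw.trans (le_of_eq ?_)
      rcases lt_or_gt_of_ne (sin_trd_ne_zero hw) with h | h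
      · rw [abs_of_neg h]
        simp [boolSign, h.le.not_gt]
      · rw [abs_of_pos h]
        simp [boolSign, h]
    obtain ⟨hu, hc, h⟩ := eq_face h1 h2 h3
    exact ⟨ε₁, ε₂, _, _, hu, hc, h⟩
  by_cases h : |z.1.2.2.cos| ≤ |z.1.2.2.sin|
  · obtain ⟨ε₁, ε₂, u, c, hu, hc, hz⟩ := key z h
    refine ⟨ε₁, ε₂, u, c, hu, Or.inl ⟨hc, ?_⟩⟩
    rwa [sheet, if_pos h]
  · obtain ⟨ε₁, ε₂, u, c, hu, hc, hz⟩ := key (surfaceSwap z)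
      (by rw [surfaceSwap_cos, surfaceSwap_sin]; exact (not_le.1 h).le)
    refine ⟨ε₁, ε₂, u, c, hu, Or.inr ⟨?_, ?_⟩⟩
    · rw [Set.mem_Ioo, ← abs_lt]
      refine lt_of_le_of_ne (abs_le.2 hc) fun h1 => h ?_
      have h2 := (face_abs_sin ε₁ ε₂ (decide (0 < (surfaceSwap z).1.2.2.sin)) u hc).2
      rw [h1, one_mul, ← hz, surfaceSwap_cos, surfaceSwap_sin] at h2
      exact h2.ge
    · rw [sheet, if_neg h, ← surfaceSwap_sin, ← hz, surfaceSwap_surfaceSwap]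

theorem abs_ne_one_of_mem_Ioo {x : ℝ} (hx : x ∈ Set.Ioo (-1 : ℝ) 1) : |x| ≠ 1 :=
  (abs_lt.2 hx).ne

theorem mem_Ioo_of_abs_ne_one {x : ℝ} (hx : x ∈ Set.Icc (-1 : ℝ) 1) (h : |x| ≠ 1) :
    x ∈ Set.Ioo (-1 : ℝ) 1 :=
  abs_lt.1 (lt_of_le_of_ne (abs_le.2 hx) h)

theorem mul_mem_Ioo_of_left {x y : ℝ} (hx : x ∈ Set.Ioo (-1 : ℝ) 1)
    (hy : y ∈ Set.Icc (-1 : ℝ) 1) : x * y ∈ Set.Ioo (-1 : ℝ) 1 := by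
  rw [Set.mem_Ioo, ← abs_lt, abs_mul]
  have h1 := abs_lt.2 hx
  have h2 := abs_le.2 hy
  nlinarith [abs_nonneg x, abs_nonneg y]

/-- A face or its image under the symmetry. -/
noncomputable def swapFace (s : Bool) (ε₁ ε₂ σ : Bool) (u c : ℝ) : genusFiveSurface :=
  if s then surfaceSwap (face ε₁ ε₂ σ u c) else face ε₁ ε₂ σ u c

theorem continuous_swapFace (s ε₁ ε₂ σ : Bool) :
    Continuous (Function.uncurry (swapFace s ε₁ ε₂ σ)) := by
  cases s
  · exact (continuous_face ε₁ ε₂ σ).congr fun x => by simp [swapFace, Function.uncurry]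
  · exact (continuous_surfaceSwap.comp (continuous_face ε₁ ε₂ σ)).congr fun x => by
      simp [swapFace, Function.uncurry]

theorem sheet_swapFace (s ε₁ ε₂ σ : Bool) (u : ℝ) {c : ℝ} (hc : c ∈ Set.Ioo (-1 : ℝ) 1) :
    sheet (swapFace s ε₁ ε₂ σ u c) = σ := by
  cases s
  · simpa [swapFace] using sheet_face ε₁ ε₂ σ u (Set.Ioo_subset_Icc_self hc)
  · simpa [swapFace] using sheet_surfaceSwap_face ε₁ ε₂ σ u hc

open Classical in
theorem cellDim_swapFace (s ε₁ ε₂ σ : Bool) {u c : ℝ} (hu : u ∈ Set.Icc (-1 : ℝ) 1)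
    (hc : c ∈ Set.Icc (-1 : ℝ) 1) :
    cellDim (swapFace s ε₁ ε₂ σ u c) = (if |u| = 1 then 0 else 1) + if |c| = 1 then 0 else 1 := by
  cases s
  · simpa [swapFace] using cellDim_face ε₁ ε₂ σ hu hc
  · simpa [swapFace, cellDim_surfaceSwap] using cellDim_face ε₁ ε₂ σ hu hc

theorem swapFace_inj {s s' ε₁ ε₂ σ ε₁' ε₂' σ' : Bool} {u c u' c' : ℝ}
    (hc : c ∈ Set.Ioo (-1 : ℝ) 1) (hc' : c' ∈ Set.Ioo (-1 : ℝ) 1) (h : swapFace s ε₁ ε₂ σ u c = swapFace s' ε₁' ε₂' σ' u' c') :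
    s = s' ∧ face ε₁ ε₂ σ u c = face ε₁' ε₂' σ' u' c' := by
  have key : ∀ {a b : genusFiveSurface}, |a.1.2.2.cos| < |a.1.2.2.sin| →
      |b.1.2.2.cos| < |b.1.2.2.sin| → surfaceSwap a ≠ b := by
    rintro a _ ha hb rfl
    rw [surfaceSwap_cos, surfaceSwap_sin] at hb
    exact lt_asymm ha hb
  have lt : ∀ (ε₁ ε₂ σ : Bool) (u : ℝ) {c : ℝ}, c ∈ Set.Ioo (-1 : ℝ) 1 →
      |(face ε₁ ε₂ σ u c).1.2.2.cos| < |(face ε₁ ε₂ σ u c).1.2.2.sin| := by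
    intro ε₁ ε₂ σ u c hc
    obtain ⟨h1, h2⟩ := face_abs_sin ε₁ ε₂ σ u (Set.Ioo_subset_Icc_self hc)
    rw [h2]
    nlinarith [abs_lt.2 hc]
  cases s <;> cases s' <;> simp only [swapFace, Bool.false_eq_true, if_false, if_true] at h
  · exact ⟨rfl, h⟩
  · exact (key (lt _ _ _ _ hc') (lt _ _ _ _ hc) h.symm).elim
  · exact (key (lt _ _ _ _ hc) (lt _ _ _ _ hc') h).elim
  · exact ⟨rfl, surfaceSwap_injective h⟩

theorem exists_vertex {z : genusFiveSurface} (hz : cellDim z = 0) :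
    ∃ a b, z = face true true (sheet z) (boolSign a) (boolSign b) := by
  classical
  obtain ⟨ε₁, ε₂, u, c, hu, ⟨hc, h⟩ | ⟨hc, h⟩⟩ := exists_face z
  · rw [h, cellDim_face _ _ _ hu hc] at hz
    have h1 : |u| = 1 := by
      by_contra hn
      simp [hn] at hz
    have h2 : |c| = 1 := by
      by_contra hn
      simp [hn] at hz
    obtain ⟨a, rfl⟩ := exists_boolSign_of_abs h1
    obtain ⟨b, rfl⟩ := exists_boolSign_of_abs h2
    refine ⟨a, b, ?_⟩
    rw [← face_congr_fst ε₁ true (sheet z) (boolSign b) h1, ← face_congr_snd ε₁ ε₂ _ h1 h2]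
    exact h
  · rw [h, cellDim_surfaceSwap, cellDim_face _ _ _ hu (Set.Ioo_subset_Icc_self hc)] at hz
    simp [abs_ne_one_of_mem_Ioo hc] at hz

theorem exists_edge {z : genusFiveSurface} (hz : cellDim z = 1) :
    (∃ ε₁ ε₂ b, ∃ t ∈ Set.Ioo (-1 : ℝ) 1, z = face ε₁ ε₂ (sheet z) t (boolSign b)) ∨
    (∃ s ε a, ∃ t ∈ Set.Ioo (-1 : ℝ) 1, z = swapFace s true ε (sheet z) (boolSign a) t) := by
  classical
  obtain ⟨ε₁, ε₂, u, c, hu, ⟨hc, h⟩ | ⟨hc, h⟩⟩ := exists_face z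
  · rw [h, cellDim_face _ _ _ hu hc] at hz
    by_cases h1 : |u| = 1
    · have h2 : |c| ≠ 1 := by
        intro hn
        simp [hn, h1] at hz
      obtain ⟨a, rfl⟩ := exists_boolSign_of_abs h1
      refine Or.inr ⟨false, ε₂, a, c, mem_Ioo_of_abs_ne_one hc h2, ?_⟩
      simp only [swapFace, Bool.false_eq_true, if_false]
      rw [← face_congr_fst ε₁ ε₂ _ c h1]
      exact h
    · have h2 : |c| = 1 := by
        by_contra hn
        simp [hn, h1] at hz
      obtain ⟨b, rfl⟩ := exists_boolSign_of_abs h2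
      exact Or.inl ⟨ε₁, ε₂, b, u, mem_Ioo_of_abs_ne_one hu h1, h⟩
  · rw [h, cellDim_surfaceSwap, cellDim_face _ _ _ hu (Set.Ioo_subset_Icc_self hc)] at hz
    have h1 : |u| = 1 := by
      by_contra hn
      simp [hn, abs_ne_one_of_mem_Ioo hc] at hz
    obtain ⟨a, rfl⟩ := exists_boolSign_of_abs h1
    refine Or.inr ⟨true, ε₂, a, c, hc, ?_⟩
    simp only [swapFace, if_true]
    rw [← face_congr_fst ε₁ ε₂ _ c h1]
    exact h

theorem exists_swapFace {z : genusFiveSurface} (hz : cellDim z = 2) :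
    ∃ s ε₁ ε₂, ∃ t ∈ Set.Ioo (-1 : ℝ) 1, ∃ c ∈ Set.Ioo (-1 : ℝ) 1,
      z = swapFace s ε₁ ε₂ (sheet z) t c := by
  classical
  obtain ⟨ε₁, ε₂, u, c, hu, ⟨hc, h⟩ | ⟨hc, h⟩⟩ := exists_face z
  · rw [h, cellDim_face _ _ _ hu hc] at hz
    have h1 : |u| ≠ 1 := by
      intro hn
      simp only [hn, if_true] at hz
      split_ifs at hz <;> omega
    have h2 : |c| ≠ 1 := by
      intro hn
      simp only [hn, if_true] at hz
      split_ifs at hz <;> omega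
    refine ⟨false, ε₁, ε₂, u, mem_Ioo_of_abs_ne_one hu h1, c, mem_Ioo_of_abs_ne_one hc h2, ?_⟩
    simpa [swapFace] using h
  · rw [h, cellDim_surfaceSwap, cellDim_face _ _ _ hu (Set.Ioo_subset_Icc_self hc)] at hz
    have h1 : |u| ≠ 1 := by
      intro hn
      simp only [hn, if_true] at hz
      split_ifs at hz <;> omega
    refine ⟨true, ε₁, ε₂, u, mem_Ioo_of_abs_ne_one hu h1, c, hc, ?_⟩
    simpa [swapFace] using h

/-- A quotient of `Σ̂` by the trivial group or by `ι̂` inherits a finite cell decomposition with as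
many cells as there are in the sheets that represent it, and thus its Euler characteristic is
`-4` times the number of these sheets. -/
theorem hasEulerCharacteristic_of_sheets {Y B : Type} [TopologicalSpace Y] [T2Space Y] [Finite B]
    {β : B → Bool} (hβ : Function.Injective β) {q : genusFiveSurface → Y} (hq : Continuous q)
    (hfib : ∀ z z', q z = q z' → z' = z ∨ z' = iotaHat z)
    (hinj : ∀ z z', sheet z ∈ Set.range β → sheet z' ∈ Set.range β → q z = q z' → z = z')
    (hsurj : ∀ y, ∃ z, q z = y ∧ sheet z ∈ Set.range β) :
    HasEulerCharacteristic Y (-4 * (Nat.card B : ℤ)) := by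
  classical
  choose lift hlift hsheet using hsurj
  have hdim : ∀ z, cellDim (lift (q z)) = cellDim z := by
    intro z
    rcases hfib _ _ (hlift (q z)).symm with h | h
    · rw [h]
    · rw [h, cellDim_iotaHat]
  have hIcc := @Set.Ioo_subset_Icc_self ℝ _ (-1) 1
  have key := hasEulerCharacteristic_of_cells (X := Y) (C₀ := B × Bool × Bool)
    (C₁ := (B × Bool × Bool × Bool) ⊕ (B × Bool × Bool × Bool)) (C₂ := B × Bool × Bool × Bool)
    (fun y => cellDim (lift y))
    (fun i => q (face true true (β i.1) (boolSign i.2.1) (boolSign i.2.2)))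
    (Sum.elim (fun i t => q (face i.2.1 i.2.2.1 (β i.1) t (boolSign i.2.2.2)))
      (fun i t => q (swapFace i.2.1 true i.2.2.1 (β i.1) (boolSign i.2.2.2) t)))
    (fun i t u => q (swapFace i.2.1 i.2.2.1 i.2.2.2 (β i.1) t u))
    ?_ ?_ ?_ ?_ ?_ ?_ ?_ ?_ ?_ ?_ (fun y => cellDim_le _) ?_ ?_ ?_
  · convert key using 1
    simp [Nat.card_prod, Nat.card_sum]
    ring
  · rintro (i | i)
    · exact (hq.comp ((continuous_face _ _ _).comp (Continuous.prodMk_left _))).continuousOn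
    · exact (hq.comp ((continuous_swapFace _ _ _ _).comp (Continuous.prodMk_right _))).continuousOn
  · intro i
    exact (hq.comp (continuous_swapFace _ _ _ _)).continuousOn
  · intro i
    simp [hdim, cellDim_face _ _ _ (boolSign_mem _) (boolSign_mem _), abs_boolSign]
  · rintro (i | i) t ht
    · simp [hdim, cellDim_face _ _ _ (hIcc ht) (boolSign_mem _), abs_boolSign,
        abs_ne_one_of_mem_Ioo ht]
    · simp [hdim, cellDim_swapFace _ _ _ _ (boolSign_mem _) (hIcc ht), abs_boolSign,
        abs_ne_one_of_mem_Ioo ht]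
  · intro i t ht u hu
    simp [hdim, cellDim_swapFace _ _ _ _ (hIcc ht) (hIcc hu), abs_ne_one_of_mem_Ioo ht,
      abs_ne_one_of_mem_Ioo hu]
  · rintro (i | i) t ht
    · simp [hdim, cellDim_face _ _ _ (abs_le.1 ht.le) (boolSign_mem _), abs_boolSign, ht]
    · simp [hdim, cellDim_swapFace _ _ _ _ (boolSign_mem _) (abs_le.1 ht.le), abs_boolSign, ht]
  · intro i t ht u hu h
    simp only [hdim, cellDim_swapFace _ _ _ _ ht hu]
    rcases h with h | h
    · rw [if_pos h]
      split_ifs <;> simp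
    · rw [if_pos h]
      split_ifs <;> simp
  · rintro ⟨b, i, j⟩ ⟨b', i', j'⟩ h
    have h1 := hinj _ _ (by rw [sheet_face _ _ _ _ (boolSign_mem _)]; exact ⟨_, rfl⟩)
      (by rw [sheet_face _ _ _ _ (boolSign_mem _)]; exact ⟨_, rfl⟩) h
    obtain ⟨h2, h3, h4, -, -⟩ := face_inj (boolSign_mem _) (boolSign_mem _) (boolSign_mem _)
      (boolSign_mem _) h1
    simp only [Prod.mk.injEq]
    exact ⟨hβ h4, boolSign_injective h2, boolSign_injective h3⟩
  · have haux : ∀ (ε₁ ε₂ σ b s ε σ' a : Bool), ∀ t ∈ Set.Ioo (-1 : ℝ) 1,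
        ∀ t' ∈ Set.Ioo (-1 : ℝ) 1,
        face ε₁ ε₂ σ t (boolSign b) ≠ swapFace s true ε σ' (boolSign a) t' := by
      intro ε₁ ε₂ σ b s ε σ' a t ht t' ht' h
      obtain ⟨h1, h2⟩ := face_abs_sin ε₁ ε₂ σ t (boolSign_mem b)
      obtain ⟨h3, h4⟩ := face_abs_sin true ε σ' (boolSign a) (hIcc ht')
      rw [abs_boolSign, one_mul, h] at h2
      have h5 := abs_lt.2 ht'
      cases s <;> simp only [swapFace, Bool.false_eq_true, if_false, if_true, surfaceSwap_cos,
        surfaceSwap_sin] at h2 <;> rw [h4] at h2 <;> nlinarith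
    have hsh : ∀ i : (B × Bool × Bool × Bool) ⊕ (B × Bool × Bool × Bool), ∀ t ∈ Set.Ioo (-1 : ℝ) 1,
        sheet (Sum.elim (fun i t => (face i.2.1 i.2.2.1 (β i.1) t (boolSign i.2.2.2)))
          (fun i t => (swapFace i.2.1 true i.2.2.1 (β i.1) (boolSign i.2.2.2) t)) i t) ∈
          Set.range β := by
      rintro (i | i) t ht
      · simp only [Sum.elim_inl]
        rw [sheet_face _ _ _ _ (boolSign_mem _)]
        exact ⟨_, rfl⟩
      · simp only [Sum.elim_inr]
        rw [sheet_swapFace _ _ _ _ _ ht]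
        exact ⟨_, rfl⟩
    rintro (⟨b, ε₁, ε₂, j⟩ | ⟨b, s, ε, j⟩) t ht (⟨b', ε₁', ε₂', j'⟩ | ⟨b', s', ε', j'⟩) t' ht' h
    · have h1 := hinj _ _ (hsh (Sum.inl (b, ε₁, ε₂, j)) t ht)
        (hsh (Sum.inl (b', ε₁', ε₂', j')) t' ht') h
      obtain ⟨h2, h3, h4, h5, h6⟩ := face_inj (hIcc ht) (boolSign_mem _) (hIcc ht')
        (boolSign_mem _) h1
      obtain rfl := hβ h4
      obtain rfl := boolSign_injective h3
      obtain rfl := h5 ht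
      obtain rfl := h6 (mul_mem_Ioo_of_left ht (boolSign_mem _))
      exact ⟨rfl, h2⟩
    · exact (haux _ _ _ _ _ _ _ _ t ht t' ht' (hinj _ _ (hsh (Sum.inl (b, ε₁, ε₂, j)) t ht)
        (hsh (Sum.inr (b', s', ε', j')) t' ht') h)).elim
    · exact (haux _ _ _ _ _ _ _ _ t' ht' t ht (hinj _ _ (hsh (Sum.inr (b, s, ε, j)) t ht)
        (hsh (Sum.inl (b', ε₁', ε₂', j')) t' ht') h).symm).elim
    · have h1 := hinj _ _ (hsh (Sum.inr (b, s, ε, j)) t ht) (hsh (Sum.inr (b', s', ε', j')) t' ht') h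
      obtain ⟨rfl, h1⟩ := swapFace_inj ht ht' h1
      obtain ⟨h2, h3, h4, h5, h6⟩ := face_inj (boolSign_mem _) (hIcc ht) (boolSign_mem _)
        (hIcc ht') h1
      obtain rfl := hβ h4
      obtain rfl := boolSign_injective h2
      obtain rfl := h6 (by rw [mul_comm]; exact mul_mem_Ioo_of_left ht (boolSign_mem _))
      exact ⟨rfl, h3⟩
  · rintro ⟨b, s, ε₁, ε₂⟩ t ht u hu ⟨b', s', ε₁', ε₂'⟩ t' ht' u' hu' h
    have h1 := hinj _ _ (by rw [sheet_swapFace _ _ _ _ _ hu]; exact ⟨_, rfl⟩)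
      (by rw [sheet_swapFace _ _ _ _ _ hu']; exact ⟨_, rfl⟩) h
    obtain ⟨rfl, h1⟩ := swapFace_inj hu hu' h1
    obtain ⟨h2, h3, h4, h5, h6⟩ := face_inj (hIcc ht) (hIcc hu) (hIcc ht') (hIcc hu') h1
    obtain rfl := hβ h4
    obtain rfl := h5 ht
    obtain rfl := h6 (mul_mem_Ioo_of_left ht (hIcc hu))
    exact ⟨rfl, h2, h3⟩
  · intro y hy
    obtain ⟨a, b, h⟩ := exists_vertex hy
    obtain ⟨i, hi⟩ := hsheet y
    refine ⟨(i, a, b), ?_⟩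
    dsimp only
    rw [hi, ← h, hlift]
  · intro y hy
    obtain ⟨i, hi⟩ := hsheet y
    rcases exists_edge hy with ⟨ε₁, ε₂, b, t, ht, h⟩ | ⟨s, ε, a, t, ht, h⟩
    · refine ⟨Sum.inl (i, ε₁, ε₂, b), t, ht, ?_⟩
      simp only [Sum.elim_inl]
      rw [hi, ← h, hlift]
    · refine ⟨Sum.inr (i, s, ε, a), t, ht, ?_⟩
      simp only [Sum.elim_inr]
      rw [hi, ← h, hlift]
  · intro y hy
    obtain ⟨i, hi⟩ := hsheet y
    obtain ⟨s, ε₁, ε₂, t, ht, c, hc, h⟩ := exists_swapFace hy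
    refine ⟨(i, s, ε₁, ε₂), t, ht, c, hc, ?_⟩
    dsimp only
    rw [hi, ← h, hlift]

theorem swapFace_one (ε₁ ε₂ σ : Bool) {u : ℝ} (hu : u ∈ Set.Icc (-1 : ℝ) 1) :
    swapFace true ε₂ ε₁ σ u 1 = face ε₁ ε₂ σ (-u) 1 := by
  have h1 : (1 : ℝ) ∈ Set.Icc (-1 : ℝ) 1 := by norm_num
  simp only [swapFace, if_true]
  refine surface_ext ?_ ?_ ?_ ?_ ?_ ?_
  · rw [surfaceSwap_fst, face_cos_snd _ _ _ hu h1, face_cos_fst _ _ _ (neg_mem_Icc hu)]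
    simp
  · rw [surfaceSwap_fst, face_sin_snd _ _ _ hu h1, face_sin_fst _ _ _ (neg_mem_Icc hu)]
    simp
  · rw [surfaceSwap_snd, face_cos_fst _ _ _ hu, face_cos_snd _ _ _ (neg_mem_Icc hu) h1]
    simp
  · rw [surfaceSwap_snd, face_sin_fst _ _ _ hu, face_sin_snd _ _ _ (neg_mem_Icc hu) h1]
    simp
  · rw [surfaceSwap_cos, face_sin_trd _ _ _ h1, face_cos_trd _ _ _ h1]
  · rw [surfaceSwap_sin, face_sin_trd _ _ _ h1, face_cos_trd _ _ _ h1]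

theorem swapFace_neg_one (ε₁ ε₂ σ : Bool) {u : ℝ} (hu : u ∈ Set.Icc (-1 : ℝ) 1) :
    swapFace true ε₂ ε₁ σ u (-1) = face ε₁ ε₂ (!σ) u (-1) := by
  have h1 : (-1 : ℝ) ∈ Set.Icc (-1 : ℝ) 1 := by norm_num
  have hσ : boolSign (!σ) = -boolSign σ := by cases σ <;> simp [boolSign]
  simp only [swapFace, if_true]
  refine surface_ext ?_ ?_ ?_ ?_ ?_ ?_
  · rw [surfaceSwap_fst, face_cos_snd _ _ _ hu h1, face_cos_fst _ _ _ hu]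
    simp
  · rw [surfaceSwap_fst, face_sin_snd _ _ _ hu h1, face_sin_fst _ _ _ hu]
    simp
  · rw [surfaceSwap_snd, face_cos_fst _ _ _ hu, face_cos_snd _ _ _ hu h1]
    simp
  · rw [surfaceSwap_snd, face_sin_fst _ _ _ hu, face_sin_snd _ _ _ hu h1]
    simp
  · rw [surfaceSwap_cos, face_sin_trd _ _ _ h1, face_cos_trd _ _ _ h1, hσ]
    ring
  · rw [surfaceSwap_sin, face_sin_trd _ _ _ h1, face_cos_trd _ _ _ h1, hσ]
    ring

theorem connectedSpace_genusFiveSurface : ConnectedSpace genusFiveSurface := by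
  have h1 : (1 : ℝ) ∈ Set.Icc (-1 : ℝ) 1 := by norm_num
  have hm1 : (-1 : ℝ) ∈ Set.Icc (-1 : ℝ) 1 := by norm_num
  let K := connectedComponent (face true true true 1 1)
  have hmove : ∀ s ε₁ ε₂ σ u c u' c', swapFace s ε₁ ε₂ σ u c ∈ K → swapFace s ε₁ ε₂ σ u' c' ∈ K := by
    intro s ε₁ ε₂ σ u c u' c' h
    have hp : IsPreconnected (Set.range (Function.uncurry (swapFace s ε₁ ε₂ σ))) :=
      isPreconnected_range (continuous_swapFace s ε₁ ε₂ σ)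
    have := hp.subset_connectedComponent (x := swapFace s ε₁ ε₂ σ u c) ⟨(u, c), rfl⟩
    rw [← connectedComponent_eq h] at this
    exact this ⟨(u', c'), rfl⟩
  have hface : ∀ ε₁ ε₂ σ u c, swapFace false ε₁ ε₂ σ u c = face ε₁ ε₂ σ u c := fun _ _ _ _ _ => by
    simp [swapFace]
  have hvert : ∀ ε₁ ε₂ σ, face ε₁ ε₂ σ 1 1 = face true true σ 1 1 := fun ε₁ ε₂ σ => by
    rw [face_congr_snd ε₁ ε₂ σ (by simp) (by simp), face_congr_fst ε₁ true σ 1 (by simp)]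
  have hpos : ∀ ε₁ ε₂ u c, swapFace false ε₁ ε₂ true u c ∈ K := by
    intro ε₁ ε₂ u c
    refine hmove false ε₁ ε₂ true 1 1 u c ?_
    rw [hface, hvert]
    exact mem_connectedComponent
  have hswap : ∀ ε₁ ε₂ u c, swapFace true ε₁ ε₂ true u c ∈ K := by
    intro ε₁ ε₂ u c
    refine hmove true ε₁ ε₂ true 1 1 u c ?_
    rw [swapFace_one _ _ _ h1, ← hface]
    exact hpos _ _ _ _
  have hneg : ∀ ε₁ ε₂ u c, swapFace false ε₁ ε₂ false u c ∈ K := by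
    intro ε₁ ε₂ u c
    refine hmove false ε₁ ε₂ false 1 (-1) u c ?_
    rw [hface]
    have := swapFace_neg_one ε₁ ε₂ true h1
    rw [Bool.not_true] at this
    rw [← this]
    exact hswap _ _ _ _
  have hswap' : ∀ ε₁ ε₂ u c, swapFace true ε₁ ε₂ false u c ∈ K := by
    intro ε₁ ε₂ u c
    refine hmove true ε₁ ε₂ false 1 1 u c ?_
    rw [swapFace_one _ _ _ h1, ← hface]
    exact hneg _ _ _ _
  have hK : K = Set.univ := by
    rw [Set.eq_univ_iff_forall]
    intro z
    obtain ⟨ε₁, ε₂, u, c, -, ⟨-, h⟩ | ⟨-, h⟩⟩ := exists_face z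
    · rw [h, ← hface]
      cases sheet z
      · exact hneg _ _ _ _
      · exact hpos _ _ _ _
    · have : z = swapFace true ε₁ ε₂ (sheet z) u c := by simpa [swapFace] using h
      rw [this]
      cases sheet z
      · exact hswap' _ _ _ _
      · exact hswap _ _ _ _
  exact connectedSpace_iff_univ.2 (hK ▸ isConnected_connectedComponent)

/-! ### The covering surface of `Σ̂` in `ℝ³` -/

/-- The space `ℝ³` with coordinates `(γ, θ, ν)`. -/
abbrev Space : Type := ℝ × ℝ × ℝ

/-- The function `sin θ sin ν + sin γ cos ν`. -/
noncomputable def surfaceFun (x : Space) : ℝ :=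
  Real.sin x.2.1 * Real.sin x.2.2 + Real.sin x.1 * Real.cos x.2.2

/-- The gradient of `sin θ sin ν + sin γ cos ν`. -/
noncomputable def surfaceGrad (x : Space) : Space :=
  (Real.cos x.1 * Real.cos x.2.2, Real.cos x.2.1 * Real.sin x.2.2,
    Real.sin x.2.1 * Real.cos x.2.2 - Real.sin x.1 * Real.sin x.2.2)

/-- The inner product with a vector of `ℝ³`. -/
noncomputable def dot (u : Space) : Space →L[ℝ] ℝ :=
  u.1 • ContinuousLinearMap.fst ℝ ℝ (ℝ × ℝ) +
    (u.2.1 • (ContinuousLinearMap.fst ℝ ℝ ℝ).comp (ContinuousLinearMap.snd ℝ ℝ (ℝ × ℝ)) +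
      u.2.2 • (ContinuousLinearMap.snd ℝ ℝ ℝ).comp (ContinuousLinearMap.snd ℝ ℝ (ℝ × ℝ)))

@[simp] theorem dot_apply (u v : Space) :
    dot u v = u.1 * v.1 + (u.2.1 * v.2.1 + u.2.2 * v.2.2) := by
  simp [dot]

/-- The determinant of three vectors of `ℝ³`. -/
def tripleDet (a b c : Space) : ℝ :=
  a.1 * (b.2.1 * c.2.2 - b.2.2 * c.2.1) - a.2.1 * (b.1 * c.2.2 - b.2.2 * c.1) +
    a.2.2 * (b.1 * c.2.1 - b.2.1 * c.1)

theorem contDiff_surfaceFun {n : WithTop ℕ∞} : ContDiff ℝ n surfaceFun := by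
  unfold surfaceFun
  fun_prop

theorem contDiff_surfaceGrad {n : WithTop ℕ∞} : ContDiff ℝ n surfaceGrad := by
  unfold surfaceGrad
  fun_prop

theorem hasFDerivAt_surfaceFun (x : Space) :
    HasFDerivAt surfaceFun (dot (surfaceGrad x)) x := by
  have h1 : HasFDerivAt (fun y : Space => y.1) (ContinuousLinearMap.fst ℝ ℝ (ℝ × ℝ)) x :=
    hasFDerivAt_fst
  have h2 : HasFDerivAt (fun y : Space => y.2.1)
      ((ContinuousLinearMap.fst ℝ ℝ ℝ).comp (ContinuousLinearMap.snd ℝ ℝ (ℝ × ℝ))) x :=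
    hasFDerivAt_fst.comp x hasFDerivAt_snd
  have h3 : HasFDerivAt (fun y : Space => y.2.2)
      ((ContinuousLinearMap.snd ℝ ℝ ℝ).comp (ContinuousLinearMap.snd ℝ ℝ (ℝ × ℝ))) x :=
    hasFDerivAt_snd.comp x hasFDerivAt_snd
  refine ((h2.sin.mul h3.sin).add (h1.sin.mul h3.cos)).congr_fderiv ?_
  ext <;> simp [surfaceGrad] <;> ring

theorem surfaceGrad_regular (x : Space) :
    0 < dot (surfaceGrad x) (surfaceGrad x) + surfaceFun x ^ 2 := by
  by_contra hcon
  have hγ := Real.sin_sq_add_cos_sq x.1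
  have hθ := Real.sin_sq_add_cos_sq x.2.1
  have hν := Real.sin_sq_add_cos_sq x.2.2
  simp only [dot_apply, surfaceGrad, surfaceFun] at hcon
  generalize Real.sin x.1 = a at *
  generalize Real.cos x.1 = b at *
  generalize Real.sin x.2.1 = c at *
  generalize Real.cos x.2.1 = d at *
  generalize Real.sin x.2.2 = e at *
  generalize Real.cos x.2.2 = f at *
  have h1 : b * f = 0 := by
    nlinarith [sq_nonneg (b * f), sq_nonneg (d * e), sq_nonneg (c * f - a * e),
      sq_nonneg (c * e + a * f)]
  have h2 : d * e = 0 := by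
    nlinarith [sq_nonneg (b * f), sq_nonneg (d * e), sq_nonneg (c * f - a * e),
      sq_nonneg (c * e + a * f)]
  have h3 : c * f - a * e = 0 := by
    nlinarith [sq_nonneg (b * f), sq_nonneg (d * e), sq_nonneg (c * f - a * e),
      sq_nonneg (c * e + a * f)]
  have h4 : c * e + a * f = 0 := by
    nlinarith [sq_nonneg (b * f), sq_nonneg (d * e), sq_nonneg (c * f - a * e),
      sq_nonneg (c * e + a * f)]
  have h5 : c = 0 := by linear_combination f * h3 + e * h4 - c * hν
  have h6 : a = 0 := by linear_combination f * h4 - e * h3 - a * hν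
  subst h5 h6
  have h7 : f ^ 2 = 0 := by linear_combination (b * f) * h1 - f ^ 2 * hγ
  have h8 : e ^ 2 = 0 := by linear_combination (d * e) * h2 - e ^ 2 * hθ
  linarith

/-- The covering of `Σ̂` in `ℝ³`. -/
def coverSurface : Set Space := {x | surfaceFun x = 0}

theorem exists_frame {x : Space} (hx : x ∈ coverSurface) :
    ∃ w : Space × Space, 0 < tripleDet (surfaceGrad x) w.1 w.2 := by
  have h := surfaceGrad_regular x
  rw [show surfaceFun x = 0 from hx] at h
  simp only [dot_apply] at h
  generalize surfaceGrad x = N at h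
  obtain ⟨a, b, c⟩ := N
  simp only at h
  by_cases ha : a = 0
  · by_cases hb : b = 0
    · refine ⟨((1, 0, 0), (0, c, 0)), ?_⟩
      simp only [tripleDet]
      subst ha hb
      nlinarith
    · refine ⟨((0, 0, 1), (b, 0, 0)), ?_⟩
      simp only [tripleDet]
      nlinarith [mul_self_pos.2 hb]
  · refine ⟨((0, 1, 0), (0, 0, a)), ?_⟩
    simp only [tripleDet]
    nlinarith [mul_self_pos.2 ha]

/-- A frame of the plane in which a surface chart takes its values. -/
noncomputable def surfaceFrame (x : coverSurface) : Space × Space := (exists_frame x.2).choose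

theorem surfaceFrame_pos (x : coverSurface) :
    0 < tripleDet (surfaceGrad x) (surfaceFrame x).1 (surfaceFrame x).2 :=
  (exists_frame x.2).choose_spec

/-- The linear map to the plane with the given rows. -/
noncomputable def frameMap (w : Space × Space) : Space →L[ℝ] Plane :=
  (dot w.1).smulRight (EuclideanSpace.single (0 : Fin 2) (1 : ℝ)) +
    (dot w.2).smulRight (EuclideanSpace.single (1 : Fin 2) (1 : ℝ))

@[simp] theorem frameMap_zero (w : Space × Space) (v : Space) : frameMap w v 0 = dot w.1 v := by
  simp [frameMap]

@[simp] theorem frameMap_one (w : Space × Space) (v : Space) : frameMap w v 1 = dot w.2 v := by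
  simp [frameMap]

/-- The linear endomorphism of `ℝ³` with the given rows. -/
noncomputable def rowsMap (a b c : Space) : Space →L[ℝ] Space :=
  (dot a).prod ((dot b).prod (dot c))

theorem rowsMap_injective {a b c : Space} (h : tripleDet a b c ≠ 0) :
    Function.Injective (rowsMap a b c) := by
  rw [injective_iff_map_eq_zero]
  rintro ⟨x, y, z⟩ hv
  simp only [rowsMap, ContinuousLinearMap.prod_apply, dot_apply, Prod.mk_eq_zero] at hv
  obtain ⟨h1, h2, h3⟩ := hv
  simp only [tripleDet] at h
  refine Prod.ext ?_ (Prod.ext ?_ ?_) <;> refine mul_left_cancel₀ h ?_ <;> simp only [Prod.fst_zero,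
    Prod.snd_zero]
  · linear_combination (b.2.1 * c.2.2 - b.2.2 * c.2.1) * h1 - (a.2.1 * c.2.2 - a.2.2 * c.2.1) * h2
      + (a.2.1 * b.2.2 - a.2.2 * b.2.1) * h3
  · linear_combination -(b.1 * c.2.2 - b.2.2 * c.1) * h1 + (a.1 * c.2.2 - a.2.2 * c.1) * h2
      - (a.1 * b.2.2 - a.2.2 * b.1) * h3
  · linear_combination (b.1 * c.2.1 - b.2.1 * c.1) * h1 - (a.1 * c.2.1 - a.2.1 * c.1) * h2
      + (a.1 * b.2.1 - a.2.1 * b.1) * h3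

/-- An endomorphism of `ℝ³` with nonzero determinant, as an equivalence. -/
noncomputable def rowsEquiv (a b c : Space) (h : tripleDet a b c ≠ 0) : Space ≃L[ℝ] Space :=
  (LinearEquiv.ofInjectiveEndo (rowsMap a b c : Space →ₗ[ℝ] Space)
    (rowsMap_injective h)).toContinuousLinearEquiv

theorem coe_rowsEquiv (a b c : Space) (h : tripleDet a b c ≠ 0) :
    (rowsEquiv a b c h : Space →L[ℝ] Space) = rowsMap a b c := by
  ext <;> rfl

/-- The equation of the surface together with two linear coordinates. -/
noncomputable def straighten (x : coverSurface) (y : Space) : Space :=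
  (surfaceFun y, dot (surfaceFrame x).1 (y - x), dot (surfaceFrame x).2 (y - x))

theorem contDiff_straighten (x : coverSurface) : ContDiff ℝ ω (straighten x) := by
  refine contDiff_surfaceFun.prodMk (ContDiff.prodMk ?_ ?_)
  · exact (dot _).contDiff.comp (contDiff_id.sub contDiff_const)
  · exact (dot _).contDiff.comp (contDiff_id.sub contDiff_const)

theorem hasFDerivAt_straighten (x : coverSurface) (y : Space) :
    HasFDerivAt (straighten x)
      (rowsMap (surfaceGrad y) (surfaceFrame x).1 (surfaceFrame x).2) y := by
  refine (hasFDerivAt_surfaceFun y).prodMk (HasFDerivAt.prodMk ?_ ?_)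
  · exact ((dot _).hasFDerivAt).comp y ((hasFDerivAt_id y).sub_const _)
  · exact ((dot _).hasFDerivAt).comp y ((hasFDerivAt_id y).sub_const _)

/-- The frame of `x` is positive at `y`. -/
def framePositive (x : coverSurface) : Set Space :=
  {y | 0 < tripleDet (surfaceGrad y) (surfaceFrame x).1 (surfaceFrame x).2}

theorem isOpen_framePositive (x : coverSurface) : IsOpen (framePositive x) := by
  refine isOpen_lt continuous_const ?_
  have : Continuous surfaceGrad := (contDiff_surfaceGrad (n := 0)).continuous
  unfold tripleDet
  fun_prop

/-- Local straightening of the surface. -/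
noncomputable def straightenHomeo (x : coverSurface) : OpenPartialHomeomorph Space Space :=
  ((contDiff_straighten x).contDiffAt.toOpenPartialHomeomorph (straighten x)
    (f' := rowsEquiv _ _ _ (surfaceFrame_pos x).ne') (a := x.1)
    (by rw [coe_rowsEquiv]; exact hasFDerivAt_straighten x x.1) (by simp)).restrOpen
      (framePositive x) (isOpen_framePositive x)

theorem straightenHomeo_coe (x : coverSurface) : ⇑(straightenHomeo x) = straighten x := rfl

theorem mem_straightenHomeo_source (x : coverSurface) : x.1 ∈ (straightenHomeo x).source := by
  rw [straightenHomeo, OpenPartialHomeomorph.restrOpen_source]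
  exact ⟨ContDiffAt.mem_toOpenPartialHomeomorph_source _ _ _, surfaceFrame_pos x⟩

theorem straightenHomeo_source_subset (x : coverSurface) :
    (straightenHomeo x).source ⊆ framePositive x := by
  rw [straightenHomeo, OpenPartialHomeomorph.restrOpen_source]
  exact Set.inter_subset_right

theorem contDiffAt_straightenHomeo_symm (x : coverSurface) {t : Space}
    (ht : t ∈ (straightenHomeo x).target) : ContDiffAt ℝ ω (straightenHomeo x).symm t := by
  have hpos := straightenHomeo_source_subset x ((straightenHomeo x).map_target ht)
  refine OpenPartialHomeomorph.contDiffAt_symm _ ht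
    (f₀' := rowsEquiv _ _ _ (ne_of_gt hpos)) ?_ ?_
  · rw [coe_rowsEquiv]
    exact hasFDerivAt_straighten x _
  · exact (contDiff_straighten x).contDiffAt

/-- The inclusion of the plane of linear coordinates. -/
noncomputable def planeInclusion : Plane →L[ℝ] Space :=
  (0 : Plane →L[ℝ] ℝ).prod ((EuclideanSpace.proj 0).prod (EuclideanSpace.proj 1))

@[simp] theorem planeInclusion_apply (t : Plane) : planeInclusion t = (0, t 0, t 1) := rfl

/-- The linear coordinates of a point. -/
noncomputable def surfaceProj (x : coverSurface) (y : Space) : Plane :=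
  frameMap (surfaceFrame x) (y - x)

theorem contDiff_surfaceProj (x : coverSurface) {n : WithTop ℕ∞} :
    ContDiff ℝ n (surfaceProj x) :=
  (frameMap _).contDiff.comp (contDiff_id.sub contDiff_const)

@[simp] theorem surfaceProj_self (x : coverSurface) : surfaceProj x x = 0 := by
  simp [surfaceProj]

theorem planeInclusion_surfaceProj (x : coverSurface) {y : Space} (hy : y ∈ coverSurface) :
    planeInclusion (surfaceProj x y) = straighten x y := by
  rw [planeInclusion_apply, surfaceProj, frameMap_zero, frameMap_one, straighten,
    show surfaceFun y = 0 from hy]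

theorem straightenHomeo_symm_mem (x : coverSurface) {t : Plane}
    (ht : planeInclusion t ∈ (straightenHomeo x).target) :
    (straightenHomeo x).symm (planeInclusion t) ∈ coverSurface := by
  have := (straightenHomeo x).right_inv ht
  rw [straightenHomeo_coe] at this
  exact congrArg Prod.fst this

theorem surfaceProj_symm (x : coverSurface) {t : Plane}
    (ht : planeInclusion t ∈ (straightenHomeo x).target) :
    surfaceProj x ((straightenHomeo x).symm (planeInclusion t)) = t := by
  have h := (straightenHomeo x).right_inv ht
  rw [straightenHomeo_coe, ← planeInclusion_surfaceProj x (straightenHomeo_symm_mem x ht)] at h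
  simp only [planeInclusion_apply, Prod.mk.injEq, true_and] at h
  ext j
  fin_cases j
  · exact h.1
  · exact h.2

open Classical in
/-- The local parametrization of the surface. -/
noncomputable def surfaceParam (x : coverSurface) (t : Plane) : coverSurface :=
  if h : (straightenHomeo x).symm (planeInclusion t) ∈ coverSurface then ⟨_, h⟩ else x

theorem coe_surfaceParam (x : coverSurface) {t : Plane}
    (ht : planeInclusion t ∈ (straightenHomeo x).target) :
    (surfaceParam x t : Space) = (straightenHomeo x).symm (planeInclusion t) := by
  rw [surfaceParam, dif_pos (straightenHomeo_symm_mem x ht)]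

/-- The chart of the covering surface around `x`. -/
noncomputable def coverChart (x : coverSurface) : OpenPartialHomeomorph coverSurface Plane where
  toFun y := surfaceProj x y
  invFun := surfaceParam x
  source := Subtype.val ⁻¹' (straightenHomeo x).source
  target := planeInclusion ⁻¹' (straightenHomeo x).target
  map_source' y hy := by
    rw [Set.mem_preimage, planeInclusion_surfaceProj x y.2]
    exact (straightenHomeo x).map_source hy
  map_target' t ht := by
    rw [Set.mem_preimage, coe_surfaceParam x ht]
    exact (straightenHomeo x).map_target ht
  left_inv' y hy := by
    apply Subtype.ext
    have h := planeInclusion_surfaceProj x y.2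
    rw [coe_surfaceParam x (by rw [h]; exact (straightenHomeo x).map_source hy), h]
    exact (straightenHomeo x).left_inv hy
  right_inv' t ht := by
    rw [coe_surfaceParam x ht]
    exact surfaceProj_symm x ht
  open_source := (straightenHomeo x).open_source.preimage continuous_subtype_val
  open_target := (straightenHomeo x).open_target.preimage planeInclusion.continuous
  continuousOn_toFun :=
    ((contDiff_surfaceProj x (n := 0)).continuous.comp continuous_subtype_val).continuousOn
  continuousOn_invFun := by
    rw [Topology.IsInducing.subtypeVal.continuousOn_iff]
    refine ContinuousOn.congr (f := (straightenHomeo x).symm ∘ planeInclusion) ?_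
      fun t ht => coe_surfaceParam x ht
    exact (straightenHomeo x).continuousOn_symm.comp planeInclusion.continuous.continuousOn
      fun t ht => ht

theorem coverChart_coe (x y : coverSurface) : coverChart x y = surfaceProj x y := rfl

theorem coverChart_symm_coe (x : coverSurface) : ⇑(coverChart x).symm = surfaceParam x := rfl

theorem mem_coverChart_source (x : coverSurface) : x ∈ (coverChart x).source :=
  mem_straightenHomeo_source x

theorem zero_mem_coverChart_target (x : coverSurface) : 0 ∈ (coverChart x).target := by
  have := (coverChart x).map_source (mem_coverChart_source x)
  rwa [coverChart_coe, surfaceProj_self] at this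

theorem surfaceParam_zero (x : coverSurface) : surfaceParam x 0 = x := by
  have := (coverChart x).left_inv (mem_coverChart_source x)
  rwa [coverChart_coe, surfaceProj_self] at this

theorem surfaceParam_surfaceProj (x : coverSurface) {y : coverSurface}
    (hy : y ∈ (coverChart x).source) : surfaceParam x (surfaceProj x y) = y :=
  (coverChart x).left_inv hy

theorem surfaceProj_surfaceParam (x : coverSurface) {t : Plane} (ht : t ∈ (coverChart x).target) :
    surfaceProj x (surfaceParam x t) = t :=
  (coverChart x).right_inv ht

theorem continuousAt_surfaceParam (x : coverSurface) {t : Plane}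
    (ht : t ∈ (coverChart x).target) : ContinuousAt (surfaceParam x) t :=
  (coverChart x).symm.continuousAt ht

theorem contDiffAt_surfaceParam (x : coverSurface) {t : Plane} (ht : t ∈ (coverChart x).target) :
    ContDiffAt ℝ ω (fun t => (surfaceParam x t : Space)) t := by
  have h1 : ContDiffAt ℝ ω ((straightenHomeo x).symm ∘ planeInclusion) t :=
    (contDiffAt_straightenHomeo_symm x ht).comp t planeInclusion.contDiff.contDiffAt
  refine h1.congr_of_eventuallyEq ?_
  filter_upwards [(coverChart x).open_target.mem_nhds ht] with s hs using coe_surfaceParam x hs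

theorem surfaceParam_framePositive (x : coverSurface) {t : Plane}
    (ht : t ∈ (coverChart x).target) : (surfaceParam x t : Space) ∈ framePositive x := by
  rw [coe_surfaceParam x ht]
  exact straightenHomeo_source_subset x ((straightenHomeo x).map_target ht)

/-! ### Surfaces covered by the surface in `ℝ³` -/

/-- The deck transformations of the covering of `T × S¹ / ι̂` by `ℝ³`. -/
noncomputable def deck (σ : Bool) (m n l : ℤ) (x : Space) : Space :=
  (boolSign σ * x.1 + 2 * Real.pi * m, boolSign σ * x.2.1 + 2 * Real.pi * n,
    x.2.2 + (if σ then 0 else Real.pi) + 2 * Real.pi * l)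

theorem contDiff_deck (σ : Bool) (m n l : ℤ) {k : WithTop ℕ∞} : ContDiff ℝ k (deck σ m n l) := by
  unfold deck
  fun_prop

theorem sin_add_two_pi_mul (x : ℝ) (k : ℤ) : Real.sin (x + 2 * Real.pi * k) = Real.sin x := by
  rw [show x + 2 * Real.pi * k = x + k * (2 * Real.pi) by ring, Real.sin_add_int_mul_two_pi]

theorem cos_add_two_pi_mul (x : ℝ) (k : ℤ) : Real.cos (x + 2 * Real.pi * k) = Real.cos x := by
  rw [show x + 2 * Real.pi * k = x + k * (2 * Real.pi) by ring, Real.cos_add_int_mul_two_pi]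

theorem sin_deck_fst (σ : Bool) (m n l : ℤ) (x : Space) :
    Real.sin (deck σ m n l x).1 = boolSign σ * Real.sin x.1 := by
  cases σ <;> simp [deck, boolSign, sin_add_two_pi_mul]

theorem cos_deck_fst (σ : Bool) (m n l : ℤ) (x : Space) :
    Real.cos (deck σ m n l x).1 = Real.cos x.1 := by
  cases σ <;> simp [deck, boolSign, cos_add_two_pi_mul]

theorem sin_deck_snd (σ : Bool) (m n l : ℤ) (x : Space) :
    Real.sin (deck σ m n l x).2.1 = boolSign σ * Real.sin x.2.1 := by
  cases σ <;> simp [deck, boolSign, sin_add_two_pi_mul]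

theorem cos_deck_snd (σ : Bool) (m n l : ℤ) (x : Space) :
    Real.cos (deck σ m n l x).2.1 = Real.cos x.2.1 := by
  cases σ <;> simp [deck, boolSign, cos_add_two_pi_mul]

theorem sin_deck_trd (σ : Bool) (m n l : ℤ) (x : Space) :
    Real.sin (deck σ m n l x).2.2 = boolSign σ * Real.sin x.2.2 := by
  cases σ <;> simp [deck, boolSign, sin_add_two_pi_mul, Real.sin_add_pi]

theorem cos_deck_trd (σ : Bool) (m n l : ℤ) (x : Space) :
    Real.cos (deck σ m n l x).2.2 = boolSign σ * Real.cos x.2.2 := by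
  cases σ <;> simp [deck, boolSign, cos_add_two_pi_mul, Real.cos_add_pi]

theorem surfaceFun_deck (σ : Bool) (m n l : ℤ) (x : Space) :
    surfaceFun (deck σ m n l x) = surfaceFun x := by
  rw [surfaceFun, sin_deck_fst, sin_deck_snd, sin_deck_trd, cos_deck_trd, surfaceFun]
  linear_combination (Real.sin x.2.1 * Real.sin x.2.2 + Real.sin x.1 * Real.cos x.2.2) *
    boolSign_sq σ

/-- The linear part of a deck transformation. -/
def deckLinear (σ : Bool) (v : Space) : Space := (boolSign σ * v.1, boolSign σ * v.2.1, v.2.2)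

theorem surfaceGrad_deck (σ : Bool) (m n l : ℤ) (x : Space) :
    surfaceGrad (deck σ m n l x) = deckLinear σ (surfaceGrad x) := by
  simp only [surfaceGrad, deckLinear, sin_deck_fst, sin_deck_snd, sin_deck_trd, cos_deck_trd,
    cos_deck_fst, cos_deck_snd]
  refine Prod.ext ?_ (Prod.ext ?_ ?_)
  · ring
  · ring
  · linear_combination (Real.sin x.2.1 * Real.cos x.2.2 - Real.sin x.1 * Real.sin x.2.2) *
      boolSign_sq σ

/-- The linear part of a deck transformation, as a continuous linear map. -/
noncomputable def deckLinearMap (σ : Bool) : Space →L[ℝ] Space :=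
  (boolSign σ • ContinuousLinearMap.id ℝ ℝ).prodMap
    ((boolSign σ • ContinuousLinearMap.id ℝ ℝ).prodMap (ContinuousLinearMap.id ℝ ℝ))

theorem deckLinearMap_apply (σ : Bool) (v : Space) : deckLinearMap σ v = deckLinear σ v := by
  obtain ⟨a, b, c⟩ := v
  simp [deckLinearMap, deckLinear]

theorem hasFDerivAt_deck (σ : Bool) (m n l : ℤ) (x : Space) :
    HasFDerivAt (deck σ m n l) (deckLinearMap σ) x := by
  have h : deck σ m n l = fun y => deckLinearMap σ y +
      (2 * Real.pi * m, 2 * Real.pi * n, (if σ then 0 else Real.pi) + 2 * Real.pi * l) := by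
    funext y
    rw [deckLinearMap_apply]
    simp [deck, deckLinear, add_assoc]
  rw [h]
  exact (deckLinearMap σ).hasFDerivAt.add_const _

theorem deck_mem (σ : Bool) (m n l : ℤ) {x : Space} (hx : x ∈ coverSurface) :
    deck σ m n l x ∈ coverSurface :=
  (surfaceFun_deck σ m n l x).trans hx

/-- The action of a deck transformation on the covering surface. -/
noncomputable def coverDeck (σ : Bool) (m n l : ℤ) (x : coverSurface) : coverSurface :=
  ⟨deck σ m n l x, deck_mem σ m n l x.2⟩

theorem continuous_coverDeck (σ : Bool) (m n l : ℤ) : Continuous (coverDeck σ m n l) :=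
  ((contDiff_deck σ m n l (k := 0)).continuous.comp continuous_subtype_val).subtype_mk _

/-- `p` is a quotient map by a group of deck transformations. -/
structure IsSurfaceCover {X : Type*} [TopologicalSpace X] (p : coverSurface → X) : Prop where
  continuous : Continuous p
  isOpenMap : IsOpenMap p
  surjective : Function.Surjective p
  exists_deck : ∀ x y, p x = p y →
    ∃ σ m n l, y = coverDeck σ m n l x ∧ ∀ z, p (coverDeck σ m n l z) = p z

theorem abs_two_pi_mul_lt {k : ℤ} (hk : |2 * Real.pi * (k : ℝ)| < 4) : k = 0 := by
  by_contra hk0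
  have h1 : (1 : ℝ) ≤ |(k : ℝ)| := by exact_mod_cast Int.one_le_abs hk0
  rw [abs_mul, abs_of_pos (by positivity : (0 : ℝ) < 2 * Real.pi)] at hk
  nlinarith [Real.pi_gt_three]

theorem eq_of_deck_of_dist_lt {σ : Bool} {m n l : ℤ} {x : Space}
    (h : dist (deck σ m n l x) x < 2) : deck σ m n l x = x := by
  rw [Prod.dist_eq, Prod.dist_eq, max_lt_iff, max_lt_iff] at h
  simp only [Real.dist_eq, deck] at h
  obtain ⟨h1, h2, h3⟩ := h
  cases σ
  · exfalso
    simp only [Bool.false_eq_true, if_false] at h3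
    rw [show x.2.2 + Real.pi + 2 * Real.pi * l - x.2.2 = Real.pi * (2 * l + 1) by ring] at h3
    have h4 : (1 : ℝ) ≤ |(2 * l + 1 : ℝ)| := by
      have : (2 * l + 1 : ℤ) ≠ 0 := by omega
      exact_mod_cast Int.one_le_abs this
    rw [abs_mul, abs_of_pos Real.pi_pos] at h3
    nlinarith [Real.pi_gt_three]
  · simp only [boolSign, if_true, one_mul, add_zero, add_sub_cancel_left] at h1 h2 h3
    obtain rfl := abs_two_pi_mul_lt (h1.trans (by norm_num))
    obtain rfl := abs_two_pi_mul_lt (h2.trans (by norm_num))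
    obtain rfl := abs_two_pi_mul_lt (h3.trans (by norm_num))
    simp [deck, boolSign]

theorem plane_clm_det (A : Plane →L[ℝ] Plane) :
    A.det = A (EuclideanSpace.single 0 1) 0 * A (EuclideanSpace.single 1 1) 1 -
      A (EuclideanSpace.single 1 1) 0 * A (EuclideanSpace.single 0 1) 1 := by
  rw [ContinuousLinearMap.det, ← LinearMap.det_toMatrix (EuclideanSpace.basisFun (Fin 2) ℝ).toBasis,
    Matrix.det_fin_two]
  simp [LinearMap.toMatrix_apply]

/-- The change of orientation between two linear coordinate systems of a plane in `ℝ³` with normal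
vector `N` is the quotient of the orientations of the coordinate systems. -/
theorem frame_change_pos {N a b a' b' w₁ w₂ : Space} (h1 : dot N w₁ = 0) (h2 : dot N w₂ = 0)
    (ha1 : dot a w₁ = 1) (ha2 : dot a w₂ = 0) (hb1 : dot b w₁ = 0) (hb2 : dot b w₂ = 1)
    (hpos : 0 < tripleDet N a b) (hpos' : 0 < tripleDet N a' b') :
    0 < dot a' w₁ * dot b' w₂ - dot a' w₂ * dot b' w₁ := by
  have key : (dot a' w₁ * dot b' w₂ - dot a' w₂ * dot b' w₁) * tripleDet N a b =
      (dot a w₁ * dot b w₂ - dot a w₂ * dot b w₁) * tripleDet N a' b' := by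
    obtain ⟨n1, n2, n3⟩ := N
    obtain ⟨x1, x2, x3⟩ := w₁
    obtain ⟨y1, y2, y3⟩ := w₂
    simp only [dot_apply] at h1 h2
    have c1 : (x2 * y3 - x3 * y2) * n2 = (x3 * y1 - x1 * y3) * n1 := by
      linear_combination y3 * h1 - x3 * h2
    have c2 : (x3 * y1 - x1 * y3) * n3 = (x1 * y2 - x2 * y1) * n2 := by
      linear_combination y1 * h1 - x1 * h2
    have c3 : (x2 * y3 - x3 * y2) * n3 = (x1 * y2 - x2 * y1) * n1 := by
      linear_combination x2 * h2 - y2 * h1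
    obtain ⟨a1, a2, a3⟩ := a
    obtain ⟨b1, b2, b3⟩ := b
    obtain ⟨a1', a2', a3'⟩ := a'
    obtain ⟨b1', b2', b3'⟩ := b'
    simp only [dot_apply, tripleDet]
    linear_combination
      ((a2' * b3' - a3' * b2') * (-(a1 * b3 - a3 * b1)) -
        (a2 * b3 - a3 * b2) * (-(a1' * b3' - a3' * b1'))) * c1 +
      ((-(a1' * b3' - a3' * b1')) * (a1 * b2 - a2 * b1) -
        (-(a1 * b3 - a3 * b1)) * (a1' * b2' - a2' * b1')) * c2 +
      ((a2' * b3' - a3' * b2') * (a1 * b2 - a2 * b1) -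
        (a2 * b3 - a3 * b2) * (a1' * b2' - a2' * b1')) * c3
  rw [ha1, ha2, hb1, hb2] at key
  by_contra hcon
  nlinarith

theorem tripleDet_deckLinear (σ : Bool) (a b c : Space) :
    tripleDet (deckLinear σ a) (deckLinear σ b) (deckLinear σ c) = tripleDet a b c := by
  simp only [tripleDet, deckLinear]
  have h := boolSign_sq σ
  linear_combination (a.1 * (b.2.1 * c.2.2 - b.2.2 * c.2.1) - a.2.1 * (b.1 * c.2.2 - b.2.2 * c.1) +
    a.2.2 * (b.1 * c.2.1 - b.2.1 * c.1)) * h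

theorem dot_deckLinear (σ : Bool) (a b : Space) :
    dot (deckLinear σ a) b = dot a (deckLinear σ b) := by
  simp only [dot_apply, deckLinear]
  ring

theorem deckLinear_deckLinear (σ : Bool) (a : Space) : deckLinear σ (deckLinear σ a) = a := by
  simp [deckLinear, ← mul_assoc, boolSign_sq]

namespace IsSurfaceCover

variable {X : Type*} [TopologicalSpace X] {p : coverSurface → X}

theorem locally_injective (hp : IsSurfaceCover p) (x : coverSurface) :
    Set.InjOn p (Metric.ball x 1) := by
  intro y hy z hz h
  obtain ⟨σ, m, n, l, rfl, -⟩ := hp.exists_deck y z h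
  have h1 : dist (coverDeck σ m n l y) y < 2 := by
    have := dist_triangle_right (coverDeck σ m n l y) y x
    rw [Metric.mem_ball] at hy hz
    linarith
  exact Subtype.ext (eq_of_deck_of_dist_lt h1).symm

theorem isLocalHomeomorph (hp : IsSurfaceCover p) : IsLocalHomeomorph p := by
  rw [isLocalHomeomorph_iff_isOpenEmbedding_restrict]
  intro x
  refine ⟨Metric.ball x 1, Metric.ball_mem_nhds x one_pos, ?_⟩
  exact Topology.IsOpenEmbedding.of_continuous_injective_isOpenMap
    (hp.continuous.comp continuous_subtype_val) (hp.locally_injective x).injective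
    (hp.isOpenMap.comp Metric.isOpen_ball.isOpenMap_subtype_val)

/-- The chart around `p x`. -/
noncomputable def chart (hp : IsSurfaceCover p) (x : coverSurface) :
    OpenPartialHomeomorph X Plane :=
  (hp.isLocalHomeomorph.localInverseAt (x := x)).trans (coverChart x)

theorem mem_chart_source (hp : IsSurfaceCover p) (x : coverSurface) :
    p x ∈ (hp.chart x).source := by
  simp [chart, mem_coverChart_source]

theorem chart_apply (hp : IsSurfaceCover p) (x : coverSurface) : hp.chart x (p x) = 0 := by
  simp [chart, coverChart_coe]

theorem chart_symm_apply (hp : IsSurfaceCover p) (x : coverSurface) (t : Plane) :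
    (hp.chart x).symm t = p (surfaceParam x t) := by
  simp [chart, coverChart_symm_coe]

theorem chart_target_subset (hp : IsSurfaceCover p) (x : coverSurface) :
    (hp.chart x).target ⊆ (coverChart x).target := by
  intro t ht
  simp only [chart, OpenPartialHomeomorph.trans_target] at ht
  exact ht.1

/-- The smooth structure of a surface covered by the surface in `ℝ³`. -/
@[reducible] noncomputable def chartedSpace (hp : IsSurfaceCover p) : ChartedSpace Plane X where
  atlas := Set.range hp.chart
  chartAt y := hp.chart (Function.surjInv hp.surjective y)
  mem_chart_source y := by
    obtain ⟨x, hx⟩ : ∃ x, x = Function.surjInv hp.surjective y := ⟨_, rfl⟩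
    have hy : p x = y := by rw [hx]; exact Function.surjInv_eq _ y
    rw [← hx, ← hy]
    exact hp.mem_chart_source x
  chart_mem_atlas y := ⟨_, rfl⟩

/-- The coordinate changes of the surface. -/
theorem chart_transition (hp : IsSurfaceCover p) (x x' : coverSurface) {t : Plane}
    (ht : t ∈ ((hp.chart x).symm.trans (hp.chart x')).source) :
    ∃ σ m n l,
      (surfaceParam x' ((hp.chart x).symm.trans (hp.chart x') t) : Space) =
        deck σ m n l (surfaceParam x t) ∧
      (hp.chart x).symm.trans (hp.chart x') =ᶠ[𝓝 t]
        fun z => surfaceProj x' (deck σ m n l (surfaceParam x z)) := by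
  set T := (hp.chart x).symm.trans (hp.chart x') with hT
  have hTmk : ∀ z ∈ T.source, z ∈ (coverChart x).target ∧ T z ∈ (coverChart x').target ∧
      p (surfaceParam x z) = p (surfaceParam x' (T z)) := by
    intro z hz
    rw [hT, OpenPartialHomeomorph.trans_source] at hz
    have hz1 : z ∈ (hp.chart x).target := hz.1
    have hz2 : (hp.chart x).symm z ∈ (hp.chart x').source := hz.2
    have hz3 : T z ∈ (hp.chart x').target := (hp.chart x').map_source hz2
    refine ⟨hp.chart_target_subset x hz1, hp.chart_target_subset x' hz3, ?_⟩
    rw [← hp.chart_symm_apply, ← hp.chart_symm_apply]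
    exact ((hp.chart x').left_inv hz2).symm
  obtain ⟨h1, h2, h3⟩ := hTmk t ht
  obtain ⟨σ, m, n, l, h4, h5⟩ := hp.exists_deck _ _ h3
  refine ⟨σ, m, n, l, congrArg Subtype.val h4, ?_⟩
  have c1 : ContinuousAt (fun z => surfaceParam x' (T z)) t :=
    ContinuousAt.comp (g := surfaceParam x') (continuousAt_surfaceParam x' h2) (T.continuousAt ht)
  have c2 : ContinuousAt (fun z => coverDeck σ m n l (surfaceParam x z)) t :=
    (continuous_coverDeck σ m n l).continuousAt.comp (continuousAt_surfaceParam x h1)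
  have hU := Metric.ball_mem_nhds (surfaceParam x' (T t)) one_pos
  have hU' := hU
  rw [h4] at hU'
  filter_upwards [c1 hU, c2 hU', T.open_source.mem_nhds ht] with z hz1 hz2 hz3
  rw [← h4] at hz2
  obtain ⟨g1, g2, g3⟩ := hTmk z hz3
  have h6 : surfaceParam x' (T z) = coverDeck σ m n l (surfaceParam x z) :=
    hp.locally_injective _ hz1 hz2 (by rw [h5, g3])
  rw [← surfaceProj_surfaceParam x' g2, h6]
  rfl

theorem contDiffAt_transition (hp : IsSurfaceCover p) (x x' : coverSurface) {t : Plane}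
    (ht : t ∈ ((hp.chart x).symm.trans (hp.chart x')).source) :
    ContDiffAt ℝ ω ((hp.chart x).symm.trans (hp.chart x')) t := by
  obtain ⟨σ, m, n, l, -, h⟩ := hp.chart_transition x x' ht
  refine ContDiffAt.congr_of_eventuallyEq ?_ h
  have ht' : t ∈ (coverChart x).target := by
    rw [OpenPartialHomeomorph.trans_source] at ht
    exact hp.chart_target_subset x ht.1
  exact (contDiff_surfaceProj x').contDiffAt.comp t
    ((contDiff_deck σ m n l).contDiffAt.comp t (contDiffAt_surfaceParam x ht'))

theorem isManifold (hp : IsSurfaceCover p) :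
    letI := hp.chartedSpace
    IsManifold (𝓡 2) ω X := by
  let := hp.chartedSpace
  refine isManifold_of_contDiffOn (𝓡 2) ω X ?_
  rintro _ _ ⟨x, rfl⟩ ⟨x', rfl⟩
  rintro t ⟨ht, -⟩
  exact (hp.contDiffAt_transition x x' ht).contDiffWithinAt

theorem transition_det_pos (hp : IsSurfaceCover p) (x x' : coverSurface) {t : Plane}
    (ht : t ∈ ((hp.chart x).symm.trans (hp.chart x')).source) :
    0 < (fderiv ℝ ((hp.chart x).symm.trans (hp.chart x')) t).det := by
  obtain ⟨σ, m, n, l, h0, h⟩ := hp.chart_transition x x' ht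
  have ht1 : t ∈ (coverChart x).target := by
    rw [OpenPartialHomeomorph.trans_source] at ht
    exact hp.chart_target_subset x ht.1
  have ht2 : (hp.chart x).symm.trans (hp.chart x') t ∈ (coverChart x').target := by
    have h2 := ((hp.chart x).symm.trans (hp.chart x')).map_source ht
    rw [OpenPartialHomeomorph.trans_target] at h2
    exact hp.chart_target_subset x' h2.1
  obtain ⟨W, hW⟩ : ∃ W : Plane →L[ℝ] Space,
      HasFDerivAt (fun t => (surfaceParam x t : Space)) W t :=
    ⟨_, ((contDiffAt_surfaceParam x ht1).differentiableAt (by simp)).hasFDerivAt⟩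
  have hpos := surfaceParam_framePositive x ht1
  have hpos' := surfaceParam_framePositive x' ht2
  rw [h0] at hpos'
  rw [framePositive, Set.mem_ofPred_eq] at hpos hpos'
  rw [surfaceGrad_deck] at hpos'
  set N := surfaceGrad (surfaceParam x t) with hN
  have hNW : ∀ v, dot N (W v) = 0 := by
    have h1 := (hasFDerivAt_surfaceFun (surfaceParam x t)).comp t hW
    have h2 : (surfaceFun ∘ fun t => (surfaceParam x t : Space)) = fun _ => 0 :=
      funext fun t => (surfaceParam x t).2
    rw [h2] at h1
    have h3 := h1.unique (hasFDerivAt_const 0 t)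
    intro v
    exact DFunLike.congr_fun h3 v
  have hproj : ∀ y v : Space, ∀ x₀ : coverSurface, HasFDerivAt (surfaceProj x₀)
      (frameMap (surfaceFrame x₀)) y := fun y v x₀ =>
    (frameMap (surfaceFrame x₀)).hasFDerivAt.comp y ((hasFDerivAt_id y).sub_const _)
  have hFW : ∀ v, frameMap (surfaceFrame x) (W v) = v := by
    have h1 := (hproj (surfaceParam x t) 0 x).comp t hW
    have h2 : (surfaceProj x ∘ fun t => (surfaceParam x t : Space)) =ᶠ[𝓝 t] id := by
      filter_upwards [(coverChart x).open_target.mem_nhds ht1] with s hs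
      exact surfaceProj_surfaceParam x hs
    have h3 := (h1.congr_of_eventuallyEq h2.symm).unique (hasFDerivAt_id t)
    intro v
    exact DFunLike.congr_fun h3 v
  have hT : HasFDerivAt ((hp.chart x).symm.trans (hp.chart x'))
      ((frameMap (surfaceFrame x')).comp ((deckLinearMap σ).comp W)) t :=
    (((hproj _ 0 x').comp t ((hasFDerivAt_deck σ m n l _).comp t hW))).congr_of_eventuallyEq h
  rw [hT.fderiv, plane_clm_det]
  simp only [ContinuousLinearMap.comp_apply, frameMap_zero, frameMap_one, deckLinearMap_apply]
  rw [← dot_deckLinear, ← dot_deckLinear, ← dot_deckLinear, ← dot_deckLinear]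
  have e0 := hFW (EuclideanSpace.single 0 1)
  have e1 := hFW (EuclideanSpace.single 1 1)
  refine frame_change_pos (N := N) (a := (surfaceFrame x).1) (b := (surfaceFrame x).2)
    (hNW _) (hNW _) ?_ ?_ ?_ ?_ hpos ?_
  · simpa using congrArg (fun v : Plane => v 0) e0
  · simpa using congrArg (fun v : Plane => v 0) e1
  · simpa using congrArg (fun v : Plane => v 1) e0
  · simpa using congrArg (fun v : Plane => v 1) e1
  · rw [← tripleDet_deckLinear σ, deckLinear_deckLinear, deckLinear_deckLinear]
    exact hpos'

theorem isOrientable (hp : IsSurfaceCover p) :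
    letI := hp.chartedSpace
    IsOrientable X := by
  let := hp.chartedSpace
  have := hp.isManifold
  refine ⟨Set.range hp.chart, fun c hc => IsManifold.subset_maximalAtlas hc, fun y => ?_, ?_⟩
  · obtain ⟨x, rfl⟩ := hp.surjective y
    exact ⟨_, ⟨x, rfl⟩, hp.mem_chart_source x⟩
  · rintro _ ⟨x, rfl⟩ _ ⟨x', rfl⟩ t ht
    exact hp.transition_det_pos x x' ht

theorem chart_mem_maximalAtlas (hp : IsSurfaceCover p) (x : coverSurface) :
    letI := hp.chartedSpace
    hp.chart x ∈ IsManifold.maximalAtlas (𝓡 2) ω X := by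
  let := hp.chartedSpace
  have := hp.isManifold
  exact IsManifold.subset_maximalAtlas ⟨x, rfl⟩

/-- A map on the surface is analytic near `p x` if and only if it is so in the parametrization. -/
theorem contMDiffAt_iff (hp : IsSurfaceCover p) {E H M : Type*} [NormedAddCommGroup E]
    [NormedSpace ℝ E] [TopologicalSpace H] {J : ModelWithCorners ℝ E H} [TopologicalSpace M]
    [ChartedSpace H M] (f : X → M) (x : coverSurface) :
    letI := hp.chartedSpace
    ContMDiffAt (𝓡 2) J ω f (p x) ↔
      ContMDiffAt (𝓡 2) J ω (fun t : Plane => f (p (surfaceParam x t))) 0 := by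
  let := hp.chartedSpace
  have := hp.isManifold
  have hc := hp.chart_mem_maximalAtlas x
  have hx := hp.mem_chart_source x
  have h0 := (hp.chart x).map_source hx
  rw [hp.chart_apply] at h0
  constructor
  · intro h
    have h1 := contMDiffAt_symm_of_mem_maximalAtlas hc h0
    have h2 : ContMDiffAt (𝓡 2) J ω f ((hp.chart x).symm 0) := by
      rw [hp.chart_symm_apply, surfaceParam_zero]
      exact h
    refine (h2.comp 0 h1).congr_of_eventuallyEq (Filter.Eventually.of_forall fun t => ?_)
    simp [hp.chart_symm_apply]
  · intro h
    have h1 := contMDiffAt_of_mem_maximalAtlas hc hx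
    rw [← hp.chart_apply x] at h
    refine (h.comp _ h1).congr_of_eventuallyEq ?_
    filter_upwards [(hp.chart x).open_source.mem_nhds hx] with y hy
    rw [Function.comp_apply, ← hp.chart_symm_apply, (hp.chart x).left_inv hy]

end IsSurfaceCover

/-! ### Analytic structures induced by an embedding -/

/-- A criterion for the analytic structure of a surface to be induced by an embedding of a space
above it: locally, there are analytic maps between the ambient spaces that are compatible with the
projections to the surface. -/
theorem IsSurfaceCover.inducesAnalyticStructure {X V Z : Type*} [TopologicalSpace X]
    [NormedAddCommGroup V] [NormedSpace ℝ V] [TopologicalSpace Z] {p : coverSurface → X}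
    (hp : IsSurfaceCover p) {i : Z → V} {π : Z → X} (hi : Topology.IsInducing i)
    (h : ∀ z, ∃ x : coverSurface, p x = π z ∧
      (∃ A : V → Space, ContDiffAt ℝ ω A (i z) ∧ A (i z) = x ∧
        ∀ᶠ z' in 𝓝 z, ∃ hA : A (i z') ∈ coverSurface, p ⟨A (i z'), hA⟩ = π z') ∧
      ∃ B : Space → V, ContDiffAt ℝ ω B x ∧ B x = i z ∧
        ∀ y : coverSurface, ∃ z', i z' = B y ∧ π z' = p y) :
    letI := hp.chartedSpace
    InducesAnalyticStructure i π := by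
  let := hp.chartedSpace
  intro φ z
  obtain ⟨x, hx, ⟨A, hA, hAz, hA'⟩, B, hB, hBx, hB'⟩ := h z
  rw [← hx, hp.contMDiffAt_iff, contMDiffAt_iff_contDiffAt]
  have h0 := zero_mem_coverChart_target x
  constructor
  · intro hφ
    have hA0 : surfaceProj x (A (i z)) = 0 := by rw [hAz, surfaceProj_self]
    refine ⟨fun v => φ (p (surfaceParam x (surfaceProj x (A v)))), ?_, ?_⟩
    · refine ContDiffAt.analyticAt ?_
      refine ContDiffAt.comp (g := fun t => φ (p (surfaceParam x t))) (i z) ?_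
        ((contDiff_surfaceProj x).contDiffAt.comp (i z) hA)
      rw [hA0]
      exact hφ
    · have hc : ContinuousAt (fun z' => A (i z')) z :=
        ContinuousAt.comp (f := i) hA.continuousAt hi.continuous.continuousAt
      have hs : (straightenHomeo x).source ∈ 𝓝 (A (i z)) := by
        rw [hAz]
        exact (straightenHomeo x).open_source.mem_nhds (mem_straightenHomeo_source x)
      filter_upwards [hA', hc hs] with z' hz' hsz
      obtain ⟨hz1, hz2⟩ := hz'
      have := surfaceParam_surfaceProj x (y := ⟨A (i z'), hz1⟩) hsz
      rw [this, hz2]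
  · rintro ⟨Φ, hΦ, hΦ'⟩
    have h1 : ContDiffAt ℝ ω (fun t => Φ (B (surfaceParam x t))) 0 := by
      refine ContDiffAt.comp (g := Φ) 0 ?_
        (ContDiffAt.comp (g := B) 0 ?_ (contDiffAt_surfaceParam x h0))
      · rw [surfaceParam_zero, hBx]
        exact hΦ.contDiffAt
      · rw [surfaceParam_zero]
        exact hB
    refine h1.congr_of_eventuallyEq ?_
    rw [hi.nhds_eq_comap, Filter.eventually_comap] at hΦ'
    have hc : ContinuousAt (fun t => B (surfaceParam x t)) 0 := by
      refine ContinuousAt.comp (g := B) ?_ (contDiffAt_surfaceParam x h0).continuousAt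
      rw [surfaceParam_zero]
      exact hB.continuousAt
    rw [← hBx] at hΦ'
    have hc' := hc.tendsto
    rw [surfaceParam_zero] at hc'
    filter_upwards [hc'.eventually hΦ'] with t ht
    obtain ⟨z', hz1, hz2⟩ := hB' (surfaceParam x t)
    rw [← hz2, ← hz1]
    exact ht z' hz1

/-- The angle near `α` with cosine `C` and sine `S`. -/
noncomputable def localAngle (α C S : ℝ) : ℝ :=
  α + Real.arcsin (S * Real.cos α - C * Real.sin α)

@[simp] theorem localAngle_self (α : ℝ) : localAngle α (Real.cos α) (Real.sin α) = α := by
  rw [localAngle, mul_comm, sub_self, Real.arcsin_zero, add_zero]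

theorem cos_sin_localAngle {α C S : ℝ} (h : C ^ 2 + S ^ 2 = 1)
    (hpos : 0 < C * Real.cos α + S * Real.sin α) :
    Real.cos (localAngle α C S) = C ∧ Real.sin (localAngle α C S) = S := by
  have hα := Real.sin_sq_add_cos_sq α
  have hsq : (C * Real.cos α + S * Real.sin α) ^ 2 +
      (S * Real.cos α - C * Real.sin α) ^ 2 = 1 := by
    linear_combination h + (C ^ 2 + S ^ 2) * hα
  have hs : Real.sin (Real.arcsin (S * Real.cos α - C * Real.sin α)) =
      S * Real.cos α - C * Real.sin α :=
    Real.sin_arcsin (by nlinarith) (by nlinarith)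
  have hc : Real.cos (Real.arcsin (S * Real.cos α - C * Real.sin α)) =
      C * Real.cos α + S * Real.sin α := by
    rw [Real.cos_arcsin, show 1 - (S * Real.cos α - C * Real.sin α) ^ 2 =
      (C * Real.cos α + S * Real.sin α) ^ 2 by linarith, Real.sqrt_sq hpos.le]
  rw [localAngle, Real.cos_add, Real.sin_add, hs, hc]
  constructor
  · linear_combination C * hα
  · linear_combination S * hα

theorem contDiffAt_localAngle {E : Type*} [NormedAddCommGroup E] [NormedSpace ℝ E] {C S : E → ℝ}
    {v : E} {α : ℝ} (hC : ContDiffAt ℝ ω C v) (hS : ContDiffAt ℝ ω S v)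
    (hC' : C v = Real.cos α) (hS' : S v = Real.sin α) :
    ContDiffAt ℝ ω (fun w => localAngle α (C w) (S w)) v := by
  refine contDiffAt_const.add ?_
  have h0 : S v * Real.cos α - C v * Real.sin α = 0 := by
    rw [hC', hS']
    ring
  refine ContDiffAt.comp v (g := Real.arcsin) ?_ ((hS.mul contDiffAt_const).sub
    (hC.mul contDiffAt_const))
  rw [h0]
  exact Real.contDiffAt_arcsin (by norm_num) (by norm_num)

theorem eventually_cos_sin_localAngle {Z : Type*} [TopologicalSpace Z] {C S : Z → ℝ} {z : Z}
    {α : ℝ} (hC : ContinuousAt C z) (hS : ContinuousAt S z) (hC' : C z = Real.cos α)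
    (hS' : S z = Real.sin α) :
    ∀ᶠ w in 𝓝 z, C w ^ 2 + S w ^ 2 = 1 → Real.cos (localAngle α (C w) (S w)) = C w ∧
      Real.sin (localAngle α (C w) (S w)) = S w := by
  have hc : ContinuousAt (fun w => C w * Real.cos α + S w * Real.sin α) z :=
    (hC.mul continuousAt_const).add (hS.mul continuousAt_const)
  have h0 : 0 < C z * Real.cos α + S z * Real.sin α := by
    rw [hC', hS']
    nlinarith [Real.sin_sq_add_cos_sq α]
  filter_upwards [hc.eventually (lt_mem_nhds h0)] with w hw h
  exact cos_sin_localAngle h hw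

/-! ### The surfaces `Σ̂` and `Σ̂ / ι̂` -/

theorem mem_coverSurface_iff {x : Space} :
    x ∈ coverSurface ↔
      ((x.1 : Real.Angle), (x.2.1 : Real.Angle), (x.2.2 : Real.Angle)) ∈ genusFiveSurface := by
  rw [mem_genusFiveSurface, Real.Angle.sin_coe, Real.Angle.sin_coe, Real.Angle.sin_coe,
    Real.Angle.cos_coe]
  exact Iff.rfl

/-- The covering map to `Σ̂`. -/
noncomputable def toSurface (x : coverSurface) : genusFiveSurface :=
  ⟨((x.1.1 : Real.Angle), (x.1.2.1 : Real.Angle), (x.1.2.2 : Real.Angle)),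
    mem_coverSurface_iff.1 x.2⟩

theorem continuous_toSurface : Continuous toSurface := by
  refine Continuous.subtype_mk (Continuous.prodMk ?_ (Continuous.prodMk ?_ ?_)) _
  all_goals exact Real.Angle.continuous_coe.comp (by fun_prop)

theorem toSurface_surjective : Function.Surjective toSurface := by
  rintro ⟨⟨γ, θ, ν⟩, h⟩
  induction γ using Real.Angle.induction_on with
  | _ x =>
    induction θ using Real.Angle.induction_on with
    | _ y =>
      induction ν using Real.Angle.induction_on with
      | _ w => exact ⟨⟨(x, y, w), mem_coverSurface_iff.2 h⟩, rfl⟩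

theorem isOpenMap_toSurface : IsOpenMap toSurface := by
  have hc : IsOpenMap ((↑) : ℝ → Real.Angle) := QuotientAddGroup.isOpenMap_coe
  have h3 := hc.prodMap (hc.prodMap hc)
  rintro U ⟨V, hV, rfl⟩
  refine ⟨_, h3 V hV, ?_⟩
  ext z
  constructor
  · rintro ⟨x, hx, hxz⟩
    have hx' : x ∈ coverSurface := mem_coverSurface_iff.2 (by
      have := z.2
      rw [← hxz] at this
      exact this)
    exact ⟨⟨x, hx'⟩, hx, Subtype.ext hxz⟩
  · rintro ⟨x, hx, rfl⟩
    exact ⟨x.1, hx, rfl⟩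

theorem toSurface_coverDeck_true (m n l : ℤ) (x : coverSurface) :
    toSurface (coverDeck true m n l x) = toSurface x := by
  apply surface_ext
  all_goals simp only [toSurface, coverDeck, Real.Angle.cos_coe, Real.Angle.sin_coe, sin_deck_fst,
    sin_deck_snd, sin_deck_trd, cos_deck_fst, cos_deck_snd, cos_deck_trd, boolSign, if_true,
    one_mul]

theorem toSurface_coverDeck_false (m n l : ℤ) (x : coverSurface) :
    toSurface (coverDeck false m n l x) = iotaHat (toSurface x) := by
  apply surface_ext
  all_goals simp only [toSurface, coverDeck, Real.Angle.cos_coe, Real.Angle.sin_coe, sin_deck_fst,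
    sin_deck_snd, sin_deck_trd, cos_deck_fst, cos_deck_snd, cos_deck_trd, boolSign, iotaHat,
    Bool.false_eq_true, if_false, neg_one_mul, Real.Angle.cos_neg, Real.Angle.sin_neg,
    Real.Angle.sin_add_pi, Real.Angle.cos_add_pi]

theorem exists_deck_of_toSurface_eq {x y : coverSurface} (h : toSurface y = toSurface x) :
    ∃ m n l, y = coverDeck true m n l x := by
  have h' := congrArg Subtype.val h
  simp only [toSurface, Prod.mk.injEq, Real.Angle.angle_eq_iff_two_pi_dvd_sub] at h'
  obtain ⟨⟨m, hm⟩, ⟨n, hn⟩, l, hl⟩ := h'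
  refine ⟨m, n, l, Subtype.ext (Prod.ext ?_ (Prod.ext ?_ ?_))⟩ <;>
    simp only [coverDeck, deck, boolSign, if_true] <;> linarith

theorem exists_deck_of_toSurface_eq_iotaHat {x y : coverSurface}
    (h : toSurface y = iotaHat (toSurface x)) : ∃ m n l, y = coverDeck false m n l x := by
  rw [← toSurface_coverDeck_false 0 0 0] at h
  obtain ⟨m, n, l, rfl⟩ := exists_deck_of_toSurface_eq h
  refine ⟨m, n, l, Subtype.ext (Prod.ext ?_ (Prod.ext ?_ ?_))⟩ <;>
    simp [coverDeck, deck, boolSign]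

theorem iotaHat_ne (x : genusFiveSurface) : iotaHat x ≠ x := by
  intro h
  have h1 := sheet_iotaHat x
  rw [h] at h1
  cases hs : sheet x <;> simp [hs] at h1

theorem continuous_iotaHat : Continuous iotaHat := by
  refine Continuous.subtype_mk ?_ _
  fun_prop

theorem isSurfaceCover_comp {X : Type*} [TopologicalSpace X] {q : genusFiveSurface → X}
    (hc : Continuous q) (ho : IsOpenMap q) (hs : Function.Surjective q)
    (hfib : ∀ z z', q z = q z' → z' = z ∨ (z' = iotaHat z ∧ ∀ w, q (iotaHat w) = q w)) :
    IsSurfaceCover (q ∘ toSurface) where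
  continuous := hc.comp continuous_toSurface
  isOpenMap := ho.comp isOpenMap_toSurface
  surjective := hs.comp toSurface_surjective
  exists_deck x y h := by
    rcases hfib _ _ h with h1 | ⟨h1, h2⟩
    · obtain ⟨m, n, l, hy⟩ := exists_deck_of_toSurface_eq h1
      exact ⟨true, m, n, l, hy, fun z => congrArg q (toSurface_coverDeck_true m n l z)⟩
    · obtain ⟨m, n, l, hy⟩ := exists_deck_of_toSurface_eq_iotaHat h1
      refine ⟨false, m, n, l, hy, fun z => ?_⟩
      rw [Function.comp_apply, toSurface_coverDeck_false, h2, Function.comp_apply]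

theorem isClosed_genusFiveSurface : IsClosed genusFiveSurface := by
  have hs : Continuous Real.Angle.sin := Real.Angle.continuous_sin
  have hc : Continuous Real.Angle.cos := Real.Angle.continuous_cos
  refine isClosed_eq ?_ continuous_const
  exact ((hs.comp (by fun_prop)).mul (hs.comp (by fun_prop))).add
    ((hs.comp (by fun_prop)).mul (hc.comp (by fun_prop)))

instance : CompactSpace genusFiveSurface := by
  have : Fact (0 < 2 * Real.pi) := ⟨by positivity⟩
  have : CompactSpace Real.Angle := inferInstanceAs (CompactSpace (AddCircle (2 * Real.pi)))
  exact isCompact_iff_compactSpace.1 isClosed_genusFiveSurface.isCompact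

theorem toCircle_coe_eq (t : Real.Angle) : (t.toCircle : ℂ) = ⟨t.cos, t.sin⟩ := by
  induction t using Real.Angle.induction_on with
  | _ x =>
    rw [Real.Angle.toCircle_coe, Circle.coe_exp, Complex.exp_mul_I, Real.Angle.cos_coe,
      Real.Angle.sin_coe]
    apply Complex.ext <;> simp [← Complex.ofReal_cos, ← Complex.ofReal_sin]

theorem isInducing_genusFiveEmb : Topology.IsInducing genusFiveEmb := by
  have hc : Continuous fun t : Real.Angle => (t.toCircle : ℂ) := by
    have h : (fun t : Real.Angle => (t.toCircle : ℂ)) =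
        fun t => Complex.equivRealProdCLM.symm (t.cos, t.sin) := by
      funext t
      rw [toCircle_coe_eq]
      rfl
    rw [h]
    exact Complex.equivRealProdCLM.symm.continuous.comp
      (Real.Angle.continuous_cos.prodMk Real.Angle.continuous_sin)
  have hcont : Continuous genusFiveEmb :=
    (hc.comp (by fun_prop)).prodMk ((hc.comp (by fun_prop)).prodMk (hc.comp (by fun_prop)))
  refine (hcont.isClosedEmbedding ?_).isInducing
  intro x y h
  simp only [genusFiveEmb, Prod.mk.injEq, toCircle_coe_eq, Complex.mk.injEq] at h
  obtain ⟨⟨h1, h2⟩, ⟨h3, h4⟩, h5, h6⟩ := h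
  exact surface_ext h1 h2 h3 h4 h5 h6

theorem inducesAnalyticStructure_genusFiveEmb {X : Type*} [TopologicalSpace X]
    {q : genusFiveSurface → X} (hq : IsSurfaceCover (q ∘ toSurface)) :
    letI := hq.chartedSpace
    InducesAnalyticStructure genusFiveEmb q := by
  refine hq.inducesAnalyticStructure isInducing_genusFiveEmb fun z => ?_
  obtain ⟨x, rfl⟩ := toSurface_surjective z
  have hre : ContDiff ℝ ω Complex.re := Complex.reCLM.contDiff
  have him : ContDiff ℝ ω Complex.im := Complex.imCLM.contDiff
  have cre := Complex.continuous_re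
  have cim := Complex.continuous_im
  have ce := isInducing_genusFiveEmb.continuous
  refine ⟨x, rfl, ⟨fun w => (localAngle x.1.1 w.1.re w.1.im,
    localAngle x.1.2.1 w.2.1.re w.2.1.im, localAngle x.1.2.2 w.2.2.re w.2.2.im), ?_, ?_, ?_⟩,
    fun y => (Complex.equivRealProdCLM.symm (Real.cos y.1, Real.sin y.1),
      Complex.equivRealProdCLM.symm (Real.cos y.2.1, Real.sin y.2.1),
      Complex.equivRealProdCLM.symm (Real.cos y.2.2, Real.sin y.2.2)), ?_, ?_, ?_⟩
  · refine ContDiffAt.prodMk ?_ (ContDiffAt.prodMk ?_ ?_)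
    all_goals
      refine contDiffAt_localAngle ?_ ?_ ?_ ?_
      · exact (hre.comp (by fun_prop)).contDiffAt
      · exact (him.comp (by fun_prop)).contDiffAt
      · simp only [genusFiveEmb, toSurface, toCircle_coe_eq, Real.Angle.cos_coe,
          Real.Angle.sin_coe]
      · simp only [genusFiveEmb, toSurface, toCircle_coe_eq, Real.Angle.cos_coe,
          Real.Angle.sin_coe]
  · simp only [genusFiveEmb, toSurface, toCircle_coe_eq, Real.Angle.cos_coe,
          Real.Angle.sin_coe, localAngle_self]
  · have key : ∀ f : ℂ × ℂ × ℂ → ℂ, Continuous f → ∀ α : ℝ,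
        f (genusFiveEmb (toSurface x)) = ⟨Real.cos α, Real.sin α⟩ →
        ∀ᶠ z' in 𝓝 (toSurface x), (f (genusFiveEmb z')).re ^ 2 + (f (genusFiveEmb z')).im ^ 2 = 1 →
          Real.cos (localAngle α (f (genusFiveEmb z')).re (f (genusFiveEmb z')).im) =
            (f (genusFiveEmb z')).re ∧
          Real.sin (localAngle α (f (genusFiveEmb z')).re (f (genusFiveEmb z')).im) =
            (f (genusFiveEmb z')).im := by
      intro f hf α h
      refine eventually_cos_sin_localAngle (C := fun z' => (f (genusFiveEmb z')).re)
        (S := fun z' => (f (genusFiveEmb z')).im) ?_ ?_ ?_ ?_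
      · exact (cre.comp (hf.comp ce)).continuousAt
      · exact (cim.comp (hf.comp ce)).continuousAt
      · simp [h]
      · simp [h]
    filter_upwards [key (fun w => w.1) (by fun_prop) x.1.1
        (by simp only [genusFiveEmb, toSurface, toCircle_coe_eq, Real.Angle.cos_coe,
          Real.Angle.sin_coe]),
      key (fun w => w.2.1) (by fun_prop) x.1.2.1
        (by simp only [genusFiveEmb, toSurface, toCircle_coe_eq, Real.Angle.cos_coe,
          Real.Angle.sin_coe]),
      key (fun w => w.2.2) (by fun_prop) x.1.2.2
        (by simp only [genusFiveEmb, toSurface, toCircle_coe_eq, Real.Angle.cos_coe,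
          Real.Angle.sin_coe])] with z' h1 h2 h3
    simp only [genusFiveEmb, toCircle_coe_eq, Real.Angle.cos_sq_add_sin_sq, forall_const]
      at h1 h2 h3
    simp only [genusFiveEmb, toCircle_coe_eq]
    have hmem : ((localAngle x.1.1 z'.1.1.cos z'.1.1.sin,
        localAngle x.1.2.1 z'.1.2.1.cos z'.1.2.1.sin,
        localAngle x.1.2.2 z'.1.2.2.cos z'.1.2.2.sin) : Space) ∈ coverSurface := by
      change Real.sin _ * Real.sin _ + Real.sin _ * Real.cos _ = 0
      rw [h1.2, h2.2, h3.1, h3.2]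
      exact z'.2
    refine ⟨hmem, congrArg q ?_⟩
    apply surface_ext <;> simp only [toSurface, Real.Angle.cos_coe, Real.Angle.sin_coe]
    exacts [h1.1, h1.2, h2.1, h2.2, h3.1, h3.2]
  · refine ContDiff.contDiffAt (ContDiff.prodMk ?_ (ContDiff.prodMk ?_ ?_))
    all_goals exact Complex.equivRealProdCLM.symm.contDiff.comp (by fun_prop)
  · simp only [genusFiveEmb, toSurface, toCircle_coe_eq, Real.Angle.cos_coe, Real.Angle.sin_coe]
    rfl
  · intro y
    refine ⟨toSurface y, ?_, rfl⟩
    simp only [genusFiveEmb, toSurface, toCircle_coe_eq, Real.Angle.cos_coe, Real.Angle.sin_coe]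
    rfl

theorem isSurfaceCover_toSurface : IsSurfaceCover ((fun z : genusFiveSurface => z) ∘ toSurface) :=
  isSurfaceCover_comp continuous_id IsOpenMap.id Function.surjective_id fun _ _ h => Or.inl h.symm

theorem isClosedOrientableSurface_genusFiveSurface :
    letI := isSurfaceCover_toSurface.chartedSpace
    IsClosedOrientableSurface 5 genusFiveSurface := by
  let := isSurfaceCover_toSurface.chartedSpace
  refine ⟨isSurfaceCover_toSurface.isManifold, inferInstance, inferInstance,
    connectedSpace_genusFiveSurface, isSurfaceCover_toSurface.isOrientable, ?_⟩
  have h := hasEulerCharacteristic_of_sheets (Y := genusFiveSurface) (β := id)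
    Function.injective_id (q := id) continuous_id (fun _ _ h => Or.inl h.symm)
    (fun _ _ _ _ h => h) (fun y => ⟨y, rfl, _, rfl⟩)
  rw [show -4 * (Nat.card Bool : ℤ) = 2 - 2 * ((5 : ℕ) : ℤ) by simp] at h
  exact h

/-- `q` is an open quotient map by the involution `ι̂`. -/
structure IsIotaQuotient {X : Type} [TopologicalSpace X] (q : genusFiveSurface → X) : Prop where
  continuous : Continuous q
  isOpenMap : IsOpenMap q
  surjective : Function.Surjective q
  eq_iff : ∀ z z', q z = q z' ↔ z' = z ∨ z' = iotaHat z

namespace IsIotaQuotient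

variable {X : Type} [TopologicalSpace X] {q : genusFiveSurface → X}

theorem isSurfaceCover (hq : IsIotaQuotient q) : IsSurfaceCover (q ∘ toSurface) :=
  isSurfaceCover_comp hq.continuous hq.isOpenMap hq.surjective fun z z' h =>
    ((hq.eq_iff z z').1 h).imp id fun h => ⟨h, fun _ => ((hq.eq_iff _ _).2 (Or.inr rfl)).symm⟩

theorem isClosedOrientableSurface (hq : IsIotaQuotient q) :
    letI := hq.isSurfaceCover.chartedSpace
    IsClosedOrientableSurface 3 X := by
  let := hq.isSurfaceCover.chartedSpace
  have ht : T2Space X := by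
    rw [t2Space_iff_of_isOpenQuotientMap ⟨hq.surjective, hq.continuous, hq.isOpenMap⟩]
    have : {z : genusFiveSurface × genusFiveSurface | q z.1 = q z.2} =
        {z | z.2 = z.1} ∪ {z | z.2 = iotaHat z.1} := by
      ext z
      exact hq.eq_iff _ _
    rw [this]
    exact (isClosed_eq continuous_snd continuous_fst).union
      (isClosed_eq continuous_snd (continuous_iotaHat.comp continuous_fst))
  have := connectedSpace_genusFiveSurface
  refine ⟨hq.isSurfaceCover.isManifold, ht, hq.surjective.compactSpace hq.continuous,
    hq.surjective.connectedSpace hq.continuous, hq.isSurfaceCover.isOrientable, ?_⟩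
  have hsheet : ∀ z, sheet z ∈ Set.range (fun _ : Unit => true) ↔ sheet z = true := by
    intro z
    exact ⟨fun ⟨_, h⟩ => h.symm, fun h => ⟨(), h.symm⟩⟩
  have h := hasEulerCharacteristic_of_sheets (Y := X) (β := fun _ : Unit => true)
    (Function.injective_of_subsingleton _) hq.continuous (fun z z' h => (hq.eq_iff z z').1 h)
    (by
      intro z z' hz hz' h
      rw [hsheet] at hz hz'
      rcases (hq.eq_iff z z').1 h with h | h
      · exact h.symm
      · rw [h, sheet_iotaHat, hz] at hz'
        exact absurd hz' (by simp))
    (by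
      intro y
      obtain ⟨z, rfl⟩ := hq.surjective y
      cases hz : sheet z
      · exact ⟨iotaHat z, ((hq.eq_iff _ _).2 (Or.inr rfl)).symm,
          (hsheet _).2 (by rw [sheet_iotaHat, hz]; rfl)⟩
      · exact ⟨z, rfl, (hsheet _).2 hz⟩)
  rw [show -4 * (Nat.card Unit : ℤ) = 2 - 2 * ((3 : ℕ) : ℤ) by simp] at h
  exact h

end IsIotaQuotient

theorem isIotaQuotient_genusFiveMk : IsIotaQuotient genusFiveMk where
  continuous := continuous_quotient_mk'
  isOpenMap := by
    intro U hU
    have : genusFiveMk ⁻¹' (genusFiveMk '' U) = U ∪ iotaHat ⁻¹' U := by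
      ext x
      simp only [Set.mem_preimage, Set.mem_image, Set.mem_union]
      constructor
      · rintro ⟨y, hy, hyx⟩
        rcases Quotient.exact hyx with h | h
        · exact Or.inl (h ▸ hy)
        · refine Or.inr ?_
          rw [h, iotaHat_iotaHat]
          exact hy
      · rintro (h | h)
        · exact ⟨x, h, rfl⟩
        · exact ⟨_, h, Quotient.sound (Or.inr (iotaHat_iotaHat x).symm)⟩
    change IsOpen (genusFiveMk ⁻¹' (genusFiveMk '' U))
    rw [this]
    exact hU.union (hU.preimage continuous_iotaHat)
  surjective := Quotient.exists_rep
  eq_iff _ _ := Quotient.eq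

/-! ### Cosine and sine as functions of the square of the angle -/

theorem exists_entire {c : ℕ → ℝ} (hc : ∀ n, c n ≠ 0)
    (hc' : Filter.Tendsto (fun n => ‖c n.succ‖ / ‖c n‖) Filter.atTop (𝓝 0)) :
    ∃ g : ℝ → ℝ, (∀ n, ContDiff ℝ n g) ∧ ∀ x, g x = ∑' n, c n * x ^ n := by
  have hr := FormalMultilinearSeries.ofScalars_radius_eq_top_of_tendsto ℝ c
    (Filter.Eventually.of_forall hc) hc'
  have h := (FormalMultilinearSeries.ofScalars ℝ c).hasFPowerSeriesOnBall
    (by rw [hr]; exact ENNReal.zero_lt_top)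
  refine ⟨_, fun n => ?_, fun x => FormalMultilinearSeries.ofScalars_sum_eq c x⟩
  rw [hr] at h
  refine AnalyticOnNhd.contDiff (fun x _ => ?_)
  exact h.analyticAt_of_mem (by simp)

theorem exists_cosSq : ∃ g : ℝ → ℝ, (∀ n, ContDiff ℝ n g) ∧ ∀ x, g (x ^ 2) = Real.cos x := by
  have hne : ∀ n : ℕ, ((-1 : ℝ) ^ n / ((2 * n).factorial : ℝ)) ≠ 0 := fun n => by positivity
  obtain ⟨g, hg, hs⟩ := exists_entire hne (by
    have : ∀ n : ℕ, ‖(-1 : ℝ) ^ n.succ / ((2 * n.succ).factorial : ℝ)‖ /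
        ‖(-1 : ℝ) ^ n / ((2 * n).factorial : ℝ)‖ = 1 / ((2 * n + 2) * (2 * n + 1)) := by
      intro n
      have h1 : ((2 * n.succ).factorial : ℝ) = (2 * n + 2) * ((2 * n + 1) * (2 * n).factorial) := by
        rw [show 2 * n.succ = 2 * n + 1 + 1 by omega, Nat.factorial_succ, Nat.factorial_succ]
        push_cast
        ring
      have h2 : (0 : ℝ) < (2 * n).factorial := by positivity
      simp only [norm_div, norm_pow, norm_neg, norm_one, one_pow, h1, norm_mul, Real.norm_natCast]
      rw [Real.norm_of_nonneg (by positivity), Real.norm_of_nonneg (by positivity)]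
      field_simp
    simp only [this]
    refine squeeze_zero (fun n => by positivity) (fun n => ?_)
      tendsto_one_div_add_atTop_nhds_zero_nat
    gcongr
    nlinarith [(Nat.cast_nonneg n : (0 : ℝ) ≤ n)])
  refine ⟨g, hg, fun x => ?_⟩
  rw [hs, ← (Real.hasSum_cos x).tsum_eq]
  congr 1
  funext n
  rw [← pow_mul]
  ring

theorem exists_sinSq : ∃ g : ℝ → ℝ, (∀ n, ContDiff ℝ n g) ∧ ∀ x, x * g (x ^ 2) = Real.sin x := by
  have hne : ∀ n : ℕ, ((-1 : ℝ) ^ n / ((2 * n + 1).factorial : ℝ)) ≠ 0 := fun n => by positivity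
  obtain ⟨g, hg, hs⟩ := exists_entire hne (by
    have : ∀ n : ℕ, ‖(-1 : ℝ) ^ n.succ / ((2 * n.succ + 1).factorial : ℝ)‖ /
        ‖(-1 : ℝ) ^ n / ((2 * n + 1).factorial : ℝ)‖ = 1 / ((2 * n + 3) * (2 * n + 2)) := by
      intro n
      have h1 : ((2 * n.succ + 1).factorial : ℝ) =
          (2 * n + 3) * ((2 * n + 2) * (2 * n + 1).factorial) := by
        rw [show 2 * n.succ + 1 = 2 * n + 1 + 1 + 1 by omega, Nat.factorial_succ,
          Nat.factorial_succ]
        push_cast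
        ring
      have h2 : (0 : ℝ) < (2 * n + 1).factorial := by positivity
      simp only [norm_div, norm_pow, norm_neg, norm_one, one_pow, h1, norm_mul, Real.norm_natCast]
      rw [Real.norm_of_nonneg (by positivity), Real.norm_of_nonneg (by positivity)]
      field_simp
    simp only [this]
    refine squeeze_zero (fun n => by positivity) (fun n => ?_)
      tendsto_one_div_add_atTop_nhds_zero_nat
    gcongr
    nlinarith [(Nat.cast_nonneg n : (0 : ℝ) ≤ n)])
  refine ⟨g, hg, fun x => ?_⟩
  rw [hs, ← (Real.hasSum_sin x).tsum_eq, ← tsum_mul_left]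
  congr 1
  funext n
  rw [← pow_mul]
  ring

/-- The entire function with `cosSq (x ^ 2) = cos x`. -/
noncomputable def cosSq : ℝ → ℝ := exists_cosSq.choose

/-- The entire function with `x * sincSq (x ^ 2) = sin x`. -/
noncomputable def sincSq : ℝ → ℝ := exists_sinSq.choose

@[fun_prop] theorem contDiff_cosSq {n : WithTop ℕ∞} : ContDiff ℝ n cosSq :=
  exists_cosSq.choose_spec.1 n

@[fun_prop] theorem contDiff_sincSq {n : WithTop ℕ∞} : ContDiff ℝ n sincSq :=
  exists_sinSq.choose_spec.1 n

theorem cosSq_sq (x : ℝ) : cosSq (x ^ 2) = Real.cos x := exists_cosSq.choose_spec.2 x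

theorem mul_sincSq_sq (x : ℝ) : x * sincSq (x ^ 2) = Real.sin x := exists_sinSq.choose_spec.2 x

@[simp] theorem cosSq_zero : cosSq 0 = 1 := by
  simpa using cosSq_sq 0

@[simp] theorem sincSq_zero : sincSq 0 = 1 := by
  have h1 : HasDerivAt (fun x : ℝ => x * sincSq (x ^ 2)) (sincSq 0) 0 := by
    have hd : DifferentiableAt ℝ (fun x : ℝ => sincSq (x ^ 2)) 0 :=
      (contDiff_sincSq.differentiable (n := 1) one_ne_zero).comp (differentiable_pow 2) 0
    simpa using (hasDerivAt_id' (0 : ℝ)).fun_mul hd.hasDerivAt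
  have h2 : HasDerivAt (fun x : ℝ => x * sincSq (x ^ 2)) 1 0 := by
    simp only [mul_sincSq_sq]
    simpa using Real.hasDerivAt_sin 0
  exact h1.unique h2

theorem cosSq_sq_add {x : ℝ} (hx : 0 ≤ x) : cosSq x ^ 2 + x * sincSq x ^ 2 = 1 := by
  obtain ⟨y, rfl⟩ : ∃ y, x = y ^ 2 := ⟨√x, (Real.sq_sqrt hx).symm⟩
  have h := Real.sin_sq_add_cos_sq y
  rw [← cosSq_sq, ← mul_sincSq_sq] at h
  linarith

theorem exp_smul_of_re_eq_zero (s : ℝ) {B : ℍ[ℝ]} (hB : B.re = 0) :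
    NormedSpace.exp (s • B) = (cosSq (s ^ 2 * ‖B‖ ^ 2) : ℍ[ℝ]) +
      (s * sincSq (s ^ 2 * ‖B‖ ^ 2)) • B := by
  rw [Quaternion.exp_of_re_eq_zero _ (by simp [hB]), norm_smul, Real.norm_eq_abs,
    show s ^ 2 * ‖B‖ ^ 2 = (|s| * ‖B‖) ^ 2 by rw [mul_pow, sq_abs], cosSq_sq]
  congr 1
  by_cases h : |s| * ‖B‖ = 0
  · have : s • B = 0 := by
      rcases mul_eq_zero.1 h with h | h
      · rw [abs_eq_zero.1 h, zero_smul]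
      · rw [norm_eq_zero.1 h, smul_zero]
    rw [mul_comm s, mul_smul, this, smul_zero, smul_zero]
  · rw [← mul_sincSq_sq, mul_div_cancel_left₀ _ h, mul_comm s, mul_smul]

/-! ### Implicit functions on a compact family -/

/-- If `F (0, y, t)` is decreasing in `t` near its zero `t₀ y`, then for all small `s` the
equation `F (s, y, t) = 0` has a unique solution near `t₀ y`, which is an analytic function. -/
theorem exists_implicit_family {E : Type*} [NormedAddCommGroup E] [NormedSpace ℝ E]
    [CompleteSpace E] {F : (ℝ × E) × ℝ → ℝ} {σ : ℝ} (hσ : 0 < σ)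
    (hF : ∀ s y t, |s| < σ → ContDiffAt ℝ ω F ((s, y), t)) {t₀ : E → ℝ} (ht₀ : Continuous t₀)
    {δ : ℝ} (hδ : 0 < δ) {K : Set E} (hK : IsCompact K)
    (hper : ∀ y, ∃ y' ∈ K, t₀ y' = t₀ y ∧ ∀ s t, |s| < σ →
      F ((s, y'), t) = F ((s, y), t))
    (h0 : ∀ y, F ((0, y), t₀ y) = 0)
    (hneg : ∀ y ∈ K, ∀ t, |t - t₀ y| ≤ δ → deriv (fun t => F ((0, y), t)) t < 0) :
    ∃ ε, 0 < ε ∧ ε ≤ σ ∧ ∃ T : ℝ → E → ℝ, ∀ s y, |s| < ε → |T s y - t₀ y| < δ ∧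
      F ((s, y), T s y) = 0 ∧ (∀ t, |t - t₀ y| ≤ δ → F ((s, y), t) = 0 → t = T s y) ∧
      ContDiffAt ℝ ω (fun z : ℝ × E => T z.1 z.2) (s, y) := by
  have hd : ∀ s y t, |s| < σ →
      HasDerivAt (fun t => F ((s, y), t)) (fderiv ℝ F ((s, y), t) (0, 1)) t := by
    intro s y t hs
    have h1 := ((hF s y t hs).differentiableAt (by simp)).hasFDerivAt
    exact h1.comp_hasDerivAt t ((hasDerivAt_const t (s, y)).prodMk (hasDerivAt_id t))
  have hsσ : ∀ᶠ s : ℝ in 𝓝 0, |s| < σ := by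
    have : Metric.ball (0 : ℝ) σ ∈ 𝓝 0 := Metric.ball_mem_nhds 0 hσ
    filter_upwards [this] with s hs
    simpa using hs
  have hKI : IsCompact (K ×ˢ Set.Icc (-δ) δ) := hK.prod isCompact_Icc
  have e1 : ∀ᶠ s in 𝓝 (0 : ℝ), ∀ w ∈ K ×ˢ Set.Icc (-δ) δ,
      fderiv ℝ F ((s, w.1), t₀ w.1 + w.2) (0, 1) < 0 := by
    refine hKI.eventually_forall_of_forall_eventually (fun w hw => ?_)
    have hc : ContinuousAt (fun z : ℝ × (E × ℝ) =>
        fderiv ℝ F ((z.1, z.2.1), t₀ z.2.1 + z.2.2) (0, 1)) (0, w) := by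
      have h1 : ContinuousAt (fderiv ℝ F) ((0, w.1), t₀ w.1 + w.2) :=
        ((hF 0 w.1 (t₀ w.1 + w.2) (by simpa using hσ)).fderiv_right (m := 0)
          (by simp)).continuousAt
      have h2 : ContinuousAt (fun z : ℝ × (E × ℝ) => ((z.1, z.2.1), t₀ z.2.1 + z.2.2)) (0, w) :=
        Continuous.continuousAt (by fun_prop)
      exact (ContinuousAt.comp (g := fderiv ℝ F) (f := fun z : ℝ × (E × ℝ) =>
        ((z.1, z.2.1), t₀ z.2.1 + z.2.2)) h1 h2).clm_apply continuousAt_const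
    refine hc.eventually (gt_mem_nhds ?_)
    have h3 := hneg w.1 hw.1 (t₀ w.1 + w.2) (by rw [add_sub_cancel_left]; exact abs_le.2 hw.2)
    rwa [(hd 0 w.1 _ (by simpa using hσ)).deriv] at h3
  have anti : ∀ s, |s| < σ → (∀ w ∈ K ×ˢ Set.Icc (-δ) δ,
      fderiv ℝ F ((s, w.1), t₀ w.1 + w.2) (0, 1) < 0) → ∀ y ∈ K,
      StrictAntiOn (fun t => F ((s, y), t)) (Set.Icc (t₀ y - δ) (t₀ y + δ)) := by
    intro s hs h y hy
    refine strictAntiOn_of_deriv_neg (convex_Icc _ _)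
      (fun t _ => (hd s y t hs).continuousAt.continuousWithinAt) (fun t ht => ?_)
    rw [interior_Icc] at ht
    rw [(hd s y t hs).deriv]
    have := h (y, t - t₀ y) ⟨hy, by constructor <;> simp only <;> linarith [ht.1, ht.2]⟩
    simpa using this
  have h00 := anti 0 (by simpa using hσ) e1.self_of_nhds
  have e2 : ∀ᶠ s in 𝓝 (0 : ℝ), ∀ y ∈ K, F ((s, y), t₀ y + δ) < 0 ∧ 0 < F ((s, y), t₀ y - δ) := by
    refine hK.eventually_forall_of_forall_eventually (fun y hy => ?_)
    have hc : ∀ u : ℝ, ContinuousAt (fun z : ℝ × E => F ((z.1, z.2), t₀ z.2 + u)) (0, y) := by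
      intro u
      have h2 : ContinuousAt (fun z : ℝ × E => ((z.1, z.2), t₀ z.2 + u)) (0, y) :=
        Continuous.continuousAt (by fun_prop)
      exact ContinuousAt.comp (g := F) (f := fun z : ℝ × E => ((z.1, z.2), t₀ z.2 + u))
        (hF 0 y (t₀ y + u) (by simpa using hσ)).continuousAt h2
    have hm := h00 y hy
    have a1 := hm (a := t₀ y) (b := t₀ y + δ) ⟨by linarith, by linarith⟩
      ⟨by linarith, le_refl _⟩ (by linarith)
    have a2 := hm (a := t₀ y - δ) (b := t₀ y) ⟨le_refl _, by linarith⟩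
      ⟨by linarith, by linarith⟩ (by linarith)
    simp only [h0] at a1 a2
    exact ((hc δ).eventually (gt_mem_nhds a1)).and ((hc (-δ)).eventually (lt_mem_nhds a2))
  obtain ⟨ε, hε, hball⟩ := Metric.eventually_nhds_iff.1 (hsσ.and (e1.and e2))
  have hε' : ∀ s, |s| < ε → _ := fun s hs => hball (y := s) (by simpa using hs)
  have main : ∀ s y, |s| < min ε σ → (∃ t, |t - t₀ y| < δ ∧ F ((s, y), t) = 0) ∧
      StrictAntiOn (fun t => F ((s, y), t)) (Set.Icc (t₀ y - δ) (t₀ y + δ)) ∧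
      ∀ t, |t - t₀ y| ≤ δ → fderiv ℝ F ((s, y), t) (0, 1) ≠ 0 := by
    intro s y hs
    obtain ⟨hs1, hs2, hs3⟩ := hε' s (hs.trans_le (min_le_left _ _))
    obtain ⟨y', hy', ht, hFF⟩ := hper y
    have hm := anti s hs1 hs2 y' hy'
    have hfun : (fun t => F ((s, y'), t)) = fun t => F ((s, y), t) := funext fun t => hFF s t hs1
    have hb := hs3 y' hy'
    rw [hfun, ht] at hm
    rw [hFF _ _ hs1, hFF _ _ hs1, ht] at hb
    refine ⟨?_, hm, ?_⟩
    · have hcont : ContinuousOn (fun t => F ((s, y), t)) (Set.Icc (t₀ y - δ) (t₀ y + δ)) :=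
        fun t _ => (hd s y t hs1).continuousAt.continuousWithinAt
      obtain ⟨t, ht1, ht2⟩ := intermediate_value_Ioo' (by linarith) hcont
        (show (0 : ℝ) ∈ Set.Ioo _ _ from ⟨hb.1, hb.2⟩)
      exact ⟨t, abs_lt.2 ⟨by linarith [ht1.1], by linarith [ht1.2]⟩, ht2⟩
    · intro t htt
      have h1 := hs2 (y', t - t₀ y') ⟨hy', by rw [ht]; exact abs_le.1 htt⟩
      simp only [add_sub_cancel] at h1
      rw [← (hd s y' t hs1).deriv, hfun, (hd s y t hs1).deriv] at h1
      exact h1.ne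
  have hex : ∀ s y, ∃ t, |s| < min ε σ → |t - t₀ y| < δ ∧ F ((s, y), t) = 0 := by
    intro s y
    by_cases hs : |s| < min ε σ
    · obtain ⟨t, ht⟩ := (main s y hs).1
      exact ⟨t, fun _ => ht⟩
    · exact ⟨0, fun h => absurd h hs⟩
  choose T hT using hex
  have huniq : ∀ s y, |s| < min ε σ → ∀ t, |t - t₀ y| ≤ δ → F ((s, y), t) = 0 → t = T s y := by
    intro s y hs t ht hFt
    have h1 := hT s y hs
    have h2 := abs_lt.1 h1.1
    have h3 := abs_le.1 ht
    refine (main s y hs).2.1.injOn ⟨by linarith, by linarith⟩ ⟨by linarith, by linarith⟩ ?_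
    exact hFt.trans h1.2.symm
  refine ⟨min ε σ, lt_min hε hσ, min_le_right _ _, T, fun s y hs =>
    ⟨(hT s y hs).1, (hT s y hs).2, huniq s y hs, ?_⟩⟩
  have hsσ' := hs.trans_le (min_le_right _ _)
  have hFu := hF s y (T s y) hsσ'
  have hne := (main s y hs).2.2 (T s y) (hT s y hs).1.le
  have hinv : (fderiv ℝ F ((s, y), T s y) ∘L .inr ℝ (ℝ × E) ℝ).IsInvertible := by
    refine ⟨ContinuousLinearEquiv.unitsEquivAut ℝ (Units.mk0 _ hne), ?_⟩
    ext
    simp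
  have hω : (ω : WithTop ℕ∞) ≠ 0 := by simp
  have hcd := hFu.contDiffAt_implicitFunction hω hinv
  refine hcd.congr_of_eventuallyEq ?_
  have ha := hFu.eventually_apply_implicitFunction hω hinv
  have hself := hFu.implicitFunction_apply_self hω hinv
  have hc1 : ContinuousAt (fun z : ℝ × E => |hFu.implicitFunction hω hinv z - t₀ z.2|) (s, y) :=
    (hcd.continuousAt.sub (ht₀.comp continuous_snd).continuousAt).abs
  have hb : ∀ᶠ z in 𝓝 (s, y), |hFu.implicitFunction hω hinv z - t₀ z.2| < δ := by
    refine hc1.eventually (gt_mem_nhds ?_)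
    have h : hFu.implicitFunction hω hinv (s, y) = T s y := hself
    change |hFu.implicitFunction hω hinv (s, y) - t₀ y| < δ
    rw [h]
    exact (hT s y hs).1
  have hs' : ∀ᶠ z : ℝ × E in 𝓝 (s, y), |z.1| < min ε σ :=
    (continuous_fst.abs.continuousAt (x := (s, y))).eventually (gt_mem_nhds hs)
  filter_upwards [ha, hb, hs'] with z h1 h2 h3
  exact (huniq z.1 z.2 h3 _ h2.le (h1.trans (hT s y hs).2)).symm

/-! ### The equations of the representation space in a gauge -/

/-- The cross product of `ℝ³`. -/
def cross (u v : Space) : Space :=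
  (u.2.1 * v.2.2 - u.2.2 * v.2.1, u.2.2 * v.1 - u.1 * v.2.2, u.1 * v.2.1 - u.2.1 * v.1)

/-- The square of the Euclidean length. -/
def lenSq (v : Space) : ℝ := v.1 ^ 2 + v.2.1 ^ 2 + v.2.2 ^ 2

/-- The image of `h` in the gauge with coordinates `(γ, θ, ν)` and height `sin (s T)`. -/
noncomputable def holH (s : ℝ) (y : Space) (T : ℝ) : Space :=
  (Real.sin (s * T), -(Real.cos (s * T) * Real.sin y.2.2), Real.cos (s * T) * Real.cos y.2.2)

/-- The imaginary part of `b h`. -/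
noncomputable def lamP (s : ℝ) (y : Space) (T : ℝ) : Space :=
  (Real.sin y.1 * (holH s y T).2.2, -(Real.cos y.1 * (holH s y T).2.2),
    Real.cos y.1 * (holH s y T).2.1 - Real.sin y.1 * (holH s y T).1)

/-- The imaginary part of `f a⁻¹ h`. -/
noncomputable def lamQ (s : ℝ) (y : Space) (T : ℝ) : Space :=
  (Real.cos y.2.1 * (holH s y T).1 - Real.sin y.2.1 * (holH s y T).2.1,
    Real.cos y.2.1 * (holH s y T).2.1 + Real.sin y.2.1 * (holH s y T).1,
    Real.cos y.2.1 * (holH s y T).2.2)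

/-- The real part of `p`. -/
noncomputable def pRe (s : ℝ) (y : Space) (T : ℝ) : ℝ := cosSq (s ^ 2 * lenSq (lamP s y T))

/-- The quotient of the imaginary part of `p` by `s` times the imaginary part of `b h`. -/
noncomputable def pIm (s : ℝ) (y : Space) (T : ℝ) : ℝ := sincSq (s ^ 2 * lenSq (lamP s y T))

/-- The real part of `q`. -/
noncomputable def qRe (s : ℝ) (y : Space) (T : ℝ) : ℝ := cosSq (s ^ 2 * lenSq (lamQ s y T))

/-- The quotient of the imaginary part of `q` by `s` times the imaginary part of `f a⁻¹ h`. -/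
noncomputable def qIm (s : ℝ) (y : Space) (T : ℝ) : ℝ := sincSq (s ^ 2 * lenSq (lamQ s y T))

/-- The real part of `p q`. -/
noncomputable def holRe (s : ℝ) (y : Space) (T : ℝ) : ℝ :=
  pRe s y T * qRe s y T - s ^ 2 * (pIm s y T * qIm s y T) * dot (lamP s y T) (lamQ s y T)

/-- The imaginary part of `p q`, divided by `s`. -/
noncomputable def holIm (s : ℝ) (y : Space) (T : ℝ) : Space :=
  (pRe s y T * qIm s y T) • lamQ s y T + (qRe s y T * pIm s y T) • lamP s y T +
    (s * (pIm s y T * qIm s y T)) • cross (lamP s y T) (lamQ s y T)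

/-- The real part of `p q h a`, divided by `s`. -/
noncomputable def eqOne (s : ℝ) (y : Space) (T : ℝ) : ℝ :=
  -(T * sincSq (s ^ 2 * T ^ 2) * holRe s y T) -
    ((holIm s y T).2.1 * (holH s y T).2.2 - (holIm s y T).2.2 * (holH s y T).2.1)

/-- The real part of `-p q h a h`, divided by `s`. -/
noncomputable def eqTwo (s : ℝ) (y : Space) (T : ℝ) : ℝ :=
  (holIm s y T).1 * (1 - 2 * (holH s y T).1 ^ 2) -
    2 * (holH s y T).1 * ((holIm s y T).2.1 * (holH s y T).2.1 +
      (holIm s y T).2.2 * (holH s y T).2.2)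

section ContDiff

variable {E : Type*} [NormedAddCommGroup E] [NormedSpace ℝ E] {n : WithTop ℕ∞}
  {s : E → ℝ} {y : E → Space} {T : E → ℝ}

@[fun_prop] theorem contDiff_holH (hs : ContDiff ℝ n s) (hy : ContDiff ℝ n y)
    (hT : ContDiff ℝ n T) : ContDiff ℝ n fun x => holH (s x) (y x) (T x) := by
  unfold holH
  fun_prop

@[fun_prop] theorem contDiff_lamP (hs : ContDiff ℝ n s) (hy : ContDiff ℝ n y)
    (hT : ContDiff ℝ n T) : ContDiff ℝ n fun x => lamP (s x) (y x) (T x) := by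
  unfold lamP
  fun_prop

@[fun_prop] theorem contDiff_lamQ (hs : ContDiff ℝ n s) (hy : ContDiff ℝ n y)
    (hT : ContDiff ℝ n T) : ContDiff ℝ n fun x => lamQ (s x) (y x) (T x) := by
  unfold lamQ
  fun_prop

@[fun_prop] theorem contDiff_pRe (hs : ContDiff ℝ n s) (hy : ContDiff ℝ n y)
    (hT : ContDiff ℝ n T) : ContDiff ℝ n fun x => pRe (s x) (y x) (T x) := by
  unfold pRe lenSq
  fun_prop

@[fun_prop] theorem contDiff_pIm (hs : ContDiff ℝ n s) (hy : ContDiff ℝ n y)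
    (hT : ContDiff ℝ n T) : ContDiff ℝ n fun x => pIm (s x) (y x) (T x) := by
  unfold pIm lenSq
  fun_prop

@[fun_prop] theorem contDiff_qRe (hs : ContDiff ℝ n s) (hy : ContDiff ℝ n y)
    (hT : ContDiff ℝ n T) : ContDiff ℝ n fun x => qRe (s x) (y x) (T x) := by
  unfold qRe lenSq
  fun_prop

@[fun_prop] theorem contDiff_qIm (hs : ContDiff ℝ n s) (hy : ContDiff ℝ n y)
    (hT : ContDiff ℝ n T) : ContDiff ℝ n fun x => qIm (s x) (y x) (T x) := by
  unfold qIm lenSq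
  fun_prop

@[fun_prop] theorem contDiff_holRe (hs : ContDiff ℝ n s) (hy : ContDiff ℝ n y)
    (hT : ContDiff ℝ n T) : ContDiff ℝ n fun x => holRe (s x) (y x) (T x) := by
  simp only [holRe, dot_apply]
  fun_prop

@[fun_prop] theorem contDiff_eqOne (hs : ContDiff ℝ n s) (hy : ContDiff ℝ n y)
    (hT : ContDiff ℝ n T) : ContDiff ℝ n fun x => eqOne (s x) (y x) (T x) := by
  unfold eqOne
  fun_prop

@[fun_prop] theorem contDiff_eqTwo (hs : ContDiff ℝ n s) (hy : ContDiff ℝ n y)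
    (hT : ContDiff ℝ n T) : ContDiff ℝ n fun x => eqTwo (s x) (y x) (T x) := by
  unfold eqTwo
  fun_prop

end ContDiff

theorem eqOne_zero (y : Space) (T : ℝ) : eqOne 0 y T = Real.cos y.1 - T := by
  simp [eqOne, holRe, holIm, pRe, qRe, pIm, qIm, lamP, lamQ, holH]
  linear_combination Real.cos y.1 * Real.sin_sq_add_cos_sq y.2.2

theorem eqTwo_zero (y : Space) (T : ℝ) : eqTwo 0 y T = surfaceFun y := by
  simp [eqTwo, holIm, pRe, qRe, pIm, qIm, lamP, lamQ, holH, surfaceFun]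

/-- The reflection in the first axis, if `σ` is `false`. -/
noncomputable def axisSign (σ : Bool) (v : Space) : Space :=
  (v.1, boolSign σ * v.2.1, boolSign σ * v.2.2)

theorem holH_deck (s : ℝ) (σ : Bool) (m n l : ℤ) (y : Space) (T : ℝ) :
    holH s (deck σ m n l y) T = axisSign σ (holH s y T) := by
  simp only [holH, axisSign, sin_deck_trd, cos_deck_trd]
  refine Prod.ext rfl (Prod.ext ?_ ?_) <;> ring

theorem lamP_deck (s : ℝ) (σ : Bool) (m n l : ℤ) (y : Space) (T : ℝ) :
    lamP s (deck σ m n l y) T = axisSign σ (lamP s y T) := by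
  simp only [lamP, holH_deck, axisSign, sin_deck_fst, cos_deck_fst]
  refine Prod.ext ?_ (Prod.ext ?_ ?_)
  · linear_combination (Real.sin y.1 * (holH s y T).2.2) * boolSign_sq σ
  · ring
  · ring

theorem lamQ_deck (s : ℝ) (σ : Bool) (m n l : ℤ) (y : Space) (T : ℝ) :
    lamQ s (deck σ m n l y) T = axisSign σ (lamQ s y T) := by
  simp only [lamQ, holH_deck, axisSign, sin_deck_snd, cos_deck_snd]
  refine Prod.ext ?_ (Prod.ext ?_ ?_)
  · linear_combination (-Real.sin y.2.1 * (holH s y T).2.1) * boolSign_sq σ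
  · ring
  · ring

theorem lenSq_axisSign (σ : Bool) (v : Space) : lenSq (axisSign σ v) = lenSq v := by
  simp only [lenSq, axisSign]
  linear_combination (v.2.1 ^ 2 + v.2.2 ^ 2) * boolSign_sq σ

theorem holRe_deck (s : ℝ) (σ : Bool) (m n l : ℤ) (y : Space) (T : ℝ) :
    holRe s (deck σ m n l y) T = holRe s y T := by
  simp only [holRe, pRe, qRe, pIm, qIm, lamP_deck, lamQ_deck, lenSq_axisSign, dot_apply]
  generalize lamP s y T = u
  generalize lamQ s y T = v
  simp only [axisSign]
  linear_combination (-s ^ 2 * (sincSq (s ^ 2 * lenSq u) * sincSq (s ^ 2 * lenSq v)) *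
    (u.2.1 * v.2.1 + u.2.2 * v.2.2)) * boolSign_sq σ

theorem holIm_deck (s : ℝ) (σ : Bool) (m n l : ℤ) (y : Space) (T : ℝ) :
    holIm s (deck σ m n l y) T = axisSign σ (holIm s y T) := by
  simp only [holIm, pRe, qRe, pIm, qIm, lamP_deck, lamQ_deck, lenSq_axisSign]
  generalize lamP s y T = u
  generalize lamQ s y T = v
  simp only [axisSign, cross, Prod.smul_mk, Prod.mk_add_mk, smul_eq_mul, Prod.smul_fst,
    Prod.smul_snd, Prod.fst_add, Prod.snd_add]
  refine Prod.ext ?_ (Prod.ext ?_ ?_)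
  · linear_combination (s * (sincSq (s ^ 2 * lenSq u) * sincSq (s ^ 2 * lenSq v)) *
      (u.2.1 * v.2.2 - u.2.2 * v.2.1)) * boolSign_sq σ
  · ring
  · ring

theorem eqOne_deck (s : ℝ) (σ : Bool) (m n l : ℤ) (y : Space) (T : ℝ) :
    eqOne s (deck σ m n l y) T = eqOne s y T := by
  simp only [eqOne, holRe_deck, holIm_deck, holH_deck, axisSign]
  linear_combination (-((holIm s y T).2.1 * (holH s y T).2.2 -
    (holIm s y T).2.2 * (holH s y T).2.1)) * boolSign_sq σ

theorem eqTwo_deck (s : ℝ) (σ : Bool) (m n l : ℤ) (y : Space) (T : ℝ) :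
    eqTwo s (deck σ m n l y) T = eqTwo s y T := by
  simp only [eqTwo, holIm_deck, holH_deck, axisSign]
  linear_combination (-2 * (holH s y T).1 * ((holIm s y T).2.1 * (holH s y T).2.1 +
      (holIm s y T).2.2 * (holH s y T).2.2)) * boolSign_sq σ

/-! ### Straightening the family of surfaces -/

/-- A fundamental cube of the translations in the deck group. -/
def cube : Set Space :=
  Set.Icc 0 (2 * Real.pi) ×ˢ (Set.Icc 0 (2 * Real.pi) ×ˢ Set.Icc 0 (2 * Real.pi))

theorem isCompact_cube : IsCompact cube := isCompact_Icc.prod (isCompact_Icc.prod isCompact_Icc)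

theorem exists_deck_mem_cube (y : Space) : ∃ m n l, deck true m n l y ∈ cube := by
  have h : ∀ x : ℝ, ∃ m : ℤ, x + 2 * Real.pi * m ∈ Set.Icc 0 (2 * Real.pi) := by
    intro x
    obtain ⟨m, hm, -⟩ := existsUnique_add_zsmul_mem_Ico Real.two_pi_pos x 0
    refine ⟨m, Set.Ico_subset_Icc_self ?_⟩
    rw [zero_add, zsmul_eq_mul] at hm
    rwa [mul_comm (2 * Real.pi)]
  obtain ⟨m, hm⟩ := h y.1
  obtain ⟨n, hn⟩ := h y.2.1
  obtain ⟨l, hl⟩ := h y.2.2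
  exact ⟨m, n, l, by simpa [deck, boolSign] using hm, by simpa [deck, boolSign] using hn,
    by simpa [deck, boolSign] using hl⟩

theorem exists_heightFunction : ∃ ε, 0 < ε ∧ ε ≤ 1 ∧ ∃ T : ℝ → Space → ℝ, ∀ s y, |s| < ε →
    |T s y - Real.cos y.1| < 5 ∧ eqOne s y (T s y) = 0 ∧
    (∀ t, |t - Real.cos y.1| ≤ 5 → eqOne s y t = 0 → t = T s y) ∧
    ContDiffAt ℝ ω (fun z : ℝ × Space => T z.1 z.2) (s, y) := by
  refine exists_implicit_family (F := fun z => eqOne z.1.1 z.1.2 z.2) (σ := 1) one_pos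
    (fun s y t _ => ContDiff.contDiffAt (by fun_prop)) (t₀ := fun y => Real.cos y.1)
    (by fun_prop) (δ := 5) (by norm_num) isCompact_cube (fun y => ?_) (fun y => ?_)
    (fun y _ t _ => ?_)
  · obtain ⟨m, n, l, h⟩ := exists_deck_mem_cube y
    exact ⟨_, h, cos_deck_fst _ _ _ _ _, fun s t _ => eqOne_deck _ _ _ _ _ _ _⟩
  · simp [eqOne_zero]
  · simp [eqOne_zero]

theorem deck_add (σ : Bool) (m n l : ℤ) (y v : Space) :
    deck σ m n l (y + v) = deck σ m n l y + deckLinear σ v := by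
  simp only [deck, deckLinear, Prod.mk_add_mk, Prod.fst_add, Prod.snd_add]
  refine Prod.ext ?_ (Prod.ext ?_ ?_) <;> simp only <;> ring

theorem deckLinear_smul (σ : Bool) (t : ℝ) (v : Space) :
    deckLinear σ (t • v) = t • deckLinear σ v := by
  simp only [deckLinear, Prod.smul_mk, smul_eq_mul, Prod.smul_fst, Prod.smul_snd]
  refine Prod.ext ?_ (Prod.ext ?_ ?_) <;> simp only <;> ring

theorem exists_normal_radius : ∃ δ : ℝ, 0 < δ ∧ δ < 1 / 2 ∧ ∀ y ∈ cube, ∀ t : ℝ, |t| ≤ δ →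
    0 < dot (surfaceGrad (y + t • surfaceGrad y)) (surfaceGrad y) + surfaceFun y ^ 2 := by
  have h : ∀ᶠ t in 𝓝 (0 : ℝ), ∀ y ∈ cube,
      0 < dot (surfaceGrad (y + t • surfaceGrad y)) (surfaceGrad y) + surfaceFun y ^ 2 := by
    refine isCompact_cube.eventually_forall_of_forall_eventually (fun y _ => ?_)
    have hg : Continuous surfaceGrad := (contDiff_surfaceGrad (n := 0)).continuous
    have hf : Continuous surfaceFun := (contDiff_surfaceFun (n := 0)).continuous
    have hc : Continuous fun z : ℝ × Space => dot (surfaceGrad (z.2 + z.1 • surfaceGrad z.2))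
        (surfaceGrad z.2) + surfaceFun z.2 ^ 2 := by
      simp only [dot_apply]
      fun_prop
    refine hc.continuousAt.eventually (lt_mem_nhds ?_)
    simpa using surfaceGrad_regular y
  obtain ⟨δ, hδ, hb⟩ := Metric.eventually_nhds_iff.1 h
  refine ⟨min (δ / 2) (1 / 4), by positivity, (min_le_right _ _).trans_lt (by norm_num),
    fun y hy t ht => hb ?_ y hy⟩
  rw [Real.dist_eq, sub_zero]
  exact ht.trans_lt ((min_le_left _ _).trans_lt (by linarith))

theorem abs_surfaceFun_le (y : Space) : |surfaceFun y| ≤ 2 := by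
  rw [surfaceFun]
  have h := fun a b : ℝ => abs_le.1 (Real.abs_sin_le_one a)
  refine (abs_add_le _ _).trans ?_
  rw [abs_mul, abs_mul]
  have h1 := Real.abs_sin_le_one y.1
  have h2 := Real.abs_sin_le_one y.2.1
  have h3 := Real.abs_sin_le_one y.2.2
  have h4 := Real.abs_cos_le_one y.2.2
  have := mul_le_one₀ h2 (abs_nonneg _) h3
  have := mul_le_one₀ h1 (abs_nonneg _) h4
  linarith

/-- A family of functions that are small perturbations of the equation of the surface and are
invariant under the deck group can be straightened. -/
theorem exists_straightening {G : ℝ → Space → ℝ} {σ : ℝ} (hσ : 0 < σ)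
    (hG : ∀ s y, |s| < σ → ContDiffAt ℝ ω (fun z : ℝ × Space => G z.1 z.2) (s, y))
    (hG0 : ∀ y, G 0 y = surfaceFun y)
    (hdeck : ∀ s τ m n l y, |s| < σ → G s (deck τ m n l y) = G s y) :
    ∃ ε, 0 < ε ∧ ε ≤ σ ∧ ∀ s, |s| < ε → ∃ Ψ : Space ≃ₜ Space,
      ContDiff ℝ ω Ψ ∧ ContDiff ℝ ω Ψ.symm ∧
      (∀ τ m n l y, Ψ (deck τ m n l y) = deck τ m n l (Ψ y)) ∧
      ∀ y, Ψ y ∈ coverSurface ↔ G s y = 0 := by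
  obtain ⟨δ, hδ, hδ', hreg⟩ := exists_normal_radius
  have hN : ∀ {k}, ContDiff ℝ k surfaceGrad := contDiff_surfaceGrad
  have hS : ∀ {k}, ContDiff ℝ k surfaceFun := contDiff_surfaceFun
  obtain ⟨ε, hε, hεσ, L, hL⟩ := exists_implicit_family
    (F := fun z => (1 - z.2 * surfaceFun z.1.2) * G z.1.1 z.1.2 -
      surfaceFun (z.1.2 + z.2 • surfaceGrad z.1.2)) hσ (t₀ := fun _ => 0) (δ := δ)
    (by
      intro s y t hs
      have h1 : ContDiffAt ℝ ω (fun z : (ℝ × Space) × ℝ => G z.1.1 z.1.2) ((s, y), t) :=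
        ContDiffAt.comp (g := fun z : ℝ × Space => G z.1 z.2) ((s, y), t) (hG s y hs) contDiffAt_fst
      have h2 : ContDiff ℝ ω fun z : (ℝ × Space) × ℝ => 1 - z.2 * surfaceFun z.1.2 := by
        fun_prop
      have h3 : ContDiff ℝ ω fun z : (ℝ × Space) × ℝ =>
          surfaceFun (z.1.2 + z.2 • surfaceGrad z.1.2) := by
        fun_prop
      exact (h2.contDiffAt.mul h1).sub h3.contDiffAt)
    continuous_const hδ isCompact_cube
    (by
      intro y
      obtain ⟨m, n, l, h⟩ := exists_deck_mem_cube y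
      refine ⟨_, h, rfl, fun s t hs => ?_⟩
      simp only [hdeck s _ _ _ _ _ hs, surfaceGrad_deck, surfaceFun_deck, ← deckLinear_smul,
        ← deck_add])
    (by
      intro y
      simp [hG0])
    (by
      intro y hy t ht
      rw [sub_zero] at ht
      have h1 : HasDerivAt (fun t : ℝ => y + t • surfaceGrad y) (surfaceGrad y) t := by
        simpa using ((hasDerivAt_id t).smul_const (surfaceGrad y)).const_add y
      have h2 := (hasFDerivAt_surfaceFun (y + t • surfaceGrad y)).comp_hasDerivAt t h1
      have h3 : HasDerivAt (fun t : ℝ => (1 - t * surfaceFun y) * surfaceFun y)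
          (-(surfaceFun y) * surfaceFun y) t := by
        simpa using (((hasDerivAt_id t).mul_const (surfaceFun y)).const_sub 1).mul_const
          (surfaceFun y)
      have h4 := (h3.sub h2).deriv
      simp only [hG0]
      refine (lt_of_eq_of_lt h4 ?_)
      linarith [hreg y hy t ht])
  have hL0 : ∀ y, L 0 y = 0 := fun y =>
    ((hL 0 y (by simpa using hε)).2.2.1 0 (by simpa using hδ.le) (by simp [hG0])).symm
  have hLdeck : ∀ s τ m n l y, |s| < ε → L s (deck τ m n l y) = L s y := by
    intro s τ m n l y hs
    obtain ⟨h1, h2, -⟩ := hL s (deck τ m n l y) hs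
    refine (hL s y hs).2.2.1 _ h1.le ?_
    simpa only [hdeck s _ _ _ _ _ (hs.trans_le hεσ), surfaceGrad_deck, surfaceFun_deck,
      ← deckLinear_smul, ← deck_add] using h2
  have hM : ∀ s y, |s| < ε →
      ContDiffAt ℝ ω (fun z : ℝ × Space => L z.1 z.2 • surfaceGrad z.2) (s, y) :=
    fun s y hs => (hL s y hs).2.2.2.smul (hN.comp contDiff_snd).contDiffAt
  have hMd : ∀ s y, |s| < ε → HasFDerivAt (fun y => L s y • surfaceGrad y)
      ((fderiv ℝ (fun z : ℝ × Space => L z.1 z.2 • surfaceGrad z.2) (s, y)).comp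
        (ContinuousLinearMap.inr ℝ ℝ Space)) y := by
    intro s y hs
    have h1 := ((hM s y hs).differentiableAt (by simp)).hasFDerivAt
    exact HasFDerivAt.comp (g := fun z : ℝ × Space => L z.1 z.2 • surfaceGrad z.2) y h1
      (hasFDerivAt_prodMk_right s y)
  have e1 : ∀ᶠ s in 𝓝 (0 : ℝ), ∀ y ∈ cube,
      ‖(fderiv ℝ (fun z : ℝ × Space => L z.1 z.2 • surfaceGrad z.2) (s, y)).comp
        (ContinuousLinearMap.inr ℝ ℝ Space)‖ < 1 / 2 := by
    refine isCompact_cube.eventually_forall_of_forall_eventually (fun y _ => ?_)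
    have hc : ContinuousAt (fun w : ℝ × Space =>
        ‖(fderiv ℝ (fun z : ℝ × Space => L z.1 z.2 • surfaceGrad z.2) w).comp
          (ContinuousLinearMap.inr ℝ ℝ Space)‖) (0, y) :=
      ((((hM 0 y (by simpa using hε)).fderiv_right (m := 0) (by simp)).continuousAt).clm_comp
        continuousAt_const).norm
    refine hc.eventually (gt_mem_nhds ?_)
    have h1 := hMd 0 y (by simpa using hε)
    simp only [hL0, zero_smul] at h1
    have h2 := h1.unique (hasFDerivAt_const (0 : Space) y)
    simp only [h2, norm_zero]
    norm_num
  obtain ⟨ε', hε', hball⟩ := Metric.eventually_nhds_iff.1 e1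
  refine ⟨min ε ε', lt_min hε hε', (min_le_left _ _).trans hεσ, fun s hs => ?_⟩
  have hsε := hs.trans_le (min_le_left _ _)
  have hbd : ∀ y, ‖fderiv ℝ (fun y => L s y • surfaceGrad y) y‖ ≤ 1 / 2 := by
    intro y
    obtain ⟨m, n, l, hy⟩ := exists_deck_mem_cube y
    have h1 := hMd s (deck true m n l y) hsε
    have h2 := h1.comp y (hasFDerivAt_deck true m n l y)
    have h3 : ((fun y => L s y • surfaceGrad y) ∘ deck true m n l) =
        fun y => L s y • surfaceGrad y := by
      funext y
      simp only [Function.comp_apply, hLdeck s _ _ _ _ _ hsε, surfaceGrad_deck]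
      simp [deckLinear, boolSign]
    have h4 : deckLinearMap true = ContinuousLinearMap.id ℝ Space := by
      ext <;> simp [deckLinearMap, boolSign]
    rw [h3, h4, ContinuousLinearMap.comp_id] at h2
    rw [h2.fderiv]
    exact (hball (y := s) (by simpa using hs.trans_le (min_le_right _ _)) _ hy).le
  have hdiff : Differentiable ℝ fun y => L s y • surfaceGrad y :=
    fun y => (hMd s y hsε).differentiableAt
  have hlip : LipschitzWith (1 / 2) fun y => L s y • surfaceGrad y :=
    lipschitzWith_of_nnnorm_fderiv_le hdiff fun y => by exact_mod_cast hbd y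
  have happ : ApproximatesLinearOn (fun y => y + L s y • surfaceGrad y)
      (ContinuousLinearEquiv.refl ℝ Space : Space →L[ℝ] Space) Set.univ (1 / 2) := by
    intro x _ y _
    have h1 := hlip.norm_sub_le x y
    convert! h1 using 2
    simp
    abel
  have hc : Subsingleton Space ∨ (1 / 2 : NNReal) <
      ‖((ContinuousLinearEquiv.refl ℝ Space).symm : Space →L[ℝ] Space)‖₊⁻¹ := by
    right
    have : ((ContinuousLinearEquiv.refl ℝ Space).symm : Space →L[ℝ] Space) =
        ContinuousLinearMap.id ℝ Space := rfl
    rw [this, ContinuousLinearMap.nnnorm_id, inv_one]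
    exact half_lt_self one_pos
  have hcd : ContDiff ℝ ω fun y => y + L s y • surfaceGrad y := by
    refine contDiff_id.add (contDiff_iff_contDiffAt.2 fun y => ?_)
    exact ContDiffAt.comp (g := fun z : ℝ × Space => L z.1 z.2 • surfaceGrad z.2) y (hM s y hsε)
      (contDiff_prodMk_right s).contDiffAt
  refine ⟨happ.toHomeomorph _ hc, hcd, ?_, fun τ m n l y => ?_, fun y => ?_⟩
  · have hinj : ∀ y, Function.Injective
        (ContinuousLinearMap.id ℝ Space + fderiv ℝ (fun y => L s y • surfaceGrad y) y) := by
      intro y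
      rw [injective_iff_map_eq_zero]
      intro v hv
      have h1 : fderiv ℝ (fun y => L s y • surfaceGrad y) y v = -v :=
        eq_neg_of_add_eq_zero_right hv
      have h2 := (fderiv ℝ (fun y => L s y • surfaceGrad y) y).le_opNorm v
      rw [h1, norm_neg] at h2
      have h3 := mul_le_mul_of_nonneg_right (hbd y) (norm_nonneg v)
      exact norm_le_zero_iff.1 (by linarith)
    refine Homeomorph.contDiff_symm _ (f₀' := fun y => (LinearEquiv.ofInjectiveEndo
      ((ContinuousLinearMap.id ℝ Space + fderiv ℝ (fun y => L s y • surfaceGrad y) y :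
        Space →L[ℝ] Space) : Space →ₗ[ℝ] Space) (hinj y)).toContinuousLinearEquiv) (fun y => ?_) hcd
    exact ((hasFDerivAt_id y).add (hdiff y).hasFDerivAt)
  · change deck τ m n l y + L s (deck τ m n l y) • surfaceGrad (deck τ m n l y) =
      deck τ m n l (y + L s y • surfaceGrad y)
    rw [deck_add, hLdeck s _ _ _ _ _ hsε, surfaceGrad_deck, deckLinear_smul]
  · obtain ⟨h1, h2, -⟩ := hL s y hsε
    change surfaceFun (y + L s y • surfaceGrad y) = 0 ↔ _
    rw [← sub_eq_zero.1 h2]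
    have h3 : L s y * surfaceFun y < 1 := by
      refine (le_abs_self _).trans_lt ?_
      rw [abs_mul]
      rw [sub_zero] at h1
      have := abs_surfaceFun_le y
      nlinarith [abs_nonneg (surfaceFun y), abs_nonneg (L s y)]
    rw [mul_eq_zero, or_iff_right (by linarith)]

/-- The solutions of the equations of the representation space for a fixed small parameter `s`:
`T` is the height of `h`, and `Ψ` straightens the surface of solutions. -/
structure IsStraightening (s : ℝ) (T : Space → ℝ) (Ψ : Space ≃ₜ Space) : Prop where
  eqOne_eq_zero : ∀ y, eqOne s y (T y) = 0
  height_lt : ∀ y, |T y| < 6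
  height_unique : ∀ y t, |t| ≤ 4 → eqOne s y t = 0 → t = T y
  contDiff_height : ContDiff ℝ ω T
  contDiff : ContDiff ℝ ω Ψ
  contDiff_symm : ContDiff ℝ ω Ψ.symm
  deck : ∀ σ m n l y, Ψ (deck σ m n l y) = Earring.deck σ m n l (Ψ y)
  height_deck : ∀ σ m n l y, T (Earring.deck σ m n l y) = T y
  mem_iff : ∀ y, Ψ y ∈ coverSurface ↔ eqTwo s y (T y) = 0

theorem contDiff_uncurried_eqTwo :
    ContDiff ℝ ω fun w : (ℝ × Space) × ℝ => eqTwo w.1.1 w.1.2 w.2 := by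
  fun_prop

attribute [irreducible] eqOne eqTwo

theorem exists_isStraightening : ∃ ε, 0 < ε ∧ ε ≤ 1 ∧ ∃ T : ℝ → Space → ℝ,
    (∀ s y, |s| < ε → ContDiffAt ℝ ω (fun z : ℝ × Space => T z.1 z.2) (s, y)) ∧
    (∀ y, T 0 y = Real.cos y.1) ∧
    ∀ s, |s| < ε → ∃ Ψ : Space ≃ₜ Space, IsStraightening s (T s) Ψ := by
  obtain ⟨ε, hε, hε1, T, hT⟩ := exists_heightFunction
  have hTdeck : ∀ s σ m n l y, |s| < ε → T s (deck σ m n l y) = T s y := by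
    intro s σ m n l y hs
    obtain ⟨h1, h2, -⟩ := hT s (deck σ m n l y) hs
    rw [cos_deck_fst] at h1
    rw [eqOne_deck] at h2
    exact (hT s y hs).2.2.1 _ h1.le h2
  have hT0 : ∀ y, T 0 y = Real.cos y.1 := fun y =>
    ((hT 0 y (by simpa using hε)).2.2.1 _ (by simp) (by rw [eqOne_zero, sub_self])).symm
  obtain ⟨ε', hε', hεε, hΨ⟩ := exists_straightening (G := fun s y => eqTwo s y (T s y)) hε
    (fun s y hs => by
      exact ContDiffAt.comp (g := fun w : (ℝ × Space) × ℝ => eqTwo w.1.1 w.1.2 w.2) (s, y)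
        contDiff_uncurried_eqTwo.contDiffAt (contDiffAt_id.prodMk (hT s y hs).2.2.2))
    (fun y => eqTwo_zero _ _)
    (fun s τ m n l y hs => by rw [hTdeck s _ _ _ _ _ hs, eqTwo_deck])
  refine ⟨ε', hε', hεε.trans hε1, T, fun s y hs => (hT s y (hs.trans_le hεε)).2.2.2, hT0,
    fun s hs => ?_⟩
  obtain ⟨Ψ, h1, h2, h3, h4⟩ := hΨ s hs
  have hs' := hs.trans_le hεε
  refine ⟨Ψ, fun y => (hT s y hs').2.1, fun y => ?_, fun y t ht h => ?_, ?_, h1, h2, h3,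
    fun σ m n l y => hTdeck s σ m n l y hs', h4⟩
  · have h5 := abs_lt.1 (hT s y hs').1
    have h6 := abs_le.1 (Real.abs_cos_le_one y.1)
    exact abs_lt.2 ⟨by linarith, by linarith⟩
  · refine (hT s y hs').2.2.1 t ?_ h
    have h5 := abs_le.1 ht
    have h6 := abs_le.1 (Real.abs_cos_le_one y.1)
    exact abs_le.2 ⟨by linarith, by linarith⟩
  · exact contDiff_iff_contDiffAt.2 fun y =>
      ContDiffAt.comp (g := fun z : ℝ × Space => T z.1 z.2) y (hT s y hs').2.2.2
        (contDiff_prodMk_right s).contDiffAt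

/-! ### Perturbed traceless representations -/

section Group

variable {G : Type*} [Group G] {a b e f p q h w : G}

theorem relation_conj_p (hp : p * (b * h) = b * h * p) : p⁻¹ * b = b * h * p⁻¹ * h⁻¹ := by
  rw [inv_mul_eq_iff_eq_mul, show p * (b * h * p⁻¹ * h⁻¹) = p * (b * h) * p⁻¹ * h⁻¹ by group, hp]
  group

theorem relation_conj_q (hq : q * (f * a⁻¹ * h) = f * a⁻¹ * h * q) :
    f⁻¹ * q * f = a⁻¹ * h * q * h⁻¹ * a := by
  have h1 : q = f * a⁻¹ * h * q * (f * a⁻¹ * h)⁻¹ := by rw [← hq, mul_inv_cancel_right]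
  have h2 : f⁻¹ * q * f = f⁻¹ * (f * a⁻¹ * h * q * (f * a⁻¹ * h)⁻¹) * f := by rw [← h1]
  rw [h2]
  group

/-- The relation of the inner sphere, in terms of `p q h⁻¹ a`. -/
theorem inner_relation_iff (he : b * a = e * f) (hp : p * (b * h) = b * h * p)
    (hq : q * (f * a⁻¹ * h) = f * a⁻¹ * h * q) :
    q⁻¹ * p⁻¹ * b * p * q * (h⁻¹ * a * w * h) = q⁻¹ * e * q * f ↔
      h⁻¹ * (p * q * h⁻¹ * a) * w * h = p * q * h⁻¹ * a := by
  have h1 : q⁻¹ * p⁻¹ * b * p * q * (h⁻¹ * a * w * h) =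
      q⁻¹ * b * h * p⁻¹ * (h⁻¹ * (p * q * h⁻¹ * a) * w * h) := by
    rw [show q⁻¹ * p⁻¹ * b * p * q * (h⁻¹ * a * w * h) =
      q⁻¹ * (p⁻¹ * b) * (p * q * (h⁻¹ * a * w * h)) by group, relation_conj_p hp]
    group
  have h2 : q⁻¹ * e * q * f = q⁻¹ * b * h * p⁻¹ * (p * q * h⁻¹ * a) := by
    rw [show q⁻¹ * e * q * f = q⁻¹ * (e * f) * (f⁻¹ * q * f) by group, relation_conj_q hq, ← he]
    group
  rw [h1, h2, mul_right_inj]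

/-- The relation of the earring, in terms of `p q h⁻¹ a`. -/
theorem earring_relation_iff (hp : p * (b * h) = b * h * p)
    (hq : q * (f * a⁻¹ * h) = f * a⁻¹ * h * q) :
    ⁅f⁻¹ * q⁻¹ * f * a⁻¹ * b⁻¹ * p⁻¹ * b, h⁆ = w ↔
      h⁻¹ * (p * q * h⁻¹ * a) * w * h = p * q * h⁻¹ * a := by
  have h1 : f⁻¹ * q⁻¹ * f * a⁻¹ * b⁻¹ * p⁻¹ * b = (p * q * h⁻¹ * a)⁻¹ * h⁻¹ := by
    rw [show f⁻¹ * q⁻¹ * f * a⁻¹ * b⁻¹ * p⁻¹ * b =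
      (f⁻¹ * q * f)⁻¹ * a⁻¹ * b⁻¹ * (p⁻¹ * b) by group, relation_conj_p hp, relation_conj_q hq]
    group
  rw [h1]
  generalize p * q * h⁻¹ * a = v
  rw [commutatorElement_def, mul_inv_eq_iff_eq_mul,
    show v⁻¹ * h⁻¹ * h * (v⁻¹ * h⁻¹)⁻¹ = v⁻¹ * (h * v) by group, inv_mul_eq_iff_eq_mul,
    show h⁻¹ * v * w * h = h⁻¹ * (v * (w * h)) by group, inv_mul_eq_iff_eq_mul, eq_comm]

end Group

/-- The image of a generator. -/
noncomputable def gen {s : ℝ} (ρ : PertRep s) (x : Gen) : SU2 := ρ.1 (elt (word x))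

theorem evalGen_apply {s : ℝ} (ρ : PertRep s) (x : Gen) : evalGen s ρ x = gen ρ x := rfl

theorem map_lamP {s : ℝ} (ρ : PertRep s) : ρ.1 (elt wordLamP) = gen ρ .b * gen ρ .h := by
  simp only [wordLamP, elt, map_mul, gen]

theorem map_lamQ {s : ℝ} (ρ : PertRep s) :
    ρ.1 (elt wordLamQ) = gen ρ .f * (gen ρ .a)⁻¹ * gen ρ .h := by
  simp only [wordLamQ, elt, map_mul, map_inv, gen]

theorem gen_p {s : ℝ} (ρ : PertRep s) :
    (gen ρ .p : ℍ[ℝ]) = NormedSpace.exp (s • ((gen ρ .b * gen ρ .h : SU2) : ℍ[ℝ]).im) := by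
  rw [← map_lamP]
  exact ρ.2.p_pert

theorem gen_q {s : ℝ} (ρ : PertRep s) : (gen ρ .q : ℍ[ℝ]) =
    NormedSpace.exp (s • ((gen ρ .f * (gen ρ .a)⁻¹ * gen ρ .h : SU2) : ℍ[ℝ]).im) := by
  rw [← map_lamQ]
  exact ρ.2.q_pert

theorem gen_outer {s : ℝ} (ρ : PertRep s) :
    gen ρ .b * gen ρ .a = gen ρ .e * gen ρ .f := by
  simp only [gen]
  rw [← map_mul, ← map_mul, ← map_mul, ← map_mul]
  congr 1
  exact elt_eq_of_mem (by simp [relators])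

theorem gen_inner {s : ℝ} (ρ : PertRep s) :
    (gen ρ .q)⁻¹ * (gen ρ .p)⁻¹ * gen ρ .b * gen ρ .p * gen ρ .q *
      ((gen ρ .h)⁻¹ * gen ρ .a * gen ρ .w * gen ρ .h) =
      (gen ρ .q)⁻¹ * gen ρ .e * gen ρ .q * gen ρ .f := by
  have h : elt (wordC * wordD) = elt (wordG * word .f) := elt_eq_of_mem (by simp [relators])
  have h1 := congrArg ρ.1 h
  simp only [wordC, wordD, wordG, elt, map_mul, map_inv] at h1
  exact h1

theorem gen_comm_p {s : ℝ} (ρ : PertRep s) :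
    gen ρ .p * (gen ρ .b * gen ρ .h) = gen ρ .b * gen ρ .h * gen ρ .p := by
  have h : elt ⁅word .p, wordLamP⁆ = 1 := PresentedGroup.one_of_mem (by simp [relators])
  have h1 := congrArg ρ.1 h
  simp only [elt, map_commutatorElement, map_one, commutatorElement_eq_one_iff_mul_comm] at h1
  rwa [← map_lamP]

theorem gen_comm_q {s : ℝ} (ρ : PertRep s) :
    gen ρ .q * (gen ρ .f * (gen ρ .a)⁻¹ * gen ρ .h) =
      gen ρ .f * (gen ρ .a)⁻¹ * gen ρ .h * gen ρ .q := by
  have h : elt ⁅word .q, wordLamQ⁆ = 1 := PresentedGroup.one_of_mem (by simp [relators])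
  have h1 := congrArg ρ.1 h
  simp only [elt, map_commutatorElement, map_one, commutatorElement_eq_one_iff_mul_comm] at h1
  rwa [← map_lamQ]

/-- A representation is determined by the images of `a`, `b`, `f` and `h`. -/
theorem PertRep.ext_gen {s : ℝ} {ρ σ : PertRep s} (ha : gen ρ .a = gen σ .a)
    (hb : gen ρ .b = gen σ .b) (hf : gen ρ .f = gen σ .f) (hh : gen ρ .h = gen σ .h) : ρ = σ := by
  refine Subtype.ext (PresentedGroup.ext fun x => ?_)
  change gen ρ x = gen σ x
  cases x
  · exact Subtype.ext (ρ.2.w2.trans σ.2.w2.symm)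
  · exact ha
  · exact hb
  · have h1 := gen_outer ρ
    have h2 := gen_outer σ
    rw [ha, hb, hf, h2] at h1
    exact (mul_right_cancel h1).symm
  · exact hf
  · refine Subtype.ext ?_
    rw [gen_p, gen_p, hb, hh]
  · refine Subtype.ext ?_
    rw [gen_q, gen_q, hf, ha, hh]
  · exact hh

theorem SU2.mul_star_self (u : SU2) : (u : ℍ[ℝ]) * star (u : ℍ[ℝ]) = 1 :=
  Unitary.mul_star_self_of_mem u.2

theorem SU2.star_mul_self (u : SU2) : star (u : ℍ[ℝ]) * (u : ℍ[ℝ]) = 1 :=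
  Unitary.star_mul_self_of_mem u.2

theorem SU2.im_conj (u x : SU2) :
    ((u * x * u⁻¹ : SU2) : ℍ[ℝ]).im = (u : ℍ[ℝ]) * (x : ℍ[ℝ]).im * star (u : ℍ[ℝ]) := by
  have h : (u : ℍ[ℝ]) * (x : ℍ[ℝ]) * star (u : ℍ[ℝ]) = ((x : ℍ[ℝ]).re : ℍ[ℝ]) +
      (u : ℍ[ℝ]) * (x : ℍ[ℝ]).im * star (u : ℍ[ℝ]) := by
    conv_lhs => rw [← Quaternion.re_add_im (x : ℍ[ℝ])]
    rw [mul_add, add_mul, ← Quaternion.coe_commutes, mul_assoc _ (u : ℍ[ℝ]), SU2.mul_star_self,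
      mul_one]
  have h2 : ((u * x * u⁻¹ : SU2) : ℍ[ℝ]) = ((x : ℍ[ℝ]).re : ℍ[ℝ]) +
      (u : ℍ[ℝ]) * (x : ℍ[ℝ]).im * star (u : ℍ[ℝ]) := h
  have h3 := Quaternion.re_add_im ((u * x * u⁻¹ : SU2) : ℍ[ℝ])
  rw [SU2.re_conj] at h3
  exact add_left_cancel (h3.trans h2)

theorem SU2.norm_coe (u : SU2) : ‖(u : ℍ[ℝ])‖ = 1 := CStarRing.norm_coe_unitary u

theorem SU2.exp_conj (u : SU2) (s : ℝ) {B : ℍ[ℝ]} (hB : B.re = 0) :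
    NormedSpace.exp (s • ((u : ℍ[ℝ]) * B * star (u : ℍ[ℝ]))) =
      (u : ℍ[ℝ]) * NormedSpace.exp (s • B) * star (u : ℍ[ℝ]) := by
  have h1 : ((u : ℍ[ℝ]) * B * star (u : ℍ[ℝ])).re = 0 := by
    have h := SU2.normSq_eq u
    simp only [Quaternion.re_mul, Quaternion.imI_mul, Quaternion.imJ_mul, Quaternion.imK_mul,
      Quaternion.re_star, Quaternion.imI_star, Quaternion.imJ_star, Quaternion.imK_star, hB]
    ring
  have h2 : ‖(u : ℍ[ℝ]) * B * star (u : ℍ[ℝ])‖ = ‖B‖ := by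
    rw [norm_mul, norm_mul, norm_star, SU2.norm_coe, one_mul, mul_one]
  rw [exp_smul_of_re_eq_zero s h1, exp_smul_of_re_eq_zero s hB, h2, mul_add, add_mul,
    ← Quaternion.coe_commutes, mul_assoc _ (u : ℍ[ℝ]), SU2.mul_star_self, mul_one, mul_smul_comm,
    smul_mul_assoc]

/-- The conjugate of a representation. -/
noncomputable def PertRep.conj {s : ℝ} (u : SU2) (ρ : PertRep s) : PertRep s :=
  ⟨(MulAut.conj u).toMonoidHom.comp ρ.1, by
    have key : ∀ x, ((MulAut.conj u).toMonoidHom.comp ρ.1) x = u * ρ.1 x * u⁻¹ := fun _ => rfl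
    refine ⟨?_, ?_, ?_, ?_, ?_, ?_, ?_, ?_⟩
    · rw [key, Submonoid.coe_mul, Submonoid.coe_mul, ρ.2.w2, mul_neg, mul_one, neg_mul,
        SU2.coe_inv, SU2.mul_star_self]
    · rw [key, SU2.re_conj, ρ.2.a_traceless]
    · rw [key, SU2.re_conj, ρ.2.b_traceless]
    · rw [key, SU2.re_conj, ρ.2.e_traceless]
    · rw [key, SU2.re_conj, ρ.2.f_traceless]
    · rw [key, SU2.re_conj, ρ.2.h_traceless]
    · rw [key, key, SU2.im_conj, SU2.exp_conj _ _ (Quaternion.re_im _), ← ρ.2.p_pert]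
      rfl
    · rw [key, key, SU2.im_conj, SU2.exp_conj _ _ (Quaternion.re_im _), ← ρ.2.q_pert]
      rfl⟩

theorem gen_conj {s : ℝ} (u : SU2) (ρ : PertRep s) (x : Gen) :
    gen (ρ.conj u) x = u * gen ρ x * u⁻¹ := rfl

theorem conjClass_eq_iff {s : ℝ} {ρ σ : PertRep s} :
    conjClass s ρ = conjClass s σ ↔ ∃ u, σ = ρ.conj u := by
  refine (Quotient.eq (r := conjSetoid s)).trans ⟨?_, ?_⟩
  · rintro ⟨u, hu⟩
    exact ⟨u, Subtype.ext (MonoidHom.ext hu)⟩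
  · rintro ⟨u, rfl⟩
    exact ⟨u, fun x => rfl⟩

theorem conjClass_conj {s : ℝ} (u : SU2) (ρ : PertRep s) :
    conjClass s (ρ.conj u) = conjClass s ρ :=
  (conjClass_eq_iff.2 ⟨u, rfl⟩).symm

theorem comm_exp_im (s : ℝ) (x : ℍ[ℝ]) :
    NormedSpace.exp (s • x.im) * x = x * NormedSpace.exp (s • x.im) := by
  rw [exp_smul_of_re_eq_zero s (Quaternion.re_im x), add_mul, mul_add, Quaternion.coe_commutes]
  congr 1
  rw [smul_mul_assoc, mul_smul_comm]
  congr 1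
  conv_lhs => rw [← Quaternion.re_add_im x]
  conv_rhs => rw [← Quaternion.re_add_im x]
  rw [mul_add, add_mul, Quaternion.coe_commutes]
  simp

theorem anticommute_iff {v h : ℍ[ℝ]} (hre : h.re = 0) (hn : ‖h‖ = 1) :
    v * h = -(h * v) ↔ v.re = 0 ∧ (v * h).re = 0 := by
  have hn2 : h.imI ^ 2 + h.imJ ^ 2 + h.imK ^ 2 = 1 := by
    have h1 := Quaternion.normSq_eq_norm_mul_self h
    rw [hn, Quaternion.normSq_def', hre] at h1
    linarith
  constructor
  · intro h1
    have e0 := congrArg (fun z : ℍ[ℝ] => z.re) h1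
    have e1 := congrArg (fun z : ℍ[ℝ] => z.imI) h1
    have e2 := congrArg (fun z : ℍ[ℝ] => z.imJ) h1
    have e3 := congrArg (fun z : ℍ[ℝ] => z.imK) h1
    simp only [Quaternion.re_mul, Quaternion.imI_mul, Quaternion.imJ_mul, Quaternion.imK_mul,
      Quaternion.re_neg, Quaternion.imI_neg, Quaternion.imJ_neg, Quaternion.imK_neg, hre]
      at e0 e1 e2 e3 ⊢
    constructor
    · linear_combination (1 / 2) * h.imI * e1 + (1 / 2) * h.imJ * e2 + (1 / 2) * h.imK * e3 -
        v.re * hn2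
    · linear_combination (1 / 2) * e0
  · rintro ⟨h1, h2⟩
    simp only [Quaternion.re_mul, hre, h1] at h2
    ext <;> simp only [Quaternion.re_mul, Quaternion.imI_mul, Quaternion.imJ_mul,
      Quaternion.imK_mul, Quaternion.re_neg, Quaternion.imI_neg, Quaternion.imJ_neg,
      Quaternion.imK_neg, hre, h1]
    · linear_combination 2 * h2
    · ring
    · ring
    · ring

theorem SU2.coe_inv_of_re {u : SU2} (hu : (u : ℍ[ℝ]).re = 0) :
    ((u⁻¹ : SU2) : ℍ[ℝ]) = -(u : ℍ[ℝ]) := by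
  rw [SU2.coe_inv]
  ext <;> simp [hu]

/-- The relations of the inner sphere and of the earring in terms of real parts. -/
theorem relation_iff_re {v h w : SU2} (hw : (w : ℍ[ℝ]) = -1) (hh : (h : ℍ[ℝ]).re = 0) :
    h⁻¹ * v * w * h = v ↔ (v : ℍ[ℝ]).re = 0 ∧ ((v * h : SU2) : ℍ[ℝ]).re = 0 := by
  rw [Submonoid.coe_mul, ← anticommute_iff hh (SU2.norm_coe h),
    show h⁻¹ * v * w * h = h⁻¹ * (v * w * h) by group, inv_mul_eq_iff_eq_mul, Subtype.ext_iff,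
    Submonoid.coe_mul, Submonoid.coe_mul, Submonoid.coe_mul, hw, mul_neg, mul_one, neg_mul]
  constructor <;> intro h1
  · rw [← h1, neg_neg]
  · rw [h1, neg_neg]

/-- The equations for the images of the generators. -/
theorem gen_re {s : ℝ} (ρ : PertRep s) :
    ((gen ρ .p * gen ρ .q * gen ρ .h * gen ρ .a : SU2) : ℍ[ℝ]).re = 0 ∧
      ((gen ρ .p * gen ρ .q * gen ρ .h * gen ρ .a * gen ρ .h : SU2) : ℍ[ℝ]).re = 0 := by
  have h1 := (inner_relation_iff (gen_outer ρ) (gen_comm_p ρ) (gen_comm_q ρ)).1 (gen_inner ρ)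
  have hh : (gen ρ .h : ℍ[ℝ]).re = 0 := ρ.2.h_traceless
  rw [relation_iff_re (w := gen ρ .w) ρ.2.w2 hh] at h1
  simp only [Submonoid.coe_mul, SU2.coe_inv_of_re hh, mul_neg, neg_mul, Quaternion.re_neg,
    neg_eq_zero] at h1 ⊢
  exact h1

/-- Construction of representations from the images of the generators. -/
theorem exists_pertRep (s : ℝ) {a b f h p q : SU2} (ha : (a : ℍ[ℝ]).re = 0)
    (hb : (b : ℍ[ℝ]).re = 0) (he : ((b * a * f⁻¹ : SU2) : ℍ[ℝ]).re = 0) (hf : (f : ℍ[ℝ]).re = 0)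
    (hh : (h : ℍ[ℝ]).re = 0)
    (hp : (p : ℍ[ℝ]) = NormedSpace.exp (s • ((b * h : SU2) : ℍ[ℝ]).im))
    (hq : (q : ℍ[ℝ]) = NormedSpace.exp (s • ((f * a⁻¹ * h : SU2) : ℍ[ℝ]).im))
    (h1 : ((p * q * h * a : SU2) : ℍ[ℝ]).re = 0)
    (h2 : ((p * q * h * a * h : SU2) : ℍ[ℝ]).re = 0) :
    ∃ ρ : PertRep s, gen ρ .a = a ∧ gen ρ .b = b ∧ gen ρ .f = f ∧ gen ρ .h = h ∧
      gen ρ .e = b * a * f⁻¹ ∧ gen ρ .p = p ∧ gen ρ .q = q := by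
  obtain ⟨w, hw⟩ : ∃ w : SU2, (w : ℍ[ℝ]) = -1 := by
    refine ⟨SU2.mk (-1) 0 0 0 (by norm_num), ?_⟩
    ext <;> simp
  have cp : p * (b * h) = b * h * p := by
    apply Subtype.ext
    change (p : ℍ[ℝ]) * ((b * h : SU2) : ℍ[ℝ]) = ((b * h : SU2) : ℍ[ℝ]) * (p : ℍ[ℝ])
    rw [hp]
    exact comm_exp_im _ _
  have cq : q * (f * a⁻¹ * h) = f * a⁻¹ * h * q := by
    apply Subtype.ext
    change (q : ℍ[ℝ]) * ((f * a⁻¹ * h : SU2) : ℍ[ℝ]) = ((f * a⁻¹ * h : SU2) : ℍ[ℝ]) * (q : ℍ[ℝ])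
    rw [hq]
    exact comm_exp_im _ _
  have hr : h⁻¹ * (p * q * h⁻¹ * a) * w * h = p * q * h⁻¹ * a := by
    rw [relation_iff_re hw hh]
    simp only [Submonoid.coe_mul, SU2.coe_inv_of_re hh, mul_neg, neg_mul, Quaternion.re_neg,
      neg_eq_zero] at h1 h2 ⊢
    exact ⟨h1, h2⟩
  let x : Gen → SU2 := fun
    | .w => w
    | .a => a
    | .b => b
    | .e => b * a * f⁻¹
    | .f => f
    | .p => p
    | .q => q
    | .h => h
  have hlift : ∀ r ∈ relators, FreeGroup.lift x r = 1 := by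
    intro r hr'
    simp only [relators, Set.mem_insert_iff, Set.mem_singleton_iff] at hr'
    rcases hr' with rfl | rfl | rfl | rfl | rfl
    · rw [map_commutatorElement, commutatorElement_eq_one_iff_mul_comm]
      simp only [wordLamP, map_mul, FreeGroup.lift_apply_of]
      exact cp
    · rw [map_commutatorElement, commutatorElement_eq_one_iff_mul_comm]
      simp only [wordLamQ, map_mul, map_inv, FreeGroup.lift_apply_of]
      exact cq
    · simp only [map_mul, map_inv, FreeGroup.lift_apply_of, mul_inv_eq_one]
      exact (inv_mul_cancel_right _ _).symm
    · simp only [wordC, wordD, wordG, map_mul, map_inv, FreeGroup.lift_apply_of, mul_inv_eq_one]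
      exact (inner_relation_iff (e := b * a * f⁻¹) (inv_mul_cancel_right _ _).symm cp cq).2 hr
    · simp only [map_mul, map_inv, FreeGroup.lift_apply_of, mul_inv_eq_one, map_commutatorElement]
      exact (earring_relation_iff cp cq).2 hr
  have hgen : ∀ g, PresentedGroup.toGroup hlift (elt (word g)) = x g :=
    fun g => PresentedGroup.toGroup.of hlift
  refine ⟨⟨PresentedGroup.toGroup hlift, ?_⟩, hgen _, hgen _, hgen _, hgen _, hgen _, hgen _,
    hgen _⟩
  refine ⟨?_, ?_, ?_, ?_, ?_, ?_, ?_, ?_⟩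
  · rw [hgen]; exact hw
  · rw [hgen]; exact ha
  · rw [hgen]; exact hb
  · rw [hgen]; exact he
  · rw [hgen]; exact hf
  · rw [hgen]; exact hh
  · rw [hgen, wordLamP, elt, map_mul, map_mul, hgen, hgen]; exact hp
  · rw [hgen, wordLamQ, elt, map_mul, map_mul, map_mul, map_inv, map_mul, map_inv, hgen, hgen, hgen]
    exact hq

/-! ### Representations in a gauge -/

/-- The imaginary quaternion with the given components. -/
def vecQuat (v : Space) : ℍ[ℝ] := ⟨0, v.1, v.2.1, v.2.2⟩

@[simp] theorem vecQuat_re (v : Space) : (vecQuat v).re = 0 := rfl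
@[simp] theorem vecQuat_imI (v : Space) : (vecQuat v).imI = v.1 := rfl
@[simp] theorem vecQuat_imJ (v : Space) : (vecQuat v).imJ = v.2.1 := rfl
@[simp] theorem vecQuat_imK (v : Space) : (vecQuat v).imK = v.2.2 := rfl

theorem norm_vecQuat_sq (v : Space) : ‖vecQuat v‖ ^ 2 = lenSq v := by
  rw [sq, ← Quaternion.normSq_eq_norm_mul_self, Quaternion.normSq_def', lenSq]
  simp

@[simp] theorem quat_re (x y z t : ℝ) : (quat x y z t).re = x := rfl
@[simp] theorem quat_imI (x y z t : ℝ) : (quat x y z t).imI = y := rfl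
@[simp] theorem quat_imJ (x y z t : ℝ) : (quat x y z t).imJ = z := rfl
@[simp] theorem quat_imK (x y z t : ℝ) : (quat x y z t).imK = t := rfl

/-- The quaternion `𝐢` as an element of `SU(2)`. -/
noncomputable def unitI : SU2 := SU2.mk 0 1 0 0 (by norm_num)

/-- The element `e^{t𝐤}𝐢` of `SU(2)`. -/
noncomputable def unitIJ (t : ℝ) : SU2 :=
  SU2.mk 0 (Real.cos t) (Real.sin t) 0 (by linarith [Real.sin_sq_add_cos_sq t])

theorem lenSq_holH (s : ℝ) (y : Space) (T : ℝ) : lenSq (holH s y T) = 1 := by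
  simp only [lenSq, holH]
  linear_combination Real.sin_sq_add_cos_sq (s * T) +
    Real.cos (s * T) ^ 2 * Real.sin_sq_add_cos_sq y.2.2

/-- The image of `h` as an element of `SU(2)`. -/
noncomputable def unitH (s : ℝ) (y : Space) (T : ℝ) : SU2 :=
  SU2.mk 0 (holH s y T).1 (holH s y T).2.1 (holH s y T).2.2 (by
    have := lenSq_holH s y T
    rw [lenSq] at this
    linarith)

theorem lenSq_nonneg (v : Space) : 0 ≤ lenSq v := by
  rw [lenSq]
  positivity

/-- The exponential of `s` times an imaginary quaternion. -/
noncomputable def unitExp (s : ℝ) (v : Space) : SU2 :=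
  SU2.mk (cosSq (s ^ 2 * lenSq v)) (s * sincSq (s ^ 2 * lenSq v) * v.1)
    (s * sincSq (s ^ 2 * lenSq v) * v.2.1) (s * sincSq (s ^ 2 * lenSq v) * v.2.2) (by
    have := cosSq_sq_add (mul_nonneg (sq_nonneg s) (lenSq_nonneg v))
    rw [← this]
    simp only [lenSq]
    ring)

theorem coe_unitExp (s : ℝ) (v : Space) :
    (unitExp s v : ℍ[ℝ]) = NormedSpace.exp (s • vecQuat v) := by
  rw [exp_smul_of_re_eq_zero s (vecQuat_re v), norm_vecQuat_sq]
  ext <;> simp [unitExp]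

theorem im_unitIJ_mul_unitH (s : ℝ) (y : Space) (T : ℝ) :
    ((unitIJ y.1 * unitH s y T : SU2) : ℍ[ℝ]).im = vecQuat (lamP s y T) := by
  ext <;> simp [unitIJ, unitH, lamP, Quaternion.imI_mul, Quaternion.imJ_mul, Quaternion.imK_mul]

theorem im_unitIJ_mul_unitI_mul_unitH (s : ℝ) (y : Space) (T : ℝ) :
    ((unitIJ y.2.1 * unitI⁻¹ * unitH s y T : SU2) : ℍ[ℝ]).im = vecQuat (lamQ s y T) := by
  ext <;> simp [unitIJ, unitH, unitI, lamQ, SU2.coe_inv, Quaternion.re_mul, Quaternion.imI_mul,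
    Quaternion.imJ_mul, Quaternion.imK_mul]

theorem unitExp_mul_unitExp (s : ℝ) (y : Space) (T : ℝ) :
    ((unitExp s (lamP s y T) * unitExp s (lamQ s y T) : SU2) : ℍ[ℝ]) =
      quat (holRe s y T) (s * (holIm s y T).1) (s * (holIm s y T).2.1) (s * (holIm s y T).2.2) := by
  simp only [holRe, holIm, pRe, pIm, qRe, qIm]
  generalize lamP s y T = u
  generalize lamQ s y T = v
  ext <;> simp [unitExp, cross, Quaternion.re_mul, Quaternion.imI_mul,
    Quaternion.imJ_mul, Quaternion.imK_mul] <;> ring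

theorem mul_mul_sincSq (s T : ℝ) : s * (T * sincSq (s ^ 2 * T ^ 2)) = Real.sin (s * T) := by
  rw [← mul_assoc, ← mul_pow, mul_sincSq_sq]

theorem re_eq_eqOne (s : ℝ) (y : Space) (T : ℝ) :
    ((unitExp s (lamP s y T) * unitExp s (lamQ s y T) * unitH s y T * unitI : SU2) : ℍ[ℝ]).re =
      s * eqOne s y T := by
  rw [mul_assoc, Submonoid.coe_mul, unitExp_mul_unitExp, eqOne]
  have h1 := mul_mul_sincSq s T
  have h2 : (holH s y T).1 = Real.sin (s * T) := rfl
  simp [unitH, unitI, Quaternion.re_mul, Quaternion.imI_mul, Quaternion.imJ_mul,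
    Quaternion.imK_mul]
  rw [← h2] at h1
  linear_combination (holRe s y T) * h1

theorem re_eq_eqTwo (s : ℝ) (y : Space) (T : ℝ) :
    ((unitExp s (lamP s y T) * unitExp s (lamQ s y T) * unitH s y T * unitI * unitH s y T : SU2) :
      ℍ[ℝ]).re = -(s * eqTwo s y T) := by
  rw [mul_assoc, mul_assoc, Submonoid.coe_mul, unitExp_mul_unitExp, eqTwo]
  have h1 := lenSq_holH s y T
  rw [lenSq] at h1
  simp [unitH, unitI, Quaternion.re_mul, Quaternion.imI_mul, Quaternion.imJ_mul,
    Quaternion.imK_mul]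
  linear_combination (-s * (holIm s y T).1) * h1

/-- The images of the generators of `ρ` are given by the coordinates `y` and the height `T`. -/
structure IsGauge {s : ℝ} (ρ : PertRep s) (y : Space) (T : ℝ) : Prop where
  a : gen ρ .a = unitI
  b : gen ρ .b = unitIJ y.1
  f : gen ρ .f = unitIJ y.2.1
  h : gen ρ .h = unitH s y T

theorem IsGauge.p {s : ℝ} {ρ : PertRep s} {y : Space} {T : ℝ} (h : IsGauge ρ y T) :
    gen ρ .p = unitExp s (lamP s y T) := by
  apply Subtype.ext
  rw [gen_p, h.b, h.h, im_unitIJ_mul_unitH, coe_unitExp]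

theorem IsGauge.q {s : ℝ} {ρ : PertRep s} {y : Space} {T : ℝ} (h : IsGauge ρ y T) :
    gen ρ .q = unitExp s (lamQ s y T) := by
  apply Subtype.ext
  rw [gen_q, h.a, h.f, h.h, im_unitIJ_mul_unitI_mul_unitH, coe_unitExp]

theorem IsGauge.e {s : ℝ} {ρ : PertRep s} {y : Space} {T : ℝ} (h : IsGauge ρ y T) :
    gen ρ .e = unitIJ y.1 * unitI * (unitIJ y.2.1)⁻¹ := by
  rw [eq_mul_inv_iff_mul_eq, ← h.a, ← h.b, ← h.f]
  exact (gen_outer ρ).symm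

theorem IsGauge.eqOne_eq_zero {s : ℝ} (hs : s ≠ 0) {ρ : PertRep s} {y : Space} {T : ℝ}
    (h : IsGauge ρ y T) : eqOne s y T = 0 := by
  have h1 := (gen_re ρ).1
  rw [h.p, h.q, h.h, h.a, re_eq_eqOne] at h1
  exact (mul_eq_zero.1 h1).resolve_left hs

theorem IsGauge.eqTwo_eq_zero {s : ℝ} (hs : s ≠ 0) {ρ : PertRep s} {y : Space} {T : ℝ}
    (h : IsGauge ρ y T) : eqTwo s y T = 0 := by
  have h1 := (gen_re ρ).2
  rw [h.p, h.q, h.h, h.a, re_eq_eqTwo, neg_eq_zero] at h1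
  exact (mul_eq_zero.1 h1).resolve_left hs

theorem exists_isGauge {s : ℝ} {y : Space} {T : ℝ} (h1 : eqOne s y T = 0) (h2 : eqTwo s y T = 0) :
    ∃ ρ : PertRep s, IsGauge ρ y T := by
  obtain ⟨ρ, ha, hb, hf, hh, -⟩ := exists_pertRep s (a := unitI) (b := unitIJ y.1)
    (f := unitIJ y.2.1) (h := unitH s y T) (p := unitExp s (lamP s y T))
    (q := unitExp s (lamQ s y T)) rfl rfl
    (by simp [unitIJ, unitI, SU2.coe_inv, Quaternion.re_mul, Quaternion.imI_mul,
      Quaternion.imJ_mul, Quaternion.imK_mul]) rfl rfl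
    (by rw [coe_unitExp, im_unitIJ_mul_unitH])
    (by rw [coe_unitExp, im_unitIJ_mul_unitI_mul_unitH])
    (by rw [re_eq_eqOne, h1, mul_zero]) (by rw [re_eq_eqTwo, h2, mul_zero, neg_zero])
  exact ⟨ρ, ha, hb, hf, hh⟩

theorem IsGauge.unique {s : ℝ} {ρ σ : PertRep s} {y : Space} {T : ℝ} (h : IsGauge ρ y T)
    (h' : IsGauge σ y T) : ρ = σ :=
  PertRep.ext_gen (h.a.trans h'.a.symm) (h.b.trans h'.b.symm) (h.f.trans h'.f.symm)
    (h.h.trans h'.h.symm)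

theorem norm_exp_sub_one_le (s : ℝ) {B : ℍ[ℝ]} (hB : B.re = 0) (hn : ‖B‖ ≤ 1) :
    ‖NormedSpace.exp (s • B) - 1‖ ≤ |s| := by
  have h1 : ‖NormedSpace.exp (s • B) - 1‖ ^ 2 ≤ (s * ‖B‖) ^ 2 := by
    have hn2 : B.imI ^ 2 + B.imJ ^ 2 + B.imK ^ 2 = ‖B‖ ^ 2 := by
      have h1 := Quaternion.normSq_eq_norm_mul_self B
      rw [Quaternion.normSq_def', hB] at h1
      linarith
    rw [exp_smul_of_re_eq_zero s hB, sq, ← Quaternion.normSq_eq_norm_mul_self,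
      Quaternion.normSq_def']
    simp [hB]
    rw [← mul_pow, cosSq_sq]
    have h2 := mul_sincSq_sq (s * ‖B‖)
    have h3 := Real.sin_sq_add_cos_sq (s * ‖B‖)
    have h4 := Real.one_sub_sq_div_two_le_cos (x := s * ‖B‖)
    have h5 : (s * sincSq ((s * ‖B‖) ^ 2)) ^ 2 * ‖B‖ ^ 2 = Real.sin (s * ‖B‖) ^ 2 := by
      rw [← h2]
      ring
    nlinarith
  have h2 : |s * ‖B‖| ≤ |s| := by
    rw [abs_mul, abs_norm]
    exact mul_le_of_le_one_right (abs_nonneg s) hn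
  have h3 := sq_le_sq.1 h1
  rw [abs_norm] at h3
  exact h3.trans h2

theorem SU2.norm_im_le (u : SU2) : ‖(u : ℍ[ℝ]).im‖ ≤ 1 := by
  have h1 := SU2.normSq_eq u
  have h2 := Quaternion.normSq_eq_norm_mul_self (u : ℍ[ℝ]).im
  rw [Quaternion.normSq_def'] at h2
  simp only [Quaternion.re_im, Quaternion.imI_im, Quaternion.imJ_im, Quaternion.imK_im] at h2
  nlinarith [norm_nonneg (u : ℍ[ℝ]).im, sq_nonneg (u : ℍ[ℝ]).re]

theorem abs_re_le_norm (x : ℍ[ℝ]) : |x.re| ≤ ‖x‖ := by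
  have h2 := Quaternion.normSq_eq_norm_mul_self x
  rw [Quaternion.normSq_def'] at h2
  refine abs_le_of_sq_le_sq ?_ (norm_nonneg x)
  nlinarith [sq_nonneg x.imI, sq_nonneg x.imJ, sq_nonneg x.imK]

/-- The images of `h` and `a` are almost orthogonal. -/
theorem abs_re_h_mul_a_le {s : ℝ} (ρ : PertRep s) :
    |((gen ρ .h * gen ρ .a : SU2) : ℍ[ℝ]).re| ≤ 2 * |s| := by
  have h1 := (gen_re ρ).1
  rw [mul_assoc, Submonoid.coe_mul, Submonoid.coe_mul] at h1
  have hp : ‖(gen ρ .p : ℍ[ℝ]) - 1‖ ≤ |s| := by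
    rw [gen_p]
    exact norm_exp_sub_one_le s (Quaternion.re_im _) (SU2.norm_im_le _)
  have hq : ‖(gen ρ .q : ℍ[ℝ]) - 1‖ ≤ |s| := by
    rw [gen_q]
    exact norm_exp_sub_one_le s (Quaternion.re_im _) (SU2.norm_im_le _)
  have hn := SU2.norm_coe (gen ρ .h * gen ρ .a)
  generalize ((gen ρ .h * gen ρ .a : SU2) : ℍ[ℝ]) = v at h1 hn ⊢
  have hpn := SU2.norm_coe (gen ρ .p)
  generalize (gen ρ .p : ℍ[ℝ]) = p at h1 hp hpn
  generalize (gen ρ .q : ℍ[ℝ]) = q at h1 hq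
  have h2 : v.re = -(((p * (q - 1) + (p - 1)) * v).re) := by
    have : (p * (q - 1) + (p - 1)) * v = p * q * v - v := by noncomm_ring
    rw [this, Quaternion.re_sub, h1]
    ring
  rw [h2, abs_neg]
  refine (abs_re_le_norm _).trans ?_
  rw [norm_mul, hn, mul_one]
  refine (norm_add_le _ _).trans ?_
  rw [norm_mul, hpn, one_mul]
  linarith

/-- The inclusion of the outer sphere on meridians. -/
theorem outerRestriction_meridian {s : ℝ} (ρ : PertRep s) (x : SphereGen) :
    (outerRestriction s ρ).1 (meridian x) = ρ.1 (elt (outerWord x)) := by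
  change ρ.1 (outerInclusion (meridian x)) = _
  rw [outerInclusion, meridian, PresentedGroup.toGroup.of]

/-- Every representation has a gauge. -/
theorem exists_conj_isGauge {s : ℝ} (hs : s ≠ 0) (ρ : PertRep s) :
    ∃ u y T, |T| ≤ 4 ∧ IsGauge (ρ.conj u) y T := by
  obtain ⟨x, u, h1, h2, h3⟩ := exists_hasCoordinates (outerRestriction s ρ)
  rw [outerRestriction_meridian] at h1 h2 h3
  have ha : gen (ρ.conj u) .a = unitI := by
    refine Subtype.ext (h1.trans ?_)
    ext <;> simp [unitI]
  have hIJ : ∀ t : Real.Angle, ∃ r : ℝ, circleIJ t = (unitIJ r : ℍ[ℝ]) := by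
    intro t
    induction t using Real.Angle.induction_on with
    | _ r => exact ⟨r, by ext <;> simp [unitIJ]⟩
  obtain ⟨γ, hγ⟩ := hIJ x.1
  obtain ⟨θ, hθ⟩ := hIJ x.2
  have hb : gen (ρ.conj u) .b = unitIJ γ := Subtype.ext (h2.trans hγ)
  have hf : gen (ρ.conj u) .f = unitIJ θ := Subtype.ext (h3.trans hθ)
  have hre : (gen (ρ.conj u) .h : ℍ[ℝ]).re = 0 := (ρ.conj u).2.h_traceless
  have hn := SU2.normSq_eq (gen (ρ.conj u) .h)
  have hbd := abs_re_h_mul_a_le (ρ.conj u)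
  rw [ha] at hbd
  have hbd' : |(gen (ρ.conj u) .h : ℍ[ℝ]).imI| ≤ 2 * |s| := by
    simpa [unitI, Quaternion.re_mul] using hbd
  rw [hre] at hn
  obtain ⟨z, hz⟩ : ∃ z, z = (gen (ρ.conj u) .h : ℍ[ℝ]) := ⟨_, rfl⟩
  rw [← hz] at hn hbd' hre
  have hI : |z.imI| ≤ 1 := by
    rw [← sq_le_one_iff_abs_le_one]
    nlinarith [sq_nonneg z.imJ, sq_nonneg z.imK]
  have hI' := abs_le.1 hI
  have hsin := Real.sin_arcsin hI'.1 hI'.2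
  have hcos : Real.cos (Real.arcsin z.imI) ^ 2 = z.imJ ^ 2 + z.imK ^ 2 := by
    have := Real.sin_sq_add_cos_sq (Real.arcsin z.imI)
    rw [hsin] at this
    linarith
  obtain ⟨ν, hν1, hν2⟩ : ∃ ν, z.imJ = -(Real.cos (Real.arcsin z.imI) * Real.sin ν) ∧
      z.imK = Real.cos (Real.arcsin z.imI) * Real.cos ν := by
    by_cases hc : Real.cos (Real.arcsin z.imI) = 0
    · rw [hc] at hcos ⊢
      exact ⟨0, by nlinarith [sq_nonneg z.imJ, sq_nonneg z.imK],
        by nlinarith [sq_nonneg z.imJ, sq_nonneg z.imK]⟩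
    · obtain ⟨ν, h5, h6⟩ := exists_angle (c := z.imK / Real.cos (Real.arcsin z.imI))
        (s := -z.imJ / Real.cos (Real.arcsin z.imI)) (by
          field_simp
          linarith)
      refine ⟨ν, ?_, ?_⟩
      · rw [h6]
        field_simp
      · rw [h5]
        field_simp
  have hsT : s * (Real.arcsin z.imI / s) = Real.arcsin z.imI := mul_div_cancel₀ _ hs
  refine ⟨u, (γ, θ, ν), Real.arcsin z.imI / s, ?_, ha, hb, hf, ?_⟩
  · have h7 : |Real.arcsin z.imI| ≤ Real.pi / 2 :=
      abs_le.2 ⟨by linarith [Real.neg_pi_div_two_le_arcsin z.imI], Real.arcsin_le_pi_div_two _⟩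
    have h8 := Real.mul_abs_le_abs_sin h7
    rw [hsin] at h8
    rw [abs_div, div_le_iff₀ (abs_pos.2 hs)]
    have h9 : |Real.arcsin z.imI| = Real.pi / 2 * (2 / Real.pi * |Real.arcsin z.imI|) := by
      field_simp
    have h10 : Real.pi / 2 * (2 / Real.pi * |Real.arcsin z.imI|) ≤ Real.pi / 2 * (2 * |s|) :=
      mul_le_mul_of_nonneg_left (h8.trans hbd') (by positivity)
    rw [h9]
    refine h10.trans ?_
    nlinarith [Real.pi_lt_four, abs_nonneg s]
  · apply Subtype.ext
    rw [← hz]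
    ext
    · exact hre
    · simp [unitH, holH, hsT, hsin]
    · simp [unitH, holH, hsT, hν1]
    · simp [unitH, holH, hsT, hν2]

/-! ### Coordinates from invariants -/

theorem contDiff_quaternion_re {n : WithTop ℕ∞} : ContDiff ℝ n fun x : ℍ[ℝ] => x.re := by
  have h : (fun x : ℍ[ℝ] => x.re) = fun x => inner ℝ x 1 := by
    funext x
    rw [Quaternion.inner_def, star_one, mul_one]
  rw [h]
  exact contDiff_id.inner ℝ contDiff_const

theorem quat_eq_sum (r i j k : ℝ) : quat r i j k =
    r • quat 1 0 0 0 + i • quat 0 1 0 0 + j • quat 0 0 1 0 + k • quat 0 0 0 1 := by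
  ext <;> simp

@[fun_prop] theorem contDiff_quat {E : Type*} [NormedAddCommGroup E] [NormedSpace ℝ E]
    {n : WithTop ℕ∞} {r i j k : E → ℝ} (hr : ContDiff ℝ n r) (hi : ContDiff ℝ n i)
    (hj : ContDiff ℝ n j) (hk : ContDiff ℝ n k) :
    ContDiff ℝ n fun x => quat (r x) (i x) (j x) (k x) := by
  simp only [quat_eq_sum (r _)]
  fun_prop

/-- The negative real part of a product of two images of generators. -/
noncomputable def pairing (x y : Gen) (z : Gen → ℍ[ℝ]) : ℝ := -(z x * z y).re

/-- The negative real part of a product of three images of generators. -/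
noncomputable def triple (x y y' : Gen) (z : Gen → ℍ[ℝ]) : ℝ := -(z x * z y * z y').re

@[fun_prop] theorem contDiff_pairing (x y : Gen) {n : WithTop ℕ∞} :
    ContDiff ℝ n (pairing x y) := by
  have h : ContDiff ℝ n fun z : Gen → ℍ[ℝ] => z x * z y :=
    (contDiff_apply ℝ _ x).mul (contDiff_apply ℝ _ y)
  exact (contDiff_quaternion_re.comp h).neg

@[fun_prop] theorem contDiff_triple (x y y' : Gen) {n : WithTop ℕ∞} :
    ContDiff ℝ n (triple x y y') := by
  have h : ContDiff ℝ n fun z : Gen → ℍ[ℝ] => z x * z y * z y' :=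
    ((contDiff_apply ℝ _ x).mul (contDiff_apply ℝ _ y)).mul (contDiff_apply ℝ _ y')
  exact (contDiff_quaternion_re.comp h).neg

theorem pairing_conj {s : ℝ} (u : SU2) (ρ : PertRep s) (x y : Gen) :
    pairing x y (evalGen s (ρ.conj u)) = pairing x y (evalGen s ρ) := by
  simp only [pairing, evalGen_apply, gen_conj, ← Submonoid.coe_mul]
  rw [show u * gen ρ x * u⁻¹ * (u * gen ρ y * u⁻¹) = u * (gen ρ x * gen ρ y) * u⁻¹ by group,
    SU2.re_conj]

theorem triple_conj {s : ℝ} (u : SU2) (ρ : PertRep s) (x y y' : Gen) :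
    triple x y y' (evalGen s (ρ.conj u)) = triple x y y' (evalGen s ρ) := by
  simp only [triple, evalGen_apply, gen_conj, ← Submonoid.coe_mul]
  rw [show u * gen ρ x * u⁻¹ * (u * gen ρ y * u⁻¹) * (u * gen ρ y' * u⁻¹) =
    u * (gen ρ x * gen ρ y * gen ρ y') * u⁻¹ by group, SU2.re_conj]

/-- For `z` with coordinates `y`, the square of `sin y₀.1 sin y.1 + sin y₀.2 sin y.2`. -/
noncomputable def signForm (y₀ : Space) (z : Gen → ℍ[ℝ]) : ℝ :=
  Real.sin y₀.1 ^ 2 * (1 - pairing .a .b z ^ 2) +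
    2 * (Real.sin y₀.1 * Real.sin y₀.2.1) *
      (pairing .b .f z - pairing .a .b z * pairing .a .f z) +
    Real.sin y₀.2.1 ^ 2 * (1 - pairing .a .f z ^ 2)

/-- The sine of the local coordinate `γ`. -/
noncomputable def localSinFst (y₀ : Space) (z : Gen → ℍ[ℝ]) : ℝ :=
  (Real.sin y₀.1 * (1 - pairing .a .b z ^ 2) +
    Real.sin y₀.2.1 * (pairing .b .f z - pairing .a .b z * pairing .a .f z)) / √(signForm y₀ z)

/-- The sine of the local coordinate `θ`. -/
noncomputable def localSinSnd (y₀ : Space) (z : Gen → ℍ[ℝ]) : ℝ :=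
  (Real.sin y₀.1 * (pairing .b .f z - pairing .a .b z * pairing .a .f z) +
    Real.sin y₀.2.1 * (1 - pairing .a .f z ^ 2)) / √(signForm y₀ z)

/-- The sine of the local coordinate `ν`. -/
noncomputable def localSinTrd (y₀ : Space) (z : Gen → ℍ[ℝ]) : ℝ :=
  -(Real.sin y₀.1 * (pairing .b .h z - pairing .a .b z * pairing .a .h z) +
    Real.sin y₀.2.1 * (pairing .f .h z - pairing .a .f z * pairing .a .h z)) /
      (√(1 - pairing .a .h z ^ 2) * √(signForm y₀ z))

/-- The cosine of the local coordinate `ν`. -/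
noncomputable def localCosTrd (y₀ : Space) (z : Gen → ℍ[ℝ]) : ℝ :=
  (Real.sin y₀.1 * triple .a .b .h z + Real.sin y₀.2.1 * triple .a .f .h z) /
      (√(1 - pairing .a .h z ^ 2) * √(signForm y₀ z))

/-- The local coordinates near `y₀`. -/
noncomputable def localCoord (y₀ : Space) (z : Gen → ℍ[ℝ]) : Space :=
  (localAngle y₀.1 (pairing .a .b z) (localSinFst y₀ z),
    localAngle y₀.2.1 (pairing .a .f z) (localSinSnd y₀ z),
    localAngle y₀.2.2 (localCosTrd y₀ z) (localSinTrd y₀ z))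

section ContDiff

variable {y₀ : Space} {z : Gen → ℍ[ℝ]}

theorem contDiff_signForm {n : WithTop ℕ∞} : ContDiff ℝ n (signForm y₀) := by
  unfold signForm
  fun_prop

theorem contDiffAt_localSinFst (h : 0 < signForm y₀ z) : ContDiffAt ℝ ω (localSinFst y₀) z :=
  ContDiffAt.div (ContDiff.contDiffAt (by fun_prop)) (contDiff_signForm.contDiffAt.sqrt h.ne')
    (Real.sqrt_pos.2 h).ne'

theorem contDiffAt_localSinSnd (h : 0 < signForm y₀ z) : ContDiffAt ℝ ω (localSinSnd y₀) z :=
  ContDiffAt.div (ContDiff.contDiffAt (by fun_prop)) (contDiff_signForm.contDiffAt.sqrt h.ne')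
    (Real.sqrt_pos.2 h).ne'

theorem contDiffAt_localSinTrd (h : 0 < signForm y₀ z) (h' : 0 < 1 - pairing .a .h z ^ 2) :
    ContDiffAt ℝ ω (localSinTrd y₀) z :=
  ContDiffAt.div (ContDiff.contDiffAt (by fun_prop))
    ((ContDiffAt.sqrt (contDiff_const.sub ((contDiff_pairing _ _).pow 2)).contDiffAt h'.ne').mul
      (contDiff_signForm.contDiffAt.sqrt h.ne'))
    (mul_pos (Real.sqrt_pos.2 h') (Real.sqrt_pos.2 h)).ne'

theorem contDiffAt_localCosTrd (h : 0 < signForm y₀ z) (h' : 0 < 1 - pairing .a .h z ^ 2) :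
    ContDiffAt ℝ ω (localCosTrd y₀) z :=
  ContDiffAt.div (ContDiff.contDiffAt (by fun_prop))
    ((ContDiffAt.sqrt (contDiff_const.sub ((contDiff_pairing _ _).pow 2)).contDiffAt h'.ne').mul
      (contDiff_signForm.contDiffAt.sqrt h.ne'))
    (mul_pos (Real.sqrt_pos.2 h') (Real.sqrt_pos.2 h)).ne'

end ContDiff

section Gauge

variable {s : ℝ} {ρ : PertRep s} {y : Space} {T : ℝ}

theorem IsGauge.pairing_a_b (h : IsGauge ρ y T) : pairing .a .b (evalGen s ρ) = Real.cos y.1 := by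
  simp [pairing, evalGen_apply, h.a, h.b, unitI, unitIJ, Quaternion.re_mul]

theorem IsGauge.pairing_a_f (h : IsGauge ρ y T) :
    pairing .a .f (evalGen s ρ) = Real.cos y.2.1 := by
  simp [pairing, evalGen_apply, h.a, h.f, unitI, unitIJ, Quaternion.re_mul]

theorem IsGauge.pairing_b_f (h : IsGauge ρ y T) : pairing .b .f (evalGen s ρ) =
    Real.cos y.1 * Real.cos y.2.1 + Real.sin y.1 * Real.sin y.2.1 := by
  simp [pairing, evalGen_apply, h.b, h.f, unitIJ, Quaternion.re_mul]
  ring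

theorem IsGauge.pairing_a_h (h : IsGauge ρ y T) :
    pairing .a .h (evalGen s ρ) = Real.sin (s * T) := by
  simp [pairing, evalGen_apply, h.a, h.h, unitI, unitH, holH, Quaternion.re_mul]

theorem IsGauge.pairing_b_h (h : IsGauge ρ y T) : pairing .b .h (evalGen s ρ) =
    Real.cos y.1 * Real.sin (s * T) - Real.sin y.1 * (Real.cos (s * T) * Real.sin y.2.2) := by
  simp [pairing, evalGen_apply, h.b, h.h, unitIJ, unitH, holH, Quaternion.re_mul]
  ring

theorem IsGauge.pairing_f_h (h : IsGauge ρ y T) : pairing .f .h (evalGen s ρ) =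
    Real.cos y.2.1 * Real.sin (s * T) -
      Real.sin y.2.1 * (Real.cos (s * T) * Real.sin y.2.2) := by
  simp [pairing, evalGen_apply, h.f, h.h, unitIJ, unitH, holH, Quaternion.re_mul]
  ring

theorem IsGauge.triple_b (h : IsGauge ρ y T) : triple .a .b .h (evalGen s ρ) =
    Real.sin y.1 * (Real.cos (s * T) * Real.cos y.2.2) := by
  simp [triple, evalGen_apply, h.a, h.b, h.h, unitI, unitIJ, unitH, holH, Quaternion.re_mul,
    Quaternion.imI_mul, Quaternion.imJ_mul, Quaternion.imK_mul]

theorem IsGauge.triple_f (h : IsGauge ρ y T) : triple .a .f .h (evalGen s ρ) =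
    Real.sin y.2.1 * (Real.cos (s * T) * Real.cos y.2.2) := by
  simp [triple, evalGen_apply, h.a, h.f, h.h, unitI, unitIJ, unitH, holH, Quaternion.re_mul,
    Quaternion.imI_mul, Quaternion.imJ_mul, Quaternion.imK_mul]

theorem IsGauge.signForm_eq (h : IsGauge ρ y T) (y₀ : Space) : signForm y₀ (evalGen s ρ) =
    (Real.sin y₀.1 * Real.sin y.1 + Real.sin y₀.2.1 * Real.sin y.2.1) ^ 2 := by
  rw [signForm, h.pairing_a_b, h.pairing_a_f, h.pairing_b_f]
  linear_combination -Real.sin y₀.1 ^ 2 * Real.sin_sq_add_cos_sq y.1 -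
    Real.sin y₀.2.1 ^ 2 * Real.sin_sq_add_cos_sq y.2.1

/-- The local sines and cosines are those of the coordinates, up to a common sign. -/
theorem IsGauge.exists_sign (h : IsGauge ρ y T) (hc : 0 < Real.cos (s * T)) {y₀ : Space}
    (hpos : 0 < signForm y₀ (evalGen s ρ)) : ∃ σ : Bool,
    0 < boolSign σ * (Real.sin y₀.1 * Real.sin y.1 + Real.sin y₀.2.1 * Real.sin y.2.1) ∧
    localSinFst y₀ (evalGen s ρ) = boolSign σ * Real.sin y.1 ∧
    localSinSnd y₀ (evalGen s ρ) = boolSign σ * Real.sin y.2.1 ∧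
    localSinTrd y₀ (evalGen s ρ) = boolSign σ * Real.sin y.2.2 ∧
    localCosTrd y₀ (evalGen s ρ) = boolSign σ * Real.cos y.2.2 := by
  have hS : √(1 - Real.sin (s * T) ^ 2) = Real.cos (s * T) := by
    rw [show 1 - Real.sin (s * T) ^ 2 = Real.cos (s * T) ^ 2 by
      linarith [Real.sin_sq_add_cos_sq (s * T)], Real.sqrt_sq hc.le]
  rw [localSinFst, localSinSnd, localSinTrd, localCosTrd, h.pairing_a_b, h.pairing_a_f,
    h.pairing_b_f, h.pairing_a_h, h.pairing_b_h, h.pairing_f_h, h.triple_b, h.triple_f, hS]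
  rw [h.signForm_eq] at hpos ⊢
  obtain ⟨w, hw⟩ : ∃ w, w = Real.sin y₀.1 * Real.sin y.1 + Real.sin y₀.2.1 * Real.sin y.2.1 :=
    ⟨_, rfl⟩
  rw [← hw] at hpos ⊢
  have hw0 : w ≠ 0 := by
    rintro rfl
    simp at hpos
  obtain ⟨σ, hσ⟩ : ∃ σ, 0 < boolSign σ * w := by
    rcases lt_or_gt_of_ne hw0 with h1 | h1
    · exact ⟨false, by simpa [boolSign] using h1⟩
    · exact ⟨true, by simpa [boolSign] using h1⟩
  have hσ2 := boolSign_sq σ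
  have hsq : √(w ^ 2) = boolSign σ * w := by
    rw [show w ^ 2 = (boolSign σ * w) ^ 2 by linear_combination (-w ^ 2) * hσ2,
      Real.sqrt_sq hσ.le]
  have hγ := Real.sin_sq_add_cos_sq y.1
  have hθ := Real.sin_sq_add_cos_sq y.2.1
  rw [hsq]
  refine ⟨σ, hσ, ?_, ?_, ?_, ?_⟩
  · rw [div_eq_iff hσ.ne']
    linear_combination (-Real.sin y₀.1) * hγ - Real.sin y.1 * hw - Real.sin y.1 * w * hσ2
  · rw [div_eq_iff hσ.ne']
    linear_combination (-Real.sin y₀.2.1) * hθ - Real.sin y.2.1 * hw - Real.sin y.2.1 * w * hσ2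
  · rw [div_eq_iff (mul_pos hc hσ).ne']
    linear_combination (-Real.cos (s * T) * Real.sin y.2.2) * hw -
      Real.sin y.2.2 * Real.cos (s * T) * w * hσ2
  · rw [div_eq_iff (mul_pos hc hσ).ne']
    linear_combination (-Real.cos (s * T) * Real.cos y.2.2) * hw -
      Real.cos y.2.2 * Real.cos (s * T) * w * hσ2

end Gauge

theorem exists_deck_of_trig {x y : Space} {σ : Bool} (h1 : Real.cos y.1 = Real.cos x.1)
    (h2 : Real.sin y.1 = boolSign σ * Real.sin x.1) (h3 : Real.cos y.2.1 = Real.cos x.2.1)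
    (h4 : Real.sin y.2.1 = boolSign σ * Real.sin x.2.1)
    (h5 : Real.cos y.2.2 = boolSign σ * Real.cos x.2.2)
    (h6 : Real.sin y.2.2 = boolSign σ * Real.sin x.2.2) : ∃ m n l, y = deck σ m n l x := by
  have key : ∀ a b : ℝ, Real.cos a = Real.cos b → Real.sin a = Real.sin b →
      ∃ k : ℤ, a = b + 2 * Real.pi * k := by
    intro a b hc hs
    obtain ⟨k, hk⟩ := Real.Angle.angle_eq_iff_two_pi_dvd_sub.1 (Real.Angle.cos_sin_inj hc hs)
    exact ⟨k, by linarith⟩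
  rw [← cos_deck_fst σ 0 0 0 x] at h1
  rw [← sin_deck_fst σ 0 0 0 x] at h2
  rw [← cos_deck_snd σ 0 0 0 x] at h3
  rw [← sin_deck_snd σ 0 0 0 x] at h4
  rw [← cos_deck_trd σ 0 0 0 x] at h5
  rw [← sin_deck_trd σ 0 0 0 x] at h6
  obtain ⟨m, hm⟩ := key _ _ h1 h2
  obtain ⟨n, hn⟩ := key _ _ h3 h4
  obtain ⟨l, hl⟩ := key _ _ h5 h6
  refine ⟨m, n, l, Prod.ext ?_ (Prod.ext ?_ ?_)⟩
  · rw [hm]; simp [deck]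
  · rw [hn]; simp [deck]
  · rw [hl]; simp [deck]

/-- Near a representation that does not restrict to a corner there are analytic coordinates. -/
theorem IsGauge.exists_localCoord {s : ℝ} {ρ₀ : PertRep s} {y₀ : Space} {T₀ : ℝ}
    (h₀ : IsGauge ρ₀ y₀ T₀) (hc₀ : 0 < Real.cos (s * T₀))
    (hreg : Real.sin y₀.1 ≠ 0 ∨ Real.sin y₀.2.1 ≠ 0) :
    ∃ A : (Gen → ℍ[ℝ]) → Space, ContDiffAt ℝ ω A (evalGen s ρ₀) ∧ A (evalGen s ρ₀) = y₀ ∧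
      ∀ᶠ v in 𝓝 (evalGen s ρ₀), ∀ (ρ : PertRep s) y T u, IsGauge ρ y T → 0 < Real.cos (s * T) →
        evalGen s (ρ.conj u) = v → ∃ σ m n l, A v = deck σ m n l y := by
  have hw : 0 < Real.sin y₀.1 * Real.sin y₀.1 + Real.sin y₀.2.1 * Real.sin y₀.2.1 := by
    rcases hreg with h | h
    · nlinarith [mul_self_pos.2 h, mul_self_nonneg (Real.sin y₀.2.1)]
    · nlinarith [mul_self_pos.2 h, mul_self_nonneg (Real.sin y₀.1)]
  have hpos : 0 < signForm y₀ (evalGen s ρ₀) := by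
    rw [h₀.signForm_eq]
    positivity
  have hpos' : 0 < 1 - pairing .a .h (evalGen s ρ₀) ^ 2 := by
    rw [h₀.pairing_a_h, show 1 - Real.sin (s * T₀) ^ 2 = Real.cos (s * T₀) ^ 2 by
      linarith [Real.sin_sq_add_cos_sq (s * T₀)]]
    positivity
  obtain ⟨σ, hσ, h1, h2, h3, h4⟩ := h₀.exists_sign hc₀ hpos
  have hσ1 : boolSign σ = 1 := by
    cases σ
    · simp [boolSign] at hσ
      linarith
    · simp [boolSign]
  rw [hσ1, one_mul] at h1 h2 h3 h4
  have d1 := contDiffAt_localSinFst hpos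
  have d2 := contDiffAt_localSinSnd hpos
  have d3 := contDiffAt_localSinTrd hpos hpos'
  have d4 := contDiffAt_localCosTrd hpos hpos'
  have d5 : ContDiffAt ℝ ω (pairing .a .b) (evalGen s ρ₀) :=
    (contDiff_pairing _ _).contDiffAt
  have d6 : ContDiffAt ℝ ω (pairing .a .f) (evalGen s ρ₀) :=
    (contDiff_pairing _ _).contDiffAt
  refine ⟨localCoord y₀, ?_, ?_, ?_⟩
  · exact (contDiffAt_localAngle d5 d1 h₀.pairing_a_b h1).prodMk
      ((contDiffAt_localAngle d6 d2 h₀.pairing_a_f h2).prodMk (contDiffAt_localAngle d4 d3 h4 h3))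
  · rw [localCoord, h1, h2, h3, h4, h₀.pairing_a_b, h₀.pairing_a_f, localAngle_self,
      localAngle_self, localAngle_self]
  · have e1 := eventually_cos_sin_localAngle d5.continuousAt d1.continuousAt h₀.pairing_a_b h1
    have e2 := eventually_cos_sin_localAngle d6.continuousAt d2.continuousAt h₀.pairing_a_f h2
    have e3 := eventually_cos_sin_localAngle d4.continuousAt d3.continuousAt h4 h3
    have e4 : ∀ᶠ v in 𝓝 (evalGen s ρ₀), 0 < signForm y₀ v :=
      (contDiff_signForm (n := 0)).continuous.continuousAt.eventually (lt_mem_nhds hpos)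
    filter_upwards [e1, e2, e3, e4] with v k1 k2 k3 k4
    rintro ρ y T u h hc rfl
    have hinv : ∀ g : (Gen → ℍ[ℝ]) → ℝ, (∀ v v', (∀ x y, pairing x y v = pairing x y v') →
        (∀ x y y', triple x y y' v = triple x y y' v') → g v = g v') →
        g (evalGen s (ρ.conj u)) = g (evalGen s ρ) := fun g hg =>
      hg _ _ (fun x y => pairing_conj u ρ x y) (fun x y y' => triple_conj u ρ x y y')
    have i0 := hinv (signForm y₀) (fun v v' hp _ => by simp only [signForm, hp])
    have i1 := hinv (localSinFst y₀) (fun v v' hp _ => by simp only [localSinFst, signForm, hp])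
    have i2 := hinv (localSinSnd y₀) (fun v v' hp _ => by simp only [localSinSnd, signForm, hp])
    have i3 := hinv (localSinTrd y₀) (fun v v' hp _ => by simp only [localSinTrd, signForm, hp])
    have i4 := hinv (localCosTrd y₀) (fun v v' hp ht => by
      simp only [localCosTrd, signForm, hp, ht])
    rw [localCoord]
    rw [i0] at k4
    rw [i1, pairing_conj] at k1 ⊢
    rw [i2, pairing_conj] at k2 ⊢
    rw [i3, i4] at k3 ⊢
    obtain ⟨τ, -, j1, j2, j3, j4⟩ := h.exists_sign hc k4
    have hτ := boolSign_sq τ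
    rw [j1, h.pairing_a_b] at k1 ⊢
    rw [j2, h.pairing_a_f] at k2 ⊢
    rw [j3, j4] at k3 ⊢
    have l1 := k1 (by linear_combination Real.sin_sq_add_cos_sq y.1 + Real.sin y.1 ^ 2 * hτ)
    have l2 := k2 (by linear_combination Real.sin_sq_add_cos_sq y.2.1 + Real.sin y.2.1 ^ 2 * hτ)
    have l3 := k3 (by
      linear_combination Real.sin_sq_add_cos_sq y.2.2 +
        (Real.sin y.2.2 ^ 2 + Real.cos y.2.2 ^ 2) * hτ)
    exact ⟨τ, exists_deck_of_trig l1.1 l1.2 l2.1 l2.2 l3.1 l3.2⟩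

/-! ### No representation restricts to a corner of the outer pillowcase -/

theorem sin_ne_zero_of_eq_zero {s : ℝ} (hs : s ≠ 0) (hs1 : |s| < 1) {y : Space} {T : ℝ}
    (h1 : eqOne s y T = 0) (h2 : eqTwo s y T = 0) : Real.sin y.1 ≠ 0 ∨ Real.sin y.2.1 ≠ 0 := by
  by_contra! hcon
  obtain ⟨hγ, hθ⟩ := hcon
  have hγ2 := Real.sin_sq_add_cos_sq y.1
  have hθ2 := Real.sin_sq_add_cos_sq y.2.1
  have hν2 := Real.sin_sq_add_cos_sq y.2.2
  have hS2 := Real.sin_sq_add_cos_sq (s * T)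
  have hs2 := abs_lt.1 hs1
  have hpi := Real.pi_gt_three
  have hcs : 0 < Real.cos s := Real.cos_pos_of_mem_Ioo ⟨by linarith, by linarith⟩
  have hss : Real.sin s ≠ 0 := by
    intro h
    rw [Real.sin_eq_zero_iff_of_lt_of_lt (by linarith) (by linarith)] at h
    exact hs h
  rw [hγ] at hγ2
  rw [hθ] at hθ2
  have hP : lenSq (lamP s y T) = Real.cos (s * T) ^ 2 := by
    simp only [lenSq, lamP, holH, hγ]
    linear_combination (Real.cos y.1 ^ 2 * Real.cos (s * T) ^ 2) * hν2 +
      Real.cos (s * T) ^ 2 * hγ2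
  have hQ : lenSq (lamQ s y T) = 1 := by
    have h3 := lenSq_holH s y T
    simp only [lenSq, lamQ, hθ] at h3 ⊢
    linear_combination Real.cos y.2.1 ^ 2 * h3 + hθ2
  have hq1 : qRe s y T = Real.cos s := by
    rw [qRe, hQ, mul_one, cosSq_sq]
  have hq2 : s * qIm s y T = Real.sin s := by
    rw [qIm, hQ, mul_one, mul_sincSq_sq]
  have hp2 : s * Real.cos (s * T) * pIm s y T = Real.sin (s * Real.cos (s * T)) := by
    rw [pIm, hP, ← mul_pow, mul_sincSq_sq]
  have hT := mul_mul_sincSq s T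
  have k1 : s * eqOne s y T = -qRe s y T * (Real.sin (s * T) * pRe s y T -
      s * pIm s y T * Real.cos y.1 * Real.cos (s * T) ^ 2) := by
    rw [eqOne]
    simp only [holRe, holIm, cross, dot_apply, lamP, lamQ, hγ, hθ, Prod.smul_mk, smul_eq_mul,
      Prod.mk_add_mk]
    simp only [holH]
    linear_combination (-(pRe s y T * qRe s y T)) * hT +
      (s * qRe s y T * pIm s y T * Real.cos y.1 * Real.cos (s * T) ^ 2) * hν2
  have k2 : s * eqTwo s y T = -Real.cos y.2.1 * (s * qIm s y T) *
      (pRe s y T * Real.sin (s * T) + s * pIm s y T * Real.cos y.1 * Real.cos (s * T) ^ 2) := by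
    rw [eqTwo]
    simp only [holIm, cross, lamP, lamQ, hγ, hθ, Prod.smul_mk, smul_eq_mul,
      Prod.mk_add_mk]
    simp only [holH]
    linear_combination (-2 * s * pRe s y T * qIm s y T * Real.cos y.2.1 * Real.sin (s * T)) *
      (hS2 + Real.cos (s * T) ^ 2 * hν2) - (s ^ 2 * pIm s y T * qIm s y T * Real.cos y.1 *
        Real.cos y.2.1 * Real.cos (s * T) ^ 2) * hν2
  rw [h1, hq1, mul_zero, eq_comm, mul_eq_zero, or_iff_right (neg_ne_zero.2 hcs.ne')] at k1
  have hδ : Real.cos y.2.1 ≠ 0 := by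
    intro h
    rw [h] at hθ2
    norm_num at hθ2
  have hε : Real.cos y.1 ≠ 0 := by
    intro h
    rw [h] at hγ2
    norm_num at hγ2
  rw [h2, hq2, mul_zero, eq_comm, mul_eq_zero,
    or_iff_right (mul_ne_zero (neg_ne_zero.2 hδ) hss)] at k2
  have k3 : Real.cos y.1 * (Real.sin (s * Real.cos (s * T)) * Real.cos (s * T)) = 0 := by
    rw [← hp2]
    linear_combination (1 / 2) * k2 - (1 / 2) * k1
  have hC : Real.cos (s * T) = 0 := by
    rcases mul_eq_zero.1 ((mul_eq_zero.1 k3).resolve_left hε) with h | h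
    · have hc1 := Real.abs_cos_le_one (s * T)
      have h5 : |s * Real.cos (s * T)| < 1 := by
        rw [abs_mul]
        nlinarith [abs_nonneg s, abs_nonneg (Real.cos (s * T))]
      have h6 := abs_lt.1 h5
      rw [Real.sin_eq_zero_iff_of_lt_of_lt (by linarith) (by linarith)] at h
      exact (mul_eq_zero.1 h).resolve_left hs
    · exact h
  rw [hC] at hS2 k1
  rw [pRe, hP, hC] at k1
  have hS : Real.sin (s * T) = 0 := by simpa using k1
  rw [hS] at hS2
  norm_num at hS2

/-! ### The covering of the moduli space -/

/-- The images of the generators in a gauge. -/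
noncomputable def gaugeEval (s : ℝ) (y : Space) (T : ℝ) : Gen → ℍ[ℝ]
  | .w => -1
  | .a => unitI
  | .b => unitIJ y.1
  | .e => unitIJ y.1 * unitI * star (unitIJ y.2.1 : ℍ[ℝ])
  | .f => unitIJ y.2.1
  | .p => unitExp s (lamP s y T)
  | .q => unitExp s (lamQ s y T)
  | .h => unitH s y T

theorem IsGauge.evalGen_eq {s : ℝ} {ρ : PertRep s} {y : Space} {T : ℝ} (h : IsGauge ρ y T) :
    evalGen s ρ = gaugeEval s y T := by
  funext x
  rw [evalGen_apply]
  cases x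
  · exact ρ.2.w2
  · rw [h.a]; rfl
  · rw [h.b]; rfl
  · rw [h.e]; rfl
  · rw [h.f]; rfl
  · rw [h.p]; rfl
  · rw [h.q]; rfl
  · rw [h.h]; rfl

theorem contDiff_starQuaternion {n : WithTop ℕ∞} : ContDiff ℝ n fun x : ℍ[ℝ] => star x := by
  have h : (fun x : ℍ[ℝ] => star x) = fun x => (2 * x.re) • (1 : ℍ[ℝ]) - x := by
    funext x
    ext <;> simp
    ring
  rw [h]
  exact ((contDiff_const.mul contDiff_quaternion_re).smul contDiff_const).sub contDiff_id

@[fun_prop] theorem contDiff_unitIJ {E : Type*} [NormedAddCommGroup E] [NormedSpace ℝ E]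
    {n : WithTop ℕ∞} {t : E → ℝ} (ht : ContDiff ℝ n t) :
    ContDiff ℝ n fun x => (unitIJ (t x) : ℍ[ℝ]) := by
  change ContDiff ℝ n fun x => quat 0 (Real.cos (t x)) (Real.sin (t x)) 0
  fun_prop

@[fun_prop] theorem contDiff_unitH {E : Type*} [NormedAddCommGroup E] [NormedSpace ℝ E]
    {n : WithTop ℕ∞} {s : E → ℝ} {y : E → Space} {T : E → ℝ} (hs : ContDiff ℝ n s)
    (hy : ContDiff ℝ n y) (hT : ContDiff ℝ n T) :
    ContDiff ℝ n fun x => (unitH (s x) (y x) (T x) : ℍ[ℝ]) := by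
  change ContDiff ℝ n fun x => quat 0 (holH (s x) (y x) (T x)).1 (holH (s x) (y x) (T x)).2.1
    (holH (s x) (y x) (T x)).2.2
  fun_prop

@[fun_prop] theorem contDiff_unitExp {E : Type*} [NormedAddCommGroup E] [NormedSpace ℝ E]
    {n : WithTop ℕ∞} {s : E → ℝ} {v : E → Space} (hs : ContDiff ℝ n s) (hv : ContDiff ℝ n v) :
    ContDiff ℝ n fun x => (unitExp (s x) (v x) : ℍ[ℝ]) := by
  change ContDiff ℝ n fun x => quat (cosSq (s x ^ 2 * lenSq (v x)))
    (s x * sincSq (s x ^ 2 * lenSq (v x)) * (v x).1)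
    (s x * sincSq (s x ^ 2 * lenSq (v x)) * (v x).2.1)
    (s x * sincSq (s x ^ 2 * lenSq (v x)) * (v x).2.2)
  unfold lenSq
  fun_prop

theorem contDiff_gaugeEval {E : Type*} [NormedAddCommGroup E] [NormedSpace ℝ E]
    {n : WithTop ℕ∞} (s : ℝ) {y : E → Space} {T : E → ℝ} (hy : ContDiff ℝ n y)
    (hT : ContDiff ℝ n T) : ContDiff ℝ n fun x => gaugeEval s (y x) (T x) := by
  refine contDiff_pi.2 fun g => ?_
  cases g <;> simp only [gaugeEval]
  case e =>
    have h1 : ContDiff ℝ n fun x => (unitIJ (y x).1 : ℍ[ℝ]) := by fun_prop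
    have h2 : ContDiff ℝ n fun x => (unitIJ (y x).2.1 : ℍ[ℝ]) := by fun_prop
    exact (h1.mul contDiff_const).mul (contDiff_starQuaternion.comp h2)
  all_goals fun_prop

theorem unitI_conj_unitIJ (t : ℝ) : unitI * unitIJ t * unitI⁻¹ = unitIJ (-t) := by
  apply Subtype.ext
  ext <;> simp [unitI, unitIJ, SU2.coe_inv, Quaternion.re_mul, Quaternion.imI_mul,
    Quaternion.imJ_mul, Quaternion.imK_mul]

theorem unitIJ_congr {t t' : ℝ} (hc : Real.cos t = Real.cos t') (hs : Real.sin t = Real.sin t') :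
    unitIJ t = unitIJ t' := by
  apply Subtype.ext
  ext <;> simp [unitIJ, hc, hs]

theorem unitH_congr {s : ℝ} {y y' : Space} {T : ℝ} (h : holH s y T = holH s y' T) :
    unitH s y T = unitH s y' T := by
  apply Subtype.ext
  ext <;> simp [unitH, h]

theorem unitI_conj_unitH (s : ℝ) (y : Space) (T : ℝ) (m n l : ℤ) :
    unitI * unitH s y T * unitI⁻¹ = unitH s (deck false m n l y) T := by
  apply Subtype.ext
  ext <;> simp [unitI, unitH, holH_deck, axisSign, boolSign, SU2.coe_inv, Quaternion.re_mul,
    Quaternion.imI_mul, Quaternion.imJ_mul, Quaternion.imK_mul]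

theorem IsGauge.exists_conj_deck {s : ℝ} {ρ : PertRep s} {y : Space} {T : ℝ} (h : IsGauge ρ y T)
    (σ : Bool) (m n l : ℤ) : ∃ u, IsGauge (ρ.conj u) (deck σ m n l y) T := by
  cases σ
  · refine ⟨unitI, ?_, ?_, ?_, ?_⟩
    · rw [gen_conj, h.a, mul_inv_cancel_right]
    · rw [gen_conj, h.b, unitI_conj_unitIJ]
      refine unitIJ_congr ?_ ?_
      · rw [cos_deck_fst, Real.cos_neg]
      · rw [sin_deck_fst, Real.sin_neg]
        simp [boolSign]
    · rw [gen_conj, h.f, unitI_conj_unitIJ]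
      refine unitIJ_congr ?_ ?_
      · rw [cos_deck_snd, Real.cos_neg]
      · rw [sin_deck_snd, Real.sin_neg]
        simp [boolSign]
    · rw [gen_conj, h.h, unitI_conj_unitH]
  · refine ⟨1, ?_, ?_, ?_, ?_⟩
    · rw [gen_conj, h.a, one_mul, inv_one, mul_one]
    · rw [gen_conj, h.b, one_mul, inv_one, mul_one]
      refine unitIJ_congr ?_ ?_
      · rw [cos_deck_fst]
      · rw [sin_deck_fst]
        simp [boolSign]
    · rw [gen_conj, h.f, one_mul, inv_one, mul_one]
      refine unitIJ_congr ?_ ?_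
      · rw [cos_deck_snd]
      · rw [sin_deck_snd]
        simp [boolSign]
    · rw [gen_conj, h.h, one_mul, inv_one, mul_one]
      refine unitH_congr ?_
      rw [holH_deck]
      simp [axisSign, boolSign]

theorem isInducing_evalGen (s : ℝ) : Topology.IsInducing (evalGen s) := ⟨rfl⟩

/-- Conjugation of all components. -/
noncomputable def conjAll (u : SU2) (v : Gen → ℍ[ℝ]) : Gen → ℍ[ℝ] :=
  fun x => (u : ℍ[ℝ]) * v x * star (u : ℍ[ℝ])

theorem contDiff_conjAll (u : SU2) {n : WithTop ℕ∞} : ContDiff ℝ n (conjAll u) :=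
  contDiff_pi.2 fun x => (contDiff_const.mul (contDiff_apply ℝ _ x)).mul contDiff_const

theorem PertRep.conj_conj {s : ℝ} (u v : SU2) (ρ : PertRep s) :
    (ρ.conj v).conj u = ρ.conj (u * v) := by
  apply PertRep.ext_gen <;> simp only [gen_conj] <;> group

theorem PertRep.conj_one {s : ℝ} (ρ : PertRep s) : ρ.conj 1 = ρ := by
  apply PertRep.ext_gen <;> simp [gen_conj]

theorem continuous_conj {s : ℝ} (u : SU2) : Continuous (PertRep.conj (s := s) u) :=
  (isInducing_evalGen s).continuous_iff.2
    ((contDiff_conjAll u (n := 0)).continuous.comp (isInducing_evalGen s).continuous)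

theorem continuous_conjClass (s : ℝ) : Continuous (conjClass s) := continuous_quotient_mk'

theorem surjective_conjClass (s : ℝ) : Function.Surjective (conjClass s) := Quotient.mk_surjective

namespace IsStraightening

variable {s : ℝ} {T : Space → ℝ} {Ψ : Space ≃ₜ Space} (h : IsStraightening s T Ψ)

theorem exists_rep (h : IsStraightening s T Ψ) (x : coverSurface) :
    ∃ ρ : PertRep s, IsGauge ρ (Ψ.symm x) (T (Ψ.symm x)) := by
  refine exists_isGauge (h.eqOne_eq_zero _) ((h.mem_iff _).1 ?_)
  rw [Homeomorph.apply_symm_apply]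
  exact x.2

/-- The representation above a point of the covering surface. -/
noncomputable def rep (x : coverSurface) : PertRep s := (h.exists_rep x).choose

theorem isGauge_rep (x : coverSurface) : IsGauge (h.rep x) (Ψ.symm x) (T (Ψ.symm x)) :=
  (h.exists_rep x).choose_spec

/-- The covering of the moduli space. -/
noncomputable def cover (x : coverSurface) : NAT s := conjClass s (h.rep x)

theorem evalGen_rep (x : coverSurface) :
    evalGen s (h.rep x) = gaugeEval s (Ψ.symm x) (T (Ψ.symm x)) :=
  (h.isGauge_rep x).evalGen_eq

theorem contDiff_gaugeEval (h : IsStraightening s T Ψ) :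
    ContDiff ℝ ω fun x => gaugeEval s (Ψ.symm x) (T (Ψ.symm x)) :=
  Earring.contDiff_gaugeEval s h.contDiff_symm (h.contDiff_height.comp h.contDiff_symm)

theorem continuous_cover : Continuous h.cover := by
  refine (continuous_conjClass s).comp ((isInducing_evalGen s).continuous_iff.2 ?_)
  have : evalGen s ∘ h.rep = fun x : coverSurface => gaugeEval s (Ψ.symm x) (T (Ψ.symm x)) :=
    funext h.evalGen_rep
  rw [this]
  exact h.contDiff_gaugeEval.continuous.comp continuous_subtype_val

theorem symm_deck (h : IsStraightening s T Ψ) (σ : Bool) (m n l : ℤ) (x : Space) :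
    Ψ.symm (Earring.deck σ m n l x) = Earring.deck σ m n l (Ψ.symm x) := by
  rw [Homeomorph.symm_apply_eq, h.deck, Homeomorph.apply_symm_apply]

theorem cover_coverDeck (σ : Bool) (m n l : ℤ) (x : coverSurface) :
    h.cover (coverDeck σ m n l x) = h.cover x := by
  obtain ⟨u, hu⟩ := (h.isGauge_rep x).exists_conj_deck σ m n l
  have h1 := h.isGauge_rep (coverDeck σ m n l x)
  rw [show (coverDeck σ m n l x : Space) = Earring.deck σ m n l x from rfl, h.symm_deck,
    h.height_deck] at h1
  rw [cover, h1.unique hu, conjClass_conj]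
  rfl

theorem cos_pos (h : IsStraightening s T Ψ) (hs : |s| < 1 / 6) (y : Space) :
    0 < Real.cos (s * T y) := by
  have h1 : |s * T y| < 1 := by
    rw [abs_mul]
    nlinarith [abs_nonneg s, abs_nonneg (T y), h.height_lt y]
  have h2 := abs_lt.1 h1
  have hpi := Real.pi_gt_three
  exact Real.cos_pos_of_mem_Ioo ⟨by linarith, by linarith⟩

theorem exists_cover_eq (hs0 : s ≠ 0) (ρ : PertRep s) : ∃ x u, ρ.conj u = h.rep x := by
  obtain ⟨u, y, t, ht, hg⟩ := exists_conj_isGauge hs0 ρ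
  obtain rfl := h.height_unique y t ht (hg.eqOne_eq_zero hs0)
  have hmem := (h.mem_iff y).2 (hg.eqTwo_eq_zero hs0)
  refine ⟨⟨Ψ y, hmem⟩, u, ?_⟩
  have h1 := h.isGauge_rep ⟨Ψ y, hmem⟩
  simp only [Homeomorph.symm_apply_apply] at h1
  exact hg.unique h1

theorem surjective_cover (hs0 : s ≠ 0) : Function.Surjective h.cover := by
  intro z
  obtain ⟨ρ, rfl⟩ := surjective_conjClass s z
  obtain ⟨x, u, hx⟩ := h.exists_cover_eq hs0 ρ
  exact ⟨x, by rw [cover, ← hx, conjClass_conj]⟩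

theorem regular (h : IsStraightening s T Ψ) (hs0 : s ≠ 0) (hs : |s| < 1 / 6) (x : coverSurface) :
    Real.sin (Ψ.symm x).1 ≠ 0 ∨ Real.sin (Ψ.symm x).2.1 ≠ 0 := by
  refine sin_ne_zero_of_eq_zero hs0 (hs.trans (by norm_num)) (h.eqOne_eq_zero _) ?_
  rw [← h.mem_iff, Homeomorph.apply_symm_apply]
  exact x.2

/-- Locally, the point of the covering surface is an analytic function of the representation. -/
theorem exists_local_section (hs0 : s ≠ 0) (hs : |s| < 1 / 6) {z : PertRep s} {x : coverSurface}
    (hz : h.cover x = conjClass s z) :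
    ∃ A : (Gen → ℍ[ℝ]) → Space, ContDiffAt ℝ ω A (evalGen s z) ∧ A (evalGen s z) = x ∧
      ∀ᶠ z' in 𝓝 z, ∃ hA : A (evalGen s z') ∈ coverSurface,
        h.cover ⟨A (evalGen s z'), hA⟩ = conjClass s z' := by
  obtain ⟨u, rfl⟩ := conjClass_eq_iff.1 hz
  obtain ⟨A, hA, hA0, hA'⟩ :=
    (h.isGauge_rep x).exists_localCoord (h.cos_pos hs _) (h.regular hs0 hs x)
  have hu : ∀ ρ : PertRep s, conjAll u⁻¹ (evalGen s ρ) = evalGen s (ρ.conj u⁻¹) := fun _ => rfl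
  have hu0 : ((h.rep x).conj u).conj u⁻¹ = h.rep x := by
    rw [PertRep.conj_conj, inv_mul_cancel, PertRep.conj_one]
  refine ⟨fun v => Ψ (A (conjAll u⁻¹ v)), ?_, ?_, ?_⟩
  · refine h.contDiff.contDiffAt.comp _ (ContDiffAt.comp _ ?_ (contDiff_conjAll u⁻¹).contDiffAt)
    rw [hu, hu0]
    exact hA
  · simp only [hu, hu0, hA0, Homeomorph.apply_symm_apply]
  · have hc : Filter.Tendsto (fun z' : PertRep s => evalGen s (z'.conj u⁻¹))
        (𝓝 ((h.rep x).conj u)) (𝓝 (evalGen s (h.rep x))) := by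
      have := ((isInducing_evalGen s).continuous.comp (continuous_conj u⁻¹)).tendsto
        ((h.rep x).conj u)
      simp only [Function.comp_def, hu0] at this
      exact this
    filter_upwards [hc.eventually hA'] with z' hz'
    obtain ⟨x', v, hx'⟩ := h.exists_cover_eq hs0 z'
    have hv : z'.conj u⁻¹ = (h.rep x').conj (u⁻¹ * v⁻¹) := by
      rw [← hx', PertRep.conj_conj]
      congr 1
      group
    obtain ⟨σ, m, n, l, hd⟩ := hz' _ _ _ _ (h.isGauge_rep x') (h.cos_pos hs _)
      (congrArg (evalGen s) hv.symm)
    have he : Ψ (A (conjAll u⁻¹ (evalGen s z'))) = Earring.deck σ m n l x' := by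
      rw [hu, hd, h.deck, Homeomorph.apply_symm_apply]
    have hmem : Ψ (A (conjAll u⁻¹ (evalGen s z'))) ∈ coverSurface := by
      rw [he]
      exact deck_mem σ m n l x'.2
    refine ⟨hmem, ?_⟩
    have h2 : (⟨_, hmem⟩ : coverSurface) = coverDeck σ m n l x' := Subtype.ext he
    rw [h2, cover_coverDeck, cover, ← hx', conjClass_conj]

theorem isOpenMap_cover (hs0 : s ≠ 0) (hs : |s| < 1 / 6) : IsOpenMap h.cover := by
  intro U hU
  change IsOpen (conjClass s ⁻¹' (h.cover '' U))
  rw [isOpen_iff_mem_nhds]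
  rintro z ⟨x, hxU, hz⟩
  obtain ⟨A, hA, hA0, hA'⟩ := h.exists_local_section hs0 hs hz
  obtain ⟨V, hV, rfl⟩ := hU
  have hc : Filter.Tendsto (fun z' => A (evalGen s z')) (𝓝 z) (𝓝 x) := by
    have := hA.continuousAt.tendsto
    rw [hA0] at this
    exact this.comp (isInducing_evalGen s).continuous.continuousAt
  filter_upwards [hA', hc (hV.mem_nhds hxU)] with z' hz' hV'
  obtain ⟨h1, h2⟩ := hz'
  exact ⟨_, hV', h2⟩

theorem isSurfaceCover (hs0 : s ≠ 0) (hs : |s| < 1 / 6) : IsSurfaceCover h.cover where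
  continuous := h.continuous_cover
  isOpenMap := h.isOpenMap_cover hs0 hs
  surjective := h.surjective_cover hs0
  exists_deck x y hxy := by
    obtain ⟨u, hu⟩ := conjClass_eq_iff.1 hxy
    obtain ⟨A, -, hA0, hA'⟩ :=
      (h.isGauge_rep y).exists_localCoord (h.cos_pos hs _) (h.regular hs0 hs y)
    obtain ⟨σ, m, n, l, hd⟩ := hA'.self_of_nhds _ _ _ _ (h.isGauge_rep x) (h.cos_pos hs _)
      (congrArg (evalGen s) hu.symm)
    rw [hA0, ← h.symm_deck, Ψ.symm.injective.eq_iff] at hd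
    exact ⟨σ, m, n, l, Subtype.ext hd, h.cover_coverDeck σ m n l⟩

theorem inducesAnalyticStructure (hs0 : s ≠ 0) (hs : |s| < 1 / 6) :
    letI := (h.isSurfaceCover hs0 hs).chartedSpace
    InducesAnalyticStructure (evalGen s) (conjClass s) := by
  refine (h.isSurfaceCover hs0 hs).inducesAnalyticStructure (isInducing_evalGen s) fun z => ?_
  obtain ⟨x, u, hx⟩ := h.exists_cover_eq hs0 z
  have hz : h.cover x = conjClass s z := by rw [cover, ← hx, conjClass_conj]
  have hz' : (h.rep x).conj u⁻¹ = z := by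
    rw [← hx, PertRep.conj_conj, inv_mul_cancel, PertRep.conj_one]
  refine ⟨x, hz, h.exists_local_section hs0 hs hz,
    fun y => conjAll u⁻¹ (gaugeEval s (Ψ.symm y) (T (Ψ.symm y))),
    ((contDiff_conjAll _).comp h.contDiff_gaugeEval).contDiffAt, ?_, fun y => ?_⟩
  · change conjAll u⁻¹ (gaugeEval s (Ψ.symm x) (T (Ψ.symm x))) = _
    rw [← h.evalGen_rep, ← hz']
    rfl
  · refine ⟨(h.rep y).conj u⁻¹, ?_, conjClass_conj _ _⟩
    change _ = conjAll u⁻¹ (gaugeEval s (Ψ.symm y) (T (Ψ.symm y)))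
    rw [← h.evalGen_rep]
    rfl

end IsStraightening

/-! ### The moduli space as a quotient of the surface of genus five -/

/-- A surface covered by the surface in `ℝ³` with the full group of deck transformations is a
quotient by `ι̂`. -/
theorem IsSurfaceCover.exists_isIotaQuotient {X : Type} [TopologicalSpace X] {p : coverSurface → X}
    (hp : IsSurfaceCover p) (hd : ∀ σ m n l x, p (coverDeck σ m n l x) = p x) :
    ∃ q : genusFiveSurface → X, IsIotaQuotient q ∧ q ∘ toSurface = p := by
  obtain ⟨q, hq⟩ : ∃ q : genusFiveSurface → X, q ∘ toSurface = p := by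
    refine ⟨fun z => p (Function.surjInv toSurface_surjective z), ?_⟩
    funext x
    obtain ⟨m, n, l, h⟩ := exists_deck_of_toSurface_eq (x := x)
      (Function.surjInv_eq toSurface_surjective (toSurface x))
    change p (Function.surjInv toSurface_surjective (toSurface x)) = p x
    rw [h, hd]
  have hqx : ∀ x, q (toSurface x) = p x := fun x => congrFun hq x
  have hquot : Topology.IsQuotientMap toSurface :=
    isOpenMap_toSurface.isQuotientMap continuous_toSurface toSurface_surjective
  refine ⟨q, ⟨?_, ?_, ?_, ?_⟩, hq⟩
  · rw [hquot.continuous_iff, hq]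
    exact hp.continuous
  · intro U hU
    have h : q '' U = p '' (toSurface ⁻¹' U) := by
      rw [← hq, Set.image_comp, Set.image_preimage_eq U toSurface_surjective]
    rw [h]
    exact hp.isOpenMap _ (hU.preimage continuous_toSurface)
  · intro y
    obtain ⟨x, rfl⟩ := hp.surjective y
    exact ⟨toSurface x, hqx x⟩
  · intro z z'
    obtain ⟨x, rfl⟩ := toSurface_surjective z
    obtain ⟨x', rfl⟩ := toSurface_surjective z'
    rw [hqx, hqx]
    constructor
    · intro h
      obtain ⟨σ, m, n, l, rfl, -⟩ := hp.exists_deck x x' h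
      cases σ
      · exact Or.inr (toSurface_coverDeck_false m n l x)
      · exact Or.inl (toSurface_coverDeck_true m n l x)
    · rintro (h | h)
      · obtain ⟨m, n, l, rfl⟩ := exists_deck_of_toSurface_eq h
        rw [hd]
      · obtain ⟨m, n, l, rfl⟩ := exists_deck_of_toSurface_eq_iotaHat h
        rw [hd]

theorem IsSurfaceCover.isClosedOrientableSurface {X : Type} [TopologicalSpace X]
    {p : coverSurface → X} (hp : IsSurfaceCover p)
    (hd : ∀ σ m n l x, p (coverDeck σ m n l x) = p x) :
    letI := hp.chartedSpace
    IsClosedOrientableSurface 3 X := by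
  obtain ⟨q, hq, rfl⟩ := hp.exists_isIotaQuotient hd
  exact hq.isClosedOrientableSurface

theorem IsSurfaceCover.contMDiff_of_comp_eq {X Y : Type*} [TopologicalSpace X]
    [TopologicalSpace Y] {p : coverSurface → X} {p' : coverSurface → Y} (hp : IsSurfaceCover p)
    (hp' : IsSurfaceCover p') {f : X → Y} (hf : ∀ x, f (p x) = p' x) :
    letI := hp.chartedSpace
    letI := hp'.chartedSpace
    ContMDiff (𝓡 2) (𝓡 2) ω f := by
  let := hp.chartedSpace
  let := hp'.chartedSpace
  have := hp'.isManifold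
  intro y
  obtain ⟨x, rfl⟩ := hp.surjective y
  rw [hp.contMDiffAt_iff]
  simp only [hf]
  exact (hp'.contMDiffAt_iff (f := fun y => y) x).1 contMDiffAt_id

theorem IsSurfaceCover.exists_comp_eq {X Y : Type*} [TopologicalSpace X] {p : coverSurface → X}
    {p' : coverSurface → Y} (hp : IsSurfaceCover p)
    (hd' : ∀ σ m n l x, p' (coverDeck σ m n l x) = p' x) : ∃ f : X → Y, ∀ x, f (p x) = p' x := by
  refine ⟨fun y => p' (Function.surjInv hp.surjective y), fun x => ?_⟩
  obtain ⟨σ, m, n, l, h, -⟩ := hp.exists_deck x (Function.surjInv hp.surjective (p x))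
    (Function.surjInv_eq hp.surjective (p x)).symm
  change p' (Function.surjInv hp.surjective (p x)) = p' x
  rw [h, hd']

/-- Two quotients by the full group of deck transformations are diffeomorphic. -/
theorem IsSurfaceCover.nonempty_diffeomorph {X Y : Type*} [TopologicalSpace X]
    [TopologicalSpace Y] {p : coverSurface → X} {p' : coverSurface → Y} (hp : IsSurfaceCover p)
    (hp' : IsSurfaceCover p') (hd : ∀ σ m n l x, p (coverDeck σ m n l x) = p x)
    (hd' : ∀ σ m n l x, p' (coverDeck σ m n l x) = p' x) :
    letI := hp.chartedSpace
    letI := hp'.chartedSpace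
    Nonempty (X ≃ₘ^ω⟮𝓡 2, 𝓡 2⟯ Y) := by
  obtain ⟨f, hf⟩ := hp.exists_comp_eq hd'
  obtain ⟨g, hg⟩ := hp'.exists_comp_eq hd
  let := hp.chartedSpace
  let := hp'.chartedSpace
  refine ⟨⟨⟨f, g, ?_, ?_⟩, hp.contMDiff_of_comp_eq hp' hf, hp'.contMDiff_of_comp_eq hp hg⟩⟩
  · intro y
    obtain ⟨x, rfl⟩ := hp.surjective y
    rw [hf, hg]
  · intro y
    obtain ⟨x, rfl⟩ := hp'.surjective y
    rw [hg, hf]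

theorem genusFiveMk_toSurface_coverDeck (σ : Bool) (m n l : ℤ) (x : coverSurface) :
    (genusFiveMk ∘ toSurface) (coverDeck σ m n l x) = (genusFiveMk ∘ toSurface) x := by
  have h := isIotaQuotient_genusFiveMk.eq_iff
  cases σ
  · exact ((h _ _).2 (Or.inr (toSurface_coverDeck_false m n l x))).symm
  · exact congrArg genusFiveMk (toSurface_coverDeck_true m n l x)

/-! ### Jets of maps to `SU(2)` -/

theorem re_mul_comm (x y : ℍ[ℝ]) : (x * y).re = (y * x).re := by
  simp only [Quaternion.re_mul]
  ring

/-- The value and the derivatives in two directions of a map to `SU(2)`, the first one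
trivialised by left and the second one by right translation, and a central coordinate. -/
@[ext] structure Jet where
  /-- the value -/
  val : SU2
  /-- the first derivative -/
  fst : ℍ[ℝ]
  /-- the second derivative -/
  snd : ℍ[ℝ]
  /-- the central coordinate -/
  cen : ℝ

namespace Jet

noncomputable instance : Mul Jet :=
  ⟨fun j k => ⟨j.val * k.val, k.fst + star (k.val : ℍ[ℝ]) * j.fst * k.val,
    j.snd + j.val * k.snd * star (j.val : ℍ[ℝ]), j.cen + k.cen + (j.fst * k.snd).re⟩⟩

noncomputable instance : One Jet := ⟨⟨1, 0, 0, 0⟩⟩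

noncomputable instance : Inv Jet :=
  ⟨fun j => ⟨j.val⁻¹, -(j.val * j.fst * star (j.val : ℍ[ℝ])),
    -(star (j.val : ℍ[ℝ]) * j.snd * j.val),
    -j.cen + (j.val * j.fst * star (j.val : ℍ[ℝ]) * j.snd).re⟩⟩

@[simp] theorem mul_val (j k : Jet) : (j * k).val = j.val * k.val := rfl
@[simp] theorem mul_fst (j k : Jet) :
    (j * k).fst = k.fst + star (k.val : ℍ[ℝ]) * j.fst * k.val := rfl
@[simp] theorem mul_snd (j k : Jet) :
    (j * k).snd = j.snd + j.val * k.snd * star (j.val : ℍ[ℝ]) := rfl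
@[simp] theorem mul_cen (j k : Jet) :
    (j * k).cen = j.cen + k.cen + (j.fst * k.snd).re := rfl
@[simp] theorem one_val : (1 : Jet).val = 1 := rfl
@[simp] theorem one_fst : (1 : Jet).fst = 0 := rfl
@[simp] theorem one_snd : (1 : Jet).snd = 0 := rfl
@[simp] theorem one_cen : (1 : Jet).cen = 0 := rfl

noncomputable instance : Group Jet :=
  Group.ofLeftAxioms
    (by
      intro j k l
      ext1
      · simp [mul_assoc]
      · simp [mul_assoc, mul_add, add_mul, add_assoc]
      · simp [mul_assoc, mul_add, add_mul, add_assoc]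
      · have h := re_mul_comm (star (k.val : ℍ[ℝ])) (j.fst * k.val * l.snd)
        simp only [mul_assoc] at h
        simp only [mul_cen, mul_fst, mul_snd, mul_add, add_mul, Quaternion.re_add, mul_assoc, h]
        ring)
    (by
      intro j
      ext1 <;> simp)
    (by
      intro j
      have h1 := SU2.star_mul_self j.val
      ext1
      · exact inv_mul_cancel j.val
      · change j.fst + star (j.val : ℍ[ℝ]) * -(j.val * j.fst * star (j.val : ℍ[ℝ])) * j.val = 0
        rw [mul_neg, neg_mul, show star (j.val : ℍ[ℝ]) * (j.val * j.fst * star (j.val : ℍ[ℝ])) *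
          j.val = star (j.val : ℍ[ℝ]) * j.val * j.fst * (star (j.val : ℍ[ℝ]) * j.val) by
            simp only [mul_assoc], h1, one_mul, mul_one, add_neg_cancel]
      · change -(star (j.val : ℍ[ℝ]) * j.snd * j.val) +
          star (j.val : ℍ[ℝ]) * j.snd * star (star (j.val : ℍ[ℝ])) = 0
        rw [star_star, neg_add_cancel]
      · change -j.cen + (j.val * j.fst * star (j.val : ℍ[ℝ]) * j.snd).re + j.cen +
          (-(j.val * j.fst * star (j.val : ℍ[ℝ])) * j.snd).re = 0
        rw [neg_mul, Quaternion.re_neg]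
        ring)

/-- A central element. -/
noncomputable def central (r : ℝ) : Jet := ⟨1, 0, 0, r⟩

@[simp] theorem central_val (r : ℝ) : (central r).val = 1 := rfl
@[simp] theorem central_fst (r : ℝ) : (central r).fst = 0 := rfl
@[simp] theorem central_snd (r : ℝ) : (central r).snd = 0 := rfl
@[simp] theorem central_cen (r : ℝ) : (central r).cen = r := rfl

theorem central_mul_comm (r : ℝ) (j : Jet) : central r * j = j * central r := by
  ext1 <;> simp [add_comm]

/-- The central element of order two. -/
noncomputable def negOne : Jet := ⟨⟨-1, by simp [Unitary.mem_iff]⟩, 0, 0, 0⟩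

theorem negOne_mul_comm (j : Jet) : negOne * j = j * negOne := by
  ext1
  · apply Subtype.ext
    simp [negOne]
  all_goals simp [negOne]

theorem negOne_mul_negOne : negOne * negOne = 1 := by
  ext1
  · apply Subtype.ext
    simp [negOne]
  all_goals simp [negOne]

end Jet

/-- The algebraic relation between the central factors of the two boundary spheres. -/
theorem central_factor_sq {G : Type*} [Group G] {a b e f p q h c d z κ κ' : G}
    (hz : ∀ x, z * x = x * z) (hz2 : z * z = 1) (hκ : ∀ x, κ * x = x * κ)
    (hκ' : ∀ x, κ' * x = x * κ') (hh : h * h = z) (he : b * a = κ * (e * f))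
    (hp : p * (b * h) = b * h * p) (hq : q * (f * a⁻¹ * h) = f * a⁻¹ * h * q)
    (hc : c = q⁻¹ * p⁻¹ * b * p * q) (hd : d = h⁻¹ * a * z * h)
    (hi : c * d = κ' * (q⁻¹ * e * q * f)) : κ' * κ' = κ * κ := by
  obtain ⟨v, hv⟩ : ∃ v, v = p * q * h⁻¹ * a := ⟨_, rfl⟩
  have h1 : c * d = q⁻¹ * b * h * p⁻¹ * (h⁻¹ * v * z * h) := by
    rw [hc, hd, hv, show q⁻¹ * p⁻¹ * b * p * q * (h⁻¹ * a * z * h) =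
      q⁻¹ * (p⁻¹ * b) * (p * q * (h⁻¹ * a * z * h)) by group, relation_conj_p hp]
    group
  have h2 : κ * (q⁻¹ * e * q * f) = q⁻¹ * b * h * p⁻¹ * v := by
    rw [show κ * (q⁻¹ * e * q * f) = (κ * q⁻¹) * (e * f) * (f⁻¹ * q * f) by group,
      relation_conj_q hq, hκ, mul_assoc q⁻¹ κ, ← he, hv]
    group
  have h3 : κ * (h⁻¹ * v * z * h) = κ' * v := by
    have h4 : κ * (c * d) = κ' * (q⁻¹ * b * h * p⁻¹ * v) := by
      rw [hi, ← h2, ← mul_assoc κ κ', hκ κ', mul_assoc κ' κ]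
    rw [h1, ← mul_assoc κ, hκ, ← mul_assoc κ', hκ', mul_assoc _ κ, mul_assoc _ κ'] at h4
    exact mul_left_cancel h4
  have hzh : h⁻¹ = z * h := by
    rw [inv_eq_iff_mul_eq_one, ← mul_assoc, ← hz, mul_assoc, hh, hz2]
  have h5 : κ * (h * v * h) = κ' * v := by
    have h8 : z * h * v * z * h = h * v * h := by
      rw [show z * h * v * z * h = z * (h * v) * z * h by group, hz (h * v),
        show h * v * z * z * h = h * v * (z * z) * h by group, hz2, mul_one]
    rw [← h3, ← h8, ← hzh]
  have h6 : κ * κ * v = κ' * κ' * v := by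
    have h7 : κ * (h * (κ * (h * v * h)) * h) = κ' * (κ' * v) := by
      rw [h5, ← mul_assoc h, ← hκ', mul_assoc κ', mul_assoc κ', ← mul_assoc κ, hκ κ',
        mul_assoc κ', h5]
    rw [← mul_assoc h κ, ← hκ h] at h7
    rw [mul_assoc κ' κ' v, ← h7, show κ * (κ * h * (h * v * h) * h) =
      κ * κ * (h * h * v * (h * h)) by group, hh, hz v,
      show v * z * z = v * (z * z) by group, hz2, mul_one]
  exact (mul_right_cancel h6).symm

section IsJet

variable {E : Type*} [NormedAddCommGroup E] [NormedSpace ℝ E] {u v : E} {g g' : E → SU2}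
  {j j' k : Jet}

/-- `j` is a jet at `0` of the map `g`, for the directions `u` and `v`. -/
def IsJet (u v : E) (g : E → SU2) (j : Jet) : Prop :=
  j.val = g 0 ∧ ∃ D : E →L[ℝ] ℍ[ℝ], HasFDerivAt (fun t => (g t : ℍ[ℝ])) D 0 ∧
    D u = g 0 * j.fst ∧ D v = j.snd * g 0

theorem IsJet.congr (h : IsJet u v g j) (hg : g' =ᶠ[𝓝 0] g) : IsJet u v g' j := by
  obtain ⟨h1, D, h2, h3, h4⟩ := h
  have h0 : g' 0 = g 0 := hg.self_of_nhds
  exact ⟨h1.trans h0.symm, D, h2.congr_of_eventuallyEq (hg.fun_comp Subtype.val),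
    by rw [h0, h3], by rw [h0, h4]⟩

theorem exists_isJet (hg : DifferentiableAt ℝ (fun t => (g t : ℍ[ℝ])) 0) (r : ℝ) :
    ∃ j, IsJet u v g j ∧ j.cen = r := by
  refine ⟨⟨g 0, star (g 0 : ℍ[ℝ]) * fderiv ℝ (fun t => (g t : ℍ[ℝ])) 0 u,
    fderiv ℝ (fun t => (g t : ℍ[ℝ])) 0 v * star (g 0 : ℍ[ℝ]), r⟩, ⟨rfl, _, hg.hasFDerivAt, ?_, ?_⟩,
    rfl⟩
  · rw [← mul_assoc, SU2.mul_star_self, one_mul]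
  · rw [mul_assoc, SU2.star_mul_self, mul_one]

theorem IsJet.mul (h : IsJet u v g j) (h' : IsJet u v g' j') :
    IsJet u v (fun t => g t * g' t) (j * j') := by
  obtain ⟨h1, D, h2, h3, h4⟩ := h
  obtain ⟨h1', D', h2', h3', h4'⟩ := h'
  refine ⟨by rw [Jet.mul_val, h1, h1'], _, h2.mul' h2', ?_, ?_⟩
  · simp only [add_apply, smul_apply, smul_eq_mul,
      MulOpposite.smul_eq_mul_unop, MulOpposite.unop_op, h3,
      h3', Submonoid.coe_mul, Jet.mul_fst, h1']
    rw [mul_add, mul_assoc, mul_assoc, mul_assoc, mul_assoc, ← mul_assoc (g' 0 : ℍ[ℝ]) (star _),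
      SU2.mul_star_self, one_mul]
  · simp only [add_apply, smul_apply, smul_eq_mul,
      MulOpposite.smul_eq_mul_unop, MulOpposite.unop_op, h4, h4', Submonoid.coe_mul, Jet.mul_snd,
      h1]
    rw [add_mul, add_comm]
    simp only [mul_assoc]
    rw [← mul_assoc (star _) (g 0 : ℍ[ℝ]), SU2.star_mul_self, one_mul]

theorem IsJet.exists_central (h : IsJet u v g j) (h' : IsJet u v g j') :
    ∃ r, j' = Jet.central r * j := by
  obtain ⟨h1, D, h2, h3, h4⟩ := h
  obtain ⟨h1', D', h2', h3', h4'⟩ := h'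
  obtain rfl := h2.unique h2'
  refine ⟨j'.cen - j.cen, ?_⟩
  ext1
  · simp [h1, h1']
  · have h5 : star (g 0 : ℍ[ℝ]) * (g 0 * j'.fst) = star (g 0 : ℍ[ℝ]) * (g 0 * j.fst) := by
      rw [← h3, ← h3']
    rw [← mul_assoc, ← mul_assoc, SU2.star_mul_self, one_mul, one_mul] at h5
    simp [h5]
  · have h5 : j'.snd * g 0 * star (g 0 : ℍ[ℝ]) = j.snd * g 0 * star (g 0 : ℍ[ℝ]) := by
      rw [← h4, ← h4']
    rw [mul_assoc, mul_assoc, SU2.mul_star_self, mul_one, mul_one] at h5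
    simp [h5]
  · simp

theorem IsJet.central_mul (h : IsJet u v g j) (r : ℝ) : IsJet u v g (Jet.central r * j) := by
  obtain ⟨h1, D, h2, h3, h4⟩ := h
  exact ⟨by simp [h1], D, h2, by simp [h3], by simp [h4]⟩

theorem isJet_const (x : SU2) (r : ℝ) : IsJet u v (fun _ => x) ⟨x, 0, 0, r⟩ :=
  ⟨rfl, 0, hasFDerivAt_const _ _, by simp, by simp⟩

theorem IsJet.inv (h : IsJet u v g j) : IsJet u v (fun t => (g t)⁻¹) j⁻¹ := by
  have hd : DifferentiableAt ℝ (fun t => (((g t)⁻¹ : SU2) : ℍ[ℝ])) 0 := by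
    obtain ⟨-, D, h2, -⟩ := h
    exact ((contDiff_starQuaternion (n := 1)).differentiable (by simp)).differentiableAt.comp
      (0 : E) h2.differentiableAt
  obtain ⟨k, hk, -⟩ := exists_isJet (u := u) (v := v) hd 0
  have h1 := (hk.mul h).congr (g' := fun _ => 1)
    (Filter.Eventually.of_forall fun t => (inv_mul_cancel (g t)).symm)
  obtain ⟨r, hr⟩ := h1.exists_central (isJet_const 1 0)
  have h2 : j⁻¹ = Jet.central r * k := by
    have h3 : (1 : Jet) = Jet.central r * (k * j) := hr
    rw [← mul_assoc] at h3
    exact inv_eq_of_mul_eq_one_left h3.symm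
  rw [h2]
  exact hk.central_mul r

end IsJet

/-! ### The symplectic form as a central factor -/

section Isotropy

variable {E : Type*} [NormedAddCommGroup E] [NormedSpace ℝ E] {u v : E} {g g' : E → SU2}
  {j j' k : Jet}

theorem SU2.re_star_mul_fderiv {D : E →L[ℝ] ℍ[ℝ]}
    (h : HasFDerivAt (fun t => (g t : ℍ[ℝ])) D 0) (u : E) : (star (g 0 : ℍ[ℝ]) * D u).re = 0 := by
  have h1 := h.norm_sq
  have h2 : (fun t => ‖(g t : ℍ[ℝ])‖ ^ 2) = fun _ => 1 := by
    funext t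
    rw [SU2.norm_coe, one_pow]
  rw [h2] at h1
  have h3 := congrArg (fun L : E →L[ℝ] ℝ => L u) (h1.unique (hasFDerivAt_const (1 : ℝ) (0 : E)))
  simp [Quaternion.inner_def] at h3
  simp only [Quaternion.re_mul, Quaternion.re_star, Quaternion.imI_star, Quaternion.imJ_star,
    Quaternion.imK_star] at h3 ⊢
  linarith

theorem IsJet.re_fst (h : IsJet u v g j) : j.fst.re = 0 := by
  obtain ⟨-, D, h2, h3, -⟩ := h
  have h4 := SU2.re_star_mul_fderiv h2 u
  rwa [h3, ← mul_assoc, SU2.star_mul_self, one_mul] at h4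

theorem IsJet.re_snd (h : IsJet u v g j) : j.snd.re = 0 := by
  obtain ⟨-, D, h2, -, h3⟩ := h
  have h4 := SU2.re_star_mul_fderiv h2 v
  rwa [h3, re_mul_comm, mul_assoc, SU2.mul_star_self, mul_one] at h4

theorem Jet.central_mul_central (r r' : ℝ) : central r * central r' = central (r + r') := by
  ext1 <;> simp

theorem isJet_negOne : IsJet u v (fun _ => Jet.negOne.val) Jet.negOne := isJet_const _ _

theorem SU2.mul_self_eq {x : SU2} (hx : (x : ℍ[ℝ]).re = 0) : x * x = Jet.negOne.val := by
  have h := SU2.coe_inv_of_re hx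
  have h1 : ((x * x⁻¹ : SU2) : ℍ[ℝ]) = 1 := by rw [mul_inv_cancel]; rfl
  rw [Submonoid.coe_mul, h] at h1
  apply Subtype.ext
  change (x : ℍ[ℝ]) * x = -1
  rw [← h1, mul_neg, neg_neg]

/-- A family of imaginary unit quaternions has a jet whose square is central of order two. -/
theorem exists_isJet_sq (hg : DifferentiableAt ℝ (fun t => (g t : ℍ[ℝ])) 0)
    (hre : ∀ᶠ t in 𝓝 0, (g t : ℍ[ℝ]).re = 0) : ∃ j, IsJet u v g j ∧ j * j = Jet.negOne := by
  obtain ⟨j, hj, -⟩ := exists_isJet (u := u) (v := v) hg 0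
  have h1 : IsJet u v (fun _ => Jet.negOne.val) (j * j) :=
    (hj.mul hj).congr (hre.mono fun t ht => (SU2.mul_self_eq ht).symm)
  obtain ⟨r, hr⟩ := h1.exists_central isJet_negOne
  refine ⟨Jet.central (r / 2) * j, hj.central_mul _, ?_⟩
  rw [hr, mul_assoc, ← mul_assoc j, ← Jet.central_mul_comm, mul_assoc, ← mul_assoc,
    Jet.central_mul_central, add_halves]

theorem IsJet.eq_of_sq (h : IsJet u v g j) (h' : IsJet u v g j') (hj : j * j = j' * j') :
    j' = j := by
  obtain ⟨r, rfl⟩ := h.exists_central h'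
  rw [mul_assoc, ← mul_assoc j, ← Jet.central_mul_comm, mul_assoc, ← mul_assoc,
    Jet.central_mul_central] at hj
  have h1 := congrArg Jet.cen hj
  simp only [Jet.mul_cen, Jet.central_cen, Jet.central_fst, zero_mul, Quaternion.re_zero] at h1
  obtain rfl : r = 0 := by linarith
  ext1 <;> simp

/-- The real part as a continuous linear map. -/
noncomputable def reLinear : ℍ[ℝ] →L[ℝ] ℝ := innerSL ℝ 1

@[simp] theorem reLinear_apply (x : ℍ[ℝ]) : reLinear x = x.re := by
  simp [reLinear, Quaternion.inner_def]

/-- Jets of two commuting families, one of which is a function of the other, commute. -/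
theorem IsJet.commute_of_eq {l p : Jet} {φ ψ : ℝ → ℝ} (hp : IsJet u v g' p) (hl : IsJet u v g l)
    (hφ : Differentiable ℝ φ) (hψ : Differentiable ℝ ψ)
    (h : ∀ t, (g' t : ℍ[ℝ]) = (φ (g t : ℍ[ℝ]).re : ℍ[ℝ]) + ψ (g t : ℍ[ℝ]).re • (g t : ℍ[ℝ])) :
    p * l = l * p := by
  have hxre := hl.re_fst
  have hyre := hl.re_snd
  have hc : ∀ t, g' t * g t = g t * g' t := fun t => by
    apply Subtype.ext
    rw [Submonoid.coe_mul, Submonoid.coe_mul, h, add_mul, mul_add, Quaternion.coe_commutes,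
      smul_mul_assoc, mul_smul_comm]
  obtain ⟨r, hr⟩ := ((hl.mul hp).congr (g' := fun t => g' t * g t)
    (Filter.Eventually.of_forall hc)).exists_central (hp.mul hl)
  obtain ⟨hl1, D, hl2, hl3, hl4⟩ := hl
  obtain ⟨hp1, D', hp2, hp3, hp4⟩ := hp
  have hre : HasFDerivAt (fun t => (g t : ℍ[ℝ]).re) (reLinear.comp D) 0 := by
    have := reLinear.hasFDerivAt.comp (0 : E) hl2
    simpa only [Function.comp_def, reLinear_apply] using this
  have h1 := (hφ (g 0 : ℍ[ℝ]).re).hasDerivAt.comp_hasFDerivAt (0 : E) hre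
  have h2 := (hψ (g 0 : ℍ[ℝ]).re).hasDerivAt.comp_hasFDerivAt (0 : E) hre
  have h3 := (h1.smul_const (1 : ℍ[ℝ])).add (h2.smul hl2)
  have hd := h3.congr_of_eventuallyEq (f₁ := fun t => (g' t : ℍ[ℝ]))
    (Filter.Eventually.of_forall fun t => by
      simp only [Function.comp_apply, Pi.add_apply, h]
      congr 1
      rw [← Quaternion.coe_one, Quaternion.smul_coe, mul_one])
  obtain rfl := hp2.unique hd
  have hpx : p.fst = star (g' 0 : ℍ[ℝ]) * (g' 0 * p.fst) := by
    rw [← mul_assoc, SU2.star_mul_self, one_mul]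
  have hpy : p.snd = p.snd * g' 0 * star (g' 0 : ℍ[ℝ]) := by
    rw [mul_assoc, SU2.mul_star_self, mul_one]
  rw [← hp3] at hpx
  rw [← hp4] at hpy
  simp only [add_apply, smul_apply, ContinuousLinearMap.smulRight_apply, Function.comp_apply,
    ContinuousLinearMap.comp_apply, reLinear_apply, hl3, hl4, h] at hpx hpy
  generalize deriv φ (g 0 : ℍ[ℝ]).re = φ' at hpx hpy
  generalize deriv ψ (g 0 : ℍ[ℝ]).re = ψ' at hpx hpy
  generalize φ (g 0 : ℍ[ℝ]).re = φ₀ at hpx hpy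
  generalize ψ (g 0 : ℍ[ℝ]).re = ψ₀ at hpx hpy
  have hcen := congrArg Jet.cen hr
  simp only [Jet.mul_cen, Jet.central_cen, Jet.central_fst, zero_mul, Quaternion.re_zero] at hcen
  have hr0 : r = 0 := by
    have h5 : r = (p.fst * l.snd).re - (l.fst * p.snd).re := by linarith
    rw [h5, hpx, hpy]
    generalize (g 0 : ℍ[ℝ]) = q at *
    simp [Quaternion.re_mul, Quaternion.imI_mul, Quaternion.imJ_mul, Quaternion.imK_mul, hxre, hyre]
    ring
  rw [hr, hr0]
  ext1 <;> simp

theorem hasFDerivAt_unitIJ {γ : E → ℝ} {L : E →L[ℝ] ℝ} (h : HasFDerivAt γ L 0) :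
    HasFDerivAt (fun t => (unitIJ (γ t) : ℍ[ℝ]))
      (L.smulRight (quat 0 (-Real.sin (γ 0)) (Real.cos (γ 0)) 0)) 0 := by
  have h1 := (h.cos.smul_const (quat 0 1 0 0)).add (h.sin.smul_const (quat 0 0 1 0))
  refine (h1.congr_fderiv ?_).congr_of_eventuallyEq (Filter.Eventually.of_forall fun t => ?_)
  · ext x <;> simp <;> ring
  · ext <;> simp [unitIJ]

/-- The canonical jet of `unitIJ`. -/
theorem isJet_unitIJ {γ : E → ℝ} {L : E →L[ℝ] ℝ} (h : HasFDerivAt γ L 0) :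
    IsJet u v (fun t => unitIJ (γ t))
      ⟨unitIJ (γ 0), quat 0 0 0 (-L u), quat 0 0 0 (L v), -(L u * L v) / 2⟩ := by
  refine ⟨rfl, _, hasFDerivAt_unitIJ h, ?_, ?_⟩ <;>
  · ext <;> simp [unitIJ, Quaternion.re_mul, Quaternion.imI_mul, Quaternion.imJ_mul,
      Quaternion.imK_mul] <;> ring

theorem unitIJ_sq (t x y : ℝ) :
    (⟨unitIJ t, quat 0 0 0 (-x), quat 0 0 0 y, -(x * y) / 2⟩ : Jet) *
      ⟨unitIJ t, quat 0 0 0 (-x), quat 0 0 0 y, -(x * y) / 2⟩ = Jet.negOne := by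
  ext1
  · exact SU2.mul_self_eq rfl
  · ext <;> simp [unitIJ, Jet.negOne, Quaternion.re_mul, Quaternion.imI_mul, Quaternion.imJ_mul,
      Quaternion.imK_mul]
    · ring
    · linear_combination x * Real.sin_sq_add_cos_sq t
  · ext <;> simp [unitIJ, Jet.negOne, Quaternion.re_mul, Quaternion.imI_mul, Quaternion.imJ_mul,
      Quaternion.imK_mul]
    · ring
    · linear_combination (-y) * Real.sin_sq_add_cos_sq t
  · simp [Jet.negOne, Quaternion.re_mul]

theorem unitIJ_mul_unitI_mul_inv (s t : ℝ) : unitIJ s * unitI * (unitIJ t)⁻¹ = unitIJ (s + t) := by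
  apply Subtype.ext
  ext <;> simp [unitIJ, unitI, SU2.coe_inv, Quaternion.re_mul, Quaternion.imI_mul,
    Quaternion.imJ_mul, Quaternion.imK_mul, Real.cos_add, Real.sin_add]
  ring

/-- The symplectic form of the pillowcase is the central factor of the relation of the
four-punctured sphere. -/
theorem coordinate_factor {A B C F V : E → SU2} {a b c f : Jet} {γ θ : E → ℝ}
    {L M : E →L[ℝ] ℝ} (ha : IsJet u v A a) (hb : IsJet u v B b) (hc : IsJet u v C c)
    (hf : IsJet u v F f) (ha2 : a * a = Jet.negOne) (hb2 : b * b = Jet.negOne)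
    (hc2 : c * c = Jet.negOne) (hf2 : f * f = Jet.negOne)
    (hV : DifferentiableAt ℝ (fun t => (V t : ℍ[ℝ])) 0) (hγ : HasFDerivAt γ L 0)
    (hθ : HasFDerivAt θ M 0) (hVA : ∀ᶠ t in 𝓝 0, V t * A t * (V t)⁻¹ = unitI)
    (hVB : ∀ᶠ t in 𝓝 0, V t * B t * (V t)⁻¹ = unitIJ (γ t))
    (hVF : ∀ᶠ t in 𝓝 0, V t * F t * (V t)⁻¹ = unitIJ (θ t))
    (hrel : ∀ᶠ t in 𝓝 0, B t * A t = C t * F t) :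
    b * a = Jet.central ((M u * L v - L u * M v) / 2) * (c * f) := by
  obtain ⟨k, hk, -⟩ := exists_isJet (u := u) (v := v) hV 0
  have hsq : ∀ j : Jet, j * j = Jet.negOne → k * j * k⁻¹ * (k * j * k⁻¹) = Jet.negOne := by
    intro j hj
    rw [show k * j * k⁻¹ * (k * j * k⁻¹) = k * (j * j) * k⁻¹ by group, hj, ← Jet.negOne_mul_comm,
      mul_assoc, mul_inv_cancel, mul_one]
  have hconj : ∀ {G : E → SU2} {j : Jet} {α : E → ℝ} {N : E →L[ℝ] ℝ}, IsJet u v G j →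
      j * j = Jet.negOne → HasFDerivAt α N 0 →
      (∀ᶠ t in 𝓝 0, V t * G t * (V t)⁻¹ = unitIJ (α t)) → k * j * k⁻¹ =
      ⟨unitIJ (α 0), quat 0 0 0 (-N u), quat 0 0 0 (N v), -(N u * N v) / 2⟩ := by
    intro G j α N hj hj2 hα hG
    refine (isJet_unitIJ hα).eq_of_sq (((hk.mul hj).mul hk.inv).congr ?_) ?_
    · exact hG.mono fun t ht => ht.symm
    · rw [hsq j hj2, unitIJ_sq]
  have h0 : unitI = unitIJ 0 := by
    apply Subtype.ext
    ext <;> simp [unitI, unitIJ]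
  have h1 := hconj ha ha2 (hasFDerivAt_const (0 : ℝ) (0 : E)) (hVA.mono fun t ht => ht.trans h0)
  have h2 := hconj hb hb2 hγ hVB
  have h3 := hconj hf hf2 hθ hVF
  have h4 := hconj hc hc2 (hγ.add hθ) (by
    filter_upwards [hVA, hVB, hVF, hrel] with t h1 h2 h3 h4
    rw [Pi.add_apply, ← unitIJ_mul_unitI_mul_inv, ← h1, ← h2, ← h3, eq_mul_inv_of_mul_eq h4.symm]
    group)
  have key : k * b * k⁻¹ * (k * a * k⁻¹) = Jet.central ((M u * L v - L u * M v) / 2) *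
      (k * c * k⁻¹ * (k * f * k⁻¹)) := by
    rw [h1, h2, h3, h4]
    ext1
    · simp only [Jet.mul_val, Jet.central_val, one_mul, ← h0, Pi.add_apply]
      rw [← unitIJ_mul_unitI_mul_inv, inv_mul_cancel_right]
    · ext <;> simp [unitIJ, Quaternion.re_mul, Quaternion.imI_mul, Quaternion.imJ_mul,
        Quaternion.imK_mul]
      · ring
      · linear_combination (-(L u + M u)) * Real.sin_sq_add_cos_sq (θ 0)
    · ext <;> simp [unitIJ, Quaternion.re_mul, Quaternion.imI_mul, Quaternion.imJ_mul,
        Quaternion.imK_mul]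
      · ring
      · linear_combination (M v) * Real.sin_sq_add_cos_sq (γ 0 + θ 0)
    · simp [Quaternion.re_mul]
      ring
  have key' : k * (b * a) * k⁻¹ = k * (Jet.central ((M u * L v - L u * M v) / 2) * (c * f)) *
      k⁻¹ := by
    rw [← mul_assoc k (Jet.central _), ← Jet.central_mul_comm,
      show k * (b * a) * k⁻¹ = k * b * k⁻¹ * (k * a * k⁻¹) by group, key]
    group
  exact mul_left_cancel (mul_right_cancel key')

/-- The restrictions of a family of perturbed representations to the two boundary spheres pull
back the symplectic form to the same form. -/
theorem isotropy_of_family {A B C F H P Q V : E → SU2} {s : ℝ} {γ θ γ' θ' : E → ℝ}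
    {L M L' M' : E →L[ℝ] ℝ}
    (hB : DifferentiableAt ℝ (fun t => (B t : ℍ[ℝ])) 0)
    (hF : DifferentiableAt ℝ (fun t => (F t : ℍ[ℝ])) 0)
    (hH : DifferentiableAt ℝ (fun t => (H t : ℍ[ℝ])) 0)
    (hP : DifferentiableAt ℝ (fun t => (P t : ℍ[ℝ])) 0)
    (hQ : DifferentiableAt ℝ (fun t => (Q t : ℍ[ℝ])) 0)
    (hV : DifferentiableAt ℝ (fun t => (V t : ℍ[ℝ])) 0)
    (hγ : HasFDerivAt γ L 0) (hθ : HasFDerivAt θ M 0)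
    (hγ' : HasFDerivAt γ' L' 0) (hθ' : HasFDerivAt θ' M' 0)
    (hA : ∀ t, A t = unitI) (hBγ : ∀ t, B t = unitIJ (γ t)) (hFθ : ∀ t, F t = unitIJ (θ t))
    (hHre : ∀ t, (H t : ℍ[ℝ]).re = 0) (hrel : ∀ t, B t * A t = C t * F t)
    (hPexp : ∀ t, (P t : ℍ[ℝ]) = NormedSpace.exp (s • ((B t * H t : SU2) : ℍ[ℝ]).im))
    (hQexp : ∀ t, (Q t : ℍ[ℝ]) = NormedSpace.exp (s • ((F t * (A t)⁻¹ * H t : SU2) : ℍ[ℝ]).im))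
    (hrel' : ∀ t, (Q t)⁻¹ * (P t)⁻¹ * B t * P t * Q t *
      ((H t)⁻¹ * A t * Jet.negOne.val * H t) = (Q t)⁻¹ * C t * Q t * F t)
    (hVA : ∀ᶠ t in 𝓝 0, V t * ((H t)⁻¹ * A t * Jet.negOne.val * H t) * (V t)⁻¹ = unitI)
    (hVB : ∀ᶠ t in 𝓝 0, V t * ((Q t)⁻¹ * (P t)⁻¹ * B t * P t * Q t) * (V t)⁻¹ = unitIJ (γ' t))
    (hVF : ∀ᶠ t in 𝓝 0, V t * F t * (V t)⁻¹ = unitIJ (θ' t)) :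
    M' u * L' v - L' u * M' v = M u * L v - L u * M v := by
  have hAd : DifferentiableAt ℝ (fun t => (A t : ℍ[ℝ])) 0 := by
    simp only [hA]
    exact differentiableAt_const _
  have hC : ∀ t, C t = unitIJ (γ t + θ t) := fun t => by
    rw [← unitIJ_mul_unitI_mul_inv, ← hA t, ← hBγ, ← hFθ, hrel, mul_inv_cancel_right]
  have hCd : DifferentiableAt ℝ (fun t => (C t : ℍ[ℝ])) 0 := by
    simp only [hC]
    exact (hasFDerivAt_unitIJ (hγ.add hθ)).differentiableAt
  obtain ⟨a, ha, ha2⟩ := exists_isJet_sq (u := u) (v := v) hAd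
    (Filter.Eventually.of_forall fun t => by rw [hA]; rfl)
  obtain ⟨b, hb, hb2⟩ := exists_isJet_sq (u := u) (v := v) hB
    (Filter.Eventually.of_forall fun t => by rw [hBγ]; rfl)
  obtain ⟨c, hc, hc2⟩ := exists_isJet_sq (u := u) (v := v) hCd
    (Filter.Eventually.of_forall fun t => by rw [hC]; rfl)
  obtain ⟨f, hf, hf2⟩ := exists_isJet_sq (u := u) (v := v) hF
    (Filter.Eventually.of_forall fun t => by rw [hFθ]; rfl)
  obtain ⟨h, hh, hh2⟩ := exists_isJet_sq (u := u) (v := v) hH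
    (Filter.Eventually.of_forall hHre)
  obtain ⟨p, hp, -⟩ := exists_isJet (u := u) (v := v) hP 0
  obtain ⟨q, hq, -⟩ := exists_isJet (u := u) (v := v) hQ 0
  have hexp : ∀ {X Y : E → SU2} {x y : Jet}, IsJet u v X x → IsJet u v Y y →
      (∀ t, (X t : ℍ[ℝ]) = NormedSpace.exp (s • (Y t : ℍ[ℝ]).im)) → x * y = y * x := by
    intro X Y x y hx hy hXY
    refine hx.commute_of_eq hy
      (φ := fun β => cosSq (s ^ 2 * (1 - β ^ 2)) - s * sincSq (s ^ 2 * (1 - β ^ 2)) * β)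
      (ψ := fun β => s * sincSq (s ^ 2 * (1 - β ^ 2))) ?_ ?_ fun t => ?_
    · exact ContDiff.differentiable (n := 1) (by fun_prop) (by simp)
    · exact ContDiff.differentiable (n := 1) (by fun_prop) (by simp)
    · have hn : ‖(Y t : ℍ[ℝ]).im‖ ^ 2 = 1 - (Y t : ℍ[ℝ]).re ^ 2 := by
        have h1 := SU2.normSq_eq (Y t)
        rw [sq, ← Quaternion.normSq_eq_norm_mul_self, Quaternion.normSq_def']
        simp only [Quaternion.re_im, Quaternion.imI_im, Quaternion.imJ_im, Quaternion.imK_im]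
        linarith
      rw [hXY, exp_smul_of_re_eq_zero s (Quaternion.re_im _), hn]
      ext <;> simp
  have hpc := hexp hp (hb.mul hh) hPexp
  have hqc := hexp hq ((hf.mul ha.inv).mul hh) hQexp
  have hz := Jet.negOne_mul_comm
  have sq_conj : ∀ x y : Jet, y * y = Jet.negOne → x⁻¹ * y * x * (x⁻¹ * y * x) = Jet.negOne := by
    intro x y hy
    rw [show x⁻¹ * y * x * (x⁻¹ * y * x) = x⁻¹ * (y * y) * x by group, hy, ← hz, mul_assoc,
      inv_mul_cancel, mul_one]
  have h1 := coordinate_factor ha hb hc hf ha2 hb2 hc2 hf2 (V := fun _ => 1)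
    (differentiableAt_const _) hγ hθ
    (Filter.Eventually.of_forall fun t => by rw [one_mul, inv_one, mul_one, hA])
    (Filter.Eventually.of_forall fun t => by rw [one_mul, inv_one, mul_one, hBγ])
    (Filter.Eventually.of_forall fun t => by rw [one_mul, inv_one, mul_one, hFθ])
    (Filter.Eventually.of_forall hrel)
  have h2 := coordinate_factor (((hh.inv.mul ha).mul isJet_negOne).mul hh)
    ((((hq.inv.mul hp.inv).mul hb).mul hp).mul hq) ((hq.inv.mul hc).mul hq) hf
    (by rw [← hz (h⁻¹ * a), mul_assoc Jet.negOne, mul_assoc Jet.negOne, ← mul_assoc _ Jet.negOne,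
          ← hz, mul_assoc Jet.negOne, ← mul_assoc Jet.negOne, Jet.negOne_mul_negOne, one_mul,
          sq_conj h a ha2])
    (by rw [← mul_inv_rev, mul_assoc _ p q]; exact sq_conj _ _ hb2) (sq_conj _ _ hc2) hf2
    hV hγ' hθ' hVA hVB hVF (Filter.Eventually.of_forall hrel')
  have h3 := central_factor_sq hz Jet.negOne_mul_negOne (Jet.central_mul_comm _)
    (Jet.central_mul_comm _) hh2 h1 hpc hqc rfl rfl h2
  rw [Jet.central_mul_central, Jet.central_mul_central] at h3
  have h4 := congrArg Jet.cen h3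
  simp only [Jet.central_cen] at h4
  linarith

end Isotropy

/-! ### Moving frames of coplanar families -/

open scoped Classical in
/-- The unit quaternion in the direction of a quaternion. -/
noncomputable def SU2.normalize (x : ℍ[ℝ]) : SU2 :=
  if hx : x = 0 then 1 else ⟨‖x‖⁻¹ • x, by
    have hn : Quaternion.normSq (‖x‖⁻¹ • x) = 1 := by
      rw [Quaternion.normSq_eq_norm_mul_self, norm_smul, norm_inv, norm_norm,
        inv_mul_cancel₀ (norm_ne_zero_iff.2 hx), one_mul]
    rw [Unitary.mem_iff, Quaternion.star_mul_self, Quaternion.self_mul_star, hn]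
    simp⟩

theorem SU2.coe_normalize {x : ℍ[ℝ]} (hx : x ≠ 0) :
    (SU2.normalize x : ℍ[ℝ]) = ‖x‖⁻¹ • x := by
  rw [SU2.normalize, dif_neg hx]

section Frame

variable {E : Type*} [NormedAddCommGroup E] [NormedSpace ℝ E] {n : WithTop ℕ∞}

theorem contDiffAt_normalize {x : E → ℍ[ℝ]} {t₀ : E} (hx : ContDiffAt ℝ n x t₀) (h0 : x t₀ ≠ 0) :
    ContDiffAt ℝ n (fun t => (SU2.normalize (x t) : ℍ[ℝ])) t₀ := by
  have h1 : ContDiffAt ℝ n (fun t => ‖x t‖⁻¹ • x t) t₀ :=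
    ((hx.norm ℝ h0).inv (norm_ne_zero_iff.2 h0)).smul hx
  refine h1.congr_of_eventuallyEq ?_
  filter_upwards [hx.continuousAt.eventually_ne h0] with t ht
  exact SU2.coe_normalize ht

theorem SU2.normalize_conj {x z y : ℍ[ℝ]} {g : SU2} (hx : x ≠ 0) (hg : (g : ℍ[ℝ]) = z)
    (h : x * z = y * x) :
    ((SU2.normalize x * g * (SU2.normalize x)⁻¹ : SU2) : ℍ[ℝ]) = y := by
  refine SU2.conj_eq_of_mul_eq ?_
  rw [SU2.coe_normalize hx, hg, smul_mul_assoc, mul_smul_comm, h]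

theorem contDiffAt_re {x : E → ℍ[ℝ]} {t₀ : E} (hx : ContDiffAt ℝ n x t₀) :
    ContDiffAt ℝ n (fun t => (x t).re) t₀ :=
  contDiff_quaternion_re.contDiffAt.comp t₀ hx

theorem contDiffAt_im {x : E → ℍ[ℝ]} {t₀ : E} (hx : ContDiffAt ℝ n x t₀) :
    ContDiffAt ℝ n (fun t => (x t).im) t₀ := by
  have h : (fun t => (x t).im) = fun t => x t - (x t).re • (1 : ℍ[ℝ]) := by
    funext t
    ext <;> simp
  rw [h]
  exact hx.sub ((contDiffAt_re hx).smul contDiffAt_const)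

/-- The quaternion that conjugates the frame `D, N D, N` to the standard one. -/
noncomputable def frameQuat (D N : ℍ[ℝ]) : ℍ[ℝ] :=
  1 - quat 0 1 0 0 * D - quat 0 0 1 0 * (N * D) - quat 0 0 0 1 * N

theorem frameQuat_mul_fst {D N : ℍ[ℝ]} (hD : D * D = -1) :
    frameQuat D N * D = quat 0 1 0 0 * frameQuat D N := by
  have e1 : quat 0 1 0 0 * quat 0 1 0 0 = -1 := by
    ext <;> simp [Quaternion.re_mul, Quaternion.imI_mul, Quaternion.imJ_mul, Quaternion.imK_mul]
  have e2 : quat 0 1 0 0 * quat 0 0 1 0 = quat 0 0 0 1 := by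
    ext <;> simp [Quaternion.re_mul, Quaternion.imI_mul, Quaternion.imJ_mul, Quaternion.imK_mul]
  have e3 : quat 0 1 0 0 * quat 0 0 0 1 = -quat 0 0 1 0 := by
    ext <;> simp [Quaternion.re_mul, Quaternion.imI_mul, Quaternion.imJ_mul, Quaternion.imK_mul]
  simp only [frameQuat, sub_mul, mul_sub, one_mul, mul_one, mul_assoc, hD]
  simp only [← mul_assoc (quat _ _ _ _) (quat _ _ _ _), e1, e2, e3]
  simp only [mul_neg, neg_mul, mul_one, one_mul]
  abel

theorem frameQuat_mul_snd {D N : ℍ[ℝ]} (hN : N * N = -1)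
    (hDN : D * N = -(N * D)) :
    frameQuat D N * N = quat 0 0 0 1 * frameQuat D N := by
  have e1 : quat 0 0 0 1 * quat 0 1 0 0 = quat 0 0 1 0 := by
    ext <;> simp [Quaternion.re_mul, Quaternion.imI_mul, Quaternion.imJ_mul, Quaternion.imK_mul]
  have e2 : quat 0 0 0 1 * quat 0 0 1 0 = -quat 0 1 0 0 := by
    ext <;> simp [Quaternion.re_mul, Quaternion.imI_mul, Quaternion.imJ_mul, Quaternion.imK_mul]
  have e3 : quat 0 0 0 1 * quat 0 0 0 1 = -1 := by
    ext <;> simp [Quaternion.re_mul, Quaternion.imI_mul, Quaternion.imJ_mul, Quaternion.imK_mul]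
  simp only [frameQuat, sub_mul, mul_sub, one_mul, mul_one, mul_assoc, hN, hDN]
  simp only [← mul_assoc (quat _ _ _ _) (quat _ _ _ _), e1, e2, e3]
  simp only [mul_neg, neg_mul, mul_one, one_mul, ← mul_assoc N N, hN]
  abel

theorem frameQuat_self : frameQuat (unitI : ℍ[ℝ]) (quat 0 0 0 1) = quat 4 0 0 0 := by
  ext <;> simp [frameQuat, unitI, Quaternion.re_mul, Quaternion.imI_mul, Quaternion.imJ_mul,
    Quaternion.imK_mul]
  norm_num

theorem sq_eq_neg_one_of_re {x : ℍ[ℝ]} (hx : x.re = 0) (hn : ‖x‖ = 1) : x * x = -1 := by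
  have h1 := Quaternion.normSq_eq_norm_mul_self x
  rw [hn, Quaternion.normSq_def', hx] at h1
  ext <;> simp [Quaternion.re_mul, Quaternion.imI_mul, Quaternion.imJ_mul, Quaternion.imK_mul, hx]
  · linarith
  all_goals ring

/-- The quaternion `𝐤` as an element of `SU(2)`. -/
noncomputable def unitK : SU2 := SU2.mk 0 0 0 1 (by norm_num)

theorem exists_moving_frame_of_standard {D C F : E → SU2} {γ θ : ℝ}
    (hD : ContDiffAt ℝ ω (fun t => (D t : ℍ[ℝ])) 0) (hC : ContDiffAt ℝ ω (fun t => (C t : ℍ[ℝ])) 0)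
    (hF : ContDiffAt ℝ ω (fun t => (F t : ℍ[ℝ])) 0) (hDre : ∀ t, (D t : ℍ[ℝ]).re = 0)
    (hCre : ∀ t, (C t : ℍ[ℝ]).re = 0) (hFre : ∀ t, (F t : ℍ[ℝ]).re = 0)
    (hrel : ∀ t, ((C t * D t * F t : SU2) : ℍ[ℝ]).re = 0) (hD0 : D 0 = unitI)
    (hC0 : C 0 = unitIJ γ) (hF0 : F 0 = unitIJ θ) (hreg : Real.sin γ ≠ 0 ∨ Real.sin θ ≠ 0) :
    ∃ V : E → SU2, ∃ γ' θ' : E → ℝ, ContDiffAt ℝ ω (fun t => (V t : ℍ[ℝ])) 0 ∧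
      ContDiffAt ℝ ω γ' 0 ∧ ContDiffAt ℝ ω θ' 0 ∧ γ' 0 = γ ∧ θ' 0 = θ ∧
      ∀ᶠ t in 𝓝 0, V t * D t * (V t)⁻¹ = unitI ∧ V t * C t * (V t)⁻¹ = unitIJ (γ' t) ∧
        V t * F t * (V t)⁻¹ = unitIJ (θ' t) := by
  have hpos : 0 < Real.sin γ ^ 2 + Real.sin θ ^ 2 := by
    rcases hreg with h | h
    · nlinarith [sq_nonneg (Real.sin θ), mul_self_pos.2 h]
    · nlinarith [sq_nonneg (Real.sin γ), mul_self_pos.2 h]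
  obtain ⟨α, β, hαβ⟩ : ∃ α β, α * Real.sin γ + β * Real.sin θ = 1 :=
    ⟨Real.sin γ / (Real.sin γ ^ 2 + Real.sin θ ^ 2), Real.sin θ / (Real.sin γ ^ 2 + Real.sin θ ^ 2),
      by field_simp⟩
  obtain ⟨M, hM⟩ : ∃ M : E → ℍ[ℝ], M = fun t => α • ((D t : ℍ[ℝ]) * C t).im +
    β • ((D t : ℍ[ℝ]) * F t).im := ⟨_, rfl⟩
  have hMd : ContDiffAt ℝ ω M 0 := by
    rw [hM]
    exact (ContDiffAt.const_smul _ (contDiffAt_im (hD.mul hC))).add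
      (ContDiffAt.const_smul _ (contDiffAt_im (hD.mul hF)))
  have hM0 : M 0 = quat 0 0 0 1 := by
    simp only [hM, hD0, hC0, hF0]
    ext <;> simp [unitI, unitIJ, Quaternion.imI_mul, Quaternion.imJ_mul, Quaternion.imK_mul]
    exact hαβ
  have hMne : M 0 ≠ 0 := by
    rw [hM0]
    intro h
    simpa using congrArg (fun x : ℍ[ℝ] => x.imK) h
  have hMre : ∀ t, (M t).re = 0 := fun t => by simp [hM]
  have hMD : ∀ t, (M t * D t).re = 0 := fun t => by
    have h1 := hDre t
    simp [hM, Quaternion.re_mul, Quaternion.imI_mul, Quaternion.imJ_mul, Quaternion.imK_mul, h1, hCre,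
      hFre]
    ring
  have hrel' := hrel
  simp only [Submonoid.coe_mul] at hrel'
  have hCM : ∀ t, ((C t : ℍ[ℝ]) * M t).re = 0 := fun t => by
    have h1 := hrel' t
    simp [hM, Quaternion.re_mul, Quaternion.imI_mul, Quaternion.imJ_mul, Quaternion.imK_mul, hDre,
      hCre, hFre] at h1 ⊢
    linear_combination β * h1
  have hFM : ∀ t, ((F t : ℍ[ℝ]) * M t).re = 0 := fun t => by
    have h1 := hrel' t
    simp [hM, Quaternion.re_mul, Quaternion.imI_mul, Quaternion.imJ_mul, Quaternion.imK_mul, hDre,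
      hCre, hFre] at h1 ⊢
    linear_combination (-α) * h1
  obtain ⟨N, hN⟩ : ∃ N : E → SU2, N = fun t => SU2.normalize (M t) := ⟨_, rfl⟩
  obtain ⟨U, hU⟩ : ∃ U : E → ℍ[ℝ], U = fun t => frameQuat (D t) (N t) := ⟨_, rfl⟩
  have hUd : ContDiffAt ℝ ω U 0 := by
    have hNd : ContDiffAt ℝ ω (fun t => (N t : ℍ[ℝ])) 0 := by
      rw [hN]
      exact contDiffAt_normalize hMd hMne
    rw [hU]
    exact ((contDiffAt_const.sub (contDiffAt_const.mul hD)).sub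
      (contDiffAt_const.mul (hNd.mul hD))).sub (contDiffAt_const.mul hNd)
  have hU0 : U 0 = quat 4 0 0 0 := by
    have h1 : (N 0 : ℍ[ℝ]) = quat 0 0 0 1 := by
      simp only [hN]
      rw [SU2.coe_normalize hMne, hM0]
      have : ‖quat 0 0 0 1‖ = 1 := by
        have h2 := Quaternion.normSq_eq_norm_mul_self (quat 0 0 0 1)
        rw [Quaternion.normSq_def'] at h2
        simp at h2
        nlinarith [norm_nonneg (quat 0 0 0 1)]
      rw [this, inv_one, one_smul]
    simp only [hU, hD0, h1, frameQuat_self]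
  have hUne : U 0 ≠ 0 := by
    rw [hU0]
    intro h
    simpa using congrArg (fun x : ℍ[ℝ] => x.re) h
  obtain ⟨V, hV⟩ : ∃ V : E → SU2, V = fun t => SU2.normalize (U t) := ⟨_, rfl⟩
  have hVd : ContDiffAt ℝ ω (fun t => (V t : ℍ[ℝ])) 0 := by
    rw [hV]
    exact contDiffAt_normalize hUd hUne
  have hV0 : V 0 = 1 := by
    apply Subtype.ext
    have hn : ‖quat 4 0 0 0‖ = 4 := by
      have h2 := Quaternion.normSq_eq_norm_mul_self (quat 4 0 0 0)
      rw [Quaternion.normSq_def'] at h2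
      simp at h2
      nlinarith [norm_nonneg (quat 4 0 0 0)]
    simp only [hV]
    rw [SU2.coe_normalize hUne, hU0, hn]
    ext <;> simp
  have hconj : ∀ {G : E → SU2}, ContDiffAt ℝ ω (fun t => (G t : ℍ[ℝ])) 0 →
      ContDiffAt ℝ ω (fun t => ((V t * G t * (V t)⁻¹ : SU2) : ℍ[ℝ]).imI) 0 ∧
      ContDiffAt ℝ ω (fun t => ((V t * G t * (V t)⁻¹ : SU2) : ℍ[ℝ]).imJ) 0 := by
    intro G hG
    have h1 : ContDiffAt ℝ ω (fun t => ((V t * G t * (V t)⁻¹ : SU2) : ℍ[ℝ])) 0 :=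
      (hVd.mul hG).mul (contDiff_starQuaternion.contDiffAt.comp (0 : E) hVd)
    have hI : (fun t => ((V t * G t * (V t)⁻¹ : SU2) : ℍ[ℝ]).imI) = fun t =>
        -(quat 0 1 0 0 * ((V t * G t * (V t)⁻¹ : SU2) : ℍ[ℝ])).re := by
      funext t
      simp [Quaternion.re_mul]
    have hJ : (fun t => ((V t * G t * (V t)⁻¹ : SU2) : ℍ[ℝ]).imJ) = fun t =>
        -(quat 0 0 1 0 * ((V t * G t * (V t)⁻¹ : SU2) : ℍ[ℝ])).re := by
      funext t
      simp [Quaternion.re_mul]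
    rw [hI, hJ]
    exact ⟨(contDiffAt_re (contDiffAt_const.mul h1)).neg,
      (contDiffAt_re (contDiffAt_const.mul h1)).neg⟩
  have hangle : ∀ {G : E → SU2} {α : ℝ}, ContDiffAt ℝ ω (fun t => (G t : ℍ[ℝ])) 0 →
      (∀ t, (G t : ℍ[ℝ]).re = 0) → (∀ t, ((G t : ℍ[ℝ]) * M t).re = 0) → G 0 = unitIJ α →
      ∃ α' : E → ℝ, ContDiffAt ℝ ω α' 0 ∧ α' 0 = α ∧
        ∀ᶠ t in 𝓝 0, V t * N t * (V t)⁻¹ = unitK → V t * G t * (V t)⁻¹ = unitIJ (α' t) := by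
    intro G α hG hGre hGM hG0
    obtain ⟨hI, hJ⟩ := hconj hG
    have hI0 : ((V 0 * G 0 * (V 0)⁻¹ : SU2) : ℍ[ℝ]).imI = Real.cos α := by
      rw [hV0, hG0, one_mul, inv_one, mul_one]
      rfl
    have hJ0 : ((V 0 * G 0 * (V 0)⁻¹ : SU2) : ℍ[ℝ]).imJ = Real.sin α := by
      rw [hV0, hG0, one_mul, inv_one, mul_one]
      rfl
    refine ⟨_, contDiffAt_localAngle hI hJ hI0 hJ0, ?_, ?_⟩
    · rw [hI0, hJ0, localAngle_self]
    · filter_upwards [eventually_cos_sin_localAngle hI.continuousAt hJ.continuousAt hI0 hJ0,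
        hMd.continuousAt.eventually_ne hMne] with t ht hMt hVN
      have hre : ((V t * G t * (V t)⁻¹ : SU2) : ℍ[ℝ]).re = 0 := by rw [SU2.re_conj, hGre]
      have hK : ((V t * G t * (V t)⁻¹ : SU2) : ℍ[ℝ]).imK = 0 := by
        have h1 : ((V t * G t * (V t)⁻¹ * unitK : SU2) : ℍ[ℝ]).re = 0 := by
          rw [← hVN, show V t * G t * (V t)⁻¹ * (V t * N t * (V t)⁻¹) =
            V t * (G t * N t) * (V t)⁻¹ by group, SU2.re_conj, Submonoid.coe_mul]
          simp only [hN]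
          rw [SU2.coe_normalize hMt, mul_smul_comm, Quaternion.re_smul, hGM, smul_zero]
        generalize V t * G t * (V t)⁻¹ = X at h1 ⊢
        simpa [unitK, Quaternion.re_mul] using h1
      have hn := SU2.normSq_eq (V t * G t * (V t)⁻¹)
      rw [hre, hK] at hn
      obtain ⟨h1, h2⟩ := ht (by linarith)
      refine Subtype.ext (Quaternion.ext _ _ hre ?_ ?_ hK)
      · exact h1.symm
      · exact h2.symm
  obtain ⟨γ', hγ, hγ0, hγV⟩ := hangle hC hCre hCM hC0
  obtain ⟨θ', hθ, hθ0, hθV⟩ := hangle hF hFre hFM hF0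
  refine ⟨V, γ', θ', hVd, hγ, hθ, hγ0, hθ0, ?_⟩
  filter_upwards [hMd.continuousAt.eventually_ne hMne, hUd.continuousAt.eventually_ne hUne, hγV,
    hθV] with t hMt hUt hγt hθt
  have hNre : (N t : ℍ[ℝ]).re = 0 := by
    simp only [hN]
    rw [SU2.coe_normalize hMt, Quaternion.re_smul, hMre, smul_zero]
  have hDD := sq_eq_neg_one_of_re (hDre t) (SU2.norm_coe _)
  have hNN := sq_eq_neg_one_of_re hNre (SU2.norm_coe _)
  have hDN : (D t : ℍ[ℝ]) * N t = -((N t : ℍ[ℝ]) * D t) := by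
    rw [anticommute_iff hNre (SU2.norm_coe _)]
    refine ⟨hDre t, ?_⟩
    rw [re_mul_comm]
    simp only [hN]
    rw [SU2.coe_normalize hMt, smul_mul_assoc, Quaternion.re_smul, hMD, smul_zero]
  have hU' : U t = frameQuat (D t) (N t) := by rw [hU]
  have hVN : V t * N t * (V t)⁻¹ = unitK := by
    apply Subtype.ext
    rw [hV]
    exact SU2.normalize_conj hUt rfl (by rw [hU']; exact frameQuat_mul_snd hNN hDN)
  refine ⟨?_, hγt hVN, hθt hVN⟩
  apply Subtype.ext
  rw [hV]
  exact SU2.normalize_conj hUt rfl (by rw [hU']; exact frameQuat_mul_fst hDD)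

/-- A coplanar family of triples of imaginary unit quaternions that does not lie on a line has a
moving frame in which it has pillowcase coordinates. -/
theorem exists_moving_frame {D C F : E → SU2} {γ θ : ℝ} {u : SU2}
    (hD : ContDiffAt ℝ ω (fun t => (D t : ℍ[ℝ])) 0) (hC : ContDiffAt ℝ ω (fun t => (C t : ℍ[ℝ])) 0)
    (hF : ContDiffAt ℝ ω (fun t => (F t : ℍ[ℝ])) 0) (hDre : ∀ t, (D t : ℍ[ℝ]).re = 0)
    (hCre : ∀ t, (C t : ℍ[ℝ]).re = 0) (hFre : ∀ t, (F t : ℍ[ℝ]).re = 0)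
    (hrel : ∀ t, ((C t * D t * F t : SU2) : ℍ[ℝ]).re = 0) (hD0 : u * D 0 * u⁻¹ = unitI)
    (hC0 : u * C 0 * u⁻¹ = unitIJ γ) (hF0 : u * F 0 * u⁻¹ = unitIJ θ)
    (hreg : Real.sin γ ≠ 0 ∨ Real.sin θ ≠ 0) :
    ∃ V : E → SU2, ∃ γ' θ' : E → ℝ, ContDiffAt ℝ ω (fun t => (V t : ℍ[ℝ])) 0 ∧
      ContDiffAt ℝ ω γ' 0 ∧ ContDiffAt ℝ ω θ' 0 ∧ γ' 0 = γ ∧ θ' 0 = θ ∧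
      ∀ᶠ t in 𝓝 0, V t * D t * (V t)⁻¹ = unitI ∧ V t * C t * (V t)⁻¹ = unitIJ (γ' t) ∧
        V t * F t * (V t)⁻¹ = unitIJ (θ' t) := by
  have hcd : ∀ {G : E → SU2}, ContDiffAt ℝ ω (fun t => (G t : ℍ[ℝ])) 0 →
      ContDiffAt ℝ ω (fun t => ((u * G t * u⁻¹ : SU2) : ℍ[ℝ])) 0 := fun hG =>
    (contDiffAt_const.mul hG).mul contDiffAt_const
  obtain ⟨V, γ', θ', hV, h1, h2, h3, h4, h5⟩ := exists_moving_frame_of_standard (hcd hD) (hcd hC)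
    (hcd hF) (fun t => by rw [SU2.re_conj, hDre]) (fun t => by rw [SU2.re_conj, hCre])
    (fun t => by rw [SU2.re_conj, hFre]) (fun t => by
      rw [show u * C t * u⁻¹ * (u * D t * u⁻¹) * (u * F t * u⁻¹) =
        u * (C t * D t * F t) * u⁻¹ by group, SU2.re_conj, hrel]) hD0 hC0 hF0 hreg
  refine ⟨fun t => V t * u, γ', θ', hV.mul contDiffAt_const, h1, h2, h3, h4, ?_⟩
  filter_upwards [h5] with t ht
  have key : ∀ x, V t * u * x * (V t * u)⁻¹ = V t * (u * x * u⁻¹) * (V t)⁻¹ := fun x => by group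
  rw [key, key, key]
  exact ht

end Frame

/-! ### The inner sphere avoids the corners -/

/-- Two orthogonal imaginary unit quaternions are simultaneously conjugate to `𝐢` and `𝐣`. -/
theorem exists_conj_eq_unitI_unitIJ {x y : SU2} (hx : (x : ℍ[ℝ]).re = 0) (hy : (y : ℍ[ℝ]).re = 0)
    (hxy : ((x * y : SU2) : ℍ[ℝ]).re = 0) :
    ∃ u : SU2, u * x * u⁻¹ = unitI ∧ ((u * y * u⁻¹ : SU2) : ℍ[ℝ]) = quat 0 0 1 0 := by
  obtain ⟨u, hu⟩ := exists_conj_eq_I x hx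
  have hu' : u * x * u⁻¹ = unitI := by
    refine Subtype.ext (hu.trans ?_)
    ext <;> simp [unitI]
  obtain ⟨z, hz⟩ : ∃ z, z = u * y * u⁻¹ := ⟨_, rfl⟩
  have h1 : (z : ℍ[ℝ]).re = 0 := by rw [hz, SU2.re_conj, hy]
  have h2 : (z : ℍ[ℝ]).imI = 0 := by
    have h3 : ((unitI * z : SU2) : ℍ[ℝ]).re = 0 := by
      rw [hz, ← hu', show u * x * u⁻¹ * (u * y * u⁻¹) = u * (x * y) * u⁻¹ by group, SU2.re_conj,
        hxy]
    simpa [unitI, Quaternion.re_mul] using h3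
  have hn := SU2.normSq_eq z
  rw [h1, h2] at hn
  obtain ⟨t, hc, hs⟩ := exists_angle (c := (z : ℍ[ℝ]).imJ) (s := (z : ℍ[ℝ]).imK) (by linarith)
  have hc2 : Real.cos t = Real.cos (t / 2) ^ 2 - Real.sin (t / 2) ^ 2 := by
    rw [← Real.cos_two_mul', mul_div_cancel₀ t two_ne_zero]
  have hs2 : Real.sin t = 2 * Real.sin (t / 2) * Real.cos (t / 2) := by
    rw [← Real.sin_two_mul, mul_div_cancel₀ t two_ne_zero]
  have h0 := Real.sin_sq_add_cos_sq (t / 2)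
  rw [hc] at hc2
  rw [hs] at hs2
  obtain ⟨v, hv⟩ : ∃ v, v = SU2.mk (Real.cos (t / 2)) (-Real.sin (t / 2)) 0 0 (by linarith) :=
    ⟨_, rfl⟩
  refine ⟨v * u, ?_, ?_⟩
  · rw [show v * u * x * (v * u)⁻¹ = v * (u * x * u⁻¹) * v⁻¹ by group, hu', mul_inv_eq_iff_eq_mul,
      hv]
    apply Subtype.ext
    ext <;> simp [unitI, Quaternion.re_mul, Quaternion.imI_mul, Quaternion.imJ_mul,
      Quaternion.imK_mul]
  · rw [show v * u * y * (v * u)⁻¹ = v * z * v⁻¹ by rw [hz]; group]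
    refine SU2.conj_eq_of_mul_eq ?_
    rw [hv]
    generalize Real.cos (t / 2) = C at *
    generalize Real.sin (t / 2) = S at *
    ext <;> simp [Quaternion.re_mul, Quaternion.imI_mul, Quaternion.imJ_mul,
      Quaternion.imK_mul, h1, h2, hc2, hs2]
    · linear_combination C * h0
    · linear_combination S * h0

theorem sincSq_sq_ne_zero {x : ℝ} (hx : |x| < 1) : sincSq (x ^ 2) ≠ 0 := by
  intro h
  have h1 := mul_sincSq_sq x
  rw [h, mul_zero] at h1
  have h2 := abs_lt.1 hx
  have hpi := Real.pi_gt_three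
  have h3 : x = 0 :=
    (Real.sin_eq_zero_iff_of_lt_of_lt (by linarith) (by linarith)).1 h1.symm
  rw [h3, zero_pow two_ne_zero, sincSq_zero] at h
  exact one_ne_zero h

theorem not_corner_of_standard {s σ ε : ℝ} (hs0 : s ≠ 0) (hs : |s| < 1) (hσ : |σ| = |s|)
    (hε : ε ^ 2 = 1) {p : SU2} {Q b : ℍ[ℝ]} (hQ : Q = quat (Real.cos σ) (Real.sin σ) 0 0)
    (hb : b = ε • (Q * quat 0 0 0 1 * star (p : ℍ[ℝ]) * star Q)) (hbre : b.re = 0)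
    (hn : ‖(b * quat 0 1 0 0).im‖ ≤ 1)
    (hp : (p : ℍ[ℝ]) = NormedSpace.exp (s • (b * quat 0 1 0 0).im)) : False := by
  have hσ2 := Real.sin_sq_add_cos_sq σ
  have hε0 : ε ≠ 0 := by
    rintro rfl
    norm_num at hε
  rw [exp_smul_of_re_eq_zero s (Quaternion.re_im _), ← mul_pow, cosSq_sq] at hp
  have hx : |s * ‖(b * quat 0 1 0 0).im‖| < 1 := by
    rw [abs_mul, abs_norm]
    nlinarith [abs_nonneg s, norm_nonneg (b * quat 0 1 0 0).im]
  have hB := sincSq_sq_ne_zero hx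
  have hA : 0 < Real.cos (s * ‖(b * quat 0 1 0 0).im‖) := by
    have h2 := abs_lt.1 hx
    have hpi := Real.pi_gt_three
    exact Real.cos_pos_of_mem_Ioo ⟨by linarith, by linarith⟩
  generalize Real.cos (s * ‖(b * quat 0 1 0 0).im‖) = A at hp hA
  generalize sincSq ((s * ‖(b * quat 0 1 0 0).im‖) ^ 2) = B at hp hB
  have hb0 : b.re = ε * (p : ℍ[ℝ]).imK := by
    rw [hb, hQ]
    rw [Quaternion.re_smul, smul_eq_mul]
    congr 1
    simp [Quaternion.re_mul, Quaternion.imI_mul, Quaternion.imJ_mul, Quaternion.imK_mul]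
    linear_combination (p : ℍ[ℝ]).imK * hσ2
  have hbJ : b.imJ = ε * (-((p : ℍ[ℝ]).imI * (Real.cos σ ^ 2 - Real.sin σ ^ 2)) -
      (p : ℍ[ℝ]).re * (2 * Real.sin σ * Real.cos σ)) := by
    rw [hb, hQ, Quaternion.imJ_smul, smul_eq_mul]
    congr 1
    simp [Quaternion.re_mul, Quaternion.imI_mul, Quaternion.imJ_mul, Quaternion.imK_mul]
    ring
  have e0 := congrArg (fun z : ℍ[ℝ] => z.re) hp
  have e1 := congrArg (fun z : ℍ[ℝ] => z.imI) hp
  have e3 := congrArg (fun z : ℍ[ℝ] => z.imK) hp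
  simp [Quaternion.imI_mul, Quaternion.imK_mul] at e0 e1 e3
  rw [hbre, mul_zero] at e1
  have hK : (p : ℍ[ℝ]).imK = 0 := (mul_eq_zero.1 (hb0.symm.trans hbre)).resolve_left hε0
  rw [hK, hbJ, e1, e0, ← Real.sin_two_mul] at e3
  have h2 : s * B * ε * A * Real.sin (2 * σ) = 0 := by linear_combination -e3
  have h3 : Real.sin (2 * σ) = 0 := by
    simpa [hs0, hB, hε0, hA.ne'] using h2
  have h4 := abs_lt.1 (hσ.trans_lt hs)
  have hpi := Real.pi_gt_three
  have h5 := (Real.sin_eq_zero_iff_of_lt_of_lt (by linarith) (by linarith)).1 h3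
  have h6 : σ = 0 := by linarith
  rw [h6, abs_zero] at hσ
  exact hs0 (abs_eq_zero.1 hσ.symm)

theorem exp_smul_quat_I (σ : ℝ) :
    NormedSpace.exp (σ • quat 0 1 0 0) = quat (Real.cos σ) (Real.sin σ) 0 0 := by
  have hn : ‖quat 0 1 0 0‖ ^ 2 = 1 := by
    rw [sq, ← Quaternion.normSq_eq_norm_mul_self, Quaternion.normSq_def']
    simp
  rw [exp_smul_of_re_eq_zero σ rfl, hn, mul_one, cosSq_sq]
  have := mul_sincSq_sq σ
  ext <;> simp [this]

/-- The images of the meridians of the inner sphere are not all proportional. -/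
theorem not_inner_corner {s : ℝ} (hs0 : s ≠ 0) (hs : |s| < 1) {a b f h p q : SU2}
    (ha : (a : ℍ[ℝ]).re = 0) (hb : (b : ℍ[ℝ]).re = 0) (hh : (h : ℍ[ℝ]).re = 0)
    (hp : (p : ℍ[ℝ]) = NormedSpace.exp (s • ((b * h : SU2) : ℍ[ℝ]).im))
    (hq : (q : ℍ[ℝ]) = NormedSpace.exp (s • ((f * a⁻¹ * h : SU2) : ℍ[ℝ]).im))
    (hrel : ((p * q * h * a * h : SU2) : ℍ[ℝ]) = -((h * (p * q * h * a) : SU2) : ℍ[ℝ]))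
    {δ ε : ℝ} (hδ : δ ^ 2 = 1) (hε : ε ^ 2 = 1)
    (hf : (f : ℍ[ℝ]) = δ • ((h * a * h : SU2) : ℍ[ℝ]))
    (hc : (((p * q)⁻¹ * b * (p * q) : SU2) : ℍ[ℝ]) = ε • ((h * a * h : SU2) : ℍ[ℝ])) : False := by
  have haa : (a : ℍ[ℝ]) * a = -1 := sq_eq_neg_one_of_re ha (SU2.norm_coe a)
  have hhh : (h : ℍ[ℝ]) * h = -1 := sq_eq_neg_one_of_re hh (SU2.norm_coe h)
  obtain ⟨r, hr⟩ : ∃ r, r = p * q := ⟨_, rfl⟩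
  obtain ⟨Q, hQ⟩ : ∃ Q, Q = r * q * r⁻¹ := ⟨_, rfl⟩
  have hrQ : r = Q * p := by
    rw [hQ, hr]
    group
  rw [← hr] at hrel hc
  have hhah : ((h * a * h : SU2) : ℍ[ℝ]) = -((r⁻¹ * h * r * h * a : SU2) : ℍ[ℝ]) := by
    have e : h * a * h = r⁻¹ * (r * h * a * h) := by group
    rw [e, Submonoid.coe_mul, hrel, mul_neg, ← Submonoid.coe_mul,
      show r⁻¹ * (h * (r * h * a)) = r⁻¹ * h * r * h * a by group]
  have him : ((f * a⁻¹ * h : SU2) : ℍ[ℝ]).im = ((r⁻¹ : SU2) : ℍ[ℝ]) * (δ • (h : ℍ[ℝ])) *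
      star ((r⁻¹ : SU2) : ℍ[ℝ]) := by
    have h2 : ((f * a⁻¹ * h : SU2) : ℍ[ℝ]) = ((r⁻¹ : SU2) : ℍ[ℝ]) * (δ • (h : ℍ[ℝ])) *
        star ((r⁻¹ : SU2) : ℍ[ℝ]) := by
      rw [Submonoid.coe_mul, Submonoid.coe_mul, SU2.coe_inv_of_re ha, hf, hhah,
        ← SU2.coe_inv (r⁻¹), inv_inv]
      simp only [Submonoid.coe_mul, smul_mul_assoc, mul_smul_comm, mul_neg, neg_mul,
        mul_assoc]
      rw [← mul_assoc (a : ℍ[ℝ]) a, haa, neg_one_mul, mul_neg, smul_neg, neg_neg, hhh, neg_neg, mul_one]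
    have h1 : ((f * a⁻¹ * h : SU2) : ℍ[ℝ]).re = 0 := by
      have h3 := SU2.re_conj r⁻¹ h
      rw [Submonoid.coe_mul, Submonoid.coe_mul, SU2.coe_inv (r⁻¹)] at h3
      rw [h2, mul_smul_comm, smul_mul_assoc, Quaternion.re_smul, h3, hh, smul_zero]
    rw [← h2]
    exact Quaternion.ext _ _ h1.symm rfl rfl rfl
  have hδh : (δ • (h : ℍ[ℝ])).re = 0 := by rw [Quaternion.re_smul, hh, smul_zero]
  have hQe : (Q : ℍ[ℝ]) = NormedSpace.exp ((s * δ) • (h : ℍ[ℝ])) := by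
    rw [him, SU2.exp_conj _ _ hδh, ← SU2.coe_inv (r⁻¹), inv_inv] at hq
    rw [hQ, Submonoid.coe_mul, Submonoid.coe_mul, hq, mul_smul]
    simp only [← mul_assoc]
    rw [← Submonoid.coe_mul, mul_inv_cancel, Submonoid.coe_one, one_mul, mul_assoc,
      ← Submonoid.coe_mul, mul_inv_cancel, Submonoid.coe_one, mul_one]
  have hQh : Q * h = h * Q := by
    apply Subtype.ext
    have h1 := comm_exp_im (s * δ) (h : ℍ[ℝ])
    have h2 : (h : ℍ[ℝ]).im = h := by ext <;> simp [hh]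
    rwa [h2, ← hQe] at h1
  obtain ⟨v, hv⟩ : ∃ v, v = p * h * a := ⟨_, rfl⟩
  have hvh : (v : ℍ[ℝ]) * h = -((h : ℍ[ℝ]) * v) := by
    have e1 : r * h * a * h = Q * (v * h) := by rw [hrQ, hv]; group
    have e2 : h * (r * h * a) = Q * (h * v) := by
      rw [hrQ, hv, ← mul_assoc Q h, hQh]
      group
    rw [e1, e2] at hrel
    have h3 : (Q : ℍ[ℝ]) * (v * h) = -(Q * (h * v)) := hrel
    have h4 := congrArg (fun z => star (Q : ℍ[ℝ]) * z) h3
    simpa only [← mul_neg, ← mul_assoc, SU2.star_mul_self, one_mul] using h4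
  obtain ⟨hvre, hvhre⟩ := (anticommute_iff hh (SU2.norm_coe h)).1 hvh
  have hvh' : v * h = h * v⁻¹ := by
    apply Subtype.ext
    rw [Submonoid.coe_mul, Submonoid.coe_mul, hvh, SU2.coe_inv_of_re hvre, mul_neg]
  have hbv : (b : ℍ[ℝ]) = ε • ((Q * (h * v⁻¹) * p⁻¹ * Q⁻¹ : SU2) : ℍ[ℝ]) := by
    have e1 : Q * (h * v⁻¹) * p⁻¹ * Q⁻¹ = r * (h * a * h) * r⁻¹ := by
      rw [← hvh', hv, hrQ]
      group
    have e2 : b = r * (r⁻¹ * b * r) * r⁻¹ := by group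
    rw [e1, e2, Submonoid.coe_mul, Submonoid.coe_mul, hc, mul_smul_comm, smul_mul_assoc,
      ← Submonoid.coe_mul, ← Submonoid.coe_mul]
  obtain ⟨g, hg1, hg2⟩ := exists_conj_eq_unitI_unitIJ (x := h) (y := v⁻¹) hh
    (by rw [SU2.coe_inv_of_re hvre, Quaternion.re_neg, hvre, neg_zero])
    (by rw [← hvh']; exact hvhre)
  have hgI : (unitI : ℍ[ℝ]) = quat 0 1 0 0 := rfl
  have hgh : (g : ℍ[ℝ]) * h * star (g : ℍ[ℝ]) = quat 0 1 0 0 := congrArg Subtype.val hg1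
  refine not_corner_of_standard (σ := s * δ) (ε := ε) (p := g * p * g⁻¹)
    (Q := ((g * Q * g⁻¹ : SU2) : ℍ[ℝ])) (b := ((g * b * g⁻¹ : SU2) : ℍ[ℝ])) hs0 hs ?_ hε ?_ ?_
    (by rw [SU2.re_conj, hb]) ?_ ?_
  · rcases sq_eq_sq_iff_eq_or_eq_neg.1 (hδ.trans (one_pow 2).symm) with rfl | rfl <;> simp
  · rw [← exp_smul_quat_I, ← hgh, SU2.exp_conj _ _ hh, ← hQe]
    rfl
  · have e3 : quat 0 1 0 0 * quat 0 0 1 0 = quat 0 0 0 1 := by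
      ext <;> simp [Quaternion.re_mul, Quaternion.imI_mul, Quaternion.imJ_mul, Quaternion.imK_mul]
    rw [← e3, ← hgI, ← hg1, ← hg2, ← SU2.coe_inv, ← SU2.coe_inv]
    simp only [← Submonoid.coe_mul]
    rw [show g * Q * g⁻¹ * (g * h * g⁻¹ * (g * v⁻¹ * g⁻¹)) * (g * p * g⁻¹)⁻¹ * (g * Q * g⁻¹)⁻¹ =
      g * (Q * (h * v⁻¹) * p⁻¹ * Q⁻¹) * g⁻¹ by group, Submonoid.coe_mul, Submonoid.coe_mul, hbv,
      mul_smul_comm, smul_mul_assoc, ← Submonoid.coe_mul, ← Submonoid.coe_mul]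
  · rw [← hgI, ← Submonoid.coe_mul]
    exact SU2.norm_im_le _
  · rw [← hgI, ← hg1, ← Submonoid.coe_mul,
      show g * b * g⁻¹ * (g * h * g⁻¹) = g * (b * h) * g⁻¹ by group, SU2.im_conj,
      SU2.exp_conj _ _ (Quaternion.re_im _), ← hp]
    rfl

theorem innerRestriction_meridian {s : ℝ} (ρ : PertRep s) (x : SphereGen) :
    (innerRestriction s ρ).1 (meridian x) = ρ.1 (elt (innerWord x)) := by
  change ρ.1 (innerInclusion (meridian x)) = _
  rw [innerInclusion, meridian, PresentedGroup.toGroup.of]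

theorem map_wordD {s : ℝ} (ρ : PertRep s) :
    ρ.1 (elt wordD) = (gen ρ .h)⁻¹ * gen ρ .a * gen ρ .w * gen ρ .h := by
  simp only [wordD, elt, map_mul, map_inv, gen]

theorem map_wordC {s : ℝ} (ρ : PertRep s) :
    ρ.1 (elt wordC) = (gen ρ .q)⁻¹ * (gen ρ .p)⁻¹ * gen ρ .b * gen ρ .p * gen ρ .q := by
  simp only [wordC, elt, map_mul, map_inv, gen]

theorem exists_unitIJ_eq_circleIJ (t : Real.Angle) :
    ∃ r : ℝ, t = (r : Real.Angle) ∧ circleIJ t = (unitIJ r : ℍ[ℝ]) := by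
  induction t using Real.Angle.induction_on with
  | _ x => exact ⟨x, rfl, by ext <;> simp [unitIJ]⟩

/-- The inner restriction has coordinates away from the corners of the pillowcase. -/
theorem exists_inner_coordinates {s : ℝ} (hs0 : s ≠ 0) (hs : |s| < 1) (ρ : PertRep s) :
    ∃ (u : SU2) (γ θ : ℝ), u * ((gen ρ .h)⁻¹ * gen ρ .a * gen ρ .w * gen ρ .h) * u⁻¹ = unitI ∧
      u * ((gen ρ .q)⁻¹ * (gen ρ .p)⁻¹ * gen ρ .b * gen ρ .p * gen ρ .q) * u⁻¹ = unitIJ γ ∧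
      u * gen ρ .f * u⁻¹ = unitIJ θ ∧ (Real.sin γ ≠ 0 ∨ Real.sin θ ≠ 0) := by
  obtain ⟨x, u, h1, h2, h3⟩ := exists_hasCoordinates (innerRestriction s ρ)
  rw [innerRestriction_meridian] at h1 h2 h3
  obtain ⟨γ, -, hγ⟩ := exists_unitIJ_eq_circleIJ x.1
  obtain ⟨θ, -, hθ⟩ := exists_unitIJ_eq_circleIJ x.2
  have e1 : u * ((gen ρ .h)⁻¹ * gen ρ .a * gen ρ .w * gen ρ .h) * u⁻¹ = unitI := by
    refine Subtype.ext (Eq.trans ?_ (h1.trans ?_))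
    · rw [← map_wordD]; rfl
    · ext <;> simp [unitI]
  have e2 : u * ((gen ρ .q)⁻¹ * (gen ρ .p)⁻¹ * gen ρ .b * gen ρ .p * gen ρ .q) * u⁻¹ =
      unitIJ γ := by
    refine Subtype.ext (Eq.trans ?_ (h2.trans hγ))
    rw [← map_wordC]; rfl
  have e3 : u * gen ρ .f * u⁻¹ = unitIJ θ := Subtype.ext (h3.trans hθ)
  refine ⟨u, γ, θ, e1, e2, e3, ?_⟩
  by_contra! hcon
  have key : ∀ t : ℝ, Real.sin t = 0 → ∃ δ : ℝ, δ ^ 2 = 1 ∧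
      (unitIJ t : ℍ[ℝ]) = δ • (unitI : ℍ[ℝ]) := by
    intro t ht
    refine ⟨Real.cos t, ?_, ?_⟩
    · have := Real.sin_sq_add_cos_sq t
      rw [ht] at this
      linarith
    · ext <;> simp [unitIJ, unitI, ht]
  have hha : ∀ {y : SU2} {δ : ℝ}, ((u * y * u⁻¹ : SU2) : ℍ[ℝ]) = δ • (unitI : ℍ[ℝ]) →
      (y : ℍ[ℝ]) = δ • ((gen ρ .h * gen ρ .a * gen ρ .h : SU2) : ℍ[ℝ]) := by
    intro y δ hy
    have hd : (((gen ρ .h)⁻¹ * gen ρ .a * gen ρ .w * gen ρ .h : SU2) : ℍ[ℝ]) =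
        ((gen ρ .h * gen ρ .a * gen ρ .h : SU2) : ℍ[ℝ]) := by
      have hw : (gen ρ .w : ℍ[ℝ]) = -1 := ρ.2.w2
      simp only [Submonoid.coe_mul, SU2.coe_inv_of_re (u := gen ρ .h) ρ.2.h_traceless, hw]
      simp
    rw [← hd, show y = u⁻¹ * (u * y * u⁻¹) * u by group, Submonoid.coe_mul, Submonoid.coe_mul, hy,
      ← e1, mul_smul_comm, smul_mul_assoc, ← Submonoid.coe_mul, ← Submonoid.coe_mul]
    congr 2
    group
  obtain ⟨ε, hε, hε'⟩ := key γ hcon.1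
  obtain ⟨δ, hδ, hδ'⟩ := key θ hcon.2
  have hre := gen_re ρ
  refine not_inner_corner (a := gen ρ .a) (b := gen ρ .b) (h := gen ρ .h) hs0 hs
    ρ.2.a_traceless ρ.2.b_traceless ρ.2.h_traceless (gen_p ρ)
    (gen_q ρ) ?_ hδ hε (hha (by rw [e3, hδ'])) ?_
  · exact (anticommute_iff (h := (gen ρ .h : ℍ[ℝ])) ρ.2.h_traceless (SU2.norm_coe _)).2 hre
  · rw [← hha (y := (gen ρ .q)⁻¹ * (gen ρ .p)⁻¹ * gen ρ .b * gen ρ .p * gen ρ .q)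
      (by rw [e2, hε']), mul_inv_rev]
    congr 1
    group

/-! ### The inner coordinates near the corners -/

/-- The derivative in the last coordinate. -/
noncomputable def nuDeriv (W : Space → ℝ) (y : Space) : ℝ :=
  deriv (fun ν => W (y.1, y.2.1, ν)) y.2.2

theorem hasDerivAt_nuDeriv {Φ : ℝ → Space → ℝ} {z : ℝ × Space}
    (h : DifferentiableAt ℝ (fun z : ℝ × Space => Φ z.1 z.2) z) :
    HasDerivAt (fun ν => Φ z.1 (z.2.1, z.2.2.1, ν)) (nuDeriv (Φ z.1) z.2) z.2.2.2 ∧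
      nuDeriv (Φ z.1) z.2 = fderiv ℝ (fun z : ℝ × Space => Φ z.1 z.2) z (0, 0, 0, 1) := by
  have h1 : HasDerivAt (fun ν : ℝ => ((z.1, z.2.1, z.2.2.1, ν) : ℝ × Space)) (0, 0, 0, 1)
      z.2.2.2 :=
    (hasDerivAt_const _ _).prodMk ((hasDerivAt_const _ _).prodMk
      ((hasDerivAt_const _ _).prodMk (hasDerivAt_id _)))
  have h2 := HasFDerivAt.comp_hasDerivAt z.2.2.2 (l := fun z : ℝ × Space => Φ z.1 z.2)
    h.hasFDerivAt h1
  have h3 : HasDerivAt (fun ν => Φ z.1 (z.2.1, z.2.2.1, ν))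
      (fderiv ℝ (fun z : ℝ × Space => Φ z.1 z.2) z (0, 0, 0, 1)) z.2.2.2 := h2
  exact ⟨h3.differentiableAt.hasDerivAt, h3.deriv⟩

theorem eventually_hasDerivAt_nuDeriv {Φ : ℝ → Space → ℝ} {z₀ : ℝ × Space}
    (h : ContDiffAt ℝ ω (fun z : ℝ × Space => Φ z.1 z.2) z₀) :
    (∀ᶠ z in 𝓝 z₀, HasDerivAt (fun ν => Φ z.1 (z.2.1, z.2.2.1, ν)) (nuDeriv (Φ z.1) z.2)
      z.2.2.2) ∧ Filter.Tendsto (fun z : ℝ × Space => nuDeriv (Φ z.1) z.2) (𝓝 z₀)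
        (𝓝 (nuDeriv (Φ z₀.1) z₀.2)) := by
  have h0 : ContDiffAt ℝ 1 (fun z : ℝ × Space => Φ z.1 z.2) z₀ := h.of_le le_top
  have h1 : ∀ᶠ z in 𝓝 z₀, DifferentiableAt ℝ (fun z : ℝ × Space => Φ z.1 z.2) z :=
    (h0.eventually (by simp)).mono fun z hz => hz.differentiableAt one_ne_zero
  refine ⟨h1.mono fun z hz => (hasDerivAt_nuDeriv hz).1, ?_⟩
  rw [(hasDerivAt_nuDeriv h1.self_of_nhds).2]
  have h2 : ContinuousAt (fun z => fderiv ℝ (fun z : ℝ × Space => Φ z.1 z.2) z (0, 0, 0, 1)) z₀ :=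
    (h0.fderiv_right (m := 0) (by simp)).continuousAt.clm_apply continuousAt_const
  exact h2.tendsto.congr' (h1.mono fun z hz => (hasDerivAt_nuDeriv hz).2.symm)

/-- The limit of the second-order part of the derivative of a family. -/
theorem limit_nuDeriv {l : Filter (ℝ × Space)} [l.NeBot] {y₀ : Space} (hl : l ≤ 𝓝 (0, y₀))
    {c V U : ℝ → Space → ℝ} {k φ : ℝ → ℝ → ℝ} {X : ℝ}
    (hV : ContDiffAt ℝ ω (fun z : ℝ × Space => V z.1 z.2) (0, y₀))
    (hU : ContDiffAt ℝ ω (fun z : ℝ × Space => U z.1 z.2) (0, y₀))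
    (hc : ∀ s y, c s y = k y.1 y.2.1 + s * φ y.1 y.2.1 * V s y + s ^ 2 * U s y)
    (h0 : ∀ᶠ z in l, z.1 ≠ 0 ∧ nuDeriv (c z.1) z.2 = 0)
    (hX : Filter.Tendsto (fun z => φ z.2.1 z.2.2.1 / z.1) l (𝓝 X)) :
    X * nuDeriv (V 0) y₀ + nuDeriv (U 0) y₀ = 0 := by
  obtain ⟨hV1, hV2⟩ := eventually_hasDerivAt_nuDeriv hV
  obtain ⟨hU1, hU2⟩ := eventually_hasDerivAt_nuDeriv hU
  refine tendsto_nhds_unique ((hX.mul (hV2.mono_left hl)).add (hU2.mono_left hl))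
    (tendsto_const_nhds.congr' ?_)
  filter_upwards [hl hV1, hl hU1, h0] with z h1 h2 ⟨h3, h4⟩
  have h5 : HasDerivAt (fun ν => c z.1 (z.2.1, z.2.2.1, ν))
      (z.1 * φ z.2.1 z.2.2.1 * nuDeriv (V z.1) z.2 + z.1 ^ 2 * nuDeriv (U z.1) z.2) z.2.2.2 := by
    simp only [hc]
    exact ((h1.const_mul _).const_add _).add (h2.const_mul _)
  have h6 := h5.deriv.symm.trans h4
  field_simp
  refine (mul_left_cancel₀ h3 ?_).symm
  linear_combination h6

/-- The limits of the coordinates that satisfy a perturbed equation together with its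
derivative. -/
theorem limit_coordinates {l : Filter (ℝ × Space)} {y₀ : Space} (hl : l ≤ 𝓝 (0, y₀))
    {G A B R : ℝ → Space → ℝ}
    (hA : ContDiffAt ℝ ω (fun z : ℝ × Space => A z.1 z.2) (0, y₀))
    (hB : ContDiffAt ℝ ω (fun z : ℝ × Space => B z.1 z.2) (0, y₀))
    (hR : ContDiffAt ℝ ω (fun z : ℝ × Space => R z.1 z.2) (0, y₀))
    (hG : ∀ s y, G s y = Real.sin y.2.1 * A s y + Real.sin y.1 * B s y + s * R s y)
    (hA0 : ∀ y, A 0 y = Real.sin y.2.2) (hB0 : ∀ y, B 0 y = Real.cos y.2.2)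
    (h0 : ∀ᶠ z in l, z.1 ≠ 0 ∧ G z.1 z.2 = 0 ∧ nuDeriv (G z.1) z.2 = 0) :
    Filter.Tendsto (fun z => Real.sin z.2.1 / z.1) l
      (𝓝 (nuDeriv (R 0) y₀ * Real.sin y₀.2.2 - R 0 y₀ * Real.cos y₀.2.2)) ∧
    Filter.Tendsto (fun z => Real.sin z.2.2.1 / z.1) l
      (𝓝 (-R 0 y₀ * Real.sin y₀.2.2 - nuDeriv (R 0) y₀ * Real.cos y₀.2.2)) := by
  obtain ⟨hA1, hA2⟩ := eventually_hasDerivAt_nuDeriv hA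
  obtain ⟨hB1, hB2⟩ := eventually_hasDerivAt_nuDeriv hB
  obtain ⟨hR1, hR2⟩ := eventually_hasDerivAt_nuDeriv hR
  have hA' : nuDeriv (A 0) y₀ = Real.cos y₀.2.2 := by
    simp only [nuDeriv, hA0]
    exact (Real.hasDerivAt_sin _).deriv
  have hB' : nuDeriv (B 0) y₀ = -Real.sin y₀.2.2 := by
    simp only [nuDeriv, hB0]
    exact (Real.hasDerivAt_cos _).deriv
  have tA := hA.continuousAt.tendsto.mono_left hl
  have tB := hB.continuousAt.tendsto.mono_left hl
  have tR := hR.continuousAt.tendsto.mono_left hl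
  have tA' := hA2.mono_left hl
  have tB' := hB2.mono_left hl
  have tR' := hR2.mono_left hl
  simp only [hA0, hB0, hA', hB'] at tA tB tA' tB'
  have tD := (tB.mul tA').sub (tA.mul tB')
  have hD : Real.cos y₀.2.2 * Real.cos y₀.2.2 - Real.sin y₀.2.2 * -Real.sin y₀.2.2 = 1 := by
    linear_combination Real.sin_sq_add_cos_sq y₀.2.2
  rw [hD] at tD
  have key : ∀ᶠ z in l, z.1 ≠ 0 ∧
      B z.1 z.2 * nuDeriv (A z.1) z.2 - A z.1 z.2 * nuDeriv (B z.1) z.2 ≠ 0 ∧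
      Real.sin z.2.2.1 * A z.1 z.2 + Real.sin z.2.1 * B z.1 z.2 + z.1 * R z.1 z.2 = 0 ∧
      Real.sin z.2.2.1 * nuDeriv (A z.1) z.2 + Real.sin z.2.1 * nuDeriv (B z.1) z.2 +
        z.1 * nuDeriv (R z.1) z.2 = 0 := by
    filter_upwards [hl hA1, hl hB1, hl hR1, h0, tD.eventually_ne one_ne_zero] with z h1 h2 h3
      ⟨h4, h5, h6⟩ h7
    refine ⟨h4, h7, (hG _ _).symm.trans h5, ?_⟩
    have h8 : HasDerivAt (fun ν => G z.1 (z.2.1, z.2.2.1, ν))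
        (Real.sin z.2.2.1 * nuDeriv (A z.1) z.2 + Real.sin z.2.1 * nuDeriv (B z.1) z.2 +
          z.1 * nuDeriv (R z.1) z.2) z.2.2.2 := by
      simp only [hG]
      exact ((h1.const_mul _).add (h2.const_mul _)).add (h3.const_mul _)
    exact h8.deriv.symm.trans h6
  constructor
  · have h1 := ((tR'.mul tA).sub (tR.mul tA')).div tD one_ne_zero
    rw [div_one] at h1
    refine h1.congr' (key.mono fun z hz => ?_)
    obtain ⟨h2, h3, h4, h5⟩ := hz
    rw [Pi.div_apply, div_eq_div_iff h3 h2]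
    linear_combination A z.1 z.2 * h5 - nuDeriv (A z.1) z.2 * h4
  · have h1 := ((tR.mul tB').sub (tR'.mul tB)).div tD one_ne_zero
    rw [div_one] at h1
    have h1' : R 0 y₀ * -Real.sin y₀.2.2 - nuDeriv (R 0) y₀ * Real.cos y₀.2.2 =
      -R 0 y₀ * Real.sin y₀.2.2 - nuDeriv (R 0) y₀ * Real.cos y₀.2.2 := by ring
    rw [← h1']
    refine h1.congr' (key.mono fun z hz => ?_)
    obtain ⟨h2, h3, h4, h5⟩ := hz
    rw [Pi.div_apply, div_eq_div_iff h3 h2]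
    linear_combination nuDeriv (B z.1) z.2 * h4 - B z.1 z.2 * h5

/-- `sin (s T) / s`. -/
noncomputable def redHeight (s T : ℝ) : ℝ := T * sincSq (s ^ 2 * T ^ 2)

theorem holH_fst (s : ℝ) (y : Space) (T : ℝ) : (holH s y T).1 = s * redHeight s T :=
  (mul_mul_sincSq s T).symm

/-- The image of `e`. -/
noncomputable def vecE (y : Space) : Space := (Real.cos (y.1 + y.2.1), Real.sin (y.1 + y.2.1), 0)

/-- The quadratic part of the rotation of `e` by `q`. -/
noncomputable def quadG (s : ℝ) (y : Space) (T : ℝ) : Space :=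
  (2 * qIm s y T ^ 2) • (dot (lamQ s y T) (vecE y) • lamQ s y T -
    lenSq (lamQ s y T) • vecE y)

/-- The image of `g`. -/
noncomputable def vecG (s : ℝ) (y : Space) (T : ℝ) : Space :=
  vecE y + (2 * s * qRe s y T * qIm s y T) • cross (vecE y) (lamQ s y T) + s ^ 2 • quadG s y T

/-- The cosine of the inner coordinate `θ`. -/
noncomputable def innerCosTheta (s : ℝ) (y : Space) (T : ℝ) : ℝ :=
  Real.cos y.2.1 - 2 * (holH s y T).1 *
    (Real.cos y.2.1 * (holH s y T).1 + Real.sin y.2.1 * (holH s y T).2.1)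

/-- The cosine of the inner coordinate `γ`. -/
noncomputable def innerCosGamma (s : ℝ) (y : Space) (T : ℝ) : ℝ :=
  Real.cos y.2.1 * (vecG s y T).1 + Real.sin y.2.1 * (vecG s y T).2.1

/-- The cosine of the sum of the inner coordinates. -/
noncomputable def innerCosAdd (s : ℝ) (y : Space) (T : ℝ) : ℝ :=
  (vecG s y T).1 - 2 * (holH s y T).1 * dot (holH s y T) (vecG s y T)

theorem innerCosTheta_eq (s : ℝ) (y : Space) (T : ℝ) : innerCosTheta s y T =
    Real.cos y.2.1 + s * Real.sin y.2.1 * (-2 * redHeight s T * (holH s y T).2.1) +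
      s ^ 2 * (-2 * redHeight s T ^ 2 * Real.cos y.2.1) := by
  rw [innerCosTheta, holH_fst]
  ring

theorem innerCosGamma_eq (s : ℝ) (y : Space) (T : ℝ) : innerCosGamma s y T =
    Real.cos y.1 + s * Real.sin y.1 * (2 * qRe s y T * qIm s y T * (lamQ s y T).2.2) +
      s ^ 2 * (Real.cos y.2.1 * (quadG s y T).1 + Real.sin y.2.1 * (quadG s y T).2.1) := by
  rw [innerCosGamma, vecG]
  simp only [vecE, cross, Prod.fst_add, Prod.snd_add, Prod.smul_fst, Prod.smul_snd, smul_eq_mul,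
    Real.cos_add, Real.sin_add]
  linear_combination (Real.cos y.1 + 2 * s * qRe s y T * qIm s y T * (lamQ s y T).2.2 *
    Real.sin y.1) * Real.sin_sq_add_cos_sq y.2.1

/-- The quadratic part of the cosine of the sum of the inner coordinates. -/
noncomputable def innerCosAddQuad (s : ℝ) (y : Space) (T : ℝ) : ℝ :=
  (quadG s y T).1 - 2 * redHeight s T * (redHeight s T * Real.cos (y.1 + y.2.1) +
    2 * qRe s y T * qIm s y T * dot (holH s y T) (cross (vecE y) (lamQ s y T)) +
    s * dot (holH s y T) (quadG s y T))

theorem innerCosAdd_eq (s : ℝ) (y : Space) (T : ℝ) : innerCosAdd s y T =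
    Real.cos (y.1 + y.2.1) + s * Real.sin (y.1 + y.2.1) *
      (2 * qRe s y T * qIm s y T * (lamQ s y T).2.2 - 2 * redHeight s T * (holH s y T).2.1) +
      s ^ 2 * innerCosAddQuad s y T := by
  rw [innerCosAdd, innerCosAddQuad, vecG]
  have h := holH_fst s y T
  generalize holH s y T = x at *
  generalize redHeight s T = S at *
  simp only [vecE, cross, dot_apply, Prod.fst_add, Prod.snd_add, Prod.smul_fst, Prod.smul_snd,
    smul_eq_mul, h]
  ring

/-- The coefficients of `sin θ`, `sin γ` and `s` in the second equation. -/
noncomputable def eqTwoCoeff (s : ℝ) (y : Space) (T : ℝ) : ℝ × ℝ × ℝ :=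
  (pRe s y T * qIm s y T * Real.cos (s * T) * Real.sin y.2.2 * (1 - 2 * (holH s y T).1 ^ 2),
    qRe s y T * pIm s y T * Real.cos (s * T) * Real.cos y.2.2 * (1 - 2 * (holH s y T).1 ^ 2),
    (pRe s y T * qIm s y T * redHeight s T * Real.cos y.2.1 +
      pIm s y T * qIm s y T * (cross (lamP s y T) (lamQ s y T)).1) *
      (1 - 2 * (holH s y T).1 ^ 2) - 2 * redHeight s T *
        ((holIm s y T).2.1 * (holH s y T).2.1 + (holIm s y T).2.2 * (holH s y T).2.2))

theorem eqTwo_eq_coeff (s : ℝ) (y : Space) (T : ℝ) : eqTwo s y T =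
    Real.sin y.2.1 * (eqTwoCoeff s y T).1 + Real.sin y.1 * (eqTwoCoeff s y T).2.1 +
      s * (eqTwoCoeff s y T).2.2 := by
  have h1 : (holIm s y T).1 = pRe s y T * qIm s y T * (lamQ s y T).1 +
      qRe s y T * pIm s y T * (lamP s y T).1 +
      s * (pIm s y T * qIm s y T) * (cross (lamP s y T) (lamQ s y T)).1 := rfl
  have h2 : (lamQ s y T).1 = Real.cos y.2.1 * (s * redHeight s T) +
      Real.sin y.2.1 * (Real.cos (s * T) * Real.sin y.2.2) := by
    rw [lamQ, holH_fst]
    simp only [holH]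
    ring
  have h3 : (lamP s y T).1 = Real.sin y.1 * (Real.cos (s * T) * Real.cos y.2.2) := rfl
  have h4 : 2 * (holH s y T).1 = 2 * s * redHeight s T := by
    rw [holH_fst]
    ring
  rw [eqTwo, h4, h1, h2, h3, eqTwoCoeff]
  ring

section ContDiff

variable {E : Type*} [NormedAddCommGroup E] [NormedSpace ℝ E] {n : WithTop ℕ∞}
  {s : E → ℝ} {y : E → Space} {T : E → ℝ}

@[fun_prop] theorem contDiff_redHeight (hs : ContDiff ℝ n s) (hT : ContDiff ℝ n T) :
    ContDiff ℝ n fun x => redHeight (s x) (T x) := by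
  unfold redHeight
  fun_prop

@[fun_prop] theorem contDiff_vecE (hy : ContDiff ℝ n y) : ContDiff ℝ n fun x => vecE (y x) := by
  unfold vecE
  fun_prop

@[fun_prop] theorem contDiff_quadG (hs : ContDiff ℝ n s) (hy : ContDiff ℝ n y)
    (hT : ContDiff ℝ n T) : ContDiff ℝ n fun x => quadG (s x) (y x) (T x) := by
  simp only [quadG, dot_apply, lenSq]
  fun_prop

@[fun_prop] theorem contDiff_vecG (hs : ContDiff ℝ n s) (hy : ContDiff ℝ n y)
    (hT : ContDiff ℝ n T) : ContDiff ℝ n fun x => vecG (s x) (y x) (T x) := by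
  unfold vecG cross
  fun_prop

@[fun_prop] theorem contDiff_innerCosTheta (hs : ContDiff ℝ n s) (hy : ContDiff ℝ n y)
    (hT : ContDiff ℝ n T) : ContDiff ℝ n fun x => innerCosTheta (s x) (y x) (T x) := by
  unfold innerCosTheta
  fun_prop

@[fun_prop] theorem contDiff_innerCosGamma (hs : ContDiff ℝ n s) (hy : ContDiff ℝ n y)
    (hT : ContDiff ℝ n T) : ContDiff ℝ n fun x => innerCosGamma (s x) (y x) (T x) := by
  have h1 := (contDiff_vecG hs hy hT).fst
  have h2 := (contDiff_vecG hs hy hT).snd.fst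
  unfold innerCosGamma
  exact ((Real.contDiff_cos.comp hy.snd.fst).mul h1).add ((Real.contDiff_sin.comp hy.snd.fst).mul h2)

@[fun_prop] theorem contDiff_innerCosAdd (hs : ContDiff ℝ n s) (hy : ContDiff ℝ n y)
    (hT : ContDiff ℝ n T) : ContDiff ℝ n fun x => innerCosAdd (s x) (y x) (T x) := by
  have h1 := contDiff_vecG hs hy hT
  have h2 := contDiff_holH hs hy hT
  simp only [innerCosAdd, dot_apply]
  exact h1.fst.sub ((contDiff_const.mul h2.fst).mul ((h2.fst.mul h1.fst).add
    ((h2.snd.fst.mul h1.snd.fst).add (h2.snd.snd.mul h1.snd.snd))))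

theorem contDiff_innerCosAddQuad {n : WithTop ℕ∞} :
    ContDiff ℝ n fun v : (ℝ × Space) × ℝ => innerCosAddQuad v.1.1 v.1.2 v.2 := by
  have h1 : ContDiff ℝ n fun v : (ℝ × Space) × ℝ => quadG v.1.1 v.1.2 v.2 :=
    contDiff_quadG (by fun_prop) (by fun_prop) (by fun_prop)
  have h2 : ContDiff ℝ n fun v : (ℝ × Space) × ℝ => holH v.1.1 v.1.2 v.2 := by fun_prop
  have h3 : ContDiff ℝ n fun v : (ℝ × Space) × ℝ => v.1.1 * ((holH v.1.1 v.1.2 v.2).1 *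
      (quadG v.1.1 v.1.2 v.2).1 + ((holH v.1.1 v.1.2 v.2).2.1 * (quadG v.1.1 v.1.2 v.2).2.1 +
        (holH v.1.1 v.1.2 v.2).2.2 * (quadG v.1.1 v.1.2 v.2).2.2)) :=
    contDiff_fst.fst.mul ((h2.fst.mul h1.fst).add ((h2.snd.fst.mul h1.snd.fst).add
      (h2.snd.snd.mul h1.snd.snd)))
  simp only [innerCosAddQuad, dot_apply]
  refine h1.fst.sub (ContDiff.mul (by fun_prop) (ContDiff.add ?_ h3))
  unfold cross
  fun_prop

theorem contDiff_cos_mul_quadG {n : WithTop ℕ∞} : ContDiff ℝ n fun v : (ℝ × Space) × ℝ =>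
    Real.cos v.1.2.2.1 * (quadG v.1.1 v.1.2 v.2).1 +
      Real.sin v.1.2.2.1 * (quadG v.1.1 v.1.2 v.2).2.1 := by
  have h1 : ContDiff ℝ n fun v : (ℝ × Space) × ℝ => quadG v.1.1 v.1.2 v.2 :=
    contDiff_quadG (by fun_prop) (by fun_prop) (by fun_prop)
  exact ContDiff.add (ContDiff.mul (by fun_prop) h1.fst) (ContDiff.mul (by fun_prop) h1.snd.fst)

end ContDiff

/-- Near a corner, the inner coordinates vary along the fibre of the outer coordinates. -/
theorem false_of_nuDeriv_eq_zero {T : ℝ → Space → ℝ} {y₀ : Space}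
    (hT : ContDiffAt ℝ ω (fun z : ℝ × Space => T z.1 z.2) (0, y₀))
    (hT0 : ∀ y, T 0 y = Real.cos y.1) {l : Filter (ℝ × Space)} [l.NeBot] (hl : l ≤ 𝓝 (0, y₀))
    (h0 : ∀ᶠ z in l, z.1 ≠ 0 ∧ eqTwo z.1 z.2 (T z.1 z.2) = 0 ∧
      nuDeriv (fun y => eqTwo z.1 y (T z.1 y)) z.2 = 0 ∧
      nuDeriv (fun y => innerCosTheta z.1 y (T z.1 y)) z.2 = 0 ∧
      nuDeriv (fun y => innerCosGamma z.1 y (T z.1 y)) z.2 = 0 ∧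
      nuDeriv (fun y => innerCosAdd z.1 y (T z.1 y)) z.2 = 0) : False := by
  have hcomp : ∀ W : ℝ → Space → ℝ → ℝ,
      ContDiff ℝ ω (fun v : (ℝ × Space) × ℝ => W v.1.1 v.1.2 v.2) →
      ContDiffAt ℝ ω (fun z : ℝ × Space => W z.1 z.2 (T z.1 z.2)) (0, y₀) := fun W hW =>
    hW.contDiffAt.comp (0, y₀) (contDiffAt_id.prodMk hT)
  obtain ⟨γ, θ, ν⟩ := y₀
  have hs : ∀ y : Space, redHeight 0 (T 0 y) = Real.cos y.1 := fun y => by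
    simp [redHeight, hT0]
  have hlim := limit_coordinates hl (G := fun s y => eqTwo s y (T s y))
    (hcomp (fun s y t => (eqTwoCoeff s y t).1) (by fun_prop))
    (hcomp (fun s y t => (eqTwoCoeff s y t).2.1) (by fun_prop))
    (hcomp (fun s y t => (eqTwoCoeff s y t).2.2) (by fun_prop))
    (fun s y => eqTwo_eq_coeff s y _)
    (fun y => by simp [eqTwoCoeff, pRe, qIm, holH]) (fun y => by simp [eqTwoCoeff, pIm, qRe, holH])
    (h0.mono fun z hz => ⟨hz.1, hz.2.1, hz.2.2.1⟩)
  obtain ⟨hX, hY⟩ := hlim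
  have hl1 : Filter.Tendsto (fun z : ℝ × Space => z.1) l (𝓝 0) :=
    continuous_fst.continuousAt.mono_left hl
  have hl2 : Filter.Tendsto (fun z : ℝ × Space => Real.sin z.2.1) l (𝓝 (Real.sin γ)) :=
    (Continuous.tendsto (f := fun z : ℝ × Space => Real.sin z.2.1) (by fun_prop)
      (0, γ, θ, ν)).mono_left hl
  have hl3 : Filter.Tendsto (fun z : ℝ × Space => Real.sin z.2.2.1) l (𝓝 (Real.sin θ)) :=
    (Continuous.tendsto (f := fun z : ℝ × Space => Real.sin z.2.2.1) (by fun_prop)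
      (0, γ, θ, ν)).mono_left hl
  have hγ : Real.sin γ = 0 := by
    have h1 := hl1.mul hX
    rw [zero_mul] at h1
    refine tendsto_nhds_unique hl2 (h1.congr' (h0.mono fun z hz => ?_))
    exact mul_div_cancel₀ _ hz.1
  have hθ : Real.sin θ = 0 := by
    have h1 := hl1.mul hY
    rw [zero_mul] at h1
    refine tendsto_nhds_unique hl3 (h1.congr' (h0.mono fun z hz => ?_))
    exact mul_div_cancel₀ _ hz.1
  have hγ2 : Real.cos γ ^ 2 = 1 := by
    have := Real.sin_sq_add_cos_sq γ
    rw [hγ] at this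
    linarith
  have hθ2 : Real.cos θ ^ 2 = 1 := by
    have := Real.sin_sq_add_cos_sq θ
    rw [hθ] at this
    linarith
  have hR : ∀ t : ℝ, (eqTwoCoeff 0 (γ, θ, t) (T 0 (γ, θ, t))).2.2 =
      -2 * Real.cos γ * Real.cos θ := by
    intro t
    simp [eqTwoCoeff, hs, pRe, qRe, pIm, qIm, holH, holIm, lamP, lamQ, cross, hγ, hθ]
    linear_combination (-3 * Real.cos γ * Real.cos θ) * Real.sin_sq_add_cos_sq t
  have hR' : nuDeriv (fun y => (eqTwoCoeff 0 y (T 0 y)).2.2) (γ, θ, ν) = 0 := by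
    simp only [nuDeriv, hR, deriv_const]
  simp only [hR', hR, zero_mul, zero_sub, sub_zero] at hX hY
  have h1 := limit_nuDeriv hl (c := fun s y => innerCosTheta s y (T s y))
    (V := fun s y => -2 * redHeight s (T s y) * (holH s y (T s y)).2.1)
    (U := fun s y => -2 * redHeight s (T s y) ^ 2 * Real.cos y.2.1)
    (k := fun _ x => Real.cos x) (φ := fun _ x => Real.sin x)
    (hcomp (fun s y t => -2 * redHeight s t * (holH s y t).2.1) (by fun_prop))
    (hcomp (fun s y t => -2 * redHeight s t ^ 2 * Real.cos y.2.1) (by fun_prop))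
    (fun s y => innerCosTheta_eq s y _) (h0.mono fun z hz => ⟨hz.1, hz.2.2.2.1⟩) hY
  have h2 := limit_nuDeriv hl (c := fun s y => innerCosGamma s y (T s y))
    (V := fun s y => 2 * qRe s y (T s y) * qIm s y (T s y) * (lamQ s y (T s y)).2.2)
    (U := fun s y => Real.cos y.2.1 * (quadG s y (T s y)).1 +
      Real.sin y.2.1 * (quadG s y (T s y)).2.1)
    (k := fun x _ => Real.cos x) (φ := fun x _ => Real.sin x)
    (hcomp (fun s y t => 2 * qRe s y t * qIm s y t * (lamQ s y t).2.2) (by fun_prop))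
    (hcomp (fun s y t => Real.cos y.2.1 * (quadG s y t).1 + Real.sin y.2.1 * (quadG s y t).2.1)
      (contDiff_cos_mul_quadG))
    (fun s y => innerCosGamma_eq s y _) (h0.mono fun z hz => ⟨hz.1, hz.2.2.2.2.1⟩) hX
  have hadd : ∀ z : ℝ × Space, Real.sin (z.2.1 + z.2.2.1) / z.1 =
      Real.sin z.2.1 / z.1 * Real.cos z.2.2.1 + Real.cos z.2.1 * (Real.sin z.2.2.1 / z.1) := by
    intro z
    rw [Real.sin_add]
    ring
  have hZ : Filter.Tendsto (fun z : ℝ × Space => Real.sin (z.2.1 + z.2.2.1) / z.1) l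
      (𝓝 (-(-2 * Real.cos γ * Real.cos θ * Real.cos ν) * Real.cos θ +
        Real.cos γ * (-(-2 * Real.cos γ * Real.cos θ) * Real.sin ν))) := by
    simp only [hadd]
    refine (hX.mul ?_).add (Filter.Tendsto.mul ?_ hY)
    · exact (Continuous.tendsto (f := fun z : ℝ × Space => Real.cos z.2.2.1) (by fun_prop)
        (0, γ, θ, ν)).mono_left hl
    · exact (Continuous.tendsto (f := fun z : ℝ × Space => Real.cos z.2.1) (by fun_prop)
        (0, γ, θ, ν)).mono_left hl
  have h3 := limit_nuDeriv hl (c := fun s y => innerCosAdd s y (T s y))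
    (V := fun s y => 2 * qRe s y (T s y) * qIm s y (T s y) * (lamQ s y (T s y)).2.2 -
      2 * redHeight s (T s y) * (holH s y (T s y)).2.1)
    (U := fun s y => innerCosAddQuad s y (T s y))
    (k := fun x x' => Real.cos (x + x')) (φ := fun x x' => Real.sin (x + x'))
    (hcomp (fun s y t => 2 * qRe s y t * qIm s y t * (lamQ s y t).2.2 -
      2 * redHeight s t * (holH s y t).2.1) (by fun_prop))
    (hcomp innerCosAddQuad contDiff_innerCosAddQuad)
    (fun s y => innerCosAdd_eq s y _) (h0.mono fun z hz => ⟨hz.1, hz.2.2.2.2.2⟩) hZ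
  have d1 : nuDeriv (fun y => -2 * redHeight 0 (T 0 y) * (holH 0 y (T 0 y)).2.1) (γ, θ, ν) =
      2 * Real.cos γ * Real.cos ν := by
    refine HasDerivAt.deriv (((Real.hasDerivAt_sin ν).const_mul (2 * Real.cos γ)).congr_deriv rfl
      |>.congr_of_eventuallyEq (Filter.Eventually.of_forall fun t => ?_))
    simp [hs, holH]
  have d2 : nuDeriv (fun y => 2 * qRe 0 y (T 0 y) * qIm 0 y (T 0 y) * (lamQ 0 y (T 0 y)).2.2)
      (γ, θ, ν) = 2 * Real.cos θ * -Real.sin ν := by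
    refine HasDerivAt.deriv (((Real.hasDerivAt_cos ν).const_mul (2 * Real.cos θ)).congr_deriv rfl
      |>.congr_of_eventuallyEq (Filter.Eventually.of_forall fun t => ?_))
    simp [qRe, qIm, lamQ, holH]
    ring
  have d3 : nuDeriv (fun y => 2 * qRe 0 y (T 0 y) * qIm 0 y (T 0 y) * (lamQ 0 y (T 0 y)).2.2 -
      2 * redHeight 0 (T 0 y) * (holH 0 y (T 0 y)).2.1)
      (γ, θ, ν) = 2 * Real.cos θ * -Real.sin ν + 2 * Real.cos γ * Real.cos ν := by
    refine HasDerivAt.deriv ((((Real.hasDerivAt_cos ν).const_mul (2 * Real.cos θ)).add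
      ((Real.hasDerivAt_sin ν).const_mul (2 * Real.cos γ))).congr_of_eventuallyEq
        (Filter.Eventually.of_forall fun t => ?_))
    simp [hs, qRe, qIm, lamQ, holH]
    ring
  have u1 : nuDeriv (fun y => -2 * redHeight 0 (T 0 y) ^ 2 * Real.cos y.2.1) (γ, θ, ν) = 0 := by
    simp only [nuDeriv, hs, deriv_const]
  have u2 : nuDeriv (fun y => Real.cos y.2.1 * (quadG 0 y (T 0 y)).1 +
      Real.sin y.2.1 * (quadG 0 y (T 0 y)).2.1) (γ, θ, ν) = 0 := by
    have h : ∀ t : ℝ, Real.cos θ * (quadG 0 (γ, θ, t) (T 0 (γ, θ, t))).1 +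
      Real.sin θ * (quadG 0 (γ, θ, t) (T 0 (γ, θ, t))).2.1 = -2 * Real.cos γ := by
      intro t
      simp [quadG, qIm, lamQ, holH, vecE, lenSq, dot_apply, hγ, hθ, Real.cos_add, Real.sin_add]
      linear_combination (2 * Real.cos γ * (Real.sin t ^ 2 + Real.cos t ^ 2) *
        (Real.cos θ ^ 2 + 1)) * hθ2 + 2 * Real.cos γ * Real.sin_sq_add_cos_sq t
    simp only [nuDeriv, h, deriv_const]
  have u3 : nuDeriv (fun y => innerCosAddQuad 0 y (T 0 y)) (γ, θ, ν) = 0 := by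
    have h : ∀ t : ℝ, innerCosAddQuad 0 (γ, θ, t) (T 0 (γ, θ, t)) =
        -4 * Real.cos γ * Real.cos θ := by
      intro t
      simp [innerCosAddQuad, hs, quadG, qIm, qRe, lamQ, holH, vecE, lenSq, dot_apply, cross, hγ,
        hθ, Real.cos_add, Real.sin_add]
      linear_combination (-2 * Real.cos γ * Real.cos θ * (Real.sin t ^ 2 + Real.cos t ^ 2)) * hθ2 -
        2 * Real.cos γ * Real.cos θ * Real.sin_sq_add_cos_sq t - 2 * Real.cos γ * Real.cos θ * hγ2
    simp only [nuDeriv, h, deriv_const]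
  rw [d1, u1] at h1
  rw [d2, u2] at h2
  rw [d3, u3] at h3
  have h4 := Real.sin_sq_add_cos_sq ν
  have h5 : Real.sin ν * Real.cos ν = 0 := by
    linear_combination (Real.cos θ / 4) * h1 - Real.sin ν * Real.cos ν * Real.cos θ ^ 2 * hγ2 -
      Real.sin ν * Real.cos ν * hθ2
  have h6 : Real.cos ν ^ 2 - Real.sin ν ^ 2 = 0 := by
    linear_combination (1 / 4) * h3 - Real.cos γ * Real.cos θ * Real.sin ν * Real.cos ν *
      (hγ2 - hθ2) - (Real.cos ν ^ 2 - Real.sin ν ^ 2) * (Real.cos θ ^ 2 * hγ2 + hθ2)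
  have h7 : Real.cos ν ^ 2 = 1 / 2 := by linarith
  have h8 : Real.sin ν ^ 2 = 1 / 2 := by linarith
  have h9 : Real.sin ν ^ 2 * Real.cos ν ^ 2 = 0 := by rw [← mul_pow, h5, zero_pow two_ne_zero]
  rw [h7, h8] at h9
  norm_num at h9

/-- For small parameters, the inner coordinates vary along the fibres of the outer coordinates. -/
theorem exists_fibre_bound {ε : ℝ} (hε : 0 < ε) {T : ℝ → Space → ℝ}
    (hT : ∀ s y, |s| < ε → ContDiffAt ℝ ω (fun z : ℝ × Space => T z.1 z.2) (s, y))
    (hT0 : ∀ y, T 0 y = Real.cos y.1)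
    (hdeck : ∀ s, |s| < ε → ∀ σ m n l y, T s (deck σ m n l y) = T s y) :
    ∃ ε', 0 < ε' ∧ ε' ≤ ε ∧ ∀ s y, s ≠ 0 → |s| < ε' → ¬ (eqTwo s y (T s y) = 0 ∧
      nuDeriv (fun y => eqTwo s y (T s y)) y = 0 ∧
      nuDeriv (fun y => innerCosTheta s y (T s y)) y = 0 ∧
      nuDeriv (fun y => innerCosGamma s y (T s y)) y = 0 ∧
      nuDeriv (fun y => innerCosAdd s y (T s y)) y = 0) := by
  by_contra! hcon
  obtain ⟨B, hB⟩ : ∃ B : Set (ℝ × Space), B = {z | z.1 ≠ 0 ∧ eqTwo z.1 z.2 (T z.1 z.2) = 0 ∧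
      nuDeriv (fun y => eqTwo z.1 y (T z.1 y)) z.2 = 0 ∧
      nuDeriv (fun y => innerCosTheta z.1 y (T z.1 y)) z.2 = 0 ∧
      nuDeriv (fun y => innerCosGamma z.1 y (T z.1 y)) z.2 = 0 ∧
      nuDeriv (fun y => innerCosAdd z.1 y (T z.1 y)) z.2 = 0} := ⟨_, rfl⟩
  have hper : ∀ {W : Space → ℝ} {m n l : ℤ}, (∀ y, W (deck true m n l y) = W y) → ∀ y,
      nuDeriv W (deck true m n l y) = nuDeriv W y := by
    intro W m n l hW y
    have h1 : (fun ν => W (y.1, y.2.1, ν)) = fun ν =>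
        W ((deck true m n l y).1, (deck true m n l y).2.1, ν + 2 * Real.pi * l) := by
      funext ν
      rw [← hW]
      simp [deck, boolSign]
    have h2 := deriv_comp_add_const
      (f := fun ν => W ((deck true m n l y).1, (deck true m n l y).2.1, ν)) (2 * Real.pi * l) y.2.2
    rw [nuDeriv, nuDeriv, h1, h2]
    simp [deck]
  have hcube : ∀ δ > 0, ∃ z ∈ B, |z.1| < δ ∧ z.2 ∈ cube := by
    intro δ hδ
    obtain ⟨s, y, hs0, hs, h⟩ := hcon (min δ ε) (lt_min hδ hε) (min_le_right _ _)
    obtain ⟨m, n, l, hy⟩ := exists_deck_mem_cube y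
    have hTd := hdeck s (hs.trans_le (min_le_right _ _)) true m n l
    refine ⟨(s, deck true m n l y), ?_, hs.trans_le (min_le_left _ _), hy⟩
    have hH : ∀ y t, holH s (deck true m n l y) t = holH s y t := fun y t => by
      rw [holH_deck]
      simp [axisSign, boolSign]
    have hQ : ∀ y t, lamQ s (deck true m n l y) t = lamQ s y t := fun y t => by
      rw [lamQ_deck]
      simp [axisSign, boolSign]
    have hE : ∀ y, vecE (deck true m n l y) = vecE y := fun y => by
      simp only [vecE, Real.cos_add, Real.sin_add, sin_deck_fst, sin_deck_snd, cos_deck_fst,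
        cos_deck_snd]
      simp [boolSign]
    have hG : ∀ y t, vecG s (deck true m n l y) t = vecG s y t := fun y t => by
      simp only [vecG, quadG, qRe, qIm, hE, hQ]
    rw [hB]
    refine ⟨hs0, ?_, ?_, ?_, ?_, ?_⟩
    · simpa only [hTd, eqTwo_deck] using h.1
    · rw [hper fun y => by rw [hTd, eqTwo_deck]]
      exact h.2.1
    · rw [hper fun y => by
        rw [hTd, innerCosTheta, hH, cos_deck_snd, sin_deck_snd, innerCosTheta]
        simp [boolSign]]
      exact h.2.2.1
    · rw [hper fun y => by
        rw [hTd, innerCosGamma, hG, cos_deck_snd, sin_deck_snd, innerCosGamma]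
        simp [boolSign]]
      exact h.2.2.2.1
    · rw [hper fun y => by rw [hTd, innerCosAdd, hG, hH, innerCosAdd]]
      exact h.2.2.2.2
  have hne : (Filter.comap Prod.fst (𝓝 (0 : ℝ)) ⊓
      Filter.principal (B ∩ Set.Icc (-1) 1 ×ˢ cube)).NeBot := by
    rw [Filter.inf_principal_neBot_iff]
    intro U hU
    obtain ⟨V, hV, hVU⟩ := Filter.mem_comap.1 hU
    obtain ⟨δ, hδ, hδV⟩ := Metric.mem_nhds_iff.1 hV
    obtain ⟨z, hz, hz1, hz2⟩ := hcube (min δ 1) (lt_min hδ one_pos)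
    refine ⟨z, hVU (hδV ?_), hz, abs_le.1 (hz1.le.trans (min_le_right _ _)), hz2⟩
    rw [Metric.mem_ball, Real.dist_0_eq_abs]
    exact hz1.trans_le (min_le_left _ _)
  obtain ⟨⟨a, y₀⟩, -, hcl⟩ := (isCompact_Icc.prod isCompact_cube) (f := Filter.comap Prod.fst
    (𝓝 (0 : ℝ)) ⊓ Filter.principal (B ∩ Set.Icc (-1) 1 ×ˢ cube))
    (inf_le_right.trans (Filter.principal_mono.2 Set.inter_subset_right))
  obtain ⟨l, hl⟩ : ∃ l, l = 𝓝 (a, y₀) ⊓ (Filter.comap Prod.fst (𝓝 (0 : ℝ)) ⊓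
    Filter.principal (B ∩ Set.Icc (-1) 1 ×ˢ cube)) := ⟨_, rfl⟩
  have hl1 : l.NeBot := by
    rw [hl]
    exact hcl
  have ha : a = 0 := by
    refine tendsto_nhds_unique (f := Prod.fst) (l := l) ?_ ?_
    · exact continuous_fst.continuousAt.mono_left (hl.le.trans inf_le_left)
    · exact Filter.tendsto_comap.mono_left (hl.le.trans (inf_le_right.trans inf_le_left))
  subst ha
  refine false_of_nuDeriv_eq_zero (hT 0 y₀ (by simpa using hε)) hT0
    (hl.le.trans inf_le_left) ?_
  have h1 : B ∩ Set.Icc (-1) 1 ×ˢ cube ∈ l :=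
    hl.le.trans (inf_le_right.trans inf_le_right) (Filter.mem_principal_self _)
  filter_upwards [h1] with z hz
  have h2 := hz.1
  rw [hB] at h2
  exact h2

/-! ### Maps to the pillowcase with local lifts to the plane -/

theorem chartAt_pStar (p : PStar) :
    chartAt Plane p = pillowChart (Function.surjInv regularMk_surjective p) := rfl

/-- In a chart of `P*`, the covering by the plane is locally of the form `y ↦ ±y + const`. -/
theorem pillowChart_planeMk (x : regularPlane) {p : PStar} (hp : p ∈ (pillowChart x).source)
    {y : Plane} (hy : planeMk y = p.1) :
    ∃ σ : ℝ, (σ = 1 ∨ σ = -1) ∧ ∃ c : Plane, ∀ {ι : Type} {l : Filter ι} {L : ι → Plane}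
      {F : ι → PStar}, Filter.Tendsto L l (𝓝 y) → Filter.Tendsto F l (𝓝 p) →
      (∀ᶠ t in l, (F t).1 = planeMk (L t)) → ∀ᶠ t in l, pillowChart x (F t) = σ • L t + c := by
  obtain ⟨h1, h2⟩ := regularMk_pillowChart hp
  obtain ⟨σ, hσ, m, n, hm, hn⟩ := planeMk_eq_iff.1 (hy.trans h1.symm)
  refine ⟨σ, hσ, !₂[2 * Real.pi * m, 2 * Real.pi * n], ?_⟩
  intro ι l L F hL hF hLF
  obtain ⟨U, hU, hinj⟩ := planeMk_locally_injective h2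
  have h3 : Filter.Tendsto (fun t => pillowChart x (F t)) l (𝓝 (pillowChart x p)) :=
    ((pillowChart x).continuousAt hp).tendsto.comp hF
  have h4 : Filter.Tendsto (fun t => σ • L t + !₂[2 * Real.pi * m, 2 * Real.pi * n]) l
      (𝓝 (pillowChart x p)) := by
    have h5 : pillowChart x p = σ • y + !₂[2 * Real.pi * m, 2 * Real.pi * n] := by
      ext j
      fin_cases j
      · simpa using hm
      · simpa using hn
    rw [h5]
    exact (hL.const_smul σ).add_const _
  filter_upwards [h3 hU, h4 hU, hF ((pillowChart x).open_source.mem_nhds hp), hLF] with t t1 t2 t3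
    t4
  refine hinj t1 t2 ?_
  rw [(regularMk_pillowChart t3).1, t4]
  exact planeMk_eq_iff.2 ⟨σ, hσ, m, n, by simp, by simp⟩

theorem contMDiffAt_of_eventuallyEq_chart {X M : Type*} [TopologicalSpace X] [ChartedSpace Plane X]
    [TopologicalSpace M] [ChartedSpace Plane M] {F : X → M} {y : X} {g : Plane → Plane}
    {g' : Plane →L[ℝ] Plane} {t₀ : Plane} (ht₀ : chartAt Plane y y = t₀) (hF : ContinuousAt F y)
    (hg : ∀ᶠ t in 𝓝 t₀, chartAt Plane (F y) (F ((chartAt Plane y).symm t)) = g t)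
    (hc : ContDiffAt ℝ ω g t₀) (hg' : HasFDerivAt g g' t₀) :
    ContMDiffAt (𝓡 2) (𝓡 2) ω F y ∧ HasMFDerivAt (𝓡 2) (𝓡 2) F y g' := by
  subst ht₀
  have h1 : writtenInExtChartAt (𝓡 2) (𝓡 2) y F =ᶠ[𝓝 (extChartAt (𝓡 2) y y)] g := hg
  refine ⟨contMDiffAt_iff.2 ⟨hF, ?_⟩, hF, ?_⟩
  · exact (ContDiffAt.congr_of_eventuallyEq hc h1).contDiffWithinAt
  · exact (HasFDerivAt.congr_of_eventuallyEq hg' h1).hasFDerivWithinAt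

namespace IsSurfaceCover

variable {X : Type*} [TopologicalSpace X] {p : coverSurface → X}

theorem chartAt_eq (hp : IsSurfaceCover p) (y : X) :
    letI := hp.chartedSpace
    chartAt Plane y = hp.chart (Function.surjInv hp.surjective y) := rfl

theorem contMDiffAt_of_lift (hp : IsSurfaceCover p) {F : X → PStar} {y : X} {x : coverSurface}
    (hx : x = Function.surjInv hp.surjective y) {L : Plane → Plane} {L' : Plane →L[ℝ] Plane}
    (hL : ∀ᶠ t in 𝓝 0, (F (p (surfaceParam x t))).1 = planeMk (L t)) (hc : ContDiffAt ℝ ω L 0)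
    (hL' : HasFDerivAt L L' 0) :
    letI := hp.chartedSpace
    ContMDiffAt (𝓡 2) (𝓡 2) ω F y ∧ ∃ σ : ℝ, (σ = 1 ∨ σ = -1) ∧
      HasMFDerivAt (𝓡 2) (𝓡 2) F y (σ • L') := by
  let := hp.chartedSpace
  have hy : p x = y := by
    rw [hx]
    exact Function.surjInv_eq _ y
  have h0 : p (surfaceParam x 0) = y := by rw [surfaceParam_zero, hy]
  have h1 : (F y).1 = planeMk (L 0) := by
    rw [← h0]
    exact hL.self_of_nhds
  have hcont : Filter.Tendsto (fun t => F (p (surfaceParam x t))) (𝓝 0) (𝓝 (F y)) := by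
    refine Topology.IsInducing.subtypeVal.tendsto_nhds_iff.2 ?_
    change Filter.Tendsto (fun t => (F (p (surfaceParam x t))).1) (𝓝 0) (𝓝 (F y).1)
    rw [h1]
    exact (continuous_planeMk.continuousAt.comp hc.continuousAt).tendsto.congr'
      (hL.mono fun t ht => ht.symm)
  obtain ⟨x', hx'⟩ : ∃ x', x' = Function.surjInv regularMk_surjective (F y) := ⟨_, rfl⟩
  have hchart : chartAt Plane (F y) = pillowChart x' := by
    rw [hx']
    exact chartAt_pStar _
  have hsrc : F y ∈ (pillowChart x').source := by
    rw [← hchart]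
    exact _root_.mem_chart_source Plane (F y)
  obtain ⟨σ, hσ, c, hσc⟩ := pillowChart_planeMk x' hsrc h1.symm
  have hloc := hσc hc.continuousAt.tendsto hcont hL
  have hchart' : chartAt Plane y = hp.chart x := by
    rw [hx]
    exact hp.chartAt_eq y
  have hct : ContinuousAt F y := by
    have h2 := (hp.chart x).continuousAt (hp.mem_chart_source x)
    rw [ContinuousAt, hp.chart_apply, hy] at h2
    refine (hcont.comp h2).congr' ?_
    rw [← hy]
    filter_upwards [(hp.chart x).open_source.mem_nhds (hp.mem_chart_source x)] with z hz
    rw [Function.comp_apply, ← hp.chart_symm_apply, (hp.chart x).left_inv hz]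
  have h3 := contMDiffAt_of_eventuallyEq_chart (F := F) (y := y) (g := fun t => σ • L t + c)
    (g' := σ • L') (t₀ := 0) (by rw [hchart', ← hy, hp.chart_apply]) hct
    (hloc.mono fun t ht => by rw [hchart, hchart', hp.chart_symm_apply, ht])
    ((hc.const_smul σ).add contDiffAt_const) ((hL'.const_smul σ).add_const c)
  exact ⟨h3.1, σ, hσ, h3.2⟩

/-- A pair of maps to `P*` whose local lifts to the plane pull back the same area form and have no
common kernel is a Lagrangian immersion. -/
theorem isLagrangianImmersion (hp : IsSurfaceCover p) {F F' : X → PStar}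
    (h : ∀ x : coverSurface, ∃ (L L' : Plane → Plane) (M M' : Plane →L[ℝ] Plane),
      (∀ᶠ t in 𝓝 0, (F (p (surfaceParam x t))).1 = planeMk (L t)) ∧
      (∀ᶠ t in 𝓝 0, (F' (p (surfaceParam x t))).1 = planeMk (L' t)) ∧
      ContDiffAt ℝ ω L 0 ∧ ContDiffAt ℝ ω L' 0 ∧ HasFDerivAt L M 0 ∧ HasFDerivAt L' M' 0 ∧
      (∀ u v, M' u 0 * M' v 1 - M' u 1 * M' v 0 = M u 0 * M v 1 - M u 1 * M v 0) ∧
      ∀ u, M u = 0 → M' u = 0 → u = 0) :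
    letI := hp.chartedSpace
    IsLagrangianImmersion (fun y => (F y, F' y)) := by
  let := hp.chartedSpace
  have key : ∀ y, ∃ M M' : Plane →L[ℝ] Plane,
      ContMDiffAt (𝓡 2) ((𝓡 2).prod (𝓡 2)) ω (fun y => (F y, F' y)) y ∧
      HasMFDerivAt (𝓡 2) ((𝓡 2).prod (𝓡 2)) (fun y => (F y, F' y)) y (M.prod M') ∧
      (∀ u v, M' u 0 * M' v 1 - M' u 1 * M' v 0 = M u 0 * M v 1 - M u 1 * M v 0) ∧
      ∀ u, M u = 0 → M' u = 0 → u = 0 := by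
    intro y
    obtain ⟨L, L', M, M', h1, h2, h3, h4, h5, h6, h7, h8⟩ := h (Function.surjInv hp.surjective y)
    obtain ⟨c1, σ, hσ, m1⟩ := hp.contMDiffAt_of_lift rfl h1 h3 h5
    obtain ⟨c2, σ', hσ', m2⟩ := hp.contMDiffAt_of_lift rfl h2 h4 h6
    refine ⟨σ • M, σ' • M', c1.prodMk c2, m1.prodMk m2, fun u v => ?_, fun u hu hu' => ?_⟩
    · have := h7 u v
      rcases hσ with rfl | rfl <;> rcases hσ' with rfl | rfl <;>
        simpa using this
    · refine h8 u ?_ ?_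
      · rcases hσ with rfl | rfl <;> simpa using hu
      · rcases hσ' with rfl | rfl <;> simpa using hu'
  refine ⟨fun y => ?_, fun y => ?_, fun y u v => ?_⟩
  · obtain ⟨M, M', h1, -⟩ := key y
    exact h1.of_le le_top
  · obtain ⟨M, M', -, h2, -, h4⟩ := key y
    rw [h2.mfderiv]
    refine (injective_iff_map_eq_zero _).2 fun u hu => ?_
    exact h4 u (congrArg Prod.fst hu) (congrArg Prod.snd hu)
  · obtain ⟨M, M', -, h2, h3, -⟩ := key y
    rw [h2.mfderiv]
    have := h3 u v
    change M' u 0 * M' v 1 - M' u 1 * M' v 0 - (M u 0 * M v 1 - M u 1 * M v 0) = 0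
    linarith

end IsSurfaceCover

/-! ### The restriction to the boundary is a Lagrangian immersion -/

theorem re_vecQuat_mul_vecQuat (u v : Space) : (vecQuat u * vecQuat v).re = -dot u v := by
  simp [Quaternion.re_mul, dot_apply]
  ring

theorem unitExp_inv_mul_vecQuat_mul (s : ℝ) (v e : Space) :
    (((unitExp s v)⁻¹ : SU2) : ℍ[ℝ]) * vecQuat e * (unitExp s v : ℍ[ℝ]) =
      vecQuat (e + (2 * s * cosSq (s ^ 2 * lenSq v) * sincSq (s ^ 2 * lenSq v)) • cross e v +
        s ^ 2 • (2 * sincSq (s ^ 2 * lenSq v) ^ 2) • (dot v e • v - lenSq v • e)) := by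
  have h := cosSq_sq_add (mul_nonneg (sq_nonneg s) (lenSq_nonneg v))
  rw [SU2.coe_inv]
  generalize hc : cosSq (s ^ 2 * lenSq v) = c at *
  generalize hk : sincSq (s ^ 2 * lenSq v) = k at *
  simp only [lenSq] at h
  ext <;> simp [unitExp, Quaternion.re_mul, Quaternion.imI_mul, Quaternion.imJ_mul,
    Quaternion.imK_mul, cross, dot_apply, hc, hk]
  · ring
  · rw [lenSq]
    linear_combination e.1 * h
  · rw [lenSq]
    linear_combination e.2.1 * h
  · rw [lenSq]
    linear_combination e.2.2 * h

namespace IsGauge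

variable {s : ℝ} {ρ : PertRep s} {y : Space} {T : ℝ}

theorem inner_g (h : IsGauge ρ y T) :
    (((gen ρ .q)⁻¹ * gen ρ .e * gen ρ .q : SU2) : ℍ[ℝ]) = vecQuat (vecG s y T) := by
  have h1 : (gen ρ .e : ℍ[ℝ]) = vecQuat (vecE y) := by
    rw [h.e, unitIJ_mul_unitI_mul_inv]
    ext <;> simp [unitIJ, vecE]
  rw [Submonoid.coe_mul, Submonoid.coe_mul, h1, h.q, unitExp_inv_mul_vecQuat_mul]
  rfl

theorem inner_d (h : IsGauge ρ y T) :
    (((gen ρ .h)⁻¹ * gen ρ .a * gen ρ .w * gen ρ .h : SU2) : ℍ[ℝ]) =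
      vecQuat ((1, 0, 0) - (2 * (holH s y T).1) • holH s y T) := by
  have hw : (gen ρ .w : ℍ[ℝ]) = -1 := ρ.2.w2
  have hn := lenSq_holH s y T
  rw [lenSq] at hn
  simp only [Submonoid.coe_mul, SU2.coe_inv, hw, h.a, h.h]
  ext <;> simp [unitI, unitH, Quaternion.re_mul, Quaternion.imI_mul, Quaternion.imJ_mul,
    Quaternion.imK_mul]
  · ring
  · linear_combination hn
  · ring
  · ring

end IsGauge

/-- The cosines of the pillowcase coordinates as inner products. -/
theorem cos_coordinates {V D C F G : SU2} {γ θ : ℝ} (hD : V * D * V⁻¹ = unitI)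
    (hC : V * C * V⁻¹ = unitIJ γ) (hF : V * F * V⁻¹ = unitIJ θ) (hrel : C * D = G * F) :
    Real.cos θ = -((D : ℍ[ℝ]) * F).re ∧ Real.cos γ = -((G : ℍ[ℝ]) * F).re ∧
      Real.cos (γ + θ) = -((D : ℍ[ℝ]) * G).re := by
  have hG : V * G * V⁻¹ = unitIJ (γ + θ) := by
    rw [← unitIJ_mul_unitI_mul_inv, ← hD, ← hC, ← hF, eq_mul_inv_of_mul_eq hrel.symm]
    group
  have key : ∀ x y : SU2, ((x : ℍ[ℝ]) * y).re =
      (((V * x * V⁻¹ : SU2) : ℍ[ℝ]) * ((V * y * V⁻¹ : SU2) : ℍ[ℝ])).re := by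
    intro x y
    rw [← Submonoid.coe_mul, ← Submonoid.coe_mul,
      show V * x * V⁻¹ * (V * y * V⁻¹) = V * (x * y) * V⁻¹ by group, SU2.re_conj]
  rw [key D F, key G F, key D G, hD, hF, hG]
  refine ⟨?_, ?_, ?_⟩
  · simp [unitI, unitIJ, Quaternion.re_mul]
  · simp [unitIJ, Quaternion.re_mul]
    have := Real.cos_sub (γ + θ) θ
    rw [add_sub_cancel_right] at this
    linarith
  · simp [unitI, unitIJ, Quaternion.re_mul]

/-- The image of the meridian `d`. -/
noncomputable def genD {s : ℝ} (ρ : PertRep s) : SU2 :=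
  (gen ρ .h)⁻¹ * gen ρ .a * gen ρ .w * gen ρ .h

/-- The image of the meridian `c`. -/
noncomputable def genC {s : ℝ} (ρ : PertRep s) : SU2 :=
  (gen ρ .q)⁻¹ * (gen ρ .p)⁻¹ * gen ρ .b * gen ρ .p * gen ρ .q

/-- The image of the meridian `g`. -/
noncomputable def genG {s : ℝ} (ρ : PertRep s) : SU2 := (gen ρ .q)⁻¹ * gen ρ .e * gen ρ .q

theorem IsGauge.cos_inner {s : ℝ} {ρ : PertRep s} {y : Space} {T : ℝ} (h : IsGauge ρ y T)
    {V : SU2} {γ θ : ℝ} (hD : V * genD ρ * V⁻¹ = unitI) (hC : V * genC ρ * V⁻¹ = unitIJ γ)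
    (hF : V * gen ρ .f * V⁻¹ = unitIJ θ) :
    innerCosTheta s y T = Real.cos θ ∧ innerCosGamma s y T = Real.cos γ ∧
      innerCosAdd s y T = Real.cos (γ + θ) := by
  obtain ⟨h1, h2, h3⟩ := cos_coordinates hD hC hF (gen_inner ρ)
  have hf : (gen ρ .f : ℍ[ℝ]) = vecQuat (Real.cos y.2.1, Real.sin y.2.1, 0) := by
    rw [h.f]
    ext <;> simp [unitIJ]
  rw [h1, h2, h3, genD, h.inner_d, h.inner_g, hf, re_vecQuat_mul_vecQuat, re_vecQuat_mul_vecQuat,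
    re_vecQuat_mul_vecQuat, neg_neg, neg_neg, neg_neg]
  refine ⟨?_, ?_, ?_⟩
  · simp [innerCosTheta, dot_apply]
    ring
  · simp [innerCosGamma, dot_apply]
    ring
  · simp [innerCosAdd, dot_apply]
    ring

theorem re_genD {s : ℝ} (ρ : PertRep s) : (genD ρ : ℍ[ℝ]).re = 0 := by
  have h := (innerRestriction s ρ).2 .a
  rw [innerRestriction_meridian] at h
  rw [genD, ← map_wordD]
  exact h

theorem re_genC {s : ℝ} (ρ : PertRep s) : (genC ρ : ℍ[ℝ]).re = 0 := by
  have h := (innerRestriction s ρ).2 .b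
  rw [innerRestriction_meridian] at h
  rw [genC, ← map_wordC]
  exact h

theorem re_genC_mul_genD_mul {s : ℝ} (ρ : PertRep s) :
    ((genC ρ * genD ρ * gen ρ .f : SU2) : ℍ[ℝ]).re = 0 := by
  have h1 : genC ρ * genD ρ = genG ρ * gen ρ .f := gen_inner ρ
  have hf : (gen ρ .f : ℍ[ℝ]) * gen ρ .f = -1 :=
    sq_eq_neg_one_of_re ρ.2.f_traceless (SU2.norm_coe _)
  have hg : (genG ρ : ℍ[ℝ]).re = 0 := by
    rw [genG, show (gen ρ .q)⁻¹ * gen ρ .e * gen ρ .q =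
      (gen ρ .q)⁻¹ * gen ρ .e * ((gen ρ .q)⁻¹)⁻¹ by rw [inv_inv], SU2.re_conj]
    exact ρ.2.e_traceless
  rw [h1, Submonoid.coe_mul, Submonoid.coe_mul, mul_assoc, hf, mul_neg, mul_one,
    Quaternion.re_neg, hg, neg_zero]

theorem hasCoordinates_outer {s : ℝ} {ρ : PertRep s} {y : Space} {T : ℝ} (h : IsGauge ρ y T) :
    pillowPoint (outerRestriction s ρ) = pillowMk ((y.1 : Real.Angle), (y.2.1 : Real.Angle)) := by
  refine pillowPoint_eq ⟨1, ?_, ?_, ?_⟩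
  all_goals rw [outerRestriction_meridian, one_mul, inv_one, mul_one]
  · change (gen ρ .a : ℍ[ℝ]) = _
    rw [h.a]
    ext <;> simp [unitI]
  · change (gen ρ .b : ℍ[ℝ]) = _
    rw [h.b]
    ext <;> simp [unitIJ]
  · change (gen ρ .f : ℍ[ℝ]) = _
    rw [h.f]
    ext <;> simp [unitIJ]

theorem pillowPoint_inner {s : ℝ} {ρ : PertRep s} {V : SU2} {γ θ : ℝ}
    (hD : V * genD ρ * V⁻¹ = unitI) (hC : V * genC ρ * V⁻¹ = unitIJ γ)
    (hF : V * gen ρ .f * V⁻¹ = unitIJ θ) :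
    pillowPoint (innerRestriction s ρ) = pillowMk ((γ : Real.Angle), (θ : Real.Angle)) := by
  refine pillowPoint_eq ⟨V, ?_, ?_, ?_⟩
  all_goals rw [innerRestriction_meridian]
  · change ((V * ρ.1 (elt wordD) * V⁻¹ : SU2) : ℍ[ℝ]) = _
    rw [map_wordD]
    refine (congrArg Subtype.val hD).trans ?_
    ext <;> simp [unitI]
  · change ((V * ρ.1 (elt wordC) * V⁻¹ : SU2) : ℍ[ℝ]) = _
    rw [map_wordC]
    refine (congrArg Subtype.val hC).trans ?_
    ext <;> simp [unitIJ]
  · refine (congrArg Subtype.val hF).trans ?_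
    ext <;> simp [unitIJ]

theorem nuDeriv_eq_zero {W : Space → ℝ} {y : Plane → Space} {w : Plane → ℝ}
    {y' : Plane →L[ℝ] Space} {w' : Plane →L[ℝ] ℝ} {u : Plane}
    (hW : DifferentiableAt ℝ W (y 0)) (hy : HasFDerivAt y y' 0) (hw : HasFDerivAt w w' 0)
    (h : ∀ᶠ t in 𝓝 0, W (y t) = w t) (hu : w' u = 0) (h1 : (y' u).1 = 0) (h2 : (y' u).2.1 = 0)
    (h3 : (y' u).2.2 ≠ 0) : nuDeriv W (y 0) = 0 := by
  have h4 : HasFDerivAt w ((fderiv ℝ W (y 0)).comp y') 0 :=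
    (hW.hasFDerivAt.comp (0 : Plane) hy).congr_of_eventuallyEq (h.mono fun t ht => ht.symm)
  have h5 : fderiv ℝ W (y 0) (y' u) = 0 := by
    rw [← hu, hw.unique h4]
    rfl
  have h6 : y' u = (y' u).2.2 • ((0, 0, 1) : Space) := by
    refine Prod.ext ?_ (Prod.ext ?_ ?_)
    · simp [h1]
    · simp [h2]
    · simp
  rw [h6, map_smul, smul_eq_mul] at h5
  have h7 : HasDerivAt (fun ν : ℝ => (((y 0).1, (y 0).2.1, ν) : Space)) (0, 0, 1) (y 0).2.2 :=
    (hasDerivAt_const _ _).prodMk ((hasDerivAt_const _ _).prodMk (hasDerivAt_id _))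
  have h8 := HasFDerivAt.comp_hasDerivAt (y 0).2.2 (l := W) hW.hasFDerivAt h7
  exact h8.deriv.trans ((mul_eq_zero.1 h5).resolve_left h3)

/-- The map to the plane with the given coordinates. -/
noncomputable def planePoint (a b : ℝ) : Plane :=
  a • EuclideanSpace.single 0 1 + b • EuclideanSpace.single 1 1

@[simp] theorem planePoint_zero (a b : ℝ) : planePoint a b 0 = a := by simp [planePoint]

@[simp] theorem planePoint_one (a b : ℝ) : planePoint a b 1 = b := by simp [planePoint]

theorem planeMk_planePoint (a b : ℝ) :
    planeMk (planePoint a b) = pillowMk ((a : Real.Angle), (b : Real.Angle)) := by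
  rw [planeMk, planePoint_zero, planePoint_one]

theorem exists_hasFDerivAt_planePoint {a b : Plane → ℝ} {a' b' : Plane →L[ℝ] ℝ}
    (ha : HasFDerivAt a a' 0) (hb : HasFDerivAt b b' 0) : ∃ M : Plane →L[ℝ] Plane,
      HasFDerivAt (fun t => planePoint (a t) (b t)) M 0 ∧ ∀ u, M u 0 = a' u ∧ M u 1 = b' u := by
  refine ⟨_, (ha.smul_const (EuclideanSpace.single 0 1)).add
    (hb.smul_const (EuclideanSpace.single 1 1)), fun u => ?_⟩
  simp

theorem contDiffAt_planePoint {a b : Plane → ℝ} (ha : ContDiffAt ℝ ω a 0)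
    (hb : ContDiffAt ℝ ω b 0) : ContDiffAt ℝ ω (fun t => planePoint (a t) (b t)) 0 :=
  (ha.smul contDiffAt_const).add (hb.smul contDiffAt_const)

namespace IsStraightening

variable {s : ℝ} {T : Space → ℝ} {Ψ : Space ≃ₜ Space} (h : IsStraightening s T Ψ)

theorem outerMap_cover (x : coverSurface) : outerMap s (h.cover x) =
    planeMk (planePoint (Ψ.symm x).1 (Ψ.symm x).2.1) := by
  rw [planeMk_planePoint]
  exact hasCoordinates_outer (h.isGauge_rep x)

theorem outerMap_notMem (h : IsStraightening s T Ψ) (hs0 : s ≠ 0) (hs : |s| < 1 / 6) (z : NAT s) :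
    outerMap s z ∉ corners := by
  obtain ⟨x, rfl⟩ := h.surjective_cover hs0 z
  rw [h.outerMap_cover, planeMk_mem_corners]
  simpa [regularPlane] using h.regular hs0 hs x

end IsStraightening

theorem innerMap_notMem {s : ℝ} (hs0 : s ≠ 0) (hs : |s| < 1) (z : NAT s) :
    innerMap s z ∉ corners := by
  obtain ⟨ρ, rfl⟩ := surjective_conjClass s z
  obtain ⟨V, γ, θ, hD, hC, hF, hr⟩ := exists_inner_coordinates hs0 hs ρ
  have h1 : innerMap s (conjClass s ρ) = planeMk (planePoint γ θ) := by
    rw [planeMk_planePoint]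
    exact pillowPoint_inner hD hC hF
  rw [h1, planeMk_mem_corners]
  simpa [regularPlane] using hr

namespace IsStraightening

variable {s : ℝ} {T : Space → ℝ} {Ψ : Space ≃ₜ Space} (h : IsStraightening s T Ψ)

theorem contDiffAt_gen (x : coverSurface) (g : Gen) :
    ContDiffAt ℝ ω (fun t => (gen (h.rep (surfaceParam x t)) g : ℍ[ℝ])) 0 := by
  have h1 : ContDiff ℝ ω fun y => gaugeEval s (Ψ.symm y) (T (Ψ.symm y)) g :=
    (contDiff_apply ℝ _ g).comp h.contDiff_gaugeEval
  have h2 := h1.contDiffAt.comp (0 : Plane)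
    (contDiffAt_surfaceParam x (zero_mem_coverChart_target x))
  refine h2.congr_of_eventuallyEq (Filter.Eventually.of_forall fun t => ?_)
  exact congrFun (h.evalGen_rep (surfaceParam x t)) g

theorem contDiffAt_gen_inv (x : coverSurface) (g : Gen) :
    ContDiffAt ℝ ω (fun t => (((gen (h.rep (surfaceParam x t)) g)⁻¹ : SU2) : ℍ[ℝ])) 0 :=
  contDiff_starQuaternion.contDiffAt.comp (0 : Plane) (h.contDiffAt_gen x g)

/-- The restrictions to the boundary spheres have local lifts that pull back the same area form and
that have no common kernel. -/
theorem exists_lifts (hs0 : s ≠ 0) (hs : |s| < 1 / 6)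
    (hnd : ∀ y, ¬ (eqTwo s y (T y) = 0 ∧ nuDeriv (fun y => eqTwo s y (T y)) y = 0 ∧
      nuDeriv (fun y => innerCosTheta s y (T y)) y = 0 ∧
      nuDeriv (fun y => innerCosGamma s y (T y)) y = 0 ∧
      nuDeriv (fun y => innerCosAdd s y (T y)) y = 0)) (x : coverSurface) :
    ∃ (L L' : Plane → Plane) (M M' : Plane →L[ℝ] Plane),
      (∀ᶠ t in 𝓝 0, outerMap s (h.cover (surfaceParam x t)) = planeMk (L t)) ∧
      (∀ᶠ t in 𝓝 0, innerMap s (h.cover (surfaceParam x t)) = planeMk (L' t)) ∧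
      ContDiffAt ℝ ω L 0 ∧ ContDiffAt ℝ ω L' 0 ∧ HasFDerivAt L M 0 ∧ HasFDerivAt L' M' 0 ∧
      (∀ u v, M' u 0 * M' v 1 - M' u 1 * M' v 0 = M u 0 * M v 1 - M u 1 * M v 0) ∧
      ∀ u, M u = 0 → M' u = 0 → u = 0 := by
  obtain ⟨ρ, hρ⟩ : ∃ ρ : Plane → PertRep s, ρ = fun t => h.rep (surfaceParam x t) := ⟨_, rfl⟩
  obtain ⟨y, hy⟩ : ∃ y : Plane → Space, y = fun t => Ψ.symm (surfaceParam x t) := ⟨_, rfl⟩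
  have hg : ∀ t, IsGauge (ρ t) (y t) (T (y t)) := fun t => by
    rw [hρ, hy]
    exact h.isGauge_rep _
  have hgen : ∀ g, ContDiffAt ℝ ω (fun t => (gen (ρ t) g : ℍ[ℝ])) 0 := fun g => by
    rw [hρ]
    exact h.contDiffAt_gen x g
  have hinv : ∀ g, ContDiffAt ℝ ω (fun t => (((gen (ρ t) g)⁻¹ : SU2) : ℍ[ℝ])) 0 := fun g => by
    rw [hρ]
    exact h.contDiffAt_gen_inv x g
  have hyc : ContDiffAt ℝ ω y 0 := by
    rw [hy]
    exact h.contDiff_symm.contDiffAt.comp (0 : Plane)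
      (contDiffAt_surfaceParam x (zero_mem_coverChart_target x))
  obtain ⟨y', hy'⟩ : ∃ y', HasFDerivAt y y' 0 :=
    ⟨_, (hyc.differentiableAt (by simp)).hasFDerivAt⟩
  obtain ⟨V₀, γ₀, θ₀, hD0, hC0, hF0, hr⟩ :=
    exists_inner_coordinates hs0 (hs.trans (by norm_num)) (ρ 0)
  obtain ⟨V, γ', θ', hV, hγ, hθ, -, -, hfr⟩ := exists_moving_frame (D := fun t => genD (ρ t))
    (C := fun t => genC (ρ t)) (F := fun t => gen (ρ t) .f)
    ((((hinv .h).mul (hgen .a)).mul (hgen .w)).mul (hgen .h))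
    (((((hinv .q).mul (hinv .p)).mul (hgen .b)).mul (hgen .p)).mul (hgen .q)) (hgen .f)
    (fun t => re_genD _) (fun t => re_genC _) (fun t => (ρ t).2.f_traceless)
    (fun t => re_genC_mul_genD_mul _) hD0 hC0 hF0 hr
  have hd : ∀ {E : Type} [NormedAddCommGroup E] [NormedSpace ℝ E] {f : Plane → E},
      ContDiffAt ℝ ω f 0 → HasFDerivAt f (fderiv ℝ f 0) 0 := fun hf =>
    (hf.differentiableAt (by simp)).hasFDerivAt
  have hy1 : HasFDerivAt (fun t => (y t).1) ((ContinuousLinearMap.fst ℝ ℝ (ℝ × ℝ)).comp y') 0 :=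
    hy'.fst
  have hy2 : HasFDerivAt (fun t => (y t).2.1) ((ContinuousLinearMap.fst ℝ ℝ ℝ).comp
      ((ContinuousLinearMap.snd ℝ ℝ (ℝ × ℝ)).comp y')) 0 := hy'.snd.fst
  obtain ⟨M, hM, hM'⟩ := exists_hasFDerivAt_planePoint hy1 hy2
  obtain ⟨M₂, hM₂, hM₂'⟩ := exists_hasFDerivAt_planePoint (hd hγ) (hd hθ)
  refine ⟨_, _, M, M₂, ?_, ?_, contDiffAt_planePoint hyc.fst hyc.snd.fst,
    contDiffAt_planePoint hγ hθ, hM, hM₂, fun u v => ?_, fun u hu hu' => ?_⟩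
  · refine Filter.Eventually.of_forall fun t => ?_
    rw [hy]
    exact h.outerMap_cover _
  · filter_upwards [hfr] with t ht
    rw [planeMk_planePoint]
    have h1 := pillowPoint_inner (ρ := ρ t) ht.1 ht.2.1 ht.2.2
    rw [← h1, hρ]
    rfl
  · have hw : ∀ t, Jet.negOne.val = gen (ρ t) .w := fun t =>
      Subtype.ext ((by simp [Jet.negOne] : (Jet.negOne.val : ℍ[ℝ]) = -1).trans (ρ t).2.w2.symm)
    have hdiff : ∀ g, DifferentiableAt ℝ (fun t => (gen (ρ t) g : ℍ[ℝ])) 0 := fun g =>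
      (hgen g).differentiableAt (by simp)
    have key := isotropy_of_family (A := fun t => gen (ρ t) .a) (B := fun t => gen (ρ t) .b)
      (C := fun t => gen (ρ t) .e) (F := fun t => gen (ρ t) .f) (H := fun t => gen (ρ t) .h)
      (P := fun t => gen (ρ t) .p) (Q := fun t => gen (ρ t) .q) (V := V) (s := s) (u := u) (v := v)
      (hdiff .b) (hdiff .f) (hdiff .h) (hdiff .p) (hdiff .q) (hV.differentiableAt (by simp)) hy1
      hy2 (hd hγ) (hd hθ) (fun t => (hg t).a) (fun t => (hg t).b) (fun t => (hg t).f)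
      (fun t => (ρ t).2.h_traceless) (fun t => gen_outer _) (fun t => gen_p _) (fun t => gen_q _)
      (fun t => by rw [hw t]; exact gen_inner _)
      (hfr.mono fun t ht => by rw [hw t]; exact ht.1) (hfr.mono fun t ht => ht.2.1)
      (hfr.mono fun t ht => ht.2.2)
    rw [(hM₂' u).1, (hM₂' u).2, (hM₂' v).1, (hM₂' v).2, (hM' u).1, (hM' u).2, (hM' v).1,
      (hM' v).2]
    linarith
  · have a1 : (y' u).1 = 0 := by
      have := (hM' u).1
      rw [hu] at this
      exact this.symm
    have a2 : (y' u).2.1 = 0 := by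
      have := (hM' u).2
      rw [hu] at this
      exact this.symm
    have b1 : fderiv ℝ γ' 0 u = 0 := by
      rw [← (hM₂' u).1, hu']
      rfl
    have b2 : fderiv ℝ θ' 0 u = 0 := by
      rw [← (hM₂' u).2, hu']
      rfl
    have a3 : (y' u).2.2 = 0 := by
      by_contra hne
      have hcd : ∀ {W : Space → ℝ}, ContDiff ℝ ω W → DifferentiableAt ℝ W (y 0) := fun hW =>
        (hW.differentiable (by simp)).differentiableAt
      have hT := h.contDiff_height
      have hcos : ∀ t, V t * genD (ρ t) * (V t)⁻¹ = unitI ∧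
          V t * genC (ρ t) * (V t)⁻¹ = unitIJ (γ' t) ∧
          V t * gen (ρ t) .f * (V t)⁻¹ = unitIJ (θ' t) → _ := fun t ht =>
        (hg t).cos_inner ht.1 ht.2.1 ht.2.2
      refine hnd (y 0) ⟨(hg 0).eqTwo_eq_zero hs0, ?_, ?_, ?_, ?_⟩
      · exact nuDeriv_eq_zero (hcd (by fun_prop)) hy' (hasFDerivAt_const (0 : ℝ) (0 : Plane))
          (Filter.Eventually.of_forall fun t => (hg t).eqTwo_eq_zero hs0) rfl a1 a2 hne
      · exact nuDeriv_eq_zero (hcd (by fun_prop)) hy' (hd hθ).cos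
          (hfr.mono fun t ht => (hcos t ht).1) (by simp [b2]) a1 a2 hne
      · exact nuDeriv_eq_zero (hcd (by fun_prop)) hy' (hd hγ).cos
          (hfr.mono fun t ht => (hcos t ht).2.1) (by simp [b1]) a1 a2 hne
      · exact nuDeriv_eq_zero (hcd (by fun_prop)) hy' ((hd hγ).add (hd hθ)).cos
          (hfr.mono fun t ht => (hcos t ht).2.2) (by simp [b1, b2]) a1 a2 hne
    have hz : y' u = 0 := Prod.ext a1 (Prod.ext a2 a3)
    have hS : DifferentiableAt ℝ (fun z => surfaceProj x (Ψ z)) (y 0) :=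
      (((contDiff_surfaceProj x (n := ω)).comp h.contDiff).differentiable (by simp)).differentiableAt
    have hid : HasFDerivAt (fun t : Plane => t)
        ((fderiv ℝ (fun z => surfaceProj x (Ψ z)) (y 0)).comp y') 0 := by
      refine (hS.hasFDerivAt.comp (0 : Plane) hy').congr_of_eventuallyEq ?_
      filter_upwards [(coverChart x).open_target.mem_nhds (zero_mem_coverChart_target x)] with t ht
      rw [Function.comp_apply, hy, Homeomorph.apply_symm_apply, surfaceProj_surfaceParam x ht]
    have h3 := congrArg (fun A : Plane →L[ℝ] Plane => A u) ((hasFDerivAt_id (0 : Plane)).unique hid)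
    simpa [hz] using h3

/-- The restriction to the boundary spheres is a Lagrangian immersion. -/
theorem isLagrangianImmersion (hs0 : s ≠ 0) (hs : |s| < 1 / 6)
    (hnd : ∀ y, ¬ (eqTwo s y (T y) = 0 ∧ nuDeriv (fun y => eqTwo s y (T y)) y = 0 ∧
      nuDeriv (fun y => innerCosTheta s y (T y)) y = 0 ∧
      nuDeriv (fun y => innerCosGamma s y (T y)) y = 0 ∧
      nuDeriv (fun y => innerCosAdd s y (T y)) y = 0)) :
    letI := (h.isSurfaceCover hs0 hs).chartedSpace
    ∃ hr : ∀ z : NAT s, outerMap s z ∉ corners ∧ innerMap s z ∉ corners,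
      IsLagrangianImmersion (fun z : NAT s =>
        ((⟨outerMap s z, (hr z).1⟩, ⟨innerMap s z, (hr z).2⟩) : PStar × PStar)) := by
  refine ⟨fun z => ⟨h.outerMap_notMem hs0 hs z,
    innerMap_notMem hs0 (hs.trans (by norm_num)) z⟩, ?_⟩
  exact (h.isSurfaceCover hs0 hs).isLagrangianImmersion (h.exists_lifts hs0 hs hnd)

end IsStraightening

end Earring

theorem theorem6p1 :
    ∃ (_ : ChartedSpace Plane genusFiveSurface) (_ : ChartedSpace Plane GenusFiveQuotient),
      InducesAnalyticStructure genusFiveEmb (fun x : genusFiveSurface => x) ∧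
      IsClosedOrientableSurface 5 genusFiveSurface ∧
      (∀ x : genusFiveSurface, iotaHat x ≠ x) ∧
      InducesAnalyticStructure genusFiveEmb genusFiveMk ∧
      IsClosedOrientableSurface 3 GenusFiveQuotient ∧
      ∃ ε : ℝ, 0 < ε ∧ ∀ s : ℝ, s ≠ 0 → |s| < ε →
        ∃ _ : ChartedSpace Plane (NAT s),
          InducesAnalyticStructure (evalGen s) (conjClass s) ∧
          IsClosedOrientableSurface 3 (NAT s) ∧
          Nonempty (NAT s ≃ₘ^ω⟮𝓡 2, 𝓡 2⟯ GenusFiveQuotient) ∧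
          ∃ hr : ∀ x : NAT s, outerMap s x ∉ corners ∧ innerMap s x ∉ corners,
            IsLagrangianImmersion (fun x : NAT s =>
              ((⟨outerMap s x, (hr x).1⟩, ⟨innerMap s x, (hr x).2⟩) : PStar × PStar)) := by
  obtain ⟨ε, hε, -, T, hT, hT0, hΨ⟩ := exists_isStraightening
  obtain ⟨ε', hε', hεε, hnd⟩ := exists_fibre_bound hε hT hT0 fun s hs σ m n l y => by
    obtain ⟨Ψ, h⟩ := hΨ s hs
    exact h.height_deck σ m n l y
  refine ⟨isSurfaceCover_toSurface.chartedSpace,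
    isIotaQuotient_genusFiveMk.isSurfaceCover.chartedSpace,
    inducesAnalyticStructure_genusFiveEmb isSurfaceCover_toSurface,
    isClosedOrientableSurface_genusFiveSurface, iotaHat_ne,
    inducesAnalyticStructure_genusFiveEmb isIotaQuotient_genusFiveMk.isSurfaceCover,
    isIotaQuotient_genusFiveMk.isClosedOrientableSurface, min ε' (1 / 6),
    lt_min hε' (by norm_num), fun s hs0 hs => ?_⟩
  have hs6 : |s| < 1 / 6 := hs.trans_le (min_le_right _ _)
  have hsε : |s| < ε' := hs.trans_le (min_le_left _ _)
  obtain ⟨Ψ, h⟩ := hΨ s (hsε.trans_le hεε)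
  exact ⟨(h.isSurfaceCover hs0 hs6).chartedSpace, h.inducesAnalyticStructure hs0 hs6,
    (h.isSurfaceCover hs0 hs6).isClosedOrientableSurface h.cover_coverDeck,
    (h.isSurfaceCover hs0 hs6).nonempty_diffeomorph isIotaQuotient_genusFiveMk.isSurfaceCover
      h.cover_coverDeck genusFiveMk_toSurface_coverDeck,
    h.isLagrangianImmersion hs0 hs6 fun y => hnd s y hs0 hsε⟩
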